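/- **Problem.** An instance of the connected $k$-median with facilities problem consists of a finite graph $G=(V,E)$ with $n=|V|\ge 1$ vertices, a metric $d:V\times V\to\mathbb{R}_{\ge 0}$, an integer $k\ge 1$ and a nonempty facility set $F\subseteq V$. A feasible solution consists of centers $c_1,\dots,c_k\in F$ (repetitions are allowed, and a center need not lie in its own cluster) and a partition of $V$ into $k$ nonempty clusters $P_1,\dots,P_k$, each inducing a connected subgraph of $G$. It is optimal if it minimizes $\sum_{i=1}^k\sum_{v\in P_i}d(v,c_i)$ among all feasible solutions. **Nice tree decompositions.** A tree decomposition of $G$ is a tree $T=(V_T,E_T)$ with bags $B_t\subseteq V$ $(t\in V_T)$ that cover $V$, such that both endpoints of every edge of $G$ lie in a common bag and, for every $v\in V$, the nodes whose bags contain $v$ induce a connected subtree of $T$. Its width is $\max_t|B_t|-1$. It is nice if it has a root with empty bag and every node $t$ is of one of these types: a *leaf* (no child, $B_t=\emptyset$); *introduce vertex* $v$ (one child $s$, $v\notin B_s$, $B_t=B_s\cup\{v\}$); *introduce edge* $\{u,v\}\in E$ (one child $s$, $B_t=B_s\ni u,v$); *forget* $v$ (one child $s$, $v\in B_s$, $B_t=B_s\setminus\{v\}$);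 *join* (exactly two children $s_1,s_2$, $B_{s_1}=B_{s_2}=B_t$); where every edge is introduced by exactly one node and every vertex is forgotten by exactly one node. **Machine model.** Programs run on a random access machine with arrays of natural numbers and arrays of real numbers. Unit-cost operations are: reading and writing a cell with a computed index, natural constants, the real constant $0$, addition and truncated subtraction of natural numbers, addition of real numbers, comparisons, Boolean connectives and branching. The input memory holds $n$, $k$, $|F|$, the number of nodes, the root, the list of facilities, the adjacency matrix of $G$, the distance matrix, and the types, children and bags of the nodes of the decomposition. **Theorem.** There is a single program with the following property. For every constant $C$ there is a polynomial $p$ such that for every instance as above, given together with a nice tree decomposition of $G$ of width $w$ with at most $C\cdot n\cdot(w+1)$ nodes, the program halts after at most $$n\cdot k^2\cdot|F|^{w+1}\cdot (b_{w+1})^2\cdot p(w)$$ steps, where $b_{w+1}$ is the $(w+1)$-th Bell number; it then outputs an optimal connected $k$-median with facilities solution (the cluster of every vertex and the center of every cluster) if a feasible solution exists, and otherwise reports that there is none. -/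

import Mathlib

/-! ### Random access machine

A unit-cost random access machine given by structured programs.  Its memory consists of arrays
`0, 1, 2, …` of natural numbers and arrays `0, 1, 2, …` of real numbers.  A program is a fixed
finite text which names finitely many arrays literally; the index into an array is computed at run
time.  On natural numbers the only arithmetic is addition and truncated subtraction, on real
numbers the only operations are addition and comparison.  Every read, write, constant, arithmetic
operation, comparison and branch costs one unit of time. -/

namespace RAM

/-- Memory contents: `nat a i` and `real a i` are the `i`-th cells of the `a`-th arrays. -/
structure State where
  nat : ℕ → ℕ → ℕ
  real : ℕ → ℕ → ℝ

/-- Expressions for natural numbers. -/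
inductive NatExpr where
  | const (c : ℕ)
  | get (a : ℕ) (i : NatExpr)
  | add (e₁ e₂ : NatExpr)
  | sub (e₁ e₂ : NatExpr)

namespace NatExpr

def eval (σ : State) : NatExpr → ℕ
  | const c => c
  | get a i => σ.nat a (i.eval σ)
  | add e₁ e₂ => e₁.eval σ + e₂.eval σ
  | sub e₁ e₂ => e₁.eval σ - e₂.eval σ

def cost : NatExpr → ℕ
  | const _ => 1
  | get _ i => i.cost + 1
  | add e₁ e₂ => e₁.cost + e₂.cost + 1
  | sub e₁ e₂ => e₁.cost + e₂.cost + 1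

end NatExpr

/-- Expressions for real numbers. -/
inductive RealExpr where
  | zero
  | get (a : ℕ) (i : NatExpr)
  | add (e₁ e₂ : RealExpr)

namespace RealExpr

noncomputable def eval (σ : State) : RealExpr → ℝ
  | zero => 0
  | get a i => σ.real a (i.eval σ)
  | add e₁ e₂ => e₁.eval σ + e₂.eval σ

def cost : RealExpr → ℕ
  | zero => 1
  | get _ i => i.cost + 1
  | add e₁ e₂ => e₁.cost + e₂.cost + 1

end RealExpr

/-- Tests. -/
inductive Test where
  | natLt (e₁ e₂ : NatExpr)
  | natEq (e₁ e₂ : NatExpr)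
  | realLt (e₁ e₂ : RealExpr)
  | not (b : Test)
  | and (b₁ b₂ : Test)

namespace Test

def Holds (σ : State) : Test → Prop
  | natLt e₁ e₂ => e₁.eval σ < e₂.eval σ
  | natEq e₁ e₂ => e₁.eval σ = e₂.eval σ
  | realLt e₁ e₂ => e₁.eval σ < e₂.eval σ
  | not b => ¬ b.Holds σ
  | and b₁ b₂ => b₁.Holds σ ∧ b₂.Holds σ

def cost : Test → ℕ
  | natLt e₁ e₂ => e₁.cost + e₂.cost + 1
  | natEq e₁ e₂ => e₁.cost + e₂.cost + 1
  | realLt e₁ e₂ => e₁.cost + e₂.cost + 1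
  | not b => b.cost + 1
  | and b₁ b₂ => b₁.cost + b₂.cost + 1

end Test

/-- Programs. `setNat a i e` and `setReal a i e` write the value of `e` to cell `i` of array `a`. -/
inductive Program where
  | skip
  | setNat (a : ℕ) (i e : NatExpr)
  | setReal (a : ℕ) (i : NatExpr) (e : RealExpr)
  | seq (c₁ c₂ : Program)
  | ite (b : Test) (c₁ c₂ : Program)
  | while (b : Test) (c : Program)

/-- Write a natural number. -/
def State.setNat (σ : State) (a i x : ℕ) : State where
  nat := Function.update σ.nat a (Function.update (σ.nat a) i x)
  real := σ.real

/-- Write a real number. -/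
noncomputable def State.setReal (σ : State) (a i : ℕ) (x : ℝ) : State where
  nat := σ.nat
  real := Function.update σ.real a (Function.update (σ.real a) i x)

/-- `Exec c σ σ' t`: the program `c`, started with memory `σ`, halts after exactly `t` units of
time with memory `σ'`. -/
inductive Exec : Program → State → State → ℕ → Prop where
  | skip (σ : State) : Exec .skip σ σ 1
  | setNat (σ : State) (a : ℕ) (i e : NatExpr) :
      Exec (.setNat a i e) σ (σ.setNat a (i.eval σ) (e.eval σ)) (i.cost + e.cost + 1)
  | setReal (σ : State) (a : ℕ) (i : NatExpr) (e : RealExpr) :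
      Exec (.setReal a i e) σ (σ.setReal a (i.eval σ) (e.eval σ)) (i.cost + e.cost + 1)
  | seq {c₁ c₂ : Program} {σ₁ σ₂ σ₃ : State} {t₁ t₂ : ℕ} :
      Exec c₁ σ₁ σ₂ t₁ → Exec c₂ σ₂ σ₃ t₂ → Exec (.seq c₁ c₂) σ₁ σ₃ (t₁ + t₂)
  | ite_true {b : Test} {c₁ c₂ : Program} {σ σ' : State} {t : ℕ} :
      b.Holds σ → Exec c₁ σ σ' t → Exec (.ite b c₁ c₂) σ σ' (b.cost + 1 + t)
  | ite_false {b : Test} {c₁ c₂ : Program} {σ σ' : State} {t : ℕ} :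
      ¬ b.Holds σ → Exec c₂ σ σ' t → Exec (.ite b c₁ c₂) σ σ' (b.cost + 1 + t)
  | while_true {b : Test} {c : Program} {σ₁ σ₂ σ₃ : State} {t₁ t₂ : ℕ} :
      b.Holds σ₁ → Exec c σ₁ σ₂ t₁ → Exec (.while b c) σ₂ σ₃ t₂ →
      Exec (.while b c) σ₁ σ₃ (b.cost + 1 + t₁ + t₂)
  | while_false {b : Test} {c : Program} {σ : State} :
      ¬ b.Holds σ → Exec (.while b c) σ σ (b.cost + 1)

end RAM

/-! ### Tree decompositions -/

/-- A tree decomposition of `G` with set of nodes `ι`. -/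
structure TreeDecomposition {V : Type*} (G : SimpleGraph V) (ι : Type*) where
  tree : SimpleGraph ι
  isTree : tree.IsTree
  bag : ι → Finset V
  exists_mem_bag : ∀ v : V, ∃ t, v ∈ bag t
  exists_edge_bag : ∀ u v : V, G.Adj u v → ∃ t, u ∈ bag t ∧ v ∈ bag t
  connected_nodes : ∀ v : V, (tree.induce {t | v ∈ bag t}).Connected

/-- The width: the size of the largest bag minus one.  (If there is a vertex, then some bag is
nonempty, and the subtraction is an honest one.) -/
def TreeDecomposition.width {V ι : Type*} {G : SimpleGraph V} [Fintype ι]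
    (T : TreeDecomposition G ι) : ℕ :=
  (Finset.univ.sup fun t => (T.bag t).card) - 1

/-- The types of the nodes of a nice tree decomposition. An edge `{u, v}` is written as an ordered
pair of its endpoints, in one of the two orders. -/
inductive NodeKind (V : Type*) where
  | leaf
  | introVertex (v : V)
  | introEdge (u v : V)
  | forget (v : V)
  | join

/-- A nice tree decomposition: a tree decomposition with a root whose bag is empty, in which every
node has one of the five types. -/
structure NiceTreeDecomposition {V : Type*} [DecidableEq V] (G : SimpleGraph V) (ι : Type*)
    extends TreeDecomposition G ι where
  root : ι
  bag_root : bag root = ∅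
  children : ι → Set ι
  mem_children : ∀ t s, s ∈ children t ↔ tree.Adj t s ∧ tree.dist root s = tree.dist root t + 1
  kind : ι → NodeKind V
  leaf_spec : ∀ t, kind t = .leaf → children t = ∅ ∧ bag t = ∅
  introVertex_spec : ∀ t v, kind t = .introVertex v →
    ∃ s, children t = {s} ∧ v ∉ bag s ∧ bag t = insert v (bag s)
  introEdge_spec : ∀ t u v, kind t = .introEdge u v →
    ∃ s, children t = {s} ∧ G.Adj u v ∧ bag t = bag s ∧ u ∈ bag t ∧ v ∈ bag t
  existsUnique_introEdge : ∀ u v, G.Adj u v →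
    ∃! t, kind t = .introEdge u v ∨ kind t = .introEdge v u
  forget_spec : ∀ t v, kind t = .forget v →
    ∃ s, children t = {s} ∧ v ∈ bag s ∧ bag t = (bag s).erase v
  existsUnique_forget : ∀ v, ∃! t, kind t = .forget v
  join_spec : ∀ t, kind t = .join →
    ∃ s₁ s₂, s₁ ≠ s₂ ∧ children t = {s₁, s₂} ∧ bag s₁ = bag t ∧ bag s₂ = bag t

/-! ### The connected `k`-median with facilities problem -/

/-- `d` is a metric on `V`. -/
structure IsDistanceMetric {V : Type*} (d : V → V → ℝ) : Prop where
  nonneg : ∀ u v, 0 ≤ d u v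
  eq_zero_iff : ∀ u v, d u v = 0 ↔ u = v
  symm : ∀ u v, d u v = d v u
  triangle : ∀ u v x, d u x ≤ d u v + d v x

/-- The clusters `P` and centers `c` form a feasible solution: the centers are facilities
(repetitions are allowed, and a center need not lie in its cluster), the clusters partition the
vertex set, and each of them induces a connected (in particular nonempty) subgraph. -/
structure IsConnectedClustering {V : Type*} (G : SimpleGraph V) (F : Finset V) (k : ℕ)
    (P : Fin k → Finset V) (c : Fin k → V) : Prop where
  center_mem : ∀ i, c i ∈ F
  disjoint : ∀ i j, i ≠ j → Disjoint (P i) (P j)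
  cover : ∀ v, ∃ i, v ∈ P i
  connected : ∀ i, (G.induce (P i : Set V)).Connected

/-- The `k`-median cost. -/
def medianCost {V : Type*} (d : V → V → ℝ) {k : ℕ} (P : Fin k → Finset V) (c : Fin k → V) : ℝ :=
  ∑ i, ∑ v ∈ P i, d v (c i)

/-- A feasible solution of minimum cost. -/
def IsOptimalConnectedMedian {V : Type*} (G : SimpleGraph V) (F : Finset V) (k : ℕ)
    (d : V → V → ℝ) (P : Fin k → Finset V) (c : Fin k → V) : Prop :=
  IsConnectedClustering G F k P c ∧
    ∀ P' c', IsConnectedClustering G F k P' c' → medianCost d P c ≤ medianCost d P' c'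

/-! ### Input and output format -/

open RAM in
/-- The `t`-th cells of the arrays `3`, `4`, `5` describe the type of the node `t`: its code, and the
vertex or the endpoints of the edge that it introduces, or the vertex that it forgets. -/
def EncodesKind {n : ℕ} (σ : State) (t : ℕ) : NodeKind (Fin n) → Prop
  | .leaf => σ.nat 3 t = 0
  | .introVertex v => σ.nat 3 t = 1 ∧ σ.nat 4 t = v
  | .introEdge u v => σ.nat 3 t = 2 ∧ σ.nat 4 t = u ∧ σ.nat 5 t = v
  | .forget v => σ.nat 3 t = 3 ∧ σ.nat 4 t = v
  | .join => σ.nat 3 t = 4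

open RAM in
/-- The memory `σ` holds the given instance, with vertices and nodes numbered from `0`:
* array `0`: `n`, `k`, the number of facilities, the number of nodes, the root;
* array `1`: the facilities, in any order and without repetition;
* array `2`: the adjacency matrix of `G`, row by row;
* arrays `3`, `4`, `5`: the types of the nodes;
* arrays `6`, `7`: the child of a node with one child (array `6`), the two children, in any order,
  of a node with two children (arrays `6` and `7`);
* arrays `8`, `9`, `10`: the size of the bag of a node, and the position in array `10` from which
  on its elements are listed, in any order and without repetition;
* real array `0`: the distance matrix, row by row.
All other arrays are zero. -/
structure EncodesInstance {n N : ℕ} (k : ℕ) (G : SimpleGraph (Fin n)) (F : Finset (Fin n))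
    (d : Fin n → Fin n → ℝ) (T : NiceTreeDecomposition G (Fin N)) (σ : State) : Prop where
  vertices : σ.nat 0 0 = n
  clusters : σ.nat 0 1 = k
  facilities_card : σ.nat 0 2 = F.card
  nodes : σ.nat 0 3 = N
  root : σ.nat 0 4 = T.root
  facilities : Set.BijOn (σ.nat 1) (Set.Iio F.card) ((fun v : Fin n => (v : ℕ)) '' F)
  adj : ∀ u v : Fin n, G.Adj u v → σ.nat 2 (u * n + v) = 1
  not_adj : ∀ u v : Fin n, ¬ G.Adj u v → σ.nat 2 (u * n + v) = 0
  kind : ∀ t : Fin N, EncodesKind σ t (T.kind t)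
  child : ∀ t s : Fin N, T.children t = {s} → σ.nat 6 t = s
  children : ∀ t s₁ s₂ : Fin N, s₁ ≠ s₂ → T.children t = {s₁, s₂} →
    (σ.nat 6 t = s₁ ∧ σ.nat 7 t = s₂) ∨ (σ.nat 6 t = s₂ ∧ σ.nat 7 t = s₁)
  bag_card : ∀ t : Fin N, σ.nat 8 t = (T.bag t).card
  bag : ∀ t : Fin N, Set.BijOn (fun j => σ.nat 10 (σ.nat 9 t + j)) (Set.Iio (T.bag t).card)
    ((fun v : Fin n => (v : ℕ)) '' (T.bag t))
  dist : ∀ u v : Fin n, σ.real 0 (u * n + v) = d u v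
  nat_zero : ∀ a i, 10 < a → σ.nat a i = 0
  real_zero : ∀ a i, 0 < a → σ.real a i = 0

open RAM in
/-- The memory `σ` holds the result: either cell `0` of array `11` is `0` and there is no feasible
solution, or this cell is `1` and there is an optimal solution `P`, `c` such that array `12` lists
for every vertex the index of its cluster, and array `13` lists the centers. -/
def HoldsOptimum {n : ℕ} (k : ℕ) (G : SimpleGraph (Fin n)) (F : Finset (Fin n))
    (d : Fin n → Fin n → ℝ) (σ : State) : Prop :=
  (σ.nat 11 0 = 0 ∧ ¬ ∃ P c, IsConnectedClustering G F k P c) ∨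
  (σ.nat 11 0 = 1 ∧ ∃ P c, IsOptimalConnectedMedian G F k d P c ∧
    (∀ i v, v ∈ P i → σ.nat 12 v = i) ∧ ∀ i : Fin k, σ.nat 13 i = c i)

/-! A clustering is encoded by a set of kept edges and a facility for every vertex that is constant
along kept edges, where the kept edges form exactly `k` components. Keeping the edges inside the
clusters turns a feasible solution into such a choice (`IsConnectedClustering.exists_keep`), and the
components of such a choice are connected clusters of the same total cost
(`isConnectedClustering_of_tops`). Since an edge may be dropped although its ends have the same
facility, adjacent clusters may share a center.

Every component has exactly one vertex that is forgotten closest to the root, its top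
(`exists_isTop`, `IsTop.eq`), so clusters can be counted by counting tops. Whether a vertex is a top
can be seen when it is forgotten: it must then be alone, among the vertices of the child's bag, in
its component of the edges kept so far. Hence the choices made below a node matter to the rest of
the graph only through the facilities of the bag vertices, the partition of the bag by connectivity
below the node, and the number of complete components. The essential point is that this information
composes: at a join node the two sides share only bag vertices, so the partition of the bag is the
supremum of the two partitions (`Setoid.onSlots_sup`). To make states of different nodes comparable,
vertices are replaced by `W = w + 1` slots such that the vertices of each bag have different slots.

The dynamic program stores for every node and state the least cost of the vertices forgotten below.
By induction from the leaves, every choice has states whose entries are at most its cost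
(`exists_tab_le`). Conversely, following back pointers from the root yields a run, and a run
describes an actual choice with exactly the recorded states and costs (`IsRun.spec`). Therefore the
root entry with `k` complete components is the optimum, and the run leading to it is an optimal
solution (`IsRun.exists_isOptimal`).

For the running time, let `m` be the number of facilities and `b` the number of partitions of the
slots, which is at most the Bell number (`Setoid.card_le_bell`). A table has `m ^ W * b * (k + 1)`
entries. The most expensive nodes are the joins: only entries with the same facilities are combined,
so there are `m ^ W * (b * (k + 1)) ^ 2` pairs, each costing `O(W)`, at each of the `O(n * W)` nodes
(`medianSteps_le`). As the machine can neither multiply nor divide, offsets, digits of codes and the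
effect of merging two blocks are tabulated in advance by repeated addition and simple recurrences;
the partitions themselves are found by closing the discrete one under merging
(`Setoid.mem_of_closed`). Correctness and time of the programs are proved together, by weakest
preconditions and an invariant rule for loops (`ends_loop`). -/

set_option linter.unusedSectionVars false

/-! ### Rooted structure of nice tree decompositions -/

namespace NiceTreeDecomposition

variable {V : Type*} [DecidableEq V] {G : SimpleGraph V} {ι : Type*}
  (T : NiceTreeDecomposition G ι)

/-- `T.Below t x`: the node `x` lies in the subtree of `t`. -/
def Below (t x : ι) : Prop := Relation.ReflTransGen (fun a b => b ∈ T.children a) t x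

variable {T}

theorem Below.refl (t : ι) : T.Below t t := Relation.ReflTransGen.refl

theorem Below.trans {t x y : ι} (h : T.Below t x) (h' : T.Below x y) : T.Below t y :=
  Relation.ReflTransGen.trans h h'

theorem below_of_mem_children {t s : ι} (h : s ∈ T.children t) : T.Below t s :=
  Relation.ReflTransGen.single h

theorem below_iff {t x : ι} : T.Below t x ↔ x = t ∨ ∃ s ∈ T.children t, T.Below s x := by
  unfold Below
  rw [Relation.ReflTransGen.cases_head_iff]
  constructor
  · rintro (h | ⟨s, h1, h2⟩)
    · exact Or.inl h.symm
    · exact Or.inr ⟨s, h1, h2⟩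
  · rintro (h | ⟨s, h1, h2⟩)
    · exact Or.inl h.symm
    · exact Or.inr ⟨s, h1, h2⟩

variable (T) in
/-- The distance of a node from the root. -/
noncomputable def depth (t : ι) : ℕ := T.tree.dist T.root t

theorem depth_of_mem_children {t s : ι} (h : s ∈ T.children t) : T.depth s = T.depth t + 1 :=
  ((T.mem_children t s).1 h).2

theorem Below.depth_le {t x : ι} (h : T.Below t x) : T.depth t ≤ T.depth x := by
  induction h with
  | refl => exact le_rfl
  | tail _ h ih => rw [depth_of_mem_children h]; omega

theorem Below.eq_of_depth_le {t x : ι} (h : T.Below t x) (hd : T.depth x ≤ T.depth t) :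
    x = t := by
  rcases below_iff.1 h with h | ⟨s, hs, h⟩
  · exact h
  · have := h.depth_le
    rw [depth_of_mem_children hs] at this
    omega

/-- The parent is the last vertex but one of a shortest path from the root; the triangle inequality
shows that its distance from the root is exactly one less. -/
theorem exists_mem_children {s : ι} (h : s ≠ T.root) : ∃ t, s ∈ T.children t := by
  obtain ⟨p, hp, hl⟩ := T.isTree.1.exists_path_of_dist T.root s
  have hnil : ¬ p.Nil := fun hn => h hn.eq.symm
  refine ⟨p.penultimate, (T.mem_children _ _).2 ⟨p.adj_penultimate hnil, ?_⟩⟩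
  have h1 : T.tree.dist T.root p.penultimate ≤ p.dropLast.length := SimpleGraph.dist_le _
  have h2 := T.isTree.1.dist_triangle (u := T.root) (v := p.penultimate) (w := s)
  have h3 : T.tree.dist p.penultimate s = 1 :=
    SimpleGraph.dist_eq_one_iff_adj.2 (p.adj_penultimate hnil)
  have h4 : p.length ≠ 0 := fun h0 => hnil (SimpleGraph.Walk.length_eq_zero_iff.1 h0)
  simp at h1
  omega

/-- Shortest walks to two parents, extended by the edge to `s`, are both shortest and hence paths; a
tree has only one path from the root to `s`. -/
theorem eq_of_mem_children {s t t' : ι} (h : s ∈ T.children t) (h' : s ∈ T.children t') :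
    t = t' := by
  obtain ⟨ha, hd⟩ := (T.mem_children _ _).1 h
  obtain ⟨ha', hd'⟩ := (T.mem_children _ _).1 h'
  obtain ⟨q, hq⟩ := T.isTree.1.exists_walk_length_eq_dist T.root t
  obtain ⟨q', hq'⟩ := T.isTree.1.exists_walk_length_eq_dist T.root t'
  have hp : (q.concat ha).IsPath := by
    apply SimpleGraph.Walk.isPath_of_length_eq_dist
    simp [hq, hd]
  have hp' : (q'.concat ha').IsPath := by
    apply SimpleGraph.Walk.isPath_of_length_eq_dist
    simp [hq', hd']
  have := congrArg Subtype.val ((T.isTree.2.subsingleton_path _ _).elim ⟨_, hp⟩ ⟨_, hp'⟩)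
  simpa using congrArg SimpleGraph.Walk.penultimate this

theorem below_root (t : ι) : T.Below T.root t := by
  induction hd : T.depth t using Nat.strong_induction_on generalizing t with
  | _ d ih =>
    by_cases h : t = T.root
    · subst h; exact Below.refl _
    · obtain ⟨x, hx⟩ := exists_mem_children h
      have := depth_of_mem_children hx
      exact (ih _ (by omega) x rfl).trans (below_of_mem_children hx)

theorem top_down {P : ι → Prop} (h0 : P T.root)
    (h : ∀ t s, s ∈ T.children t → P t → P s) (t : ι) : P t := by
  induction T.below_root t with
  | refl => exact h0
  | tail _ hc ih => exact h _ _ hc ih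

theorem bottom_up [Finite ι] {P : ι → Prop} (h : ∀ t, (∀ s ∈ T.children t, P s) → P t) (t : ι) :
    P t := by
  obtain ⟨M, hM⟩ := (Set.finite_range T.depth).bddAbove
  -- There are finitely many nodes, so depths are bounded by some `M`, and the induction is on the
  -- distance to this bound.
  induction hd : M - T.depth t using Nat.strong_induction_on generalizing t with
  | _ d ih =>
    refine h t fun s hs => ih _ ?_ s rfl
    have h1 := depth_of_mem_children hs
    have h2 : T.depth s ≤ M := hM ⟨s, rfl⟩
    omega

/-- Parents are unique, so the ancestors of `z` form a chain. -/
theorem Below.total {x y z : ι} (h : T.Below x z) (h' : T.Below y z) :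
    T.Below x y ∨ T.Below y x := by
  have hu : Relator.RightUnique (fun a b => a ∈ T.children b) := fun a b c hb hc =>
    eq_of_mem_children hb hc
  have := Relation.ReflTransGen.total_of_right_unique hu
    (Relation.reflTransGen_swap.2 h) (Relation.reflTransGen_swap.2 h')
  rcases this with h | h
  · exact Or.inr (Relation.reflTransGen_swap.1 h)
  · exact Or.inl (Relation.reflTransGen_swap.1 h)

theorem eq_of_below_below {t s₁ s₂ x : ι} (h₁ : s₁ ∈ T.children t) (h₂ : s₂ ∈ T.children t)
    (hx₁ : T.Below s₁ x) (hx₂ : T.Below s₂ x) : s₁ = s₂ := by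
  have d₁ := depth_of_mem_children h₁
  have d₂ := depth_of_mem_children h₂
  rcases hx₁.total hx₂ with h | h
  · exact (h.eq_of_depth_le (by omega)).symm
  · exact h.eq_of_depth_le (by omega)

/-- Among the five types of nodes, only a forget node drops a vertex from the bag of its child. All
later facts on where a vertex can occur rest on this and on the uniqueness of forget nodes. -/
theorem mem_bag_of_mem_children {t s : ι} {v : V} (hs : s ∈ T.children t) (hv : v ∈ T.bag s) :
    v ∈ T.bag t ∨ T.kind t = .forget v := by
  cases hk : T.kind t with
  | leaf => simp [(T.leaf_spec t hk).1] at hs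
  | introVertex u =>
    obtain ⟨s', hc, -, hb⟩ := T.introVertex_spec t u hk
    rw [hc, Set.mem_singleton_iff] at hs
    subst hs
    simp [hb, hv]
  | introEdge u w =>
    obtain ⟨s', hc, -, hb, -⟩ := T.introEdge_spec t u w hk
    rw [hc, Set.mem_singleton_iff] at hs
    subst hs
    simp [hb, hv]
  | forget u =>
    obtain ⟨s', hc, -, hb⟩ := T.forget_spec t u hk
    rw [hc, Set.mem_singleton_iff] at hs
    subst hs
    by_cases h : u = v
    · simp [h]
    · left; simp [hb, hv, Ne.symm h]
  | join =>
    obtain ⟨s₁, s₂, -, hc, hb₁, hb₂⟩ := T.join_spec t hk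
    rw [hc] at hs
    rcases hs with hs | hs
    · subst hs; simp [← hb₁, hv]
    · rw [Set.mem_singleton_iff] at hs; subst hs; simp [← hb₂, hv]

variable (T) in
/-- The node at which a vertex is forgotten. -/
noncomputable def forgetNode (v : V) : ι := (T.existsUnique_forget v).choose

variable (T) in
theorem kind_forgetNode (v : V) : T.kind (T.forgetNode v) = .forget v :=
  (T.existsUnique_forget v).choose_spec.1

theorem eq_forgetNode {t : ι} {v : V} (h : T.kind t = .forget v) : t = T.forgetNode v :=
  (T.existsUnique_forget v).choose_spec.2 t h

variable (T) in
/-- The vertices forgotten in the subtree of `t`. -/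
def forgotten (t : ι) : Set V := {v | T.Below t (T.forgetNode v)}

/-- A node below whose bag contains `v` lies below the child of the node that forgets `v`. -/
theorem below_of_mem_bag {t x s : ι} {v : V} (hx : T.kind x = .forget v) (hs : s ∈ T.children x)
    (hv : v ∈ T.bag t) : T.Below s t := by
  -- Descending from the root, whose bag is empty, `v` can enter a bag only at the child of a node
  -- that forgets it. By uniqueness that node is `x`.
  have key : ∀ t, v ∈ T.bag t → ∃ y r, T.kind y = .forget v ∧ r ∈ T.children y ∧ T.Below r t := by
    refine T.top_down (P := fun t => v ∈ T.bag t → _) ?_ ?_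
    · simp [T.bag_root]
    · intro t r hr ih hv
      rcases mem_bag_of_mem_children hr hv with h | h
      · obtain ⟨y, q, h1, h2, h3⟩ := ih h
        exact ⟨y, q, h1, h2, h3.trans (below_of_mem_children hr)⟩
      · exact ⟨t, r, h, hr, Below.refl _⟩
  obtain ⟨y, r, hy, hr, h⟩ := key t hv
  have hxy : x = y := (eq_forgetNode hx).trans (eq_forgetNode hy).symm
  subst hxy
  obtain ⟨s', hc, -⟩ := T.forget_spec x v hx
  rw [hc, Set.mem_singleton_iff] at hr hs
  rw [hs, ← hr]
  exact h

theorem exists_child_forgetNode (v : V) : ∃ s, T.children (T.forgetNode v) = {s} ∧ v ∈ T.bag s ∧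
    T.bag (T.forgetNode v) = (T.bag s).erase v :=
  T.forget_spec _ v (T.kind_forgetNode v)

theorem below_forgetNode {t : ι} {v : V} (hv : v ∈ T.bag t) :
    T.Below (T.forgetNode v) t ∧ t ≠ T.forgetNode v := by
  obtain ⟨s, hc, -, hb⟩ := T.exists_child_forgetNode v
  have hs : s ∈ T.children (T.forgetNode v) := by simp [hc]
  refine ⟨(below_of_mem_children hs).trans (below_of_mem_bag (T.kind_forgetNode v) hs hv), ?_⟩
  rintro rfl
  simp [hb] at hv

theorem below_of_forgotten {t x : ι} {v : V} (h : v ∈ T.forgotten t) (hv : v ∈ T.bag x) :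
    T.Below t x :=
  Below.trans h (below_forgetNode hv).1

/-- Bags containing `v` lie strictly below the forget node of `v`, whereas `t` lies above it. -/
theorem not_mem_bag_of_forgotten {t : ι} {v : V} (h : v ∈ T.forgotten t) : v ∉ T.bag t := by
  intro hv
  obtain ⟨h1, h2⟩ := below_forgetNode hv
  exact h2 (h1.eq_of_depth_le (Below.depth_le h))

theorem mem_bag_or_forgotten {t x : ι} {v : V} (h : T.Below t x) (hv : v ∈ T.bag x) :
    v ∈ T.bag t ∨ v ∈ T.forgotten t := by
  induction h using Relation.ReflTransGen.head_induction_on with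
  | refl => exact Or.inl hv
  | head hc _ ih =>
    rcases ih with h | h
    · rcases mem_bag_of_mem_children hc h with h | h
      · exact Or.inl h
      · right
        rw [forgotten, Set.mem_ofPred_eq, ← eq_forgetNode h]
        exact Below.refl _
    · exact Or.inr ((below_of_mem_children hc).trans h)

theorem mem_forgotten_iff {t : ι} {v : V} :
    v ∈ T.forgotten t ↔ T.kind t = .forget v ∨ ∃ s ∈ T.children t, v ∈ T.forgotten s := by
  rw [forgotten, Set.mem_ofPred_eq, below_iff]
  refine or_congr ⟨fun h => h ▸ T.kind_forgetNode v, fun h => (eq_forgetNode h).symm⟩ Iff.rfl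

theorem forgotten_leaf {t : ι} (hk : T.kind t = .leaf) : T.forgotten t = ∅ := by
  ext v
  simp [mem_forgotten_iff (t := t), hk, (T.leaf_spec t hk).1]

theorem forgotten_of_children_eq {t s : ι} (hc : T.children t = {s})
    (hk : ∀ v, T.kind t ≠ .forget v) : T.forgotten t = T.forgotten s := by
  ext v
  simp [mem_forgotten_iff (t := t), hk, hc]

theorem forgotten_forget {t s : ι} {v : V} (hk : T.kind t = .forget v) (hc : T.children t = {s}) :
    T.forgotten t = insert v (T.forgotten s) := by
  ext u
  simp [mem_forgotten_iff (t := t), hk, hc, eq_comm]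

theorem forgotten_join {t s₁ s₂ : ι} (hk : T.kind t = .join) (hc : T.children t = {s₁, s₂}) :
    T.forgotten t = T.forgotten s₁ ∪ T.forgotten s₂ := by
  ext u
  simp [mem_forgotten_iff (t := t), hk, hc]

theorem disjoint_forgotten {t s₁ s₂ : ι} (hne : s₁ ≠ s₂) (h₁ : s₁ ∈ T.children t)
    (h₂ : s₂ ∈ T.children t) : Disjoint (T.forgotten s₁) (T.forgotten s₂) :=
  Set.disjoint_left.2 fun _ hv hv' => hne (eq_of_below_below h₁ h₂ hv hv')

theorem forgotten_root : T.forgotten T.root = Set.univ :=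
  Set.eq_univ_of_forall fun _ => T.below_root _

theorem not_forgotten_child {t s : ι} {v : V} (hk : T.kind t = .forget v)
    (hs : s ∈ T.children t) : v ∉ T.forgotten s := by
  intro h
  rw [forgotten, Set.mem_ofPred_eq, ← eq_forgetNode hk] at h
  have := h.depth_le
  have := depth_of_mem_children hs
  omega

end NiceTreeDecomposition

/-! ### Restricting an equivalence relation to the slots of a bag -/

namespace Setoid

variable {V X : Type*}

/-- The equivalence relation whose only nontrivial block is `{a, b}`. -/
def pair (a b : V) : Setoid V := Relation.EqvGen.setoid fun x y => x = a ∧ y = b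

theorem pair_rel (a b : V) : pair a b a b := Relation.EqvGen.rel _ _ ⟨rfl, rfl⟩

theorem pair_le_iff {a b : V} {r : Setoid V} : pair a b ≤ r ↔ r a b := by
  refine ⟨fun h => h (pair_rel a b), fun h => Setoid.eqvGen_le ?_⟩
  rintro x y ⟨rfl, rfl⟩
  exact h

/-- The relation obtained from `r` by making `a` a block of its own. -/
def isolate (r : Setoid X) (a : X) : Setoid X where
  r x y := x = y ∨ (x ≠ a ∧ y ≠ a ∧ r x y)
  iseqv :=
    { refl := fun _ => Or.inl rfl
      symm := by
        rintro x y (h | ⟨h1, h2, h3⟩)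
        · exact Or.inl h.symm
        · exact Or.inr ⟨h2, h1, r.symm h3⟩
      trans := by
        rintro x y z (rfl | ⟨h1, h2, h3⟩) h
        · exact h
        · rcases h with rfl | ⟨_, h5, h6⟩
          · exact Or.inr ⟨h1, h2, h3⟩
          · exact Or.inr ⟨h1, h5, r.trans h3 h6⟩ }

theorem isolate_rel {r : Setoid X} {a x y : X} :
    r.isolate a x y ↔ x = y ∨ (x ≠ a ∧ y ≠ a ∧ r x y) := Iff.rfl

/-- The relation on slots that `r` induces on the vertices of `B`. -/
def onSlots (slot : V → X) (B : Set V) (r : Setoid V) : Setoid X :=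
  Relation.EqvGen.setoid fun a b => ∃ u ∈ B, ∃ v ∈ B, slot u = a ∧ slot v = b ∧ r u v

/-- Injectivity of `slot` on `B` makes the generating relation symmetric and transitive already, so
the generated equivalence adds only the diagonal. -/
theorem onSlots_rel {slot : V → X} {B : Set V} (hB : Set.InjOn slot B) {r : Setoid V} {a b : X} :
    onSlots slot B r a b ↔ a = b ∨ ∃ u ∈ B, ∃ v ∈ B, slot u = a ∧ slot v = b ∧ r u v := by
  constructor
  · intro h
    induction h with
    | rel _ _ h => exact Or.inr h
    | refl => exact Or.inl rfl
    | symm _ _ _ ih =>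
      rcases ih with h | ⟨u, hu, v, hv, h1, h2, h3⟩
      · exact Or.inl h.symm
      · exact Or.inr ⟨v, hv, u, hu, h2, h1, r.symm h3⟩
    | trans _ _ _ _ _ ih1 ih2 =>
      rcases ih1 with rfl | ⟨u, hu, v, hv, h1, h2, h3⟩
      · exact ih2
      · rcases ih2 with rfl | ⟨u', hu', v', hv', h1', h2', h3'⟩
        · exact Or.inr ⟨u, hu, v, hv, h1, h2, h3⟩
        · have := hB hv hu' (h2.trans h1'.symm)
          subst this
          exact Or.inr ⟨u, hu, v', hv', h1, h2', r.trans h3 h3'⟩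
  · rintro (rfl | h)
    · exact Setoid.refl' _ _
    · exact Relation.EqvGen.rel _ _ h

theorem onSlots_slot {slot : V → X} {B : Set V} (hB : Set.InjOn slot B) {r : Setoid V} {u v : V}
    (hu : u ∈ B) (hv : v ∈ B) : onSlots slot B r (slot u) (slot v) ↔ r u v := by
  rw [onSlots_rel hB]
  constructor
  · rintro (h | ⟨u', hu', v', hv', h1, h2, h3⟩)
    · rw [hB hu hv h]
    · rwa [← hB hu' hu h1, ← hB hv' hv h2]
  · exact fun h => Or.inr ⟨u, hu, v, hv, rfl, rfl, h⟩

theorem onSlots_mono {slot : V → X} {B : Set V} {r r' : Setoid V} (h : r ≤ r') :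
    onSlots slot B r ≤ onSlots slot B r' := by
  refine Setoid.eqvGen_le ?_
  rintro a b ⟨u, hu, v, hv, h1, h2, h3⟩
  exact Relation.EqvGen.rel _ _ ⟨u, hu, v, hv, h1, h2, h h3⟩

/-- A chain for `r₁ ⊔ r₂` between vertices of `B` alternates between steps of `r₁` and `r₂`.
Wherever it properly switches, the vertex lies in `A₁ ∩ A₂`, hence in `B`, so the chain splits into
pieces between vertices of `B`, each using one relation only. -/
theorem onSlots_sup {slot : V → X} {B A₁ A₂ : Set V} {r₁ r₂ : Setoid V}
    (h₁ : ∀ u v, r₁ u v → u = v ∨ v ∈ A₁) (h₂ : ∀ u v, r₂ u v → u = v ∨ v ∈ A₂)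
    (hA : A₁ ∩ A₂ ⊆ B) :
    onSlots slot B (r₁ ⊔ r₂) = onSlots slot B r₁ ⊔ onSlots slot B r₂ := by
  refine le_antisymm (Setoid.eqvGen_le ?_)
    (sup_le (onSlots_mono le_sup_left) (onSlots_mono le_sup_right))
  rintro _ _ ⟨u, hu, v, hv, rfl, rfl, h⟩
  set q := onSlots slot B r₁ ⊔ onSlots slot B r₂ with hq
  have q₁ : ∀ x y, x ∈ B → y ∈ B → r₁ x y → q (slot x) (slot y) := fun x y hx hy h =>
    (le_sup_left : onSlots slot B r₁ ≤ q) (Relation.EqvGen.rel _ _ ⟨x, hx, y, hy, rfl, rfl, h⟩)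
  have q₂ : ∀ x y, x ∈ B → y ∈ B → r₂ x y → q (slot x) (slot y) := fun x y hx hy h =>
    (le_sup_right : onSlots slot B r₂ ≤ q) (Relation.EqvGen.rel _ _ ⟨x, hx, y, hy, rfl, rfl, h⟩)
  -- The invariant along the chain: `y` is one step of a single relation away from some `z` in `B`
  -- whose slot is already known to be related to that of `u`.
  let P : V → Prop := fun y => ∃ z ∈ B, q (slot u) (slot z) ∧ (r₁ z y ∨ r₂ z y)
  have s₁ : ∀ x y, r₁ x y → P x → P y := by
    rintro x y hxy ⟨z, hz, hqz, hzx | hzx⟩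
    · exact ⟨z, hz, hqz, Or.inl (r₁.trans hzx hxy)⟩
    · rcases h₂ _ _ hzx with rfl | hx2
      · exact ⟨z, hz, hqz, Or.inl hxy⟩
      · rcases h₁ _ _ (r₁.symm hxy) with rfl | hx1
        · exact ⟨z, hz, hqz, Or.inr hzx⟩
        · have hxB := hA ⟨hx1, hx2⟩
          exact ⟨x, hxB, q.trans hqz (q₂ _ _ hz hxB hzx), Or.inl hxy⟩
  have s₂ : ∀ x y, r₂ x y → P x → P y := by
    rintro x y hxy ⟨z, hz, hqz, hzx | hzx⟩
    · rcases h₁ _ _ hzx with rfl | hx1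
      · exact ⟨z, hz, hqz, Or.inr hxy⟩
      · rcases h₂ _ _ (r₂.symm hxy) with rfl | hx2
        · exact ⟨z, hz, hqz, Or.inl hzx⟩
        · have hxB := hA ⟨hx1, hx2⟩
          exact ⟨x, hxB, q.trans hqz (q₁ _ _ hz hxB hzx), Or.inr hxy⟩
    · exact ⟨z, hz, hqz, Or.inr (r₂.trans hzx hxy)⟩
  -- Both relations preserve `P` in both directions, so their supremum does too; no induction on the
  -- chain is needed.
  have hker : r₁ ⊔ r₂ ≤ Setoid.ker P := by
    refine sup_le (fun x y h => ?_) (fun x y h => ?_)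
    · exact propext ⟨s₁ x y h, s₁ y x (r₁.symm h)⟩
    · exact propext ⟨s₂ x y h, s₂ y x (r₂.symm h)⟩
  have hPu : P u := ⟨u, hu, q.refl _, Or.inl (r₁.refl _)⟩
  obtain ⟨z, hz, hqz, h' | h'⟩ : P v := (hker h : P u = P v) ▸ hPu
  · exact q.trans hqz (q₁ _ _ hz hv h')
  · exact q.trans hqz (q₂ _ _ hz hv h')

theorem onSlots_pair {slot : V → X} {B : Set V} {u v : V} (hu : u ∈ B) (hv : v ∈ B) :
    onSlots slot B (pair u v) = pair (slot u) (slot v) := by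
  refine le_antisymm (Setoid.eqvGen_le ?_) (pair_le_iff.2 ?_)
  · rintro _ _ ⟨x, -, y, -, rfl, rfl, h⟩
    have : pair u v ≤ Setoid.comap slot (pair (slot u) (slot v)) := pair_le_iff.2 (pair_rel _ _)
    exact this h
  · exact Relation.EqvGen.rel _ _ ⟨u, hu, v, hv, rfl, rfl, pair_rel _ _⟩

theorem pair_support {a b x y : V} (h : pair a b x y) : x = y ∨ y ∈ ({a, b} : Set V) := by
  let r : Setoid V := ⟨fun x y => x = y ∨ (x ∈ ({a, b} : Set V) ∧ y ∈ ({a, b} : Set V)), by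
    constructor
    · intro x; exact Or.inl rfl
    · rintro x y (h | h)
      · exact Or.inl h.symm
      · exact Or.inr ⟨h.2, h.1⟩
    · rintro x y z (rfl | h) (rfl | h')
      · exact Or.inl rfl
      · exact Or.inr h'
      · exact Or.inr h
      · exact Or.inr ⟨h.1, h'.2⟩⟩
  have : pair a b ≤ r := pair_le_iff.2 (Or.inr (by simp))
  exact (this h).imp id And.right

end Setoid

/-! ### The components of the chosen edges below a node -/

namespace NiceTreeDecomposition

variable {V : Type*} [DecidableEq V] {G : SimpleGraph V} {ι : Type*}
  {T : NiceTreeDecomposition G ι}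

variable (T) in
/-- The edges introduced in the subtree of `t` at nodes that satisfy `keep` connect `u`, `v`. -/
def joined (keep : ι → Prop) (t : ι) : Setoid V :=
  Relation.EqvGen.setoid fun u v => ∃ x, T.Below t x ∧ keep x ∧ T.kind x = .introEdge u v

variable {keep : ι → Prop}

theorem joined_of_below {t x : ι} {u v : V} (h : T.Below t x) (hx : keep x)
    (hk : T.kind x = .introEdge u v) : T.joined keep t u v :=
  Relation.EqvGen.rel _ _ ⟨x, h, hx, hk⟩

theorem joined_mono {t s : ι} (h : T.Below t s) : T.joined keep s ≤ T.joined keep t := by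
  refine Setoid.eqvGen_le ?_
  rintro u v ⟨x, hx, hk, he⟩
  exact joined_of_below (h.trans hx) hk he

theorem joined_le {t : ι} {r : Setoid V}
    (h : ∀ x u v, T.Below t x → keep x → T.kind x = .introEdge u v → r u v) :
    T.joined keep t ≤ r :=
  Setoid.eqvGen_le fun u v ⟨x, hx, hk, he⟩ => h x u v hx hk he

/-- Edges introduced below `t` have both ends in a bag below `t`, and such vertices are in the bag
of `t` or forgotten below it. This provides the support hypotheses of `Setoid.onSlots_sup`. -/
theorem joined_support {t : ι} {u v : V} (h : T.joined keep t u v) :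
    u = v ∨ v ∈ (↑(T.bag t) ∪ T.forgotten t : Set V) := by
  have hmem : ∀ x u v, T.Below t x → T.kind x = .introEdge u v →
      u ∈ (↑(T.bag t) ∪ T.forgotten t : Set V) ∧ v ∈ (↑(T.bag t) ∪ T.forgotten t : Set V) := by
    intro x u v hx hk
    obtain ⟨s, -, -, -, hu, hv⟩ := T.introEdge_spec x u v hk
    exact ⟨mem_bag_or_forgotten hx hu, mem_bag_or_forgotten hx hv⟩
  have : ∀ u v, T.joined keep t u v →
      (u ∈ (↑(T.bag t) ∪ T.forgotten t : Set V) ↔ v ∈ (↑(T.bag t) ∪ T.forgotten t : Set V)) := by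
    have : T.joined keep t ≤ Setoid.ker (· ∈ (↑(T.bag t) ∪ T.forgotten t : Set V)) := by
      refine joined_le fun x u v hx _ hk => ?_
      have := hmem x u v hx hk
      exact propext ⟨fun _ => this.2, fun _ => this.1⟩
    exact fun u v h => iff_of_eq (this h)
  induction h with
  | rel u v h =>
    obtain ⟨x, hx, -, hk⟩ := h
    exact Or.inr (hmem x u v hx hk).2
  | refl => exact Or.inl rfl
  | symm u v h ih =>
    rcases ih with ih | ih
    · exact Or.inl ih.symm
    · exact Or.inr ((this _ _ h).2 ih)
  | trans u v w h1 h2 ih1 ih2 =>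
    rcases ih2 with rfl | ih2
    · exact ih1
    · exact Or.inr ih2

theorem joined_of_children_eq {t s : ι} (hc : T.children t = {s})
    (hk : ∀ u v, keep t → T.kind t ≠ .introEdge u v) : T.joined keep t = T.joined keep s := by
  refine le_antisymm (joined_le fun x u v hx hkx he => ?_)
    (joined_mono (below_of_mem_children (by simp [hc])))
  rcases below_iff.1 hx with rfl | ⟨s', hs, hx'⟩
  · exact absurd he (hk u v hkx)
  · rw [hc, Set.mem_singleton_iff] at hs
    subst hs
    exact joined_of_below hx' hkx he

theorem joined_introEdge {t s : ι} {u v : V} (hc : T.children t = {s})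
    (hk : T.kind t = .introEdge u v) (hkeep : keep t) :
    T.joined keep t = T.joined keep s ⊔ Setoid.pair u v := by
  refine le_antisymm (joined_le fun x u' v' hx hkx he => ?_)
    (sup_le (joined_mono (below_of_mem_children (by simp [hc])))
      (Setoid.pair_le_iff.2 (joined_of_below (Below.refl t) hkeep hk)))
  rcases below_iff.1 hx with rfl | ⟨s', hs, hx'⟩
  · rw [hk] at he
    obtain ⟨rfl, rfl⟩ := NodeKind.introEdge.inj he
    exact (le_sup_right : Setoid.pair u v ≤ _) (Setoid.pair_rel u v)
  · rw [hc, Set.mem_singleton_iff] at hs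
    subst hs
    exact (le_sup_left : _ ≤ _ ⊔ Setoid.pair u v) (joined_of_below hx' hkx he)

theorem joined_join {t s₁ s₂ : ι} (hc : T.children t = {s₁, s₂}) (hk : T.kind t = .join) :
    T.joined keep t = T.joined keep s₁ ⊔ T.joined keep s₂ := by
  refine le_antisymm (joined_le fun x u v hx hkx he => ?_)
    (sup_le (joined_mono (below_of_mem_children (by simp [hc])))
      (joined_mono (below_of_mem_children (by simp [hc]))))
  rcases below_iff.1 hx with rfl | ⟨s', hs, hx'⟩
  · simp [hk] at he
  · rw [hc] at hs
    rcases hs with rfl | hs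
    · exact (le_sup_left : _ ≤ _ ⊔ T.joined keep s₂) (joined_of_below hx' hkx he)
    · rw [Set.mem_singleton_iff] at hs
      subst hs
      exact (le_sup_right : _ ≤ T.joined keep s₁ ⊔ _) (joined_of_below hx' hkx he)

variable (T) in
/-- `v` is the vertex of its component that is forgotten last. -/
def IsTop (keep : ι → Prop) (v : V) : Prop :=
  ∀ s ∈ T.children (T.forgetNode v), ∀ u ∈ T.bag s, T.joined keep s v u → u = v

/-- If `v` is not a top, it is joined to another vertex of the child's bag. That vertex survives at
the node forgetting `v`, so it is forgotten at smaller depth, and induction on this depth applies.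
-/
theorem exists_isTop (keep : ι → Prop) (v : V) :
    ∃ u, T.IsTop keep u ∧ T.joined keep T.root v u := by
  induction hd : T.depth (T.forgetNode v) using Nat.strong_induction_on generalizing v with
  | _ d ih =>
    by_cases h : T.IsTop keep v
    · exact ⟨v, h, Setoid.refl' _ _⟩
    · unfold IsTop at h
      push Not at h
      obtain ⟨s, hs, u, hu, hj, hne⟩ := h
      obtain ⟨s', hc, -, hb⟩ := T.exists_child_forgetNode v
      have hs' := hs
      rw [hc, Set.mem_singleton_iff] at hs'
      subst hs'
      have hu' : u ∈ T.bag (T.forgetNode v) := by simp [hb, hu, hne]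
      obtain ⟨h1, h2⟩ := below_forgetNode hu'
      have h3 : T.depth (T.forgetNode u) < T.depth (T.forgetNode v) := by
        by_contra h4
        exact h2 (h1.eq_of_depth_le (not_lt.1 h4))
      obtain ⟨w, hw, hw'⟩ := ih _ (hd ▸ h3) u rfl
      exact ⟨w, hw, Setoid.trans' _ (joined_mono (T.below_root s) hj) hw'⟩

/-- The component of a top cannot leave the subtree of `s`. A vertex joined to `v` below `s` is `v`
itself or forgotten below `s`; in both cases every bag containing it lies below `s`, and so does the
node of every kept edge at it. -/
theorem IsTop.joined_of_joined {s t : ι} {v y : V} (hv : T.IsTop keep v)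
    (hs : s ∈ T.children (T.forgetNode v)) (h : T.joined keep t v y) : T.joined keep s v y := by
  have key : ∀ x a b, keep x → T.kind x = .introEdge a b → ∀ c ∈ T.bag x, T.joined keep s v c →
      T.Below s x := by
    intro x a b hx hk c hc hj
    rcases joined_support hj with rfl | hmem | hmem
    · exact below_of_mem_bag (T.kind_forgetNode _) hs hc
    · rw [hv s hs c hmem hj] at hc
      exact below_of_mem_bag (T.kind_forgetNode _) hs hc
    · exact below_of_forgotten hmem hc
  have hker : T.joined keep t ≤ Setoid.ker (fun y => T.joined keep s v y) := by
    refine joined_le fun x a b _ hx hk => propext ?_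
    obtain ⟨-, -, -, -, ha, hb⟩ := T.introEdge_spec x a b hk
    constructor
    · intro h
      exact Setoid.trans' _ h (joined_of_below (key x a b hx hk a ha h) hx hk)
    · intro h
      exact Setoid.trans' _ h (Setoid.symm' _ (joined_of_below (key x a b hx hk b hb h) hx hk))
  have : T.joined keep s v v = T.joined keep s v y := hker h
  exact this.mp (Setoid.refl' _ v)

/-- All other vertices of the component of a top are forgotten strictly deeper than the top; for two
different tops this would hold both ways. -/
theorem IsTop.eq {t : ι} {u v : V} (hu : T.IsTop keep u) (hv : T.IsTop keep v)
    (h : T.joined keep t u v) : u = v := by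
  have key : ∀ u v, T.IsTop keep v → T.joined keep t v u →
      u = v ∨ T.depth (T.forgetNode v) < T.depth (T.forgetNode u) := by
    intro u v hv h
    obtain ⟨s, hc, -⟩ := T.exists_child_forgetNode v
    have hs : s ∈ T.children (T.forgetNode v) := by simp [hc]
    have hj := hv.joined_of_joined hs h
    rcases joined_support hj with h | h | h
    · exact Or.inl h.symm
    · exact Or.inl (hv s hs u h hj)
    · have h1 := Below.depth_le h
      rw [depth_of_mem_children hs] at h1
      exact Or.inr h1
  rcases key u v hv (Setoid.symm' _ h) with h1 | h1
  · exact h1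
  · rcases key v u hu h with h2 | h2
    · exact h2.symm
    · omega

end NiceTreeDecomposition

/-! ### Partial solutions -/

/-- What a bag with slots in `X` sees of a partial solution: the facility assigned to each slot
(`0` for a free slot), the blocks of slots already known to be connected, and the number of
clusters that are complete. -/
@[ext] structure PartialState (X Y : Type*) where
  fac : X → Y
  blocks : Setoid X
  closed : ℕ

namespace PartialState

variable {X Y : Type*} [DecidableEq X] [Zero Y]

/-- The state of an empty bag with `j` complete clusters. -/
def init (X Y : Type*) [Zero Y] (j : ℕ) : PartialState X Y := ⟨0, ⊥, j⟩

/-- Free the slot `a`. -/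
def clear (x : PartialState X Y) (a : X) : PartialState X Y :=
  ⟨Function.update x.fac a 0, x.blocks, x.closed⟩

open Classical in
/-- Forget the vertex in slot `a`; if it is alone in its block, its cluster becomes complete. -/
noncomputable def forget (x : PartialState X Y) (a : X) : PartialState X Y :=
  ⟨Function.update x.fac a 0, x.blocks.isolate a,
    x.closed + if ∀ b, x.blocks a b → b = a then 1 else 0⟩

end PartialState

namespace NiceTreeDecomposition

variable {V : Type*} [DecidableEq V] {G : SimpleGraph V} {ι : Type*}
  {T : NiceTreeDecomposition G ι} {X Y : Type*} [DecidableEq X] [Zero Y]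
  {slot : V → X} {keep : ι → Prop}

variable (T) in
/-- The blocks of the slots of a bag. -/
def slotBlocks (slot : V → X) (keep : ι → Prop) (t : ι) : Setoid X :=
  Setoid.onSlots slot (T.bag t) (T.joined keep t)

theorem slotBlocks_leaf {t : ι} (hk : T.kind t = .leaf) : T.slotBlocks slot keep t = ⊥ := by
  refine le_bot_iff.1 (Setoid.eqvGen_le ?_)
  rintro _ _ ⟨u, hu, -⟩
  simp [(T.leaf_spec t hk).2] at hu

/-- The new vertex is neither in the bag of the child nor forgotten below it, so no edge below
touches it and its slot is a block of its own before and after. -/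
theorem slotBlocks_introVertex (hB : ∀ t, Set.InjOn slot (T.bag t)) {t s : ι} {v : V}
    (hk : T.kind t = .introVertex v) (hc : T.children t = {s}) :
    T.slotBlocks slot keep t = T.slotBlocks slot keep s := by
  obtain ⟨s', hc', hv, hb⟩ := T.introVertex_spec t v hk
  obtain rfl : s = s' := by simpa [hc] using hc'
  have hj : T.joined keep t = T.joined keep s := joined_of_children_eq hc (by simp [hk])
  have hvs : v ∉ T.forgotten s := by
    rw [← forgotten_of_children_eq hc (by simp [hk])]
    intro h
    exact not_mem_bag_of_forgotten h (by simp [hb])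
  have hiso : ∀ u, T.joined keep s u v → u = v := by
    intro u hu
    rcases joined_support hu with h | h | h
    · exact h
    · exact absurd h hv
    · exact absurd h hvs
  ext a b
  unfold slotBlocks
  rw [Setoid.onSlots_rel (hB t), Setoid.onSlots_rel (hB s), hj, hb]
  constructor
  · rintro (rfl | ⟨x, hx, y, hy, rfl, rfl, h⟩)
    · exact Or.inl rfl
    · by_cases hyv : y = v
      · subst hyv
        exact Or.inl (congrArg slot (hiso x h))
      · have hxv : x ≠ v := by
          rintro rfl
          exact hyv (hiso y (Setoid.symm' _ h))
        refine Or.inr ⟨x, ?_, y, ?_, rfl, rfl, h⟩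
        · simpa [hxv] using hx
        · simpa [hyv] using hy
  · rintro (rfl | ⟨x, hx, y, hy, h1, h2, h⟩)
    · exact Or.inl rfl
    · refine Or.inr ⟨x, ?_, y, ?_, h1, h2, h⟩
      · exact Finset.mem_coe.2 (Finset.mem_insert_of_mem hx)
      · exact Finset.mem_coe.2 (Finset.mem_insert_of_mem hy)

theorem slotBlocks_skipEdge {t s : ι} {u v : V} (hk : T.kind t = .introEdge u v)
    (hc : T.children t = {s}) (hkeep : ¬ keep t) :
    T.slotBlocks slot keep t = T.slotBlocks slot keep s := by
  obtain ⟨s', hc', -, hb, -⟩ := T.introEdge_spec t u v hk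
  obtain rfl : s = s' := by simpa [hc] using hc'
  unfold slotBlocks
  rw [joined_of_children_eq hc (by simp [hkeep]), hb]

theorem slotBlocks_joinEdge {t s : ι} {u v : V} (hk : T.kind t = .introEdge u v)
    (hc : T.children t = {s}) (hkeep : keep t) :
    T.slotBlocks slot keep t =
      T.slotBlocks slot keep s ⊔ Setoid.pair (slot u) (slot v) := by
  obtain ⟨s', hc', -, hb, hu, hv⟩ := T.introEdge_spec t u v hk
  obtain rfl : s = s' := by simpa [hc] using hc'
  unfold slotBlocks
  rw [joined_introEdge hc hk hkeep, Setoid.onSlots_sup (A₂ := {u, v})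
    (fun _ _ h => joined_support h) (fun _ _ h => Setoid.pair_support h) ?_,
    Setoid.onSlots_pair hu hv, hb]
  rintro x ⟨-, rfl | hx⟩
  · exact hu
  · rw [Set.mem_singleton_iff] at hx
    subst hx
    exact hv

theorem slotBlocks_forget (hB : ∀ t, Set.InjOn slot (T.bag t)) {t s : ι} {v : V}
    (hk : T.kind t = .forget v) (hc : T.children t = {s}) :
    T.slotBlocks slot keep t = (T.slotBlocks slot keep s).isolate (slot v) := by
  obtain ⟨s', hc', hv, hb⟩ := T.forget_spec t v hk
  obtain rfl : s = s' := by simpa [hc] using hc'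
  have hj : T.joined keep t = T.joined keep s := joined_of_children_eq hc (by simp [hk])
  ext a b
  unfold slotBlocks
  rw [Setoid.isolate_rel, Setoid.onSlots_rel (hB t), Setoid.onSlots_rel (hB s), hj, hb]
  constructor
  · rintro (rfl | ⟨x, hx, y, hy, rfl, rfl, h⟩)
    · exact Or.inl rfl
    · simp only [Finset.coe_erase, Set.mem_sdiff, Set.mem_singleton_iff] at hx hy
      exact Or.inr ⟨fun h => hx.2 (hB s hx.1 hv h), fun h => hy.2 (hB s hy.1 hv h),
        Or.inr ⟨x, hx.1, y, hy.1, rfl, rfl, h⟩⟩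
  · rintro (rfl | ⟨h1, h2, rfl | ⟨x, hx, y, hy, rfl, rfl, h⟩⟩)
    · exact Or.inl rfl
    · exact Or.inl rfl
    · refine Or.inr ⟨x, ?_, y, ?_, rfl, rfl, h⟩
      · simp only [Finset.coe_erase, Set.mem_sdiff, Set.mem_singleton_iff]
        exact ⟨hx, fun h => h1 (congrArg slot h)⟩
      · simp only [Finset.coe_erase, Set.mem_sdiff, Set.mem_singleton_iff]
        exact ⟨hy, fun h => h2 (congrArg slot h)⟩

theorem bag_eq_of_join {t s₁ s₂ : ι} (hk : T.kind t = .join) (hc : T.children t = {s₁, s₂}) :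
    T.bag s₁ = T.bag t ∧ T.bag s₂ = T.bag t := by
  obtain ⟨r₁, r₂, -, hc', h₁, h₂⟩ := T.join_spec t hk
  rw [hc] at hc'
  have hs₁ : s₁ ∈ ({r₁, r₂} : Set ι) := hc' ▸ (by simp)
  have hs₂ : s₂ ∈ ({r₁, r₂} : Set ι) := hc' ▸ (by simp)
  simp only [Set.mem_insert_iff, Set.mem_singleton_iff] at hs₁ hs₂
  constructor
  · rcases hs₁ with rfl | rfl <;> assumption
  · rcases hs₂ with rfl | rfl <;> assumption

/-- The sets of vertices forgotten below the two children are disjoint, and no bag vertex of a node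
is forgotten below that node. Vertices seen by both sides thus lie in the common bag, and
`Setoid.onSlots_sup` applies. -/
theorem slotBlocks_join {t s₁ s₂ : ι} (hne : s₁ ≠ s₂) (hk : T.kind t = .join)
    (hc : T.children t = {s₁, s₂}) :
    T.slotBlocks slot keep t = T.slotBlocks slot keep s₁ ⊔ T.slotBlocks slot keep s₂ := by
  obtain ⟨h₁, h₂⟩ := bag_eq_of_join hk hc
  unfold slotBlocks
  rw [joined_join hc hk, Setoid.onSlots_sup (fun _ _ h => joined_support h)
    (fun _ _ h => joined_support h) ?_, h₁, h₂]
  rintro x ⟨hx | hx, hx' | hx'⟩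
  · rwa [h₁] at hx
  · rwa [h₁] at hx
  · rwa [h₂] at hx'
  · have m₁ : s₁ ∈ T.children t := by simp [hc]
    have m₂ : s₂ ∈ T.children t := by simp [hc]
    exact absurd hx' (Set.disjoint_left.1 (disjoint_forgotten hne m₁ m₂) hx)

/-- This translates being a top, a statement on vertices of the bag, into the test on slots that
`PartialState.forget` performs. -/
theorem isTop_iff (hB : ∀ t, Set.InjOn slot (T.bag t)) {t s : ι} {v : V}
    (hk : T.kind t = .forget v) (hc : T.children t = {s}) :
    T.IsTop keep v ↔ ∀ b, T.slotBlocks slot keep s (slot v) b → b = slot v := by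
  obtain ⟨s', hc', hv, hb⟩ := T.forget_spec t v hk
  obtain rfl : s = s' := by simpa [hc] using hc'
  unfold IsTop slotBlocks
  rw [← eq_forgetNode hk, hc]
  simp only [Set.mem_singleton_iff, forall_eq]
  constructor
  · intro h b hb
    rcases (Setoid.onSlots_rel (hB s)).1 hb with h1 | ⟨x, hx, y, hy, h1, rfl, h2⟩
    · exact h1.symm
    · rw [hB s hx hv h1] at h2
      rw [h y hy h2]
  · intro h u hu hj
    exact hB s hu hv (h (slot u) ((Setoid.onSlots_slot (hB s) hv hu).2 hj))

/-- The maps `ch₁`, `ch₂` return the children of every node. -/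
structure IsChildMap (T : NiceTreeDecomposition G ι) (ch₁ ch₂ : ι → ι) : Prop where
  one : ∀ t s, T.children t = {s} → ch₁ t = s
  two : ∀ t s₁ s₂, s₁ ≠ s₂ → T.children t = {s₁, s₂} →
    (ch₁ t = s₁ ∧ ch₂ t = s₂) ∨ (ch₁ t = s₂ ∧ ch₂ t = s₁)

variable {ch₁ ch₂ : ι → ι}

theorem IsChildMap.introVertex (h : T.IsChildMap ch₁ ch₂) {t : ι} {v : V}
    (hk : T.kind t = .introVertex v) : T.children t = {ch₁ t} := by
  obtain ⟨s, hc, -⟩ := T.introVertex_spec t v hk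
  rw [h.one t s hc, hc]

theorem IsChildMap.introEdge (h : T.IsChildMap ch₁ ch₂) {t : ι} {u v : V}
    (hk : T.kind t = .introEdge u v) : T.children t = {ch₁ t} := by
  obtain ⟨s, hc, -⟩ := T.introEdge_spec t u v hk
  rw [h.one t s hc, hc]

theorem IsChildMap.forget (h : T.IsChildMap ch₁ ch₂) {t : ι} {v : V}
    (hk : T.kind t = .forget v) : T.children t = {ch₁ t} := by
  obtain ⟨s, hc, -⟩ := T.forget_spec t v hk
  rw [h.one t s hc, hc]

theorem IsChildMap.join (h : T.IsChildMap ch₁ ch₂) {t : ι} (hk : T.kind t = .join) :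
    ch₁ t ≠ ch₂ t ∧ T.children t = {ch₁ t, ch₂ t} := by
  obtain ⟨s₁, s₂, hne, hc, -⟩ := T.join_spec t hk
  rcases h.two t s₁ s₂ hne hc with ⟨h₁, h₂⟩ | ⟨h₁, h₂⟩
  · rw [h₁, h₂]; exact ⟨hne, hc⟩
  · rw [h₁, h₂, Set.pair_comm]; exact ⟨hne.symm, hc⟩

/-- `Attempt slot ch₁ ch₂ cost k tab t x c x₁ x₂`: from the entries `x₁`, `x₂` of the tables `tab` of
the children of `t` one obtains the state `x` at `t` with cost `c`. -/
inductive Attempt (T : NiceTreeDecomposition G ι) (slot : V → X) (ch₁ ch₂ : ι → ι)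
    (cost : V → Y → ℝ) (k : ℕ) (tab : ι → PartialState X Y → Option ℝ) (t : ι) :
    PartialState X Y → ℝ → PartialState X Y → PartialState X Y → Prop
  | leaf (hk : T.kind t = .leaf) :
      Attempt T slot ch₁ ch₂ cost k tab t (.init X Y 0) 0 (.init X Y 0) (.init X Y 0)
  | introVertex {v : V} (hk : T.kind t = .introVertex v) (x : PartialState X Y) (c : ℝ)
      (h : tab (ch₁ t) (x.clear (slot v)) = some c) :
      Attempt T slot ch₁ ch₂ cost k tab t x c (x.clear (slot v)) (.init X Y 0)
  | skipEdge {u v : V} (hk : T.kind t = .introEdge u v) (x : PartialState X Y) (c : ℝ)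
      (h : tab (ch₁ t) x = some c) :
      Attempt T slot ch₁ ch₂ cost k tab t x c x (.init X Y 0)
  | joinEdge {u v : V} (hk : T.kind t = .introEdge u v) (x : PartialState X Y) (c : ℝ)
      (h : tab (ch₁ t) x = some c) (hf : x.fac (slot u) = x.fac (slot v)) :
      Attempt T slot ch₁ ch₂ cost k tab t
        ⟨x.fac, x.blocks ⊔ Setoid.pair (slot u) (slot v), x.closed⟩ c x (.init X Y 0)
  | forget {v : V} (hk : T.kind t = .forget v) (x : PartialState X Y) (c : ℝ)
      (h : tab (ch₁ t) x = some c) (hj : (x.forget (slot v)).closed ≤ k) :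
      Attempt T slot ch₁ ch₂ cost k tab t (x.forget (slot v))
        (c + cost v (x.fac (slot v))) x (.init X Y 0)
  | join (hk : T.kind t = .join) (f : X → Y) (p₁ p₂ : Setoid X) (j₁ j₂ : ℕ) (c₁ c₂ : ℝ)
      (h₁ : tab (ch₁ t) ⟨f, p₁, j₁⟩ = some c₁) (h₂ : tab (ch₂ t) ⟨f, p₂, j₂⟩ = some c₂)
      (hj : j₁ + j₂ ≤ k) :
      Attempt T slot ch₁ ch₂ cost k tab t ⟨f, p₁ ⊔ p₂, j₁ + j₂⟩ (c₁ + c₂) ⟨f, p₁, j₁⟩ ⟨f, p₂, j₂⟩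

/-! ### Counting complete components, and the lower bound by table entries -/

section Finite

variable [Fintype V]

open Classical in
variable (T) in
/-- The finite set of vertices forgotten in the subtree of `t`. -/
noncomputable def forgottenFinset (t : ι) : Finset V := Finset.univ.filter (· ∈ T.forgotten t)

open Classical in
variable (T) in
/-- The number of components completed in the subtree of `t`. -/
noncomputable def numTops (keep : ι → Prop) (t : ι) : ℕ :=
  ((T.forgottenFinset t).filter (T.IsTop keep)).card

theorem forgottenFinset_leaf {t : ι} (hk : T.kind t = .leaf) : T.forgottenFinset t = ∅ := by
  simp [forgottenFinset, forgotten_leaf hk]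

theorem forgottenFinset_of_children_eq {t s : ι} (hc : T.children t = {s})
    (hk : ∀ v, T.kind t ≠ .forget v) : T.forgottenFinset t = T.forgottenFinset s := by
  ext v
  simp [forgottenFinset, forgotten_of_children_eq hc hk]

theorem forgottenFinset_forget {t s : ι} {v : V} (hk : T.kind t = .forget v)
    (hc : T.children t = {s}) :
    v ∉ T.forgottenFinset s ∧ T.forgottenFinset t = insert v (T.forgottenFinset s) := by
  constructor
  · simpa [forgottenFinset] using not_forgotten_child hk (by simp [hc])
  · ext u
    simp [forgottenFinset, forgotten_forget hk hc]

theorem forgottenFinset_join {t s₁ s₂ : ι} (hne : s₁ ≠ s₂) (hk : T.kind t = .join)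
    (hc : T.children t = {s₁, s₂}) :
    Disjoint (T.forgottenFinset s₁) (T.forgottenFinset s₂) ∧
      T.forgottenFinset t = T.forgottenFinset s₁ ∪ T.forgottenFinset s₂ := by
  constructor
  · rw [Finset.disjoint_left]
    intro v h₁ h₂
    simp only [forgottenFinset, Finset.mem_filter, Finset.mem_univ, true_and] at h₁ h₂
    have m₁ : s₁ ∈ T.children t := by simp [hc]
    have m₂ : s₂ ∈ T.children t := by simp [hc]
    exact Set.disjoint_left.1 (disjoint_forgotten hne m₁ m₂) h₁ h₂
  · ext u
    simp [forgottenFinset, forgotten_join hk hc]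

theorem forgottenFinset_root : T.forgottenFinset T.root = Finset.univ := by
  simp [forgottenFinset, forgotten_root]

open Classical in
theorem numTops_forget {t s : ι} {v : V} (hk : T.kind t = .forget v)
    (hc : T.children t = {s}) :
    T.numTops keep t = T.numTops keep s + if T.IsTop keep v then 1 else 0 := by
  obtain ⟨h1, h2⟩ := forgottenFinset_forget hk hc
  unfold numTops
  rw [h2, Finset.filter_insert]
  split_ifs
  · rw [Finset.card_insert_of_notMem (by simp [h1])]
  · rfl

open Classical in
theorem numTops_join {t s₁ s₂ : ι} (hne : s₁ ≠ s₂) (hk : T.kind t = .join)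
    (hc : T.children t = {s₁, s₂}) :
    T.numTops keep t = T.numTops keep s₁ + T.numTops keep s₂ := by
  obtain ⟨h1, h2⟩ := forgottenFinset_join hne hk hc
  unfold numTops
  rw [h2, Finset.filter_union, Finset.card_union_of_disjoint (Finset.disjoint_filter_filter h1)]

open Classical in
theorem numTops_leaf {t : ι} (hk : T.kind t = .leaf) : T.numTops keep t = 0 := by
  simp [numTops, forgottenFinset_leaf hk]

theorem numTops_of_children_eq {t s : ι} (hc : T.children t = {s})
    (hk : ∀ v, T.kind t ≠ .forget v) : T.numTops keep t = T.numTops keep s := by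
  simp [numTops, forgottenFinset_of_children_eq hc hk]

open Classical in
/-- The facilities of the slots of `B`. -/
noncomputable def facOn (slot : V → X) (col : V → Y) (B : Set V) (a : X) : Y :=
  if h : ∃ v ∈ B, slot v = a then col h.choose else 0

theorem facOn_slot {col : V → Y} {B : Set V} (hB : Set.InjOn slot B) {v : V} (hv : v ∈ B) :
    facOn slot col B (slot v) = col v := by
  have h : ∃ u ∈ B, slot u = slot v := ⟨v, hv, rfl⟩
  rw [facOn, dif_pos h, hB h.choose_spec.1 hv h.choose_spec.2]

theorem facOn_of_forall_ne {col : V → Y} {B : Set V} {a : X} (h : ∀ v ∈ B, slot v ≠ a) :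
    facOn slot col B a = 0 := by
  rw [facOn, dif_neg]
  rintro ⟨v, hv, h'⟩
  exact h v hv h'

/-- Free slots carry the value `0`, so removing a vertex from a bag is the same as resetting its
slot. Read from parent to child this serves introduce nodes, read from child to parent it serves
forget nodes. -/
theorem update_facOn_insert {col : V → Y} {B B' : Set V} {v : V} (hv : v ∉ B)
    (hB' : B' = insert v B) (hB : Set.InjOn slot B') :
    Function.update (facOn slot col B') (slot v) 0 = facOn slot col B := by
  subst hB'
  funext a
  by_cases ha : a = slot v
  · subst ha
    rw [Function.update_self, facOn_of_forall_ne]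
    intro u hu h
    have := hB (Set.mem_insert_of_mem v hu) (Set.mem_insert v B) h
    exact hv (this ▸ hu)
  · rw [Function.update_of_ne ha]
    by_cases h : ∃ u ∈ B, slot u = a
    · obtain ⟨u, hu, rfl⟩ := h
      rw [facOn_slot hB (Set.mem_insert_of_mem v hu),
        facOn_slot (hB.mono (Set.subset_insert v B)) hu]
    · push Not at h
      rw [facOn_of_forall_ne h, facOn_of_forall_ne]
      rintro u (rfl | hu)
      · exact fun h => ha h.symm
      · exact h u hu

variable (T) in
/-- The state at `t` of the partial solution given by the chosen edges and the facilities of the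
vertices. -/
noncomputable def profile (slot : V → X) (keep : ι → Prop) (col : V → Y) (t : ι) :
    PartialState X Y :=
  ⟨facOn slot col (T.bag t), T.slotBlocks slot keep t, T.numTops keep t⟩

variable {cost : V → Y → ℝ} {k : ℕ} {tab : ι → PartialState X Y → Option ℝ}

theorem facOn_empty {col : V → Y} : facOn slot col (∅ : Set V) = 0 := by
  funext a
  exact facOn_of_forall_ne (by simp)

/-- The entries of the tables are lower bounds for the costs of partial solutions. -/
theorem exists_tab_le [Finite ι] (hB : ∀ t, Set.InjOn slot (T.bag t)) (hch : T.IsChildMap ch₁ ch₂)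
    (hopt : ∀ t x c x₁ x₂, Attempt T slot ch₁ ch₂ cost k tab t x c x₁ x₂ →
      ∃ c' ≤ c, tab t x = some c')
    {col : V → Y} (hcol : ∀ x u v, keep x → T.kind x = .introEdge u v → col u = col v)
    (hk : ∀ t, T.numTops keep t ≤ k) (t : ι) :
    ∃ c ≤ ∑ v ∈ T.forgottenFinset t, cost v (col v), tab t (T.profile slot keep col t) = some c := by
  induction t using T.bottom_up with
  | h t ih =>
    cases hkt : T.kind t with
    | leaf =>
      have hp : T.profile slot keep col t = .init X Y 0 := by
        simp [profile, PartialState.init, slotBlocks_leaf hkt, numTops_leaf hkt,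
          (T.leaf_spec t hkt).2, facOn_empty]
      rw [hp, forgottenFinset_leaf hkt, Finset.sum_empty]
      exact hopt _ _ _ _ _ (.leaf hkt)
    | introVertex v =>
      have hc := hch.introVertex hkt
      obtain ⟨s, hc', hv, hb⟩ := T.introVertex_spec t v hkt
      obtain rfl : ch₁ t = s := by simpa [hc] using hc'
      obtain ⟨c, hle, htab⟩ := ih (ch₁ t) (by simp [hc])
      -- The state at `t` already contains the facility of the new vertex; clearing its slot gives
      -- back the state of the child. So the facility is guessed at the introduce node.
      have hp : (T.profile slot keep col t).clear (slot v) =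
          T.profile slot keep col (ch₁ t) := by
        simp only [profile, PartialState.clear]
        rw [update_facOn_insert (Finset.mem_coe.not.2 hv) (by simp [hb]) (hB t),
          slotBlocks_introVertex hB hkt hc, numTops_of_children_eq hc (by simp [hkt])]
      obtain ⟨c', h1, h2⟩ := hopt _ _ _ _ _ (.introVertex hkt (T.profile slot keep col t) c
        (by rw [hp, htab]))
      rw [forgottenFinset_of_children_eq hc (by simp [hkt])]
      exact ⟨c', h1.trans hle, h2⟩
    | introEdge u v =>
      have hc := hch.introEdge hkt
      obtain ⟨s, hc', -, hb, hu, hv⟩ := T.introEdge_spec t u v hkt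
      obtain rfl : ch₁ t = s := by simpa [hc] using hc'
      obtain ⟨c, hle, htab⟩ := ih (ch₁ t) (by simp [hc])
      rw [forgottenFinset_of_children_eq hc (by simp [hkt])]
      by_cases hkeep : keep t
      · obtain ⟨c', h1, h2⟩ := hopt _ _ _ _ _ (.joinEdge hkt _ c htab (by
          simp only [profile]
          rw [facOn_slot (hB _) (by simpa [← hb] using hu),
            facOn_slot (hB _) (by simpa [← hb] using hv), hcol t u v hkeep hkt]))
        refine ⟨c', h1.trans hle, ?_⟩
        rw [← h2]
        simp only [profile]
        rw [slotBlocks_joinEdge hkt hc hkeep, numTops_of_children_eq hc (by simp [hkt]), hb]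
      · obtain ⟨c', h1, h2⟩ := hopt _ _ _ _ _ (.skipEdge hkt _ c htab)
        refine ⟨c', h1.trans hle, ?_⟩
        rw [← h2]
        simp only [profile]
        rw [slotBlocks_skipEdge hkt hc hkeep, numTops_of_children_eq hc (by simp [hkt]), hb]
    | forget v =>
      have hc := hch.forget hkt
      obtain ⟨s, hc', hv, hb⟩ := T.forget_spec t v hkt
      obtain rfl : ch₁ t = s := by simpa [hc] using hc'
      obtain ⟨c, hle, htab⟩ := ih (ch₁ t) (by simp [hc])
      obtain ⟨hn, hf⟩ := forgottenFinset_forget hkt hc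
      have hfac : (T.profile slot keep col (ch₁ t)).fac (slot v) = col v := facOn_slot (hB _) hv
      have hp : (T.profile slot keep col (ch₁ t)).forget (slot v) = T.profile slot keep col t := by
        simp only [profile, PartialState.forget]
        rw [update_facOn_insert (B := T.bag t) (by simp [hb]) (by simp [hb, hv]) (hB _),
          slotBlocks_forget hB hkt hc, numTops_forget hkt hc]
        have hiff : T.IsTop keep v ↔
            ∀ b, (T.profile slot keep col (ch₁ t)).blocks (slot v) b → b = slot v :=
          isTop_iff hB hkt hc
        by_cases h : T.IsTop keep v
        · rw [if_pos h, if_pos (hiff.1 h)]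
        · rw [if_neg h, if_neg (hiff.not.1 h)]
      -- The cost of `v` is charged here, at its unique forget node. The attempt is admissible
      -- because the number of complete components never exceeds `k`.
      obtain ⟨c', h1, h2⟩ := hopt _ _ _ _ _ (.forget hkt _ c htab (by rw [hp]; exact hk t))
      rw [hp] at h2
      rw [hfac] at h1
      refine ⟨c', h1.trans ?_, h2⟩
      rw [hf, Finset.sum_insert hn]
      linarith
    | join =>
      obtain ⟨hne, hc⟩ := hch.join hkt
      obtain ⟨c₁, hle₁, htab₁⟩ := ih (ch₁ t) (by simp [hc])
      obtain ⟨c₂, hle₂, htab₂⟩ := ih (ch₂ t) (by simp [hc])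
      obtain ⟨hd, hf⟩ := forgottenFinset_join hne hkt hc
      obtain ⟨hb₁, hb₂⟩ := bag_eq_of_join hkt hc
      have hn := numTops_join (keep := keep) hne hkt hc
      simp only [profile, hb₁, hb₂] at htab₁ htab₂
      obtain ⟨c', h1, h2⟩ := hopt _ _ _ _ _ (.join hkt _ _ _ _ _ c₁ c₂ htab₁ htab₂
        (by rw [← hn]; exact hk t))
      refine ⟨c', h1.trans ?_, ?_⟩
      · rw [hf, Finset.sum_union hd]
        linarith
      · rw [← h2, profile, slotBlocks_join hne hkt hc, hn]

end Finite

end NiceTreeDecomposition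

/-! ### Solutions read off from the tables -/

namespace NiceTreeDecomposition

variable {V : Type*} [DecidableEq V] {G : SimpleGraph V} {ι : Type*}
  {T : NiceTreeDecomposition G ι} {X Y : Type*} [DecidableEq X] [Zero Y]
  {slot : V → X} {keep : ι → Prop} [Fintype V] {ch₁ ch₂ : ι → ι}
  {cost : V → Y → ℝ} {k : ℕ} {tab : ι → PartialState X Y → Option ℝ}

/-- `cs` chooses one entry of the table of every node such that the entries chosen at the children
of a node produce the entry chosen at the node. -/
def IsRun (T : NiceTreeDecomposition G ι) (slot : V → X) (ch₁ ch₂ : ι → ι)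
    (cost : V → Y → ℝ) (k : ℕ) (tab : ι → PartialState X Y → Option ℝ)
    (cs : ι → PartialState X Y) : Prop :=
  ∀ t, ∃ c x₁ x₂, tab t (cs t) = some c ∧ Attempt T slot ch₁ ch₂ cost k tab t (cs t) c x₁ x₂ ∧
    (T.kind t ≠ .leaf → cs (ch₁ t) = x₁) ∧ (T.kind t = .join → cs (ch₂ t) = x₂)

/-- The edge introduced at `t` is used by the run `cs`. -/
def RunKeeps (T : NiceTreeDecomposition G ι) (slot : V → X) (ch₁ : ι → ι)
    (cs : ι → PartialState X Y) (t : ι) : Prop :=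
  ∃ u v, T.kind t = .introEdge u v ∧ (cs (ch₁ t)).fac (slot u) = (cs (ch₁ t)).fac (slot v) ∧
    (cs t).blocks = (cs (ch₁ t)).blocks ⊔ Setoid.pair (slot u) (slot v)

/-- The facility assigned to `v` by the run `cs`. -/
noncomputable def runFac (T : NiceTreeDecomposition G ι) (slot : V → X) (ch₁ : ι → ι)
    (cs : ι → PartialState X Y) (v : V) : Y :=
  (cs (ch₁ (T.forgetNode v))).fac (slot v)

variable {cs : ι → PartialState X Y}

/-- Between a node and its child the facilities change at most in the slot of the introduced or
forgotten vertex, and no other vertex of the larger bag uses this slot. -/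
theorem IsRun.fac_child (hB : ∀ t, Set.InjOn slot (T.bag t)) (hch : T.IsChildMap ch₁ ch₂)
    (h : IsRun T slot ch₁ ch₂ cost k tab cs) {t s : ι} {v : V} (hs : s ∈ T.children t)
    (hv : v ∈ T.bag s) (hv' : v ∈ T.bag t) :
    (cs s).fac (slot v) = (cs t).fac (slot v) := by
  obtain ⟨c, x₁, x₂, -, hA, h₁, h₂⟩ := h t
  generalize hx : cs t = x at hA
  cases hA with
  | leaf hk => simp [(T.leaf_spec t hk).1] at hs
  | @introVertex u hk _ c hc =>
    have hc' := hch.introVertex hk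
    rw [hc', Set.mem_singleton_iff] at hs
    subst hs
    rw [h₁ (by simp [hk])]
    obtain ⟨s', hc'', hu, hb⟩ := T.introVertex_spec t u hk
    obtain rfl : ch₁ t = s' := by simpa [hc'] using hc''
    have hne : v ≠ u := fun he => hu (he ▸ hv)
    have : slot v ≠ slot u := fun he => hne (hB t hv' (by simp [hb]) he)
    simp [PartialState.clear, this]
  | skipEdge hk =>
    rw [hch.introEdge hk, Set.mem_singleton_iff] at hs
    rw [hs, h₁ (by simp [hk])]
  | joinEdge hk =>
    rw [hch.introEdge hk, Set.mem_singleton_iff] at hs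
    rw [hs, h₁ (by simp [hk])]
  | @forget u hk x c hc =>
    have hc' := hch.forget hk
    rw [hc', Set.mem_singleton_iff] at hs
    subst hs
    obtain ⟨s', hc'', hu, hb⟩ := T.forget_spec t u hk
    obtain rfl : ch₁ t = s' := by simpa [hc'] using hc''
    rw [h₁ (by simp [hk])]
    have hne : v ≠ u := by
      rintro rfl
      simp [hb] at hv'
    have : slot v ≠ slot u := fun he => hne (hB _ hv hu he)
    simp [PartialState.forget, this]
  | join hk =>
    rw [(hch.join hk).2] at hs
    rcases hs with hs | hs
    · rw [hs, h₁ (by simp [hk])]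
    · rw [Set.mem_singleton_iff] at hs
      rw [hs, h₂ hk]

/-- The value `runFac` is read off at the child of the node forgetting `v`, which lies above all
bags containing `v`; `IsRun.fac_child` carries it down to each of them. -/
theorem IsRun.fac_slot (hB : ∀ t, Set.InjOn slot (T.bag t)) (hch : T.IsChildMap ch₁ ch₂)
    (h : IsRun T slot ch₁ ch₂ cost k tab cs) {t : ι} {v : V} (hv : v ∈ T.bag t) :
    (cs t).fac (slot v) = runFac T slot ch₁ cs v := by
  refine T.top_down (P := fun t => v ∈ T.bag t → (cs t).fac (slot v) = runFac T slot ch₁ cs v)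
    (by simp [T.bag_root]) (fun t s hs ih hv => ?_) t hv
  rcases mem_bag_of_mem_children hs hv with hv' | hk
  · rw [h.fac_child hB hch hs hv hv', ih hv']
  · rw [hch.forget hk, Set.mem_singleton_iff] at hs
    rw [runFac, ← eq_forgetNode hk, hs]

theorem IsRun.runFac_eq (hB : ∀ t, Set.InjOn slot (T.bag t)) (hch : T.IsChildMap ch₁ ch₂)
    (h : IsRun T slot ch₁ ch₂ cost k tab cs) (x : ι) (u v : V)
    (hx : RunKeeps T slot ch₁ cs x) (hk : T.kind x = .introEdge u v) :
    runFac T slot ch₁ cs u = runFac T slot ch₁ cs v := by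
  obtain ⟨u', v', hk', hf, -⟩ := hx
  obtain ⟨rfl, rfl⟩ := NodeKind.introEdge.inj (hk.symm.trans hk')
  obtain ⟨s, hc, -, hb, hu, hv⟩ := T.introEdge_spec x u v hk
  obtain rfl := hch.one x s hc
  rw [hb] at hu hv
  rwa [h.fac_slot hB hch hu, h.fac_slot hB hch hv] at hf

/-- The entries chosen by a run describe the partial solutions given by its choices. -/
theorem IsRun.spec [Finite ι] (hB : ∀ t, Set.InjOn slot (T.bag t)) (hch : T.IsChildMap ch₁ ch₂)
    (h : IsRun T slot ch₁ ch₂ cost k tab cs) (t : ι) :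
    (cs t).blocks = T.slotBlocks slot (RunKeeps T slot ch₁ cs) t ∧
      (cs t).closed = T.numTops (RunKeeps T slot ch₁ cs) t ∧
      tab t (cs t) = some (∑ v ∈ T.forgottenFinset t, cost v (runFac T slot ch₁ cs v)) := by
  induction t using T.bottom_up with
  | h t ih =>
    obtain ⟨c, x₁, x₂, htab, hA, h₁, h₂⟩ := h t
    rw [htab]
    generalize hx : cs t = x at hA
    cases hA with
    | leaf hk =>
      simp [PartialState.init, slotBlocks_leaf hk, numTops_leaf hk, forgottenFinset_leaf hk]
    | introVertex hk _ c hc =>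
      have hc' := hch.introVertex hk
      obtain ⟨i1, i2, i3⟩ := ih (ch₁ t) (by simp [hc'])
      rw [h₁ (by simp [hk])] at i1 i2 i3
      rw [slotBlocks_introVertex hB hk hc', numTops_of_children_eq hc' (by simp [hk]),
        forgottenFinset_of_children_eq hc' (by simp [hk])]
      exact ⟨i1, i2, by rw [← i3, hc]⟩
    | @skipEdge u v hk _ c hc =>
      have hc' := hch.introEdge hk
      obtain ⟨i1, i2, i3⟩ := ih (ch₁ t) (by simp [hc'])
      have hs := h₁ (by simp [hk])
      rw [hs] at i1 i2 i3
      rw [numTops_of_children_eq hc' (by simp [hk]),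
        forgottenFinset_of_children_eq hc' (by simp [hk])]
      refine ⟨?_, i2, by rw [← i3, hc]⟩
      -- `RunKeeps` depends on the states alone, so it may hold although the edge was skipped. This
      -- happens only if merging the two slots changes nothing, and then both readings give the same
      -- blocks.
      by_cases hkeep : RunKeeps T slot ch₁ cs t
      · rw [slotBlocks_joinEdge hk hc' hkeep, ← i1]
        obtain ⟨u', v', hk', -, hbl⟩ := hkeep
        obtain ⟨rfl, rfl⟩ := NodeKind.introEdge.inj (hk.symm.trans hk')
        rwa [hx, hs] at hbl
      · rw [slotBlocks_skipEdge hk hc' hkeep, ← i1]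
    | @joinEdge u v hk x c hc hf =>
      have hc' := hch.introEdge hk
      obtain ⟨i1, i2, i3⟩ := ih (ch₁ t) (by simp [hc'])
      have hs := h₁ (by simp [hk])
      rw [hs] at i1 i2 i3
      rw [numTops_of_children_eq hc' (by simp [hk]),
        forgottenFinset_of_children_eq hc' (by simp [hk])]
      refine ⟨?_, i2, by rw [← i3, hc]⟩
      have hkeep : RunKeeps T slot ch₁ cs t := ⟨u, v, hk, by rw [hs, hf], by rw [hx, hs]⟩
      rw [slotBlocks_joinEdge hk hc' hkeep, ← i1]
    | @forget v hk x c hc hj =>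
      have hc' := hch.forget hk
      obtain ⟨i1, i2, i3⟩ := ih (ch₁ t) (by simp [hc'])
      have hs := h₁ (by simp [hk])
      have hcol : runFac T slot ch₁ cs v = x₁.fac (slot v) := by
        rw [runFac, ← eq_forgetNode hk, hs]
      rw [hs] at i1 i2 i3
      obtain ⟨hn, hf⟩ := forgottenFinset_forget hk hc'
      refine ⟨?_, ?_, ?_⟩
      · rw [slotBlocks_forget hB hk hc', ← i1]
        rfl
      · have hiff := isTop_iff (keep := RunKeeps T slot ch₁ cs) hB hk hc'
        rw [numTops_forget hk hc', ← i2]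
        simp only [PartialState.forget]
        rw [i1]
        by_cases h : T.IsTop (RunKeeps T slot ch₁ cs) v
        · rw [if_pos h, if_pos (hiff.1 h)]
        · rw [if_neg h, if_neg (hiff.not.1 h)]
      · rw [hf, Finset.sum_insert hn, hcol, add_comm]
        rw [hc, Option.some_inj] at i3
        rw [i3]
    | join hk f p₁ p₂ j₁ j₂ c₁ c₂ hc₁ hc₂ hj =>
      obtain ⟨hne, hc⟩ := hch.join hk
      obtain ⟨i1, i2, i3⟩ := ih (ch₁ t) (by simp [hc])
      obtain ⟨i1', i2', i3'⟩ := ih (ch₂ t) (by simp [hc])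
      rw [h₁ (by simp [hk])] at i1 i2 i3
      rw [h₂ hk] at i1' i2' i3'
      obtain ⟨hd, hf⟩ := forgottenFinset_join hne hk hc
      rw [hc₁, Option.some_inj] at i3
      rw [hc₂, Option.some_inj] at i3'
      rw [slotBlocks_join hne hk hc, numTops_join hne hk hc, hf, Finset.sum_union hd,
        ← i1, ← i2, ← i3, ← i1', ← i2', ← i3']
      exact ⟨rfl, rfl, rfl⟩

/-! ### Components and clusters -/

theorem slotBlocks_root : T.slotBlocks slot keep T.root = ⊥ := by
  refine le_bot_iff.1 (Setoid.eqvGen_le ?_)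
  rintro _ _ ⟨u, hu, -⟩
  simp [T.bag_root] at hu

theorem profile_root {col : V → Y} :
    T.profile slot keep col T.root = .init X Y (T.numTops keep T.root) := by
  simp [profile, PartialState.init, slotBlocks_root, T.bag_root, facOn_empty]

-- The number of complete components only grows towards the root. A solution with `k` clusters
-- therefore never needs a state with more than `k` of them, and the tables may be cut off there.
open Classical in
theorem numTops_le_root (t : ι) : T.numTops keep t ≤ T.numTops keep T.root := by
  unfold numTops
  refine Finset.card_le_card (Finset.filter_subset_filter _ ?_)
  simp [forgottenFinset_root]

/-- The same induction as in `exists_isTop`, now also following the label: each copying step leads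
to a vertex forgotten at smaller depth, until a top is reached. -/
theorem exists_isTop_eq {α : Type*} (cl : V → α)
    (h : ∀ v, ¬ T.IsTop keep v →
      ∃ u ∈ T.bag (T.forgetNode v), T.joined keep T.root v u ∧ cl v = cl u) (v : V) :
    ∃ u, T.IsTop keep u ∧ T.joined keep T.root v u ∧ cl v = cl u := by
  induction hd : T.depth (T.forgetNode v) using Nat.strong_induction_on generalizing v with
  | _ d ih =>
    by_cases hv : T.IsTop keep v
    · exact ⟨v, hv, Setoid.refl' _ _, rfl⟩
    · obtain ⟨u, hu, hj, hcl⟩ := h v hv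
      obtain ⟨h1, h2⟩ := below_forgetNode hu
      have h3 : T.depth (T.forgetNode u) < T.depth (T.forgetNode v) := by
        by_contra h4
        exact h2 (h1.eq_of_depth_le (not_lt.1 h4))
      obtain ⟨w, hw, hw', hw''⟩ := ih _ (hd ▸ h3) u rfl
      exact ⟨w, hw, Setoid.trans' _ hj hw', hcl.trans hw''⟩

/-- A kept edge is an edge of `G`, and it lies inside `P` or avoids it because `P` is a full class.
So the generated relation is contained in the one that, on `P`, is reachability within `P`. -/
theorem connected_induce_of_joined {P : Finset V} (hne : P.Nonempty)
    (hP : ∀ u ∈ P, ∀ v, T.joined keep T.root u v ↔ v ∈ P) :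
    (G.induce (P : Set V)).Connected := by
  have hle : T.joined keep T.root ≤
      { r := fun u v => (u ∈ P ↔ v ∈ P) ∧ ∀ (hu : u ∈ P) (hv : v ∈ P),
          (G.induce (P : Set V)).Reachable ⟨u, hu⟩ ⟨v, hv⟩
        iseqv :=
        { refl := fun u => ⟨Iff.rfl, fun _ _ => SimpleGraph.Reachable.refl _⟩
          symm := fun h => ⟨h.1.symm, fun hu hv => (h.2 hv hu).symm⟩
          trans := fun h h' => ⟨h.1.trans h'.1,
            fun hu hv => (h.2 hu (h.1.1 hu)).trans (h'.2 (h.1.1 hu) hv)⟩ } } := by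
    refine joined_le fun x u v hx hkx hk => ⟨?_, fun hu hv => ?_⟩
    · have hj : T.joined keep T.root u v := joined_of_below hx hkx hk
      exact ⟨fun hu => (hP u hu v).1 hj, fun hv => (hP v hv u).1 (Setoid.symm' _ hj)⟩
    · obtain ⟨s, -, hadj, -⟩ := T.introEdge_spec x u v hk
      exact SimpleGraph.Adj.reachable (SimpleGraph.comap_adj.2 hadj)
  obtain ⟨u₀, hu₀⟩ := hne
  have : Nonempty (P : Set V) := ⟨⟨u₀, hu₀⟩⟩
  refine SimpleGraph.Connected.mk fun u v => ?_
  exact (hle ((hP u u.2 v).2 v.2)).2 u.2 v.2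

/-- There are `k` tops and their labels cover `0, …, k - 1`, so different tops have different
labels. Every vertex has the label of the top of its component; hence the label classes are exactly
the components, and the facility of a class can be read off at its top. -/
theorem isConnectedClustering_of_tops {F : Finset V} {fac : Y → V} (hF : ∀ y, fac y ∈ F)
    {col : V → Y} (hcol : ∀ x u v, keep x → T.kind x = .introEdge u v → col u = col v)
    (hk : T.numTops keep T.root = k) {cl : V → ℕ} {cen : Fin k → V}
    (hcl : ∀ v, ¬ T.IsTop keep v →
      ∃ u ∈ T.bag (T.forgetNode v), T.joined keep T.root v u ∧ cl v = cl u)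
    (htop : ∀ v, T.IsTop keep v → cl v < k)
    (hsurj : ∀ i : Fin k, ∃ v, T.IsTop keep v ∧ cl v = i ∧ cen i = fac (col v))
    (d : V → V → ℝ) :
    IsConnectedClustering G F k (fun i : Fin k => Finset.univ.filter (cl · = i)) cen ∧
      medianCost d (fun i : Fin k => Finset.univ.filter (cl · = i)) cen =
        ∑ v, d v (fac (col v)) := by
  classical
  have hinj : ∀ u v, T.IsTop keep u → T.IsTop keep v → cl u = cl v → u = v := by
    have h1 : Set.SurjOn cl (Finset.univ.filter (T.IsTop keep) : Finset V) (Finset.range k) := by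
      intro i hi
      obtain ⟨v, hv, hvi, -⟩ := hsurj ⟨i, by simpa using hi⟩
      exact ⟨v, by simpa using hv, hvi⟩
    have h2 : (Finset.univ.filter (T.IsTop keep) : Finset V).card ≤ (Finset.range k).card := by
      rw [Finset.card_range, ← hk, numTops, forgottenFinset_root]
    have := Finset.injOn_of_surjOn_of_card_le cl (s := Finset.univ.filter (T.IsTop keep))
      (t := Finset.range k) (fun v hv => by simpa using htop v (by simpa using hv)) h1 h2
    intro u v hu hv h
    exact this (by simpa using hu) (by simpa using hv) h
  have hall := exists_isTop_eq cl hcl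
  have hiff : ∀ u v, T.joined keep T.root u v ↔ cl u = cl v := by
    intro u v
    obtain ⟨u', hu', hju, hcu⟩ := hall u
    obtain ⟨v', hv', hjv, hcv⟩ := hall v
    constructor
    · intro h
      have := hu'.eq hv' (Setoid.trans' _ (Setoid.symm' _ hju) (Setoid.trans' _ h hjv))
      rw [hcu, hcv, this]
    · intro h
      obtain rfl := hinj u' v' hu' hv' (by rw [← hcu, ← hcv, h])
      exact Setoid.trans' _ hju (Setoid.symm' _ hjv)
  have hlt : ∀ v, cl v < k := by
    intro v
    obtain ⟨u, hu, -, h⟩ := hall v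
    rw [h]
    exact htop u hu
  have hcolj : ∀ u v, T.joined keep T.root u v → col u = col v := by
    have : T.joined keep T.root ≤ Setoid.ker col :=
      joined_le fun x u v _ hx hk => hcol x u v hx hk
    exact fun u v h => this h
  have hcen : ∀ (i : Fin k) v, cl v = i → cen i = fac (col v) := by
    intro i v hv
    obtain ⟨u, -, hu, hc⟩ := hsurj i
    rw [hc, hcolj u v ((hiff u v).2 (hu.trans hv.symm))]
  refine ⟨⟨?_, ?_, ?_, ?_⟩, ?_⟩
  · intro i
    obtain ⟨v, -, -, hc⟩ := hsurj i
    rw [hc]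
    exact hF _
  · intro i j hij
    rw [Finset.disjoint_left]
    intro v hi hj
    simp only [Finset.mem_filter, Finset.mem_univ, true_and] at hi hj
    exact hij (Fin.ext (hi.symm.trans hj))
  · exact fun v => ⟨⟨cl v, hlt v⟩, by simp⟩
  · intro i
    refine connected_induce_of_joined (T := T) (keep := keep) ?_ ?_
    · obtain ⟨v, -, hv, -⟩ := hsurj i
      exact ⟨v, by simpa using hv⟩
    · intro u hu v
      simp only [Finset.mem_filter, Finset.mem_univ, true_and] at hu ⊢
      rw [hiff, hu, eq_comm]
  · unfold medianCost
    rw [← Finset.sum_fiberwise_of_maps_to (s := Finset.univ) (t := Finset.univ)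
      (g := fun v => (⟨cl v, hlt v⟩ : Fin k)) (by simp)]
    refine Finset.sum_congr rfl fun i _ => ?_
    have : (Finset.univ.filter fun v => (⟨cl v, hlt v⟩ : Fin k) = i) =
        Finset.univ.filter (cl · = i) := by
      ext v
      simp [Fin.ext_iff]
    rw [this]
    refine Finset.sum_congr rfl fun v hv => ?_
    rw [hcen i v (by simpa using hv)]

/-- The edges with both ends in the same cluster are kept. Connectedness of the clusters makes them
the components, and tops correspond to components, so there are `k` tops. Equal centers of different
clusters do no harm. -/
theorem _root_.IsConnectedClustering.exists_keep {F : Finset V} {P : Fin k → Finset V}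
    {c : Fin k → V} (h : IsConnectedClustering G F k P c) (T : NiceTreeDecomposition G ι)
    {fac : Y → V} (hF : ∀ v ∈ F, ∃ y, fac y = v) (d : V → V → ℝ) :
    ∃ (keep : ι → Prop) (col : V → Y),
      (∀ x u v, keep x → T.kind x = .introEdge u v → col u = col v) ∧
        T.numTops keep T.root = k ∧ ∑ v, d v (fac (col v)) = medianCost d P c := by
  classical
  choose idx hidx using h.cover
  choose g hg using fun i => hF (c i) (h.center_mem i)
  have hmem : ∀ v i, v ∈ P i ↔ idx v = i := by
    intro v i
    refine ⟨fun hv => ?_, fun hi => hi ▸ hidx v⟩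
    by_contra hne
    exact Finset.disjoint_left.1 (h.disjoint _ _ hne) (hidx v) hv
  let keep : ι → Prop := fun x => ∃ u v, T.kind x = .introEdge u v ∧ idx u = idx v
  have hkeep : ∀ x u v, keep x → T.kind x = .introEdge u v → idx u = idx v := by
    rintro x u v ⟨u', v', hk', he⟩ hk
    obtain ⟨rfl, rfl⟩ := NodeKind.introEdge.inj (hk.symm.trans hk')
    exact he
  have hle : T.joined keep T.root ≤ Setoid.ker idx :=
    joined_le fun x u v _ hx hk => hkeep x u v hx hk
  have hge : ∀ i, ∀ u v : (P i : Set V), T.joined keep T.root u v := by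
    intro i u v
    have hreach := (h.connected i).preconnected u v
    rw [SimpleGraph.reachable_iff_reflTransGen] at hreach
    induction hreach with
    | refl => exact Setoid.refl' _ _
    | @tail a b _ hab ih =>
      refine Setoid.trans' _ ih ?_
      have hadj : G.Adj a b := hab
      have hi : idx a = idx b := ((hmem _ _).1 a.2).trans ((hmem _ _).1 b.2).symm
      obtain ⟨x, hx | hx, -⟩ := T.existsUnique_introEdge a b hadj
      · exact joined_of_below (T.below_root x) ⟨_, _, hx, hi⟩ hx
      · exact Setoid.symm' _ (joined_of_below (T.below_root x) ⟨_, _, hx, hi.symm⟩ hx)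
  refine ⟨keep, fun v => g (idx v), fun x u v hx hk =>
    congrArg g (hkeep x u v hx hk), ?_, ?_⟩
  · unfold numTops
    rw [forgottenFinset_root]
    have : (Finset.univ.filter (T.IsTop keep) : Finset V).card = (Finset.univ : Finset (Fin k)).card := by
      refine Finset.card_bij (fun v _ => idx v) (by simp) ?_ ?_
      · intro u hu v hv he
        simp only [Finset.mem_filter, Finset.mem_univ, true_and] at hu hv
        exact hu.eq hv (hge (idx u) ⟨u, hidx u⟩ ⟨v, (hmem _ _).2 he.symm⟩)
      · intro i _
        obtain ⟨⟨v, hv⟩⟩ := (h.connected i).nonempty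
        obtain ⟨u, hu, hj⟩ := exists_isTop (T := T) keep v
        refine ⟨u, by simpa using hu, ?_⟩
        rw [← (hmem v i).1 hv]
        exact (hle hj).symm
    rw [Finset.card_univ, Fintype.card_fin] at this
    rw [← this]
  · unfold medianCost
    rw [← Finset.sum_fiberwise_of_maps_to (s := Finset.univ) (t := Finset.univ) (g := idx) (by simp)]
    refine Finset.sum_congr rfl fun i _ => ?_
    have : (Finset.univ.filter fun v => idx v = i) = P i := by
      ext v
      simp [hmem]
    rw [this]
    refine Finset.sum_congr rfl fun v hv => ?_
    rw [hg, (hmem v i).1 hv]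

/-- The entry of the root for `k` complete clusters bounds the cost of every solution. -/
theorem exists_tab_root_le [Finite ι] (hB : ∀ t, Set.InjOn slot (T.bag t))
    (hch : T.IsChildMap ch₁ ch₂) {F : Finset V} {fac : Y → V} (hF : ∀ v ∈ F, ∃ y, fac y = v)
    {d : V → V → ℝ}
    (hopt : ∀ t x c x₁ x₂, Attempt T slot ch₁ ch₂ (fun v y => d v (fac y)) k tab t x c x₁ x₂ →
      ∃ c' ≤ c, tab t x = some c')
    {P : Fin k → Finset V} {c : Fin k → V} (h : IsConnectedClustering G F k P c) :
    ∃ b ≤ medianCost d P c, tab T.root (.init X Y k) = some b := by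
  obtain ⟨keep, col, h1, h2, h3⟩ := h.exists_keep T hF d
  obtain ⟨b, hb, htab⟩ := exists_tab_le hB hch hopt h1
    (fun t => (numTops_le_root t).trans h2.le) T.root
  rw [forgottenFinset_root, h3] at hb
  rw [profile_root, h2] at htab
  exact ⟨b, hb, htab⟩

/-- A run that ends with `k` complete clusters at the root yields an optimal solution: it suffices
to number the components whose top vertices it meets, and to copy these numbers downwards. -/
theorem IsRun.exists_isOptimal [Finite ι] (hB : ∀ t, Set.InjOn slot (T.bag t))
    (hch : T.IsChildMap ch₁ ch₂) {F : Finset V} {fac : Y → V} (hF : ∀ y, fac y ∈ F)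
    (hF' : ∀ v ∈ F, ∃ y, fac y = v) {d : V → V → ℝ}
    (hopt : ∀ t x c x₁ x₂, Attempt T slot ch₁ ch₂ (fun v y => d v (fac y)) k tab t x c x₁ x₂ →
      ∃ c' ≤ c, tab t x = some c')
    (h : IsRun T slot ch₁ ch₂ (fun v y => d v (fac y)) k tab cs)
    (hroot : cs T.root = .init X Y k) {cl : V → ℕ} {cnt : ℕ}
    (hcl : ∀ t v, T.kind t = .forget v →
      ¬ (∀ b, (cs (ch₁ t)).blocks (slot v) b → b = slot v) →
      ∃ u ∈ T.bag t, (cs (ch₁ t)).blocks (slot v) (slot u) ∧ cl v = cl u)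
    (hbij : Set.BijOn cl {v | ∃ t, T.kind t = .forget v ∧
      ∀ b, (cs (ch₁ t)).blocks (slot v) b → b = slot v} (Set.Iio cnt)) :
    ∃ (P : Fin k → Finset V) (c : Fin k → V), IsOptimalConnectedMedian G F k d P c ∧
      (∀ i v, v ∈ P i → cl v = i) ∧ ∀ i : Fin k, ∃ t v, T.kind t = .forget v ∧
        (∀ b, (cs (ch₁ t)).blocks (slot v) b → b = slot v) ∧ cl v = i ∧
        c i = fac ((cs (ch₁ t)).fac (slot v)) := by
  classical
  set keep := RunKeeps T slot ch₁ cs with hkeepdef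
  set col := runFac T slot ch₁ cs with hcoldef
  have htop : ∀ t v, T.kind t = .forget v →
      (T.IsTop keep v ↔ ∀ b, (cs (ch₁ t)).blocks (slot v) b → b = slot v) := by
    intro t v hk
    rw [isTop_iff hB hk (hch.forget hk), (h.spec hB hch _).1]
  have hset : {v | ∃ t, T.kind t = .forget v ∧
      ∀ b, (cs (ch₁ t)).blocks (slot v) b → b = slot v} =
      ((Finset.univ.filter (T.IsTop keep) : Finset V) : Set V) := by
    ext v
    simp only [Set.mem_ofPred_eq, Finset.coe_filter, Finset.mem_univ, true_and]
    constructor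
    · rintro ⟨t, hk, hv⟩
      exact (htop t v hk).2 hv
    · exact fun hv => ⟨_, T.kind_forgetNode v, (htop _ v (T.kind_forgetNode v)).1 hv⟩
  have hnum : T.numTops keep T.root = k := by
    have := (h.spec hB hch T.root).2.1
    rw [hroot] at this
    exact this.symm
  rw [hset] at hbij
  -- The labels put the tops in bijection with the numbers below `cnt`, and the state at the root
  -- says that there are `k` tops.
  have hcnt : cnt = k := by
    rw [← hnum, numTops, forgottenFinset_root]
    have := hbij.image_eq
    rw [← Finset.coe_image, ← Finset.coe_range, Finset.coe_inj] at this
    rw [← Finset.card_image_of_injOn hbij.injOn, this, Finset.card_range]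
  subst hcnt
  have hsur : ∀ i : Fin cnt, ∃ v, T.IsTop keep v ∧ cl v = i := by
    intro i
    obtain ⟨v, hv, hvi⟩ := hbij.surjOn i.2
    exact ⟨v, by simpa using hv, hvi⟩
  choose w hw hwi using hsur
  have hdown : ∀ v, ¬ T.IsTop keep v →
      ∃ u ∈ T.bag (T.forgetNode v), T.joined keep T.root v u ∧ cl v = cl u := by
    intro v hv
    have hk := T.kind_forgetNode v
    obtain ⟨u, hu, hj, hc⟩ := hcl _ v hk (fun h' => hv ((htop _ v hk).2 h'))
    refine ⟨u, hu, ?_, hc⟩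
    obtain ⟨s, hc', hvs, hb⟩ := T.exists_child_forgetNode v
    obtain rfl := hch.one _ s hc'
    rw [(h.spec hB hch _).1] at hj
    rw [hb] at hu
    exact joined_mono (T.below_root _)
      ((Setoid.onSlots_slot (hB _) hvs (Finset.mem_of_mem_erase hu)).1 hj)
  have htop' : ∀ v, T.IsTop keep v → cl v < cnt := fun v hv =>
    hbij.mapsTo (by simpa using hv)
  obtain ⟨hP, hcost⟩ := isConnectedClustering_of_tops (T := T) (keep := keep) (k := cnt) hF
    (col := col) (h.runFac_eq hB hch) hnum (cl := cl) (cen := fun i => fac (col (w i))) hdown htop'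
    (fun i => ⟨w i, hw i, hwi i, rfl⟩) d
  refine ⟨_, _, ⟨hP, ?_⟩, ?_, ?_⟩
  -- The root entry equals the cost of the solution that was read off, and it is a lower bound for
  -- the cost of every other one.
  · intro P' c' h'
    obtain ⟨b, hb, htab⟩ := exists_tab_root_le hB hch hF' hopt h'
    have hr := (h.spec hB hch T.root).2.2
    rw [hroot, htab, Option.some_inj, forgottenFinset_root] at hr
    rw [hcost]
    exact hr ▸ hb
  · intro i v hv
    simpa using hv
  · intro i
    exact ⟨_, w i, T.kind_forgetNode _, (htop _ _ (T.kind_forgetNode _)).1 (hw i), hwi i, rfl⟩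

end NiceTreeDecomposition

/-! ### Partitions -/

namespace Setoid

instance finite_of_finite {α : Type*} [Finite α] : Finite (Setoid α) :=
  Finite.of_injective (fun r : Setoid α => fun a b => r a b) fun _ _ h =>
    Setoid.ext fun a b => iff_of_eq (congrFun (congrFun h a) b)

/-- Fix an element `a`. A relation is determined by the set `B` of the other elements in the class
of `a` and by its restriction to the complement of this class. Summing over `B` gives the recurrence
of the Bell numbers. -/
theorem card_le_bell (n : ℕ) : ∀ (α : Type) [Fintype α], Fintype.card α = n →
    Nat.card (Setoid α) ≤ Nat.bell n := by
  induction n using Nat.strong_induction_on with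
  | _ n ih =>
    intro α _ hα
    classical
    cases n with
    | zero =>
      have := Fintype.card_eq_zero_iff.1 hα
      have : Subsingleton (Setoid α) := ⟨fun r s => Setoid.ext fun a => isEmptyElim a⟩
      rw [Nat.bell_zero]
      exact Finite.card_le_one_iff_subsingleton.2 this
    | succ n =>
      obtain ⟨a⟩ : Nonempty α := Fintype.card_pos_iff.1 (by omega)
      have hβ : (Finset.univ.erase a).card = n := by
        rw [Finset.card_erase_of_mem (Finset.mem_univ a), Finset.card_univ, hα]; rfl
      have : Fintype (Setoid α) := Fintype.ofFinite _
      let S : Setoid α → Finset α := fun r => (Finset.univ.erase a).filter fun x => r a x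
      rw [Nat.card_eq_fintype_card, ← Finset.card_univ,
        Finset.card_eq_sum_card_fiberwise (f := S) (t := (Finset.univ.erase a).powerset)
          (fun r _ => Finset.mem_coe.2 (Finset.mem_powerset.2 (Finset.filter_subset _ _)))]
      have hfib : ∀ B ∈ (Finset.univ.erase a).powerset,
          (Finset.univ.filter fun r => S r = B).card ≤ Nat.bell (n - B.card) := by
        intro B hB
        rw [Finset.mem_powerset] at hB
        have hcard : Fintype.card {x // x ∈ (Finset.univ.erase a) \ B} = n - B.card := by
          rw [Fintype.card_subtype, Finset.filter_univ_mem, Finset.card_sdiff_of_subset hB, hβ]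
        refine le_trans ?_ (@ih (n - B.card) (by omega) _ (Subtype.fintype _) hcard)
        have : Fintype (Setoid {x // x ∈ (Finset.univ.erase a) \ B}) := Fintype.ofFinite _
        rw [Nat.card_eq_fintype_card, ← Finset.card_univ]
        refine Finset.card_le_card_of_injOn (fun r => Setoid.comap Subtype.val r) (by simp) ?_
        intro r hr s hs hrs
        simp only [Finset.coe_filter, Finset.mem_univ, true_and, Set.mem_ofPred_eq] at hr hs
        have hra : ∀ x, r a x ↔ s a x := by
          intro x
          by_cases hx : x = a
          · subst hx
            exact ⟨fun _ => s.refl' x, fun _ => r.refl' x⟩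
          · have := Finset.ext_iff.1 (hr.trans hs.symm) x
            simpa [S, hx] using this
        have hB' : ∀ x, r a x ↔ x = a ∨ x ∈ B := by
          intro x
          by_cases hx : x = a
          · subst hx
            simp
          · rw [← hr]
            simp [S, hx]
        refine Setoid.ext fun x y => ?_
        by_cases hx : r a x
        · constructor
          · intro h
            exact s.trans' (s.symm' ((hra x).1 hx)) ((hra y).1 (r.trans' hx h))
          · intro h
            exact r.trans' (r.symm' hx) ((hra y).2 (s.trans' ((hra x).1 hx) h))
        · by_cases hy : r a y
          · constructor
            · intro h
              exact absurd (r.trans' hy (r.symm' h)) hx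
            · intro h
              exact absurd ((hra x).2 (s.trans' ((hra y).1 hy) (s.symm' h))) hx
          · have hx' := (hB' x).not.1 hx
            have hy' := (hB' y).not.1 hy
            push Not at hx' hy'
            have := congrArg (fun q : Setoid _ => q ⟨x, by simp [hx']⟩ ⟨y, by simp [hy']⟩) hrs
            exact iff_of_eq this
      refine (Finset.sum_le_sum hfib).trans (le_of_eq ?_)
      rw [Finset.sum_powerset_apply_card (fun m => Nat.bell (n - m)), hβ, Nat.bell_succ,
        Nat.range_succ_eq_Iic]
      rfl

end Setoid

/-- `L` labels every element of `{0, …, W - 1}` with the least element of its block. -/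
structure IsLabeling (W : ℕ) (L : ℕ → ℕ) (r : Setoid (Fin W)) : Prop where
  rel : ∀ i j : Fin W, L i = L j ↔ r i j
  le : ∀ i < W, L i ≤ i
  idem : ∀ i < W, L (L i) = L i

namespace IsLabeling

variable {W : ℕ} {L L' : ℕ → ℕ} {r r' : Setoid (Fin W)}

/-- The label of `i` under one labeling lies in the block of `i`, hence bounds its label under the
other. Together with `setoid_eq` this lets the program decide equality of relations by comparing
rows of labels. -/
theorem eq (h : IsLabeling W L r) (h' : IsLabeling W L' r) (i : ℕ) (hi : i < W) : L i = L' i := by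
  have key : ∀ {L L' : ℕ → ℕ}, IsLabeling W L r → IsLabeling W L' r → L i ≤ L' i := by
    intro L L' h h'
    have hlt : L' i < W := (h'.le i hi).trans_lt hi
    have h1 : r ⟨L' i, hlt⟩ ⟨i, hi⟩ := (h'.rel ⟨L' i, hlt⟩ ⟨i, hi⟩).1 (h'.idem i hi)
    have h2 := (h.rel ⟨L' i, hlt⟩ ⟨i, hi⟩).2 h1
    simp only at h2
    rw [← h2]
    exact h.le _ hlt
  exact le_antisymm (key h h') (key h' h)

theorem setoid_eq (h : IsLabeling W L r) (h' : IsLabeling W L' r') (he : ∀ i < W, L i = L' i) :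
    r = r' :=
  Setoid.ext fun i j => by rw [← h.rel, ← h'.rel, he i i.2, he j j.2]

theorem congr (h : IsLabeling W L r) (he : ∀ i < W, L' i = L i) : IsLabeling W L' r where
  rel i j := by rw [he i i.2, he j j.2, h.rel]
  le i hi := by rw [he i hi]; exact h.le i hi
  idem i hi := by rw [he i hi, he _ ((h.le i hi).trans_lt hi)]; exact h.idem i hi

theorem bot : IsLabeling W id ⊥ :=
  ⟨fun i j => by rw [Setoid.bot_def, id, id, Fin.val_inj], fun _ _ => le_rfl, fun _ _ => rfl⟩

/-- Replacing the larger of the two labels by the smaller one keeps every label the least element of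
its block. If the labels agree, nothing happens. -/
theorem merge (h : IsLabeling W L r) (a c : Fin W) :
    IsLabeling W (fun i => if L i = max (L a) (L c) then min (L a) (L c) else L i)
      (r ⊔ Setoid.pair a c) := by
  have hsup : (r ⊔ Setoid.pair a c) a c :=
    (le_sup_right : Setoid.pair a c ≤ r ⊔ Setoid.pair a c) (Setoid.pair_rel a c)
  have hr : ∀ i j : Fin W, L i = L j → (r ⊔ Setoid.pair a c) i j := fun i j hij =>
    (le_sup_left : r ≤ r ⊔ Setoid.pair a c) ((h.rel i j).1 hij)
  have hor : ∀ i : Fin W, (L i = L a ∨ L i = L c) → (r ⊔ Setoid.pair a c) a i := by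
    rintro i (h | h)
    · exact hr a i h.symm
    · exact Setoid.trans' _ hsup (hr c i h.symm)
  refine ⟨fun i j => ⟨fun hij => ?_, fun hij => ?_⟩, fun i hi => ?_, fun i hi => ?_⟩
  · by_cases h1 : L i = L j
    · exact hr i j h1
    · have hi : L i = L a ∨ L i = L c := by
        split_ifs at hij <;> omega
      have hj : L j = L a ∨ L j = L c := by
        split_ifs at hij <;> omega
      exact Setoid.trans' _ (Setoid.symm' _ (hor i hi)) (hor j hj)
  · have hle : r ⊔ Setoid.pair a c ≤ Setoid.ker fun i : Fin W =>
        if L i = max (L a) (L c) then min (L a) (L c) else L i := by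
      refine sup_le (fun i j hij => ?_) (Setoid.pair_le_iff.2 ?_)
      · rw [Setoid.ker_def, (h.rel i j).2 hij]
      · rw [Setoid.ker_def]
        split_ifs <;> omega
    exact hle hij
  · have := h.le i hi
    split_ifs <;> omega
  · have h1 := h.idem i hi
    have h2 := h.idem a a.2
    have h3 := h.idem c c.2
    by_cases hx : L i = max (L a) (L c)
    · rw [if_pos hx]
      rcases le_total (L a) (L c) with hle | hle
      · rw [min_eq_left hle, h2]; simp
      · rw [min_eq_right hle, h3]; simp
    · rw [if_neg hx, h1, if_neg hx]

end IsLabeling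

/-- Every equivalence relation is reached from the discrete one by merging blocks. -/
theorem Setoid.mem_of_closed {W : ℕ} {S : Set (Setoid (Fin W))} (h0 : ⊥ ∈ S)
    (h : ∀ r ∈ S, ∀ a c, r ⊔ Setoid.pair a c ∈ S) (r : Setoid (Fin W)) : r ∈ S := by
  -- A maximal member of `S` below `r` must be `r`: merging a pair related by `r` stays in `S` and
  -- below `r`, so by maximality the pair was related before.
  obtain ⟨q, hq⟩ := (Set.toFinite {q | q ∈ S ∧ q ≤ r}).exists_maximal ⟨⊥, h0, bot_le⟩
  have : q = r := by
    refine le_antisymm hq.1.2 fun a c hac => ?_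
    have hmem : q ⊔ Setoid.pair a c ∈ {q | q ∈ S ∧ q ≤ r} :=
      ⟨h q hq.1.1 a c, sup_le hq.1.2 (Setoid.pair_le_iff.2 hac)⟩
    exact hq.2 hmem le_sup_left
      ((le_sup_right : Setoid.pair a c ≤ q ⊔ Setoid.pair a c) (Setoid.pair_rel a c))
  exact this ▸ hq.1.1

/-! ### Running programs -/

namespace RAM

/-- The program `c`, started with memory `σ`, halts, and its final memory and running time satisfy
`Q`. -/
def Ends (c : Program) (σ : State) (Q : State → ℕ → Prop) : Prop :=
  ∃ σ' t, Exec c σ σ' t ∧ Q σ' t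

theorem Ends.mono {c : Program} {σ : State} {Q Q' : State → ℕ → Prop} (h : Ends c σ Q)
    (hQ : ∀ τ t, Q τ t → Q' τ t) : Ends c σ Q' :=
  let ⟨σ', t, he, hq⟩ := h
  ⟨σ', t, he, hQ _ _ hq⟩

-- This and the next equivalences compute weakest preconditions with accumulated running time, so
-- that simplification executes straight-line code. The direction from left to right is inversion of
-- `Exec`.
@[simp] theorem ends_skip {σ : State} {Q : State → ℕ → Prop} : Ends .skip σ Q ↔ Q σ 1 :=
  ⟨fun ⟨_, _, he, hq⟩ => by cases he; exact hq, fun h => ⟨_, _, .skip σ, h⟩⟩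

@[simp] theorem ends_setNat {σ : State} {a : ℕ} {i e : NatExpr} {Q : State → ℕ → Prop} :
    Ends (.setNat a i e) σ Q ↔ Q (σ.setNat a (i.eval σ) (e.eval σ)) (i.cost + e.cost + 1) :=
  ⟨fun ⟨_, _, he, hq⟩ => by cases he; exact hq, fun h => ⟨_, _, .setNat σ a i e, h⟩⟩

@[simp] theorem ends_setReal {σ : State} {a : ℕ} {i : NatExpr} {e : RealExpr}
    {Q : State → ℕ → Prop} :
    Ends (.setReal a i e) σ Q ↔ Q (σ.setReal a (i.eval σ) (e.eval σ)) (i.cost + e.cost + 1) :=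
  ⟨fun ⟨_, _, he, hq⟩ => by cases he; exact hq, fun h => ⟨_, _, .setReal σ a i e, h⟩⟩

@[simp] theorem ends_seq {c₁ c₂ : Program} {σ : State} {Q : State → ℕ → Prop} :
    Ends (.seq c₁ c₂) σ Q ↔ Ends c₁ σ fun τ t => Ends c₂ τ fun τ' t' => Q τ' (t + t') := by
  constructor
  · rintro ⟨_, _, he, hq⟩
    cases he with
    | seq h1 h2 => exact ⟨_, _, h1, _, _, h2, hq⟩
  · rintro ⟨_, _, h1, _, _, h2, hq⟩
    exact ⟨_, _, .seq h1 h2, hq⟩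

@[simp] theorem ends_ite {b : Test} {c₁ c₂ : Program} {σ : State} {Q : State → ℕ → Prop} :
    Ends (.ite b c₁ c₂) σ Q ↔
      (b.Holds σ → Ends c₁ σ fun τ t => Q τ (b.cost + 1 + t)) ∧
      (¬ b.Holds σ → Ends c₂ σ fun τ t => Q τ (b.cost + 1 + t)) := by
  constructor
  · rintro ⟨_, _, he, hq⟩
    cases he with
    | ite_true hb h => exact ⟨fun _ => ⟨_, _, h, hq⟩, fun hn => absurd hb hn⟩
    | ite_false hb h => exact ⟨fun hn => absurd hn hb, fun _ => ⟨_, _, h, hq⟩⟩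
  · rintro ⟨h1, h2⟩
    by_cases hb : b.Holds σ
    · obtain ⟨_, _, h, hq⟩ := h1 hb
      exact ⟨_, _, .ite_true hb h, hq⟩
    · obtain ⟨_, _, h, hq⟩ := h2 hb
      exact ⟨_, _, .ite_false hb h, hq⟩

@[simp] theorem State.setNat_nat (σ : State) (a i x b j : ℕ) :
    (σ.setNat a i x).nat b j = if b = a ∧ j = i then x else σ.nat b j := by
  unfold State.setNat
  by_cases h : b = a
  · subst h
    by_cases h' : j = i
    · simp [h']
    · simp [h']
  · simp [h]

@[simp] theorem State.setNat_real (σ : State) (a i x : ℕ) : (σ.setNat a i x).real = σ.real := rfl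

@[simp] theorem State.setReal_nat (σ : State) (a i : ℕ) (x : ℝ) :
    (σ.setReal a i x).nat = σ.nat := rfl

@[simp] theorem State.setReal_real (σ : State) (a i : ℕ) (x : ℝ) (b j : ℕ) :
    (σ.setReal a i x).real b j = if b = a ∧ j = i then x else σ.real b j := by
  unfold State.setReal
  by_cases h : b = a
  · subst h
    by_cases h' : j = i
    · simp [h']
    · simp [h']
  · simp [h]

/-- Outside the listed arrays of natural and of real numbers, `τ` agrees with `σ`. -/
structure Frame (L M : List ℕ) (σ τ : State) : Prop where
  nat : ∀ a, a ∉ L → ∀ j, τ.nat a j = σ.nat a j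
  real : ∀ a, a ∉ M → ∀ j, τ.real a j = σ.real a j

variable {L M L' M' : List ℕ} {σ τ ρ : State}

theorem Frame.refl : Frame L M σ σ := ⟨fun _ _ _ => rfl, fun _ _ _ => rfl⟩

theorem Frame.trans (h : Frame L M σ τ) (h' : Frame L' M' τ ρ) (hL : L' ⊆ L) (hM : M' ⊆ M) :
    Frame L M σ ρ :=
  ⟨fun a ha j => (h'.nat a (fun h => ha (hL h)) j).trans (h.nat a ha j),
    fun a ha j => (h'.real a (fun h => ha (hM h)) j).trans (h.real a ha j)⟩

theorem Frame.mono (h : Frame L M σ τ) (hL : L ⊆ L') (hM : M ⊆ M') : Frame L' M' σ τ :=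
  ⟨fun a ha => h.nat a fun h => ha (hL h), fun a ha => h.real a fun h => ha (hM h)⟩

theorem frame_setNat {a i x : ℕ} (ha : a ∈ L) :
    Frame L M σ (τ.setNat a i x) ↔ Frame L M σ τ := by
  have : ∀ b, b ∉ L → ∀ j, (τ.setNat a i x).nat b j = τ.nat b j := by
    intro b hb j
    have : b ≠ a := fun h => hb (h ▸ ha)
    simp [this]
  exact ⟨fun h => ⟨fun b hb j => by rw [← this b hb, h.nat b hb], h.real⟩,
    fun h => ⟨fun b hb j => by rw [this b hb, h.nat b hb], h.real⟩⟩

theorem frame_setReal {a i : ℕ} {x : ℝ} (ha : a ∈ M) :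
    Frame L M σ (τ.setReal a i x) ↔ Frame L M σ τ := by
  have : ∀ b, b ∉ M → ∀ j, (τ.setReal a i x).real b j = τ.real b j := by
    intro b hb j
    have : b ≠ a := fun h => hb (h ▸ ha)
    simp [this]
  exact ⟨fun h => ⟨h.nat, fun b hb j => by rw [← this b hb, h.real b hb]⟩,
    fun h => ⟨h.nat, fun b hb j => by rw [this b hb, h.real b hb]⟩⟩

instance : Add NatExpr := ⟨.add⟩
instance : Sub NatExpr := ⟨.sub⟩
instance : Add RealExpr := ⟨.add⟩

/-- The scalar variable stored in cell `0` of the array `a`. -/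
def var (a : ℕ) : NatExpr := .get a (.const 0)

/-- Assignment to a scalar variable. -/
def assign (a : ℕ) (e : NatExpr) : Program := .setNat a (.const 0) e

scoped infixr:50 " ;; " => Program.seq
scoped infix:60 " ≔ " => assign

@[simp] theorem eval_const (c : ℕ) : (NatExpr.const c).eval σ = c := rfl
@[simp] theorem eval_add (e₁ e₂ : NatExpr) : (e₁ + e₂).eval σ = e₁.eval σ + e₂.eval σ := rfl
@[simp] theorem eval_sub (e₁ e₂ : NatExpr) : (e₁ - e₂).eval σ = e₁.eval σ - e₂.eval σ := rfl
@[simp] theorem eval_get (a : ℕ) (e : NatExpr) :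
    (NatExpr.get a e).eval σ = σ.nat a (e.eval σ) := rfl
@[simp] theorem eval_var (a : ℕ) : (var a).eval σ = σ.nat a 0 := rfl
@[simp] theorem cost_const (c : ℕ) : (NatExpr.const c).cost = 1 := rfl
@[simp] theorem cost_add (e₁ e₂ : NatExpr) : (e₁ + e₂).cost = e₁.cost + e₂.cost + 1 := rfl
@[simp] theorem cost_sub (e₁ e₂ : NatExpr) : (e₁ - e₂).cost = e₁.cost + e₂.cost + 1 := rfl
@[simp] theorem cost_get (a : ℕ) (e : NatExpr) : (NatExpr.get a e).cost = e.cost + 1 := rfl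
@[simp] theorem cost_var (a : ℕ) : (var a).cost = 2 := rfl
@[simp] theorem real_eval_add (e₁ e₂ : RealExpr) :
    (e₁ + e₂).eval σ = e₁.eval σ + e₂.eval σ := rfl
@[simp] theorem real_eval_get (a : ℕ) (e : NatExpr) :
    (RealExpr.get a e).eval σ = σ.real a (e.eval σ) := rfl
@[simp] theorem real_eval_zero : RealExpr.zero.eval σ = 0 := rfl
@[simp] theorem real_cost_add (e₁ e₂ : RealExpr) :
    (e₁ + e₂).cost = e₁.cost + e₂.cost + 1 := rfl
@[simp] theorem real_cost_get (a : ℕ) (e : NatExpr) : (RealExpr.get a e).cost = e.cost + 1 := rfl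
@[simp] theorem real_cost_zero : RealExpr.zero.cost = 1 := rfl
@[simp] theorem holds_natLt (e₁ e₂ : NatExpr) :
    (Test.natLt e₁ e₂).Holds σ ↔ e₁.eval σ < e₂.eval σ := Iff.rfl
@[simp] theorem holds_natEq (e₁ e₂ : NatExpr) :
    (Test.natEq e₁ e₂).Holds σ ↔ e₁.eval σ = e₂.eval σ := Iff.rfl
@[simp] theorem holds_realLt (e₁ e₂ : RealExpr) :
    (Test.realLt e₁ e₂).Holds σ ↔ e₁.eval σ < e₂.eval σ := Iff.rfl
@[simp] theorem holds_not (b : Test) : b.not.Holds σ ↔ ¬ b.Holds σ := Iff.rfl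
@[simp] theorem holds_and (b₁ b₂ : Test) :
    (b₁.and b₂).Holds σ ↔ b₁.Holds σ ∧ b₂.Holds σ := Iff.rfl
attribute [simp] Test.cost

@[simp] theorem ends_assign {a : ℕ} {e : NatExpr} {Q : State → ℕ → Prop} :
    Ends (a ≔ e) σ Q ↔ Q (σ.setNat a 0 (e.eval σ)) (e.cost + 2) := by
  unfold assign
  rw [ends_setNat, eval_const, cost_const, show 1 + e.cost + 1 = e.cost + 2 by omega]

/-- `loop x e c` runs `c` for `x = 0, 1, …` as long as `x < e`. -/
def loop (x : ℕ) (e : NatExpr) (c : Program) : Program :=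
  x ≔ .const 0 ;; .while (.natLt (var x) e) (c ;; x ≔ var x + .const 1)

/-- An invariant rule with time. The bound `e` is evaluated anew in each round and may change; only
the outcome of the test has to agree with `i < m`. This covers loops over a growing queue, where `m`
is the final length. The invariant for `i + 1` is asserted after the counter has been raised. -/
theorem ends_loop {x : ℕ} {e : NatExpr} {c : Program} {Q : State → ℕ → Prop} (m B : ℕ)
    (I : ℕ → State → Prop) (h0 : I 0 (σ.setNat x 0 0))
    (hb : ∀ i τ, i ≤ m → I i τ → τ.nat x 0 = i → (i < e.eval τ ↔ i < m))
    (hs : ∀ i τ, i < m → I i τ → τ.nat x 0 = i →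
      Ends c τ fun τ' t => t ≤ B ∧ τ'.nat x 0 = i ∧ I (i + 1) (τ'.setNat x 0 (i + 1)))
    (hQ : ∀ τ t, I m τ → t ≤ m * (B + e.cost + 10) + (e.cost + 7) → Q τ t) :
    Ends (loop x e c) σ Q := by
  -- A round costs, besides the body, `e.cost + 4` for the test and branch and `6` for raising the
  -- counter. The failing test costs `e.cost + 4`, and the initial assignment accounts for the
  -- remaining `3` in the bound.
  have key : ∀ r i τ, r + i = m → I i τ → τ.nat x 0 = i →
      Ends (.while (.natLt (var x) e) (c ;; x ≔ var x + .const 1)) τ fun τ' t =>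
        I m τ' ∧ t ≤ r * (B + e.cost + 10) + (e.cost + 4) := by
    intro r
    induction r with
    | zero =>
      intro i τ hi hI hx
      have hi' : i = m := by omega
      subst hi'
      refine ⟨τ, _, .while_false ?_, hI, ?_⟩
      · simp [hx, hb i τ le_rfl hI hx]
      · simp; omega
    | succ r ih =>
      intro i τ hi hI hx
      obtain ⟨τ₁, t₁, he₁, ht₁, hx₁, hI₁⟩ := hs i τ (by omega) hI hx
      obtain ⟨τ₂, t₂, he₂, hI₂, ht₂⟩ := ih (i + 1) (τ₁.setNat x 0 (i + 1)) (by omega) hI₁ (by simp)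
      have hstep : Exec (x ≔ var x + .const 1) τ₁ (τ₁.setNat x 0 (i + 1)) 6 := by
        have := Exec.setNat τ₁ x (.const 0) (var x + .const 1)
        simpa [hx₁, assign] using this
      refine ⟨τ₂, _, .while_true ?_ (.seq he₁ hstep) he₂, hI₂, ?_⟩
      · have := (hb i τ (by omega) hI hx).2 (by omega)
        simpa [hx] using this
      · rw [Nat.add_mul]
        simp
        omega
  unfold loop
  rw [ends_seq, ends_assign]
  obtain ⟨τ, t, he, hI, ht⟩ := key m 0 (σ.setNat x 0 0) rfl h0 (by simp)
  exact ⟨τ, t, he, hQ _ _ hI (by simp only [cost_const]; omega)⟩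

end RAM

/-! ### The instance in memory, and the size of the largest bag -/

namespace RAM

open Test Program

variable {σ : State}

/-- Store the largest bag size in variable `14`. -/
def widthProgram : Program :=
  14 ≔ .const 0 ;;
  loop 50 (.get 0 (.const 3))
    (ite (natLt (var 14) (.get 8 (var 50))) (14 ≔ .get 8 (var 50)) skip)

theorem ends_widthProgram : Ends widthProgram σ fun τ t =>
    t ≤ 40 * (σ.nat 0 3 + 1) ∧ Frame [14, 50] [] σ τ ∧
      τ.nat 14 0 = (Finset.range (σ.nat 0 3)).sup (σ.nat 8) := by
  unfold widthProgram
  simp only [ends_seq, ends_assign]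
  refine ends_loop (σ.nat 0 3) 20 (fun i τ => Frame [14, 50] [] σ τ ∧
    τ.nat 14 0 = (Finset.range i).sup (σ.nat 8)) ?_ ?_ ?_ ?_
  · simp [frame_setNat, Frame.refl]
  · rintro i τ - ⟨hf, -⟩ -
    simp [hf.nat]
  · rintro i τ hi ⟨hf, hW⟩ hx
    rw [Finset.range_add_one, Finset.sup_insert]
    generalize (Finset.range i).sup (σ.nat 8) = s at hW
    simp [frame_setNat, hf, hf.nat, hx, hW]
    omega
  · rintro τ t ⟨hf, hW⟩ ht
    refine ⟨?_, hf, hW⟩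
    simp at ht ⊢
    omega

/-- The memory holds the instance; `ch₁`, `ch₂` are the children of the nodes of the decomposition,
and `fac` lists the facilities. -/
structure Input {n N : ℕ} (k : ℕ) (G : SimpleGraph (Fin n)) (F : Finset (Fin n))
    (d : Fin n → Fin n → ℝ) (T : NiceTreeDecomposition G (Fin N)) (ch₁ ch₂ : Fin N → Fin N)
    (fac : Fin F.card → Fin n) (σ : State) : Prop where
  vertices : σ.nat 0 0 = n
  clusters : σ.nat 0 1 = k
  facilities_card : σ.nat 0 2 = F.card
  nodes : σ.nat 0 3 = N
  root : σ.nat 0 4 = T.root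
  facilities : ∀ i : Fin F.card, σ.nat 1 i = fac i
  fac_mem : ∀ i, fac i ∈ F
  fac_surj : ∀ v ∈ F, ∃ i, fac i = v
  isChildMap : T.IsChildMap ch₁ ch₂
  kind : ∀ t : Fin N, EncodesKind σ t (T.kind t)
  child₁ : ∀ t : Fin N, T.kind t ≠ .leaf → σ.nat 6 t = ch₁ t
  child₂ : ∀ t : Fin N, T.kind t = .join → σ.nat 7 t = ch₂ t
  bag_card : ∀ t : Fin N, σ.nat 8 t = (T.bag t).card
  bag : ∀ t : Fin N, Set.BijOn (fun j => σ.nat 10 (σ.nat 9 t + j)) (Set.Iio (T.bag t).card)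
    ((fun v : Fin n => (v : ℕ)) '' (T.bag t))

section Input

variable {n N k : ℕ} {G : SimpleGraph (Fin n)} {F : Finset (Fin n)} {d : Fin n → Fin n → ℝ}
  {T : NiceTreeDecomposition G (Fin N)} {ch₁ ch₂ : Fin N → Fin N} {fac : Fin F.card → Fin n}
  {τ : State}

/-- `Input` speaks only of the arrays up to `10`, which the programs below leave untouched, so it is
carried through all phases. The distances, in a real array, are kept as a separate hypothesis. -/
theorem Input.of_eq (h : Input k G F d T ch₁ ch₂ fac σ)
    (he : ∀ a ≤ 10, ∀ j, τ.nat a j = σ.nat a j) : Input k G F d T ch₁ ch₂ fac τ where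
  vertices := by rw [he _ (by norm_num), h.vertices]
  clusters := by rw [he _ (by norm_num), h.clusters]
  facilities_card := by rw [he _ (by norm_num), h.facilities_card]
  nodes := by rw [he _ (by norm_num), h.nodes]
  root := by rw [he _ (by norm_num), h.root]
  facilities i := by rw [he _ (by norm_num), h.facilities]
  fac_mem := h.fac_mem
  fac_surj := h.fac_surj
  isChildMap := h.isChildMap
  kind t := by
    have := h.kind t
    have h3 := he 3 (by norm_num)
    have h4 := he 4 (by norm_num)
    have h5 := he 5 (by norm_num)
    cases hk : T.kind t <;> rw [hk] at this <;> simpa [EncodesKind, h3, h4, h5] using this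
  child₁ t ht := by rw [he _ (by norm_num), h.child₁ t ht]
  child₂ t ht := by rw [he _ (by norm_num), h.child₂ t ht]
  bag_card t := by rw [he _ (by norm_num), h.bag_card]
  bag t := by
    have h9 := he 9 (by norm_num)
    have h10 := he 10 (by norm_num)
    simpa [h9, h10] using h.bag t

theorem _root_.EncodesInstance.exists_input (h : EncodesInstance k G F d T σ) :
    ∃ ch₁ ch₂ fac, Input k G F d T ch₁ ch₂ fac σ := by
  classical
  -- Whenever a node has the child in question, the cell holds its number, which is below `N`; the
  -- default value is harmless elsewhere.
  let ch₁ : Fin N → Fin N := fun t => if ht : σ.nat 6 t < N then ⟨_, ht⟩ else t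
  let ch₂ : Fin N → Fin N := fun t => if ht : σ.nat 7 t < N then ⟨_, ht⟩ else t
  have hone : ∀ t s, T.children t = {s} → σ.nat 6 t = ch₁ t ∧ ch₁ t = s := by
    intro t s hc
    have h6 := h.child t s hc
    have : ch₁ t = s := by simp [ch₁, h6]
    exact ⟨by rw [h6, this], this⟩
  have htwo : ∀ t s₁ s₂, s₁ ≠ s₂ → T.children t = {s₁, s₂} →
      (σ.nat 6 t = ch₁ t ∧ σ.nat 7 t = ch₂ t) ∧
        ((ch₁ t = s₁ ∧ ch₂ t = s₂) ∨ (ch₁ t = s₂ ∧ ch₂ t = s₁)) := by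
    intro t s₁ s₂ hne hc
    rcases h.children t s₁ s₂ hne hc with ⟨h6, h7⟩ | ⟨h6, h7⟩ <;> simp [ch₁, ch₂, h6, h7]
  have hfac : ∀ i : Fin F.card, ∃ v : Fin n, v ∈ F ∧ σ.nat 1 i = v := by
    intro i
    obtain ⟨v, hv, he⟩ := h.facilities.mapsTo i.2
    exact ⟨v, hv, he.symm⟩
  choose fac hmem hfac using hfac
  refine ⟨ch₁, ch₂, fac, ⟨h.vertices, h.clusters, h.facilities_card, h.nodes, h.root, hfac, hmem, ?_,
    ⟨fun t s hc => (hone t s hc).2, fun t s₁ s₂ hne hc => (htwo t s₁ s₂ hne hc).2⟩, h.kind, ?_, ?_,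
    h.bag_card, h.bag⟩⟩
  · intro v hv
    obtain ⟨i, hi, he⟩ := h.facilities.surjOn ⟨v, hv, rfl⟩
    exact ⟨⟨i, hi⟩, Fin.ext (by rw [← hfac]; exact he)⟩
  · intro t ht
    cases hk : T.kind t with
    | leaf => exact absurd hk ht
    | introVertex v =>
      obtain ⟨s, hc, -⟩ := T.introVertex_spec t v hk
      exact (hone t s hc).1
    | introEdge u v =>
      obtain ⟨s, hc, -⟩ := T.introEdge_spec t u v hk
      exact (hone t s hc).1
    | forget v =>
      obtain ⟨s, hc, -⟩ := T.forget_spec t v hk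
      exact (hone t s hc).1
    | join =>
      obtain ⟨s₁, s₂, hne, hc, -⟩ := T.join_spec t hk
      exact (htwo t s₁ s₂ hne hc).1.1
  · intro t hk
    obtain ⟨s₁, s₂, hne, hc, -⟩ := T.join_spec t hk
    exact (htwo t s₁ s₂ hne hc).1.2

/-- How the children of a node are read off from the memory. -/
theorem Input.children (h : Input k G F d T ch₁ ch₂ fac σ) (t : Fin N) :
    (σ.nat 3 t = 0 ∧ T.children t = ∅) ∨
    (0 < σ.nat 3 t ∧ σ.nat 3 t ≠ 4 ∧ T.children t = {ch₁ t} ∧ σ.nat 6 t = ch₁ t) ∨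
    (σ.nat 3 t = 4 ∧ ch₁ t ≠ ch₂ t ∧ T.children t = {ch₁ t, ch₂ t} ∧ σ.nat 6 t = ch₁ t ∧
      σ.nat 7 t = ch₂ t) := by
  have hk := h.kind t
  cases hkt : T.kind t with
  | leaf => rw [hkt] at hk; exact Or.inl ⟨hk, (T.leaf_spec t hkt).1⟩
  | introVertex v =>
    rw [hkt] at hk
    exact Or.inr (Or.inl ⟨by rw [hk.1]; norm_num, by rw [hk.1]; norm_num,
      h.isChildMap.introVertex hkt, h.child₁ t (by simp [hkt])⟩)
  | introEdge u v =>
    rw [hkt] at hk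
    exact Or.inr (Or.inl ⟨by rw [hk.1]; norm_num, by rw [hk.1]; norm_num,
      h.isChildMap.introEdge hkt, h.child₁ t (by simp [hkt])⟩)
  | forget v =>
    rw [hkt] at hk
    exact Or.inr (Or.inl ⟨by rw [hk.1]; norm_num, by rw [hk.1]; norm_num,
      h.isChildMap.forget hkt, h.child₁ t (by simp [hkt])⟩)
  | join =>
    rw [hkt] at hk
    exact Or.inr (Or.inr ⟨hk, (h.isChildMap.join hkt).1, (h.isChildMap.join hkt).2,
      h.child₁ t (by simp [hkt]), h.child₂ t hkt⟩)

/-! ### Breadth-first order of the nodes -/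

/-- The first `tail` entries of `q` are nodes, the first of them the root and the others children of
the first `h` ones. -/
structure IsQueue (T : NiceTreeDecomposition G (Fin N)) (q : ℕ → ℕ) (h tail : ℕ) : Prop where
  pos : 0 < tail
  root : q 0 = T.root
  inj : ∀ i < tail, ∀ j < tail, q i = q j → i = j
  parent : ∀ j < tail, 0 < j → ∃ i < j, i < h ∧ ∃ t s : Fin N, q i = t ∧ q j = s ∧ s ∈ T.children t

variable {q : ℕ → ℕ} {h tail : ℕ}

theorem root_not_mem_children (t : Fin N) : T.root ∉ T.children t := by
  intro hr
  have := NiceTreeDecomposition.depth_of_mem_children hr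
  simp [NiceTreeDecomposition.depth] at this

theorem IsQueue.succ (hq : IsQueue T q h tail) : IsQueue T q (h + 1) tail :=
  { hq with
    parent := fun j hj hj0 => by
      obtain ⟨i, h1, h2, h3⟩ := hq.parent j hj hj0
      exact ⟨i, h1, by omega, h3⟩ }

theorem IsQueue.exists_node (hq : IsQueue T q h tail) {j : ℕ} (hj : j < tail) :
    ∃ t : Fin N, q j = t := by
  rcases Nat.eq_zero_or_pos j with rfl | h0
  · exact ⟨_, hq.root⟩
  · obtain ⟨-, -, -, -, s, -, hs, -⟩ := hq.parent j hj h0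
    exact ⟨s, hs⟩

theorem IsQueue.le_nodes (hq : IsQueue T q h tail) : tail ≤ N := by
  have := Finset.card_le_card_of_injOn q (s := Finset.range tail) (t := Finset.range N)
    (fun j hj => by
      obtain ⟨t, ht⟩ := hq.exists_node (by simpa using hj)
      simp [ht])
    (fun i hi j hj hij => hq.inj i (by simpa using hi) j (by simpa using hj) hij)
  simpa using this

/-- Parents are unique and the entries of the queue are distinct, so the recorded index of a parent
of `s` is the index of `t`. -/
theorem IsQueue.lt_of_child (hq : IsQueue T q h tail) {i j : ℕ} (hi : i < tail) (hj : j < tail)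
    {t s : Fin N} (ht : q i = t) (hs : q j = s) (hc : s ∈ T.children t) : i < j ∧ i < h := by
  have h0 : 0 < j := by
    rcases Nat.eq_zero_or_pos j with rfl | h0
    · have : s = T.root := Fin.ext (by rw [← hs, hq.root])
      exact absurd (this ▸ hc) (root_not_mem_children t)
    · exact h0
  obtain ⟨i', h1, h2, t', s', ht', hs', hc'⟩ := hq.parent j hj h0
  have hs'' : s' = s := Fin.ext (by rw [← hs, ← hs'])
  subst hs''
  have htt : t = t' := NiceTreeDecomposition.eq_of_mem_children hc hc'
  subst htt
  have := hq.inj i hi i' (by omega) (ht.trans ht'.symm)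
  subst this
  exact ⟨h1, h2⟩

theorem IsQueue.push (hq : IsQueue T q (h + 1) tail) (hh : h < tail) {t s : Fin N} (ht : q h = t)
    (hs : s ∈ T.children t) (hfresh : ∀ j < tail, q j ≠ s) {q' : ℕ → ℕ}
    (hq' : ∀ j, q' j = if j = tail then (s : ℕ) else q j) :
    IsQueue T q' (h + 1) (tail + 1) where
  pos := by omega
  root := by rw [hq', if_neg hq.pos.ne, hq.root]
  inj i hi j hj hij := by
    rw [hq', hq'] at hij
    split_ifs at hij with h1 h2 h2
    · omega
    · exact absurd hij.symm (hfresh j (by omega))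
    · exact absurd hij (hfresh i (by omega))
    · exact hq.inj i (by omega) j (by omega) hij
  parent j hj hj0 := by
    by_cases hjt : j = tail
    · exact ⟨h, by omega, by omega, t, s, by rw [hq', if_neg (by omega), ht],
        by rw [hq', if_pos hjt], hs⟩
    · obtain ⟨i, h1, h2, h3⟩ := hq.parent j (by omega) hj0
      exact ⟨i, h1, h2, by rw [hq', if_neg (by omega), hq', if_neg hjt]; exact h3⟩

/-- All children of the first `h` entries of `q` occur among the first `tail` entries. -/
def IsQueueClosed (T : NiceTreeDecomposition G (Fin N)) (q : ℕ → ℕ) (h tail : ℕ) : Prop :=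
  ∀ i < h, ∀ t s : Fin N, q i = t → s ∈ T.children t → ∃ j < tail, q j = s

theorem IsQueueClosed.succ (hc : IsQueueClosed T q h tail) (hh : h < tail) {t : Fin N}
    (ht : q h = t) {q' : ℕ → ℕ} {tail' : ℕ} (hle : tail ≤ tail') (hq : ∀ j < tail, q' j = q j)
    (hs : ∀ s ∈ T.children t, ∃ j < tail', q' j = s) : IsQueueClosed T q' (h + 1) tail' := by
  intro i hi t' s ht' hs'
  rw [hq i (by omega)] at ht'
  rcases Nat.lt_succ_iff_lt_or_eq.1 hi with hi | rfl
  · obtain ⟨j, hj, he⟩ := hc i hi t' s ht' hs'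
    exact ⟨j, by omega, by rw [hq j hj, he]⟩
  · have : t' = t := Fin.ext (by rw [← ht', ht])
    exact hs s (this ▸ hs')

/-- A closed queue contains the root and, with every node, its children. -/
theorem IsQueue.exists_eq (hq : IsQueue T q tail tail) (hc : IsQueueClosed T q tail tail)
    (t : Fin N) : ∃ j < tail, q j = t := by
  refine T.top_down (P := fun t => ∃ j < tail, q j = t) ⟨0, hq.pos, hq.root⟩ ?_ t
  rintro t s hs ⟨i, hi, ht⟩
  exact hc i hi t s ht hs

theorem IsQueue.eq_nodes (hq : IsQueue T q tail tail) (hc : IsQueueClosed T q tail tail) :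
    tail = N := by
  refine le_antisymm hq.le_nodes ?_
  have : Finset.range N ⊆ (Finset.range tail).image q := by
    intro t ht
    obtain ⟨j, hj, he⟩ := hq.exists_eq hc ⟨t, by simpa using ht⟩
    exact Finset.mem_image.2 ⟨j, by simpa using hj, he⟩
  have h1 := Finset.card_le_card this
  have h2 := Finset.card_image_le (s := Finset.range tail) (f := q)
  simp at h1 h2
  omega

/-- `q` lists the nodes such that parents precede their children. -/
structure IsOrder (T : NiceTreeDecomposition G (Fin N)) (q : ℕ → ℕ) (ord : Fin N → Fin N) :
    Prop where
  eq : ∀ i : Fin N, q i = ord i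
  bij : Function.Bijective ord
  root : ∀ i, ord i = T.root → (i : ℕ) = 0
  lt : ∀ i j, ord j ∈ T.children (ord i) → i < j

theorem IsQueue.exists_isOrder (hq : IsQueue T q N N) (hc : IsQueueClosed T q N N) :
    ∃ ord, IsOrder T q ord := by
  choose ord hord using fun i : Fin N => hq.exists_node i.2
  refine ⟨ord, hord, ⟨fun i j hij => ?_, fun t => ?_⟩, fun i hi => ?_, fun i j hij => ?_⟩
  · exact Fin.ext (hq.inj i i.2 j j.2 (by rw [hord, hord, hij]))
  · obtain ⟨j, hj, he⟩ := hq.exists_eq hc t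
    exact ⟨⟨j, hj⟩, Fin.ext (by rw [← hord]; exact he)⟩
  · exact hq.inj i i.2 0 hq.pos (by rw [hord, hi, hq.root])
  · exact (hq.lt_of_child i.2 j.2 (hord i) (hord j) hij).1

/-- List the nodes in array `20`. -/
def orderProgram : Program :=
  setNat 20 (.const 0) (.get 0 (.const 4)) ;;
  15 ≔ .const 1 ;;
  loop 16 (var 15)
    (17 ≔ .get 20 (var 16) ;;
    ite (natLt (.const 0) (.get 3 (var 17)))
      (setNat 20 (var 15) (.get 6 (var 17)) ;;
      15 ≔ var 15 + .const 1 ;;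
      ite (natEq (.get 3 (var 17)) (.const 4))
        (setNat 20 (var 15) (.get 7 (var 17)) ;;
        15 ≔ var 15 + .const 1)
        skip)
      skip)

theorem ends_orderProgram (hin : Input k G F d T ch₁ ch₂ fac σ) : Ends orderProgram σ fun τ t =>
    t ≤ 80 * (N + 1) ∧ Frame [20, 15, 16, 17] [] σ τ ∧ ∃ ord, IsOrder T (τ.nat 20) ord := by
  unfold orderProgram
  simp only [ends_seq, ends_assign, ends_setNat]
  refine ends_loop N 60 (fun h τ => Frame [20, 15, 16, 17] [] σ τ ∧
    IsQueue T (τ.nat 20) h (τ.nat 15 0) ∧ IsQueueClosed T (τ.nat 20) h (τ.nat 15 0) ∧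
    h ≤ τ.nat 15 0) ?_ ?_ ?_ ?_
  · refine ⟨by simp [frame_setNat, Frame.refl], ⟨by simp, by simp [hin.root], ?_, ?_⟩, ?_, by simp⟩
    · intro i hi j hj _
      simp at hi hj
      omega
    · intro j hj h0
      simp at hj
      omega
    · intro i hi
      omega
  -- The loop bound is the current length of the queue, at most `N`. If the head caught up with it
  -- earlier, the queue would be closed and hence contain all `N` nodes.
  · rintro h τ hh ⟨hf, hq, hc, hle⟩ -
    simp only [eval_var]
    constructor
    · intro h1
      exact h1.trans_le hq.le_nodes
    · intro h1
      refine lt_of_le_of_ne hle fun he => ?_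
      rw [← he] at hq hc
      exact h1.ne (hq.eq_nodes hc)
  · rintro h τ hh ⟨hf, hq, hc, hle⟩ hx
    have hlt : h < τ.nat 15 0 := by
      refine lt_of_le_of_ne hle fun he => ?_
      rw [← he] at hq hc
      exact hh.ne (hq.eq_nodes hc)
    obtain ⟨t, ht⟩ := hq.exists_node hlt
    -- A child of `t` already in the queue would have its parent among the first `h` entries, but
    -- `t` is the entry with index `h`.
    have hfresh : ∀ s ∈ T.children t, ∀ j < τ.nat 15 0, τ.nat 20 j ≠ s := by
      intro s hs j hj he
      exact absurd (hq.lt_of_child hlt hj ht he hs).2 (lt_irrefl _)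
    have hq1 := hq.succ
    rcases hin.children t with ⟨h3, hch⟩ | ⟨h3, h4, hch, h6⟩ | ⟨h3, hne, hch, h6, h7⟩
    · simp [frame_setNat, hf, hf.nat, hx, ht, h3]
      refine ⟨?_, hc.succ hlt ht le_rfl (by simp) (by simp [hch]), hlt⟩
      convert hq1 using 1
      funext j
      simp
    · simp [frame_setNat, hf, hf.nat, hx, ht, h3, h4, h6]
      refine ⟨⟨hq1.push hlt ht (s := ch₁ t) (by simp [hch]) (hfresh _ (by simp [hch])) (by simp),
        hc.succ hlt ht (by simp) (fun j hj => by simp [hj.ne]) ?_, hle⟩, fun h0 => by omega⟩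
      intro s hs
      rw [hch, Set.mem_singleton_iff] at hs
      exact ⟨τ.nat 15 0, by simp, by simp [hs]⟩
    · simp [frame_setNat, hf, hf.nat, hx, ht, h3, h7, h6]
      have hq2 := hq1.push hlt ht (s := ch₁ t) (by simp [hch]) (hfresh _ (by simp [hch]))
        (q' := fun j => if j = τ.nat 15 0 then (ch₁ t : ℕ) else τ.nat 20 j) (by simp)
      refine ⟨hq2.push (t := t) (s := ch₂ t) (by omega) (by simp [hlt.ne, ht]) (by simp [hch]) ?_ (by simp),
        hc.succ hlt ht (by omega) (fun j hj => ?_) ?_, by omega⟩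
      · intro j hj
        split_ifs with h0
        · exact fun he => hne (Fin.ext he)
        · exact hfresh _ (by simp [hch]) j (by omega)
      · have : j ≠ τ.nat 15 0 + 1 := by omega
        simp [hj.ne, this]
      · intro s hs
        rw [hch] at hs
        rcases hs with hs | hs
        · exact ⟨τ.nat 15 0, by omega, by simp [hs]⟩
        · rw [Set.mem_singleton_iff] at hs
          exact ⟨τ.nat 15 0 + 1, by omega, by simp [hs]⟩
  · rintro τ t ⟨hf, hq, hc, hle⟩ ht
    have : τ.nat 15 0 = N := le_antisymm hq.le_nodes hle
    rw [this] at hq hc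
    refine ⟨?_, hf, hq.exists_isOrder hc⟩
    simp at ht ⊢
    omega

end Input

end RAM

/-! ### Slots -/

namespace RAM

open Test Program

variable {n N k : ℕ} {G : SimpleGraph (Fin n)} {F : Finset (Fin n)} {d : Fin n → Fin n → ℝ}
  {T : NiceTreeDecomposition G (Fin N)} {ch₁ ch₂ : Fin N → Fin N} {fac : Fin F.card → Fin n}
  {σ : State} {q : ℕ → ℕ} {ord : Fin N → Fin N}

theorem IsOrder.le_of_below (h : IsOrder T q ord) {i j : Fin N} (hb : T.Below (ord i) (ord j)) :
    i ≤ j := by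
  have key : ∀ x, T.Below (ord i) x → ∀ j, ord j = x → i ≤ j := by
    intro x hx
    induction hx with
    | refl => exact fun j hj => (h.bij.1 hj).ge
    | @tail y z _ hz ih =>
      intro j hj
      obtain ⟨a, ha⟩ := h.bij.2 y
      exact (ih a ha).trans (h.lt a j (by rw [ha, hj]; exact hz)).le
  exact key _ hb j rfl

theorem IsOrder.eq_root_or (h : IsOrder T q ord) (i : Fin N) :
    ord i = T.root ∨ ∃ j < i, ord i ∈ T.children (ord j) := by
  by_cases hr : ord i = T.root
  · exact Or.inl hr
  · obtain ⟨t, ht⟩ := NiceTreeDecomposition.exists_mem_children hr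
    obtain ⟨j, rfl⟩ := h.bij.2 t
    exact Or.inr ⟨j, h.lt j i ht, ht⟩

theorem bag_subset_of_mem_children {t s : Fin N} (hs : s ∈ T.children t)
    (hk : ∀ v, T.kind t ≠ .forget v) : T.bag s ⊆ T.bag t := fun v hv =>
  (NiceTreeDecomposition.mem_bag_of_mem_children hs hv).resolve_right (hk v)

/-- A test whether slot `51` is free in the bag of node `17`. -/
def freeProgram : Program :=
  52 ≔ .const 1 ;;
  loop 53 (.get 8 (var 17))
    (ite (natEq (.get 21 (.get 10 (.get 9 (var 17) + var 53))) (var 51)) (52 ≔ .const 0) skip)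

open Classical in
theorem ends_freeProgram (hin : Input k G F d T ch₁ ch₂ fac σ) {t : Fin N}
    (ht : σ.nat 17 0 = t) : Ends freeProgram σ fun τ s =>
    s ≤ 60 * ((T.bag t).card + 1) ∧ Frame [52, 53] [] σ τ ∧
      τ.nat 52 0 = if ∃ u ∈ T.bag t, σ.nat 21 u = σ.nat 51 0 then 0 else 1 := by
  unfold freeProgram
  simp only [ends_seq, ends_assign]
  refine ends_loop (T.bag t).card 30 (fun j τ => Frame [52, 53] [] σ τ ∧
    τ.nat 52 0 = if ∃ i < j, σ.nat 21 (σ.nat 10 (σ.nat 9 t + i)) = σ.nat 51 0 then 0 else 1)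
    ?_ ?_ ?_ ?_
  · simp [frame_setNat, Frame.refl]
  · rintro j τ - ⟨hf, -⟩ -
    simp [hf.nat, ht, hin.bag_card]
  · rintro j τ hj ⟨hf, hv⟩ hx
    simp only [Nat.exists_lt_succ_right]
    by_cases h : σ.nat 21 (σ.nat 10 (σ.nat 9 t + j)) = σ.nat 51 0 <;>
      simp [frame_setNat, hf, hf.nat, hx, hv, ht, h]
  · rintro τ s ⟨hf, hv⟩ hs
    refine ⟨?_, hf, ?_⟩
    · simp at hs ⊢
      omega
    · rw [hv]
      congr 1
      refine propext ⟨?_, ?_⟩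
      · rintro ⟨i, hi, h⟩
        obtain ⟨u, hu, he⟩ := (hin.bag t).mapsTo hi
        exact ⟨u, hu, by simp only at he; rw [he, h]⟩
      · rintro ⟨u, hu, h⟩
        obtain ⟨i, hi, he⟩ := (hin.bag t).surjOn ⟨u, hu, rfl⟩
        exact ⟨i, hi, by simp only at he; rw [he, h]⟩

/-- Give the vertex forgotten at node `17` a free slot. -/
def assignSlotProgram : Program :=
  loop 51 (var 14)
    (freeProgram ;;
    ite (natEq (var 52) (.const 1)) (setNat 21 (.get 4 (var 17)) (var 51)) skip)

theorem ends_assignSlotProgram (hin : Input k G F d T ch₁ ch₂ fac σ) {t : Fin N} {v : Fin n}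
    (ht : σ.nat 17 0 = t) (hk : T.kind t = .forget v) (hW : (T.bag t).card < σ.nat 14 0) :
    Ends assignSlotProgram σ fun τ s =>
      s ≤ 100 * (σ.nat 14 0 + 1) ^ 2 ∧ Frame [21, 51, 52, 53] [] σ τ ∧
      (∀ u : Fin n, u ≠ v → τ.nat 21 u = σ.nat 21 u) ∧ τ.nat 21 v < σ.nat 14 0 ∧
      ∀ u ∈ T.bag t, σ.nat 21 u ≠ τ.nat 21 v := by
  have hv : v ∉ T.bag t := by
    obtain ⟨s, -, -, hb⟩ := T.forget_spec t v hk
    simp [hb]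
  have h4 : σ.nat 4 t = v := by
    have := hin.kind t
    rw [hk] at this
    exact this.2
  unfold assignSlotProgram
  -- There is no early exit: later free slots overwrite earlier ones. So the invariant claims only
  -- that, once a free slot has been met, the stored one is free.
  refine ends_loop (σ.nat 14 0) (60 * (σ.nat 14 0 + 1) + 20)
    (fun a τ => Frame [21, 51, 52, 53] [] σ τ ∧ (∀ u : Fin n, u ≠ v → τ.nat 21 u = σ.nat 21 u) ∧
      ((∃ b < a, ∀ u ∈ T.bag t, σ.nat 21 u ≠ b) →
        τ.nat 21 v < a ∧ ∀ u ∈ T.bag t, σ.nat 21 u ≠ τ.nat 21 v)) ?_ ?_ ?_ ?_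
  · simp [frame_setNat, Frame.refl]
  · rintro j τ - ⟨hf, -⟩ -
    simp [hf.nat]
  · rintro a τ ha ⟨hf, h1, h2⟩ hx
    have hin' : Input k G F d T ch₁ ch₂ fac τ := hin.of_eq fun b hb j => hf.nat b (by simp; omega) j
    rw [ends_seq]
    refine (ends_freeProgram hin' (t := t) (by simp [hf.nat, ht])).mono ?_
    rintro τ₁ s₁ ⟨hs₁, hf₁, h52⟩
    have hfree : (∃ u ∈ T.bag t, τ.nat 21 u = τ.nat 51 0) ↔ ¬ ∀ u ∈ T.bag t, σ.nat 21 u ≠ a := by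
      push Not
      refine exists_congr fun u => and_congr_right fun hu => ?_
      rw [h1 u (fun h => hv (h ▸ hu)), hx]
    have hf' : Frame [21, 51, 52, 53] [] σ τ₁ := hf.trans hf₁ (by simp) (by simp)
    by_cases hfr : ∀ u ∈ T.bag t, σ.nat 21 u ≠ a
    · rw [if_neg (by rw [hfree]; exact not_not.2 hfr)] at h52
      simp [frame_setNat, hf', hf'.nat, hf₁.nat, hx, h52, ht, h4]
      refine ⟨by omega, fun u hu => ?_, fun _ _ _ => hfr⟩
      simp [Fin.val_inj, hu, h1 u hu]
    · rw [if_pos (hfree.2 hfr)] at h52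
      simp [frame_setNat, hf', hf₁.nat, hx, h52]
      refine ⟨by omega, h1, fun b hb hbu => ?_⟩
      have hb' : b < a := by
        refine lt_of_le_of_ne (by omega) ?_
        rintro rfl
        exact hfr hbu
      have := h2 ⟨b, hb', hbu⟩
      exact ⟨by omega, this.2⟩
  · rintro τ s ⟨hf, h1, h2⟩ hs
    -- By the pigeonhole principle: the bag has fewer vertices than there are slots.
    have hex : ∃ b < σ.nat 14 0, ∀ u ∈ T.bag t, σ.nat 21 u ≠ b := by
      by_contra hno
      push Not at hno
      have hsub : Finset.range (σ.nat 14 0) ⊆ (T.bag t).image fun u : Fin n => σ.nat 21 u := by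
        intro b hb
        obtain ⟨u, hu, he⟩ := hno b (by simpa using hb)
        exact Finset.mem_image.2 ⟨u, hu, he⟩
      have h3 := Finset.card_le_card hsub
      have h4 := Finset.card_image_le (s := T.bag t) (f := fun u : Fin n => σ.nat 21 u)
      simp at h3
      omega
    refine ⟨?_, hf, h1, h2 hex⟩
    simp at hs ⊢
    nlinarith

/-- Give every vertex a slot, such that the slots in every bag are distinct. -/
def slotProgram : Program :=
  loop 16 (.get 0 (.const 3))
    (17 ≔ .get 20 (var 16) ;;
    ite (natEq (.get 3 (var 17)) (.const 3)) assignSlotProgram skip)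

theorem Input.kind_eq_three (hin : Input k G F d T ch₁ ch₂ fac σ) (t : Fin N) :
    σ.nat 3 t = 3 ↔ ∃ v, T.kind t = .forget v := by
  have := hin.kind t
  cases hk : T.kind t <;> rw [hk] at this <;> simp_all [EncodesKind]

/-- Slots are given from the root downwards, to each vertex at its forget node. There the child's
bag is the present bag plus `v`; the present bag already has distinct slots, and since the child's
bag has at most `W` vertices one slot is left for `v`. -/
theorem ends_slotProgram (hin : Input k G F d T ch₁ ch₂ fac σ) (hord : IsOrder T (σ.nat 20) ord)
    (hW : ∀ t, (T.bag t).card ≤ σ.nat 14 0) : Ends slotProgram σ fun τ s =>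
      s ≤ 200 * ((N + 1) * (σ.nat 14 0 + 1) ^ 2) ∧ Frame [16, 17, 21, 51, 52, 53] [] σ τ ∧
      ∃ slot : Fin n → Fin (σ.nat 14 0), (∀ v : Fin n, τ.nat 21 v = slot v) ∧
        ∀ t, Set.InjOn slot (T.bag t) := by
  unfold slotProgram
  let P : ℕ → State → Prop := fun h τ => ∀ j : Fin N,
    (ord j = T.root ∨ ∃ i : Fin N, (i : ℕ) < h ∧ ord j ∈ T.children (ord i)) →
      Set.InjOn (fun v : Fin n => τ.nat 21 v) (T.bag (ord j)) ∧
        ∀ v ∈ T.bag (ord j), τ.nat 21 v < σ.nat 14 0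
  refine ends_loop N (100 * (σ.nat 14 0 + 1) ^ 2 + 20)
    (fun h τ => Frame [16, 17, 21, 51, 52, 53] [] σ τ ∧ P h τ) ?_ ?_ ?_ ?_
  · refine ⟨by simp [frame_setNat, Frame.refl], ?_⟩
    rintro j (hj | ⟨i, hi, -⟩)
    · simp [hj, T.bag_root]
    · omega
  · rintro j τ - ⟨hf, -⟩ -
    simp [hf.nat, hin.nodes]
  · rintro h τ hh ⟨hf, hP⟩ hx
    obtain ⟨t, ht⟩ : ∃ t, t = ord ⟨h, hh⟩ := ⟨_, rfl⟩
    have hq : σ.nat 20 h = t := by rw [ht, ← hord.eq]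
    have hPt := hP ⟨h, hh⟩ ((hord.eq_root_or ⟨h, hh⟩).imp id fun ⟨j, hj, hc⟩ => ⟨j, hj, hc⟩)
    rw [← ht] at hPt
    have hcases : ∀ j : Fin N, (ord j = T.root ∨ ∃ i : Fin N, (i : ℕ) < h + 1 ∧
        ord j ∈ T.children (ord i)) → (ord j = T.root ∨ ∃ i : Fin N, (i : ℕ) < h ∧
        ord j ∈ T.children (ord i)) ∨ ord j ∈ T.children t := by
      rintro j (hj | ⟨i, hi, hc⟩)
      · exact Or.inl (Or.inl hj)
      · rcases Nat.lt_succ_iff_lt_or_eq.1 hi with hi | rfl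
        · exact Or.inl (Or.inr ⟨i, hi, hc⟩)
        · rw [ht]; exact Or.inr hc
    by_cases h3 : σ.nat 3 t = 3
    · obtain ⟨v, hk⟩ := (hin.kind_eq_three t).1 h3
      obtain ⟨s, hcs, hvs, hb⟩ := T.forget_spec t v hk
      have hin' : Input k G F d T ch₁ ch₂ fac (τ.setNat 17 0 t) := hin.of_eq fun b hb j => by
        have : b ≠ 17 := by omega
        simp only [State.setNat_nat, this, false_and, if_false]
        exact hf.nat b (by simp; omega) j
      have hcard : (T.bag t).card < σ.nat 14 0 := by
        refine lt_of_lt_of_le ?_ (hW s)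
        rw [hb]
        exact Finset.card_erase_lt_of_mem hvs
      simp only [ends_seq, ends_assign, ends_ite]
      simp [hf.nat, hx, hq, h3]
      refine (ends_assignSlotProgram hin' (t := t) (v := v) (by simp) hk
        (by simpa [hf.nat] using hcard)).mono ?_
      rintro τ₁ s₁ ⟨hs₁, hf₁, h1, h2, h3'⟩
      simp [hf.nat] at hs₁ h1 h2 h3'
      have hf' : Frame [16, 17, 21, 51, 52, 53] [] σ τ₁ :=
        Frame.trans (τ := τ.setNat 17 0 t) (by simp [frame_setNat, hf]) hf₁ (by simp) (by simp)
      have hnew : ∀ j : Fin N, ord j ∈ T.children t →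
          Set.InjOn (fun v : Fin n => τ₁.nat 21 v) (T.bag (ord j)) ∧
          ∀ v ∈ T.bag (ord j), τ₁.nat 21 v < σ.nat 14 0 := by
        intro j hj
        rw [hcs, Set.mem_singleton_iff] at hj
        rw [hj]
        have hmem : ∀ u ∈ T.bag s, u ≠ v → u ∈ T.bag t := fun u hu hne => by simp [hb, hu, hne]
        refine ⟨fun x hx y hy hxy => ?_, fun u hu => ?_⟩
        · simp only at hxy
          by_cases hxv : x = v <;> by_cases hyv : y = v
          · rw [hxv, hyv]
          · subst hxv
            rw [h1 y hyv] at hxy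
            exact absurd hxy.symm (h3' y (hmem y hy hyv))
          · subst hyv
            rw [h1 x hxv] at hxy
            exact absurd hxy (h3' x (hmem x hx hxv))
          · rw [h1 x hxv, h1 y hyv] at hxy
            exact hPt.1 (hmem x hx hxv) (hmem y hy hyv) hxy
        · by_cases huv : u = v
          · rw [huv]; exact h2
          · rw [h1 u huv]
            exact hPt.2 u (hmem u hu huv)
      -- Changing the slot of `v` does not affect bags treated before: a bag containing `v` lies
      -- below the child of `t`, so its parent is `t` or lies below `t` and cannot precede `t` in
      -- the order.
      have hold : ∀ j : Fin N, (ord j = T.root ∨ ∃ i : Fin N, (i : ℕ) < h ∧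
          ord j ∈ T.children (ord i)) → v ∉ T.bag (ord j) := by
        rintro j (hj | ⟨i, hi, hc⟩) hvj
        · simp [hj, T.bag_root] at hvj
        · have hbel := NiceTreeDecomposition.below_of_mem_bag hk
            (show s ∈ T.children t by simp [hcs]) hvj
          have hbt : T.Below t (ord i) := by
            rcases Relation.ReflTransGen.cases_tail hbel with he | ⟨p, hp, hpc⟩
            · rw [he] at hc
              rw [NiceTreeDecomposition.eq_of_mem_children hc
                (show s ∈ T.children t by simp [hcs])]
              exact .refl _
            · rw [NiceTreeDecomposition.eq_of_mem_children hc hpc]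
              exact (NiceTreeDecomposition.below_of_mem_children (by simp [hcs])).trans hp
          rw [ht] at hbt
          have := hord.le_of_below hbt
          simp [Fin.le_def] at this
          omega
      refine ⟨by omega, by simp [hf₁.nat, hx], by simp [frame_setNat, hf'], ?_⟩
      intro j hj
      simp only [State.setNat_nat]
      norm_num
      rcases hcases j hj with hj | hj
      · have hvj := hold j hj
        obtain ⟨i1, i2⟩ := hP j hj
        have heq : ∀ u ∈ T.bag (ord j), τ₁.nat 21 u = τ.nat 21 u := fun u hu =>
          h1 u fun he => hvj (he ▸ hu)
        refine ⟨fun x hx y hy hxy => ?_, fun u hu => ?_⟩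
        · simp only [heq x hx, heq y hy] at hxy
          exact i1 hx hy hxy
        · rw [heq u hu]
          exact i2 u hu
      · exact hnew j hj
    · have hnot : ∀ v, T.kind t ≠ .forget v := fun v hv =>
        h3 ((hin.kind_eq_three t).2 ⟨v, hv⟩)
      simp [frame_setNat, hf, hf.nat, hx, hq, h3]
      intro j hj
      simp only [State.setNat_nat]
      norm_num
      rcases hcases j hj with hj | hj
      · exact hP j hj
      · have hsub := bag_subset_of_mem_children hj hnot
        exact ⟨hPt.1.mono (Finset.coe_subset.2 hsub), fun v hv => hPt.2 v (hsub hv)⟩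
  · rintro τ s ⟨hf, hP⟩ hs
    have hall : ∀ t, Set.InjOn (fun v : Fin n => τ.nat 21 v) (T.bag t) ∧
        ∀ v ∈ T.bag t, τ.nat 21 v < σ.nat 14 0 := by
      intro t
      obtain ⟨j, rfl⟩ := hord.bij.2 t
      exact hP j ((hord.eq_root_or j).imp id fun ⟨i, _, hc⟩ => ⟨i, i.2, hc⟩)
    have hlt : ∀ v : Fin n, τ.nat 21 v < σ.nat 14 0 := by
      intro v
      obtain ⟨t, ht⟩ := T.exists_mem_bag v
      exact (hall t).2 v ht
    refine ⟨?_, hf, fun v => ⟨τ.nat 21 v, hlt v⟩, fun _ => rfl, fun t x hx y hy hxy =>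
      (hall t).1 hx hy (by simpa using hxy)⟩
    simp at hs ⊢
    nlinarith [Nat.zero_le ((σ.nat 14 0 + 1) ^ 2), Nat.one_le_pow 2 (σ.nat 14 0 + 1) (by omega)]

end RAM

/-! ### Tables of multiples, powers and digits -/

namespace RAM

open Test Program

variable {σ : State}

/-- Store the first multiples of `e` in the array `a`, and the product of `e` and `bound` in
variable `y`. -/
def multiplesProgram (x y a : ℕ) (bound e : NatExpr) : Program :=
  y ≔ .const 0 ;;
  loop x bound (setNat a (var x) (var y) ;; y ≔ var y + e)

/-- Products arise by repeated addition. The hypothesis `he` requires that the writes of the loop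
itself change neither its bound nor the summand. -/
theorem ends_multiplesProgram {x y a : ℕ} {bound e : NatExpr} {m v : ℕ} (hxy : x ≠ y)
    (hxa : x ≠ a) (hya : y ≠ a)
    (he : ∀ τ, Frame [x, y, a] [] σ τ → bound.eval τ = m ∧ e.eval τ = v) :
    Ends (multiplesProgram x y a bound e) σ fun τ t =>
      t ≤ (m + 1) * (e.cost + bound.cost + 30) ∧ Frame [x, y, a] [] σ τ ∧
      τ.nat y 0 = m * v ∧ ∀ i < m, τ.nat a i = i * v := by
  unfold multiplesProgram
  simp only [ends_seq, ends_assign]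
  refine ends_loop m (e.cost + 12) (fun i τ => Frame [x, y, a] [] σ τ ∧ τ.nat y 0 = i * v ∧
    ∀ j < i, τ.nat a j = j * v) ?_ ?_ ?_ ?_
  · simp [frame_setNat, Frame.refl, hxy.symm]
  · rintro i τ - ⟨hf, -⟩ -
    rw [(he τ hf).1]
  · rintro i τ hi ⟨hf, hy, ha⟩ hx
    have hf' : Frame [x, y, a] [] σ (τ.setNat a i (τ.nat y 0)) := by simp [frame_setNat, hf]
    have hev := (he _ hf').2
    rw [hy] at hev hf'
    simp [frame_setNat, hf, hx, hy, hev, hxy, hxy.symm, hxa, hxa.symm, hya, hya.symm]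
    refine ⟨by omega, by ring, fun j hj => ?_⟩
    split_ifs with h
    · rw [h]
    · exact ha j (by omega)
  · rintro τ t ⟨hf, hy, ha⟩ ht
    refine ⟨?_, hf, hy, ha⟩
    simp at ht ⊢
    nlinarith

/-- Store the powers of the number of facilities in array `22`. -/
def powersProgram : Program :=
  setNat 22 (.const 0) (.const 1) ;;
  loop 50 (var 14)
    (multiplesProgram 51 52 53 (.get 0 (.const 2)) (.get 22 (var 50)) ;;
    setNat 22 (var 50 + .const 1) (var 52))

theorem ends_powersProgram {m W : ℕ} (hm : σ.nat 0 2 = m) (hW : σ.nat 14 0 = W) :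
    Ends powersProgram σ fun τ t =>
      t ≤ 100 * ((W + 1) * (m + 1)) ∧ Frame [22, 50, 51, 52, 53] [] σ τ ∧
        ∀ a ≤ W, τ.nat 22 a = m ^ a := by
  unfold powersProgram
  simp only [ends_seq, ends_setNat]
  refine ends_loop W (35 * (m + 1) + 10) (fun i τ => Frame [22, 50, 51, 52, 53] [] σ τ ∧
    ∀ a ≤ i, τ.nat 22 a = m ^ a) ?_ ?_ ?_ ?_
  · simp [frame_setNat, Frame.refl]
  · rintro i τ - ⟨hf, -⟩ -
    simp [hf.nat, hW]
  · rintro i τ hi ⟨hf, ha⟩ hx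
    rw [ends_seq]
    refine (ends_multiplesProgram (m := m) (v := m ^ i) (by norm_num) (by norm_num) (by norm_num)
      ?_).mono ?_
    · intro ρ hρ
      simp [hρ.nat, hf.nat, hm, hx, ha]
    · rintro ρ t ⟨ht, hρ, h52, -⟩
      have hf' : Frame [22, 50, 51, 52, 53] [] σ ρ := hf.trans hρ (by simp) (by simp)
      simp [frame_setNat, hf', hρ.nat, hx, h52]
      simp at ht
      refine ⟨by omega, fun a hai => ?_⟩
      split_ifs with h
      · rw [h, pow_succ, mul_comm]
      · exact ha a (by omega)
  · rintro τ t ⟨hf, ha⟩ ht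
    refine ⟨?_, hf, ha⟩
    simp at ht ⊢
    nlinarith

theorem div_add_mod_of_lt {W i a : ℕ} (ha : a < W) : (i * W + a) / W = i ∧ (i * W + a) % W = a := by
  constructor
  · rw [Nat.add_comm, Nat.add_mul_div_right _ _ (by omega), Nat.div_eq_of_lt ha, zero_add]
  · rw [Nat.add_comm, Nat.add_mul_mod_self_right, Nat.mod_eq_of_lt ha]

/-- How a digit of `i` arises from that of `i - P`. -/
theorem digit_step {P m i : ℕ} (hm : 0 < m) (hP : 0 < P) (hi : P ≤ i) :
    i / P % m = if (i - P) / P % m + 1 = m then 0 else (i - P) / P % m + 1 := by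
  rw [Nat.div_eq_sub_div hP hi]
  generalize (i - P) / P = x
  have := Nat.mod_lt x hm
  split_ifs with h
  · rw [Nat.add_mod, ← Nat.mod_mod x m]
    by_cases h1 : m = 1
    · subst h1; simp [Nat.mod_one]
    · rw [Nat.mod_eq_of_lt (show 1 < m by omega), Nat.mod_mod, h, Nat.mod_self]
  · rw [Nat.add_mod]
    have h1 : 1 < m := by omega
    rw [Nat.mod_eq_of_lt h1, Nat.mod_eq_of_lt (by omega)]

/-- Tabulate the digits of the numbers below `m ^ W` in array `23`, and the numbers with one digit
erased in array `24`. -/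
def digitsProgram : Program :=
  loop 50 (.get 22 (var 14))
    (loop 51 (var 14)
      (52 ≔ .get 25 (var 50) + var 51 ;;
      ite (natLt (var 50) (.get 22 (var 51)))
        (setNat 23 (var 52) (.const 0) ;; setNat 24 (var 52) (var 50))
        (53 ≔ .get 25 (var 50 - .get 22 (var 51)) + var 51 ;;
        ite (natEq (.get 23 (var 53) + .const 1) (.get 0 (.const 2)))
          (setNat 23 (var 52) (.const 0) ;; setNat 24 (var 52) (var 50))
          (setNat 23 (var 52) (.get 23 (var 53) + .const 1) ;;
          setNat 24 (var 52) (.get 24 (var 53))))))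

/-- Passing from `i - m ^ a` to `i` raises the digit with index `a` by one modulo `m`. As long as
the digit does not wrap around, erasing it gives the same number for both; after a wrap the digit is
`0` and erasing it leaves `i`. -/
theorem ends_digitsProgram {m W : ℕ} (hm : σ.nat 0 2 = m) (hm0 : 0 < m) (hW : σ.nat 14 0 = W)
    (hpw : ∀ a ≤ W, σ.nat 22 a = m ^ a) (hoff : ∀ i < m ^ W, σ.nat 25 i = i * W) :
    Ends digitsProgram σ fun τ t =>
      t ≤ 150 * ((W + 1) * (m ^ W + 1)) ∧ Frame [23, 24, 50, 51, 52, 53] [] σ τ ∧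
        ∀ i < m ^ W, ∀ a < W, τ.nat 23 (i * W + a) = i / m ^ a % m ∧
          τ.nat 24 (i * W + a) = i - i / m ^ a % m * m ^ a := by
  -- The cells are filled in the order of one running index `i * W + a`, so the nested loops share
  -- the invariant that all cells before the present one are correct.
  let P : ℕ → State → Prop := fun x τ => ∀ y < x, τ.nat 23 y = y / W / m ^ (y % W) % m ∧
    τ.nat 24 y = y / W - y / W / m ^ (y % W) % m * m ^ (y % W)
  unfold digitsProgram
  refine ends_loop (m ^ W) (100 * (W + 1)) (fun i τ => Frame [23, 24, 50, 51, 52, 53] [] σ τ ∧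
    P (i * W) τ) ?_ ?_ ?_ ?_
  · simp [frame_setNat, Frame.refl, P]
  · rintro i τ - ⟨hf, -⟩ -
    simp [hf.nat, hW, hpw]
  · rintro i τ hi ⟨hf, hP⟩ hx
    refine ends_loop W 70 (fun a τ' => Frame [23, 24, 50, 51, 52, 53] [] σ τ' ∧
      τ'.nat 50 0 = i ∧ P (i * W + a) τ') ?_ ?_ ?_ ?_
    · refine ⟨by simp [frame_setNat, hf], by simp [hx], ?_⟩
      intro y hy
      simpa using hP y (by simpa using hy)
    · rintro a ρ - ⟨hf, -⟩ -
      simp [hf.nat, hW]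
    · rintro a ρ ha ⟨hf, h50, hP⟩ h51
      have hP0 : 0 < m ^ a := pow_pos hm0 a
      obtain ⟨hdiv, hmod⟩ := div_add_mod_of_lt (i := i) ha
      by_cases hlt : i < m ^ a
      · simp [frame_setNat, hf, hf.nat, h50, h51, hpw a ha.le, hoff i hi, hlt]
        intro y hy
        by_cases hy' : y = i * W + a
        · simp [hy', hdiv, hmod, Nat.div_eq_of_lt hlt]
        · simpa [hy'] using hP y (by omega)
      · have hle : m ^ a ≤ i := not_lt.1 hlt
        have hlt' : i - m ^ a < m ^ W := by omega
        obtain ⟨hdiv', hmod'⟩ := div_add_mod_of_lt (i := i - m ^ a) ha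
        have hprev := hP ((i - m ^ a) * W + a) (by
          have : (i - m ^ a) * W < i * W := Nat.mul_lt_mul_of_pos_right (by omega) (by omega)
          omega)
        rw [hdiv', hmod'] at hprev
        have hstep := digit_step hm0 hP0 hle
        by_cases hd : (i - m ^ a) / m ^ a % m + 1 = m
        · rw [if_pos hd] at hstep
          simp [frame_setNat, hf, hf.nat, h50, h51, hpw a ha.le, hoff i hi, hoff _ hlt', hlt,
            hprev.1, hd, hm]
          intro _ y hy
          by_cases hy' : y = i * W + a
          · simp [hy', hdiv, hmod, hstep]
          · simpa [hy'] using hP y (by omega)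
        · rw [if_neg hd] at hstep
          have hne : (i - m ^ a) * W + a ≠ i * W + a := by
            intro he
            have := congrArg (· / W) he
            simp only [hdiv, hdiv'] at this
            omega
          simp [frame_setNat, hf, hf.nat, h50, h51, hpw a ha.le, hoff i hi, hoff _ hlt', hlt,
            hprev.1, hprev.2, hd, hm]
          intro _ y hy
          by_cases hy' : y = i * W + a
          · simp [hy', hdiv, hmod, hstep]
            rw [add_mul, one_mul]
            omega
          · simpa [hy'] using hP y (by omega)
    · rintro ρ t ⟨hf, h50, hP⟩ ht
      refine ⟨?_, h50, by simp [frame_setNat, hf], ?_⟩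
      · simp at ht
        omega
      · intro y hy
        simpa using hP y (by rw [add_mul] at hy; omega)
  · rintro τ t ⟨hf, hP⟩ ht
    refine ⟨?_, hf, fun i hi a ha => ?_⟩
    · simp at ht ⊢
      nlinarith
    · obtain ⟨hdiv, hmod⟩ := div_add_mod_of_lt (i := i) ha
      have := hP (i * W + a) (by
        have : (i + 1) * W ≤ m ^ W * W := Nat.mul_le_mul_right _ hi
        rw [add_mul] at this
        omega)
      rwa [hdiv, hmod] at this

/-- Decompose the indices of a table: the number of complete clusters goes to array `31`, the
index of the partition to array `32`, that of the facilities to array `33`. -/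
def unpackProgram : Program :=
  loop 50 (var 30)
    (ite (natLt (var 50) (.get 0 (.const 1) + .const 1))
      (setNat 31 (var 50) (var 50) ;; setNat 32 (var 50) (.const 0))
      (52 ≔ var 50 - (.get 0 (.const 1) + .const 1) ;;
      setNat 31 (var 50) (.get 31 (var 52)) ;;
      ite (natEq (.get 32 (var 52) + .const 1) (var 28))
        (setNat 32 (var 50) (.const 0))
        (setNat 32 (var 50) (.get 32 (var 52) + .const 1))) ;;
    ite (natLt (var 50) (var 29))
      (setNat 33 (var 50) (.const 0))
      (setNat 33 (var 50) (.get 33 (var 50 - var 29) + .const 1)))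

/-- The mixed-radix digits of `x` are found without division: the lower two from those of `x - (k +
1)`, and the highest from that of `x - R`. -/
theorem ends_unpackProgram {k b R S : ℕ} (hk : σ.nat 0 1 = k) (hb : σ.nat 28 0 = b) (hb0 : 0 < b)
    (hR : σ.nat 29 0 = R) (hR0 : 0 < R) (hS : σ.nat 30 0 = S) :
    Ends unpackProgram σ fun τ t =>
      t ≤ 100 * (S + 1) ∧ Frame [31, 32, 33, 50, 52] [] σ τ ∧
        ∀ x < S, τ.nat 31 x = x % (k + 1) ∧ τ.nat 32 x = x / (k + 1) % b ∧ τ.nat 33 x = x / R := by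
  unfold unpackProgram
  refine ends_loop S 80 (fun i τ => Frame [31, 32, 33, 50, 52] [] σ τ ∧
    ∀ x < i, τ.nat 31 x = x % (k + 1) ∧ τ.nat 32 x = x / (k + 1) % b ∧ τ.nat 33 x = x / R)
    ?_ ?_ ?_ ?_
  · simp [frame_setNat, Frame.refl]
  · rintro i τ - ⟨hf, -⟩ -
    simp [hf.nat, hS]
  · rintro i τ hi ⟨hf, hP⟩ hx
    have hsnd : ∀ ρ : State, ρ.nat 50 0 = i → Frame [31, 32, 33, 50, 52] [] σ ρ →
        (∀ x < i, ρ.nat 31 x = x % (k + 1) ∧ ρ.nat 32 x = x / (k + 1) % b ∧ ρ.nat 33 x = x / R) →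
        ρ.nat 31 i = i % (k + 1) → ρ.nat 32 i = i / (k + 1) % b →
        Ends (ite (natLt (var 50) (var 29))
          (setNat 33 (var 50) (.const 0))
          (setNat 33 (var 50) (.get 33 (var 50 - var 29) + .const 1))) ρ fun ρ' t =>
        t ≤ 20 ∧ ρ'.nat 50 0 = i ∧ Frame [31, 32, 33, 50, 52] [] σ ρ' ∧
        ∀ x < i + 1, ρ'.nat 31 x = x % (k + 1) ∧ ρ'.nat 32 x = x / (k + 1) % b ∧
          ρ'.nat 33 x = x / R := by
      intro ρ h50 hf hP h31 h32
      by_cases hlt : i < R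
      · simp [frame_setNat, hf, hf.nat, h50, hR, hlt]
        intro y hy
        by_cases hy' : y = i
        · simp [hy', h31, h32, Nat.div_eq_of_lt hlt]
        · simpa [hy'] using hP y (by omega)
      · have := hP (i - R) (by omega)
        simp [frame_setNat, hf, hf.nat, h50, hR, hlt, this]
        intro y hy
        by_cases hy' : y = i
        · simp [hy', h31, h32]
          rw [Nat.div_eq_sub_div hR0 (not_lt.1 hlt)]
        · simpa [hy'] using hP y (by omega)
    have hfin : ∀ (ρ : State) (s : ℕ), s ≤ 60 → ρ.nat 50 0 = i →
        Frame [31, 32, 33, 50, 52] [] σ ρ →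
        (∀ x < i, ρ.nat 31 x = x % (k + 1) ∧ ρ.nat 32 x = x / (k + 1) % b ∧ ρ.nat 33 x = x / R) →
        ρ.nat 31 i = i % (k + 1) → ρ.nat 32 i = i / (k + 1) % b →
        Ends (ite (natLt (var 50) (var 29))
          (setNat 33 (var 50) (.const 0))
          (setNat 33 (var 50) (.get 33 (var 50 - var 29) + .const 1))) ρ fun ρ' t =>
        s + t ≤ 80 ∧ ρ'.nat 50 0 = i ∧ Frame [31, 32, 33, 50, 52] [] σ (ρ'.setNat 50 0 (i + 1)) ∧
        ∀ x < i + 1, (ρ'.setNat 50 0 (i + 1)).nat 31 x = x % (k + 1) ∧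
          (ρ'.setNat 50 0 (i + 1)).nat 32 x = x / (k + 1) % b ∧
          (ρ'.setNat 50 0 (i + 1)).nat 33 x = x / R := by
      intro ρ s hs h50 hf hP h31 h32
      refine (hsnd ρ h50 hf hP h31 h32).mono ?_
      rintro ρ' t ⟨ht, h50', hf', hP'⟩
      refine ⟨by omega, h50', by simp [frame_setNat, hf'], by simpa using hP'⟩
    rw [ends_seq, ends_ite]
    refine ⟨fun h => ?_, fun h => ?_⟩
    · simp [hf.nat, hk, hx] at h
      simp only [ends_seq, ends_setNat]
      refine hfin _ _ (by simp) (by simp [hx]) (by simp [frame_setNat, hf]) ?_ ?_ ?_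
      · intro y hy
        simpa [hx, hy.ne] using hP y hy
      · simp [hx, Nat.mod_eq_of_lt (Nat.lt_succ_of_le h)]
      · simp [hx, Nat.div_eq_of_lt (Nat.lt_succ_of_le h)]
    · simp [hf.nat, hk, hx] at h
      have hi0 : i ≠ 0 := by omega
      have hlt : i - (k + 1) < i := by omega
      have hprev := hP (i - (k + 1)) hlt
      have hstep := digit_step hb0 (Nat.succ_pos k) h
      have hmodk : i % (k + 1) = (i - (k + 1)) % (k + 1) := Nat.mod_eq_sub_mod h
      rw [ends_seq, ends_assign, ends_seq, ends_setNat, ends_ite]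
      refine ⟨fun hd => ?_, fun hd => ?_⟩ <;> rw [ends_setNat]
      · simp [hf.nat, hk, hx, hprev, hb] at hd
        rw [Nat.succ_eq_add_one, if_pos hd] at hstep
        refine hfin _ _ (by simp) (by simp [hx]) (by simp [frame_setNat, hf]) ?_ ?_ ?_
        · intro y hy
          simpa [hx, hy.ne] using hP y hy
        · simp [hx, hmodk, hf.nat, hk, hprev.1]
        · simp [hx, hstep]
      · simp [hf.nat, hk, hx, hprev, hb] at hd
        rw [Nat.succ_eq_add_one, if_neg hd] at hstep
        refine hfin _ _ (by simp) (by simp [hx]) (by simp [frame_setNat, hf]) ?_ ?_ ?_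
        · intro y hy
          simpa [hx, hy.ne] using hP y hy
        · simp [hx, hmodk, hf.nat, hk, hprev.1]
        · simp [hx, hstep, hf.nat, hk, hprev.2.1]
  · rintro τ t ⟨hf, hP⟩ ht
    refine ⟨?_, hf, hP⟩
    simp at ht ⊢
    omega

end RAM

/-! ### Tabulating the equivalence relations on the slots -/

theorem index_eq_iff {W i a j c : ℕ} (ha : a < W) (hc : c < W) :
    i * W + a = j * W + c ↔ i = j ∧ a = c := by
  refine ⟨fun h => ?_, fun ⟨h, h'⟩ => by rw [h, h']⟩
  obtain ⟨h1, h2⟩ := RAM.div_add_mod_of_lt (i := i) ha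
  obtain ⟨h3, h4⟩ := RAM.div_add_mod_of_lt (i := j) hc
  rw [h] at h1 h2
  exact ⟨h1.symm.trans h3, h2.symm.trans h4⟩

theorem index_lt {W b i a : ℕ} (hi : i < b) (ha : a < W) : i * W + a < b * W := by
  have : (i + 1) * W ≤ b * W := Nat.mul_le_mul_right _ hi
  rw [add_mul] at this
  omega

/-- The rows of `q` with numbers below `b` are the labels of the pairwise different equivalence
relations `e 0`, `e 1`, …; the first `s` entries of `M` tell how to merge two blocks. -/
structure IsMergeTable (W : ℕ) (q M : ℕ → ℕ) (b s : ℕ) (e : ℕ → Setoid (Fin W)) : Prop where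
  pos : 0 < b
  zero : e 0 = ⊥
  labeling : ∀ π < b, IsLabeling W (fun i => q (π * W + i)) (e π)
  inj : Set.InjOn e (Set.Iio b)
  merge : ∀ π (a c : Fin W), (π * W + a) * W + c < s → π < b ∧ M ((π * W + a) * W + c) < b ∧
    e (M ((π * W + a) * W + c)) = e π ⊔ Setoid.pair a c

namespace IsMergeTable

variable {W b s : ℕ} {q M q' M' : ℕ → ℕ} {e : ℕ → Setoid (Fin W)}

theorem of_eq (h : IsMergeTable W q M b s e) (hq : ∀ j < b * W, q' j = q j)
    (hM : ∀ j < s, M' j = M j) : IsMergeTable W q' M' b s e where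
  pos := h.pos
  zero := h.zero
  labeling π hπ := (h.labeling π hπ).congr fun i hi => hq _ (index_lt hπ hi)
  inj := h.inj
  merge π a c hs := by rw [hM _ hs]; exact h.merge π a c hs

theorem le_card (h : IsMergeTable W q M b s e) : b ≤ Nat.card (Setoid (Fin W)) := by
  have := Set.ncard_le_card (e '' Set.Iio b)
  rwa [h.inj.ncard_image, Set.ncard_eq_toFinset_card', Set.toFinset_Iio,
    Nat.card_Iio] at this

/-- When all merges of listed relations are recorded, the list contains the discrete relation and is
closed under merging, so it is complete by `Setoid.mem_of_closed`. -/
theorem card_le (h : IsMergeTable W q M b s e) (hs : b * W * W ≤ s) :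
    Nat.card (Setoid (Fin W)) ≤ b ∧ ∀ r, ∃ π < b, e π = r := by
  have hmem : ∀ r, r ∈ e '' Set.Iio b := by
    refine Setoid.mem_of_closed ⟨0, h.pos, h.zero⟩ ?_
    rintro _ ⟨π, hπ, rfl⟩ a c
    obtain ⟨-, h1, h2⟩ := h.merge π a c
      ((index_lt (index_lt hπ a.2) c.2).trans_le hs)
    exact ⟨_, h1, h2⟩
  refine ⟨?_, fun r => hmem r⟩
  have huniv : e '' Set.Iio b = Set.univ := Set.eq_univ_of_forall hmem
  rw [← Set.ncard_univ, ← huniv, h.inj.ncard_image, Set.ncard_eq_toFinset_card',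
    Set.toFinset_Iio, Nat.card_Iio]

theorem index_cases {h π : ℕ} {a c a' c' : Fin W}
    (hlt : (π * W + a') * W + c' < (h * W + a) * W + c + 1) :
    (π * W + a') * W + c' < (h * W + a) * W + c ∨ (π = h ∧ a' = a ∧ c' = c) := by
  rcases Nat.lt_succ_iff_lt_or_eq.1 hlt with hlt | he
  · exact Or.inl hlt
  · obtain ⟨h1, h2⟩ := (index_eq_iff c'.2 c.2).1 he
    obtain ⟨h3, h4⟩ := (index_eq_iff a'.2 a.2).1 h1
    exact Or.inr ⟨h3, Fin.ext h4, Fin.ext h2⟩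

theorem found {h v : ℕ} {a c : Fin W} (hT : IsMergeTable W q M b ((h * W + a) * W + c) e)
    (hh : h < b) (hv : v < b) (he : e v = e h ⊔ Setoid.pair a c)
    (hM : ∀ j < (h * W + a) * W + c, M' j = M j) (hM' : M' ((h * W + a) * W + c) = v) :
    IsMergeTable W q M' b ((h * W + a) * W + c + 1) e where
  pos := hT.pos
  zero := hT.zero
  labeling := hT.labeling
  inj := hT.inj
  merge π a' c' hs := by
    rcases index_cases hs with hs | ⟨rfl, rfl, rfl⟩
    · rw [hM _ hs]; exact hT.merge π a' c' hs
    · rw [hM']; exact ⟨hh, hv, he⟩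

theorem new {h : ℕ} {a c : Fin W} (hT : IsMergeTable W q M b ((h * W + a) * W + c) e)
    (hh : h < b) (hne : ∀ π < b, e π ≠ e h ⊔ Setoid.pair a c)
    (hrow : IsLabeling W (fun i => q (b * W + i)) (e h ⊔ Setoid.pair a c))
    (hM : ∀ j < (h * W + a) * W + c, M' j = M j) (hM' : M' ((h * W + a) * W + c) = b) :
    IsMergeTable W q M' (b + 1) ((h * W + a) * W + c + 1)
      (Function.update e b (e h ⊔ Setoid.pair a c)) := by
  have hlt : ∀ π < b, Function.update e b (e h ⊔ Setoid.pair a c) π = e π := fun π hπ =>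
    Function.update_of_ne hπ.ne _ _
  refine ⟨by omega, ?_, fun π hπ => ?_, fun π hπ π' hπ' he => ?_, fun π a' c' hs => ?_⟩
  · rw [hlt _ hT.pos, hT.zero]
  · by_cases hb : π = b
    · rw [hb, Function.update_self]; exact hrow
    · rw [hlt _ (by omega)]; exact hT.labeling π (by omega)
  · simp only [Set.mem_Iio] at hπ hπ'
    by_cases hb : π = b <;> by_cases hb' : π' = b
    · omega
    · rw [hb, Function.update_self, hlt π' (by omega)] at he
      exact absurd he.symm (hne π' (by omega))
    · rw [hb', Function.update_self, hlt π (by omega)] at he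
      exact absurd he (hne π (by omega))
    · rw [hlt π (by omega), hlt π' (by omega)] at he
      exact hT.inj (by simp; omega) (by simp; omega) he
  · rcases index_cases hs with hs | ⟨rfl, rfl, rfl⟩
    · obtain ⟨h1, h2, h3⟩ := hT.merge π a' c' hs
      rw [hM _ hs, hlt _ h1, hlt _ h2]
      exact ⟨by omega, by omega, h3⟩
    · rw [hM', hlt _ hh, Function.update_self]
      exact ⟨by omega, by omega, rfl⟩

end IsMergeTable

namespace RAM

open Test Program

variable {σ : State}

/-- Write the labels obtained from the row at variable `54` by merging the blocks of variables `51`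
and `52` to the row at variable `66`. -/
def mergeRowProgram : Program :=
  55 ≔ .get 26 (var 54 + var 51) ;;
  56 ≔ .get 26 (var 54 + var 52) ;;
  ite (natLt (var 56) (var 55)) (57 ≔ var 55 ;; 55 ≔ var 56 ;; 56 ≔ var 57) skip ;;
  loop 53 (var 14)
    (ite (natEq (.get 26 (var 54 + var 53)) (var 56))
      (setNat 26 (var 66 + var 53) (var 55))
      (setNat 26 (var 66 + var 53) (.get 26 (var 54 + var 53))))

theorem ends_mergeRowProgram {W h b : ℕ} {r : Setoid (Fin W)} (a c : Fin W) (hW : σ.nat 14 0 = W)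
    (h54 : σ.nat 54 0 = h * W) (h66 : σ.nat 66 0 = b * W) (hh : h < b) (ha : σ.nat 51 0 = a)
    (hc : σ.nat 52 0 = c) (hr : IsLabeling W (fun i => σ.nat 26 (h * W + i)) r) :
    Ends mergeRowProgram σ fun τ t =>
      t ≤ 100 * (W + 1) ∧ Frame [26, 53, 55, 56, 57] [] σ τ ∧
      (∀ j < b * W, τ.nat 26 j = σ.nat 26 j) ∧
      IsLabeling W (fun i => τ.nat 26 (b * W + i)) (r ⊔ Setoid.pair a c) := by
  -- Common to both branches of the comparison, which only serves to put the smaller label into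
  -- variable `55` and the larger one into variable `56`.
  have hloop : ∀ (τ : State) (s : ℕ), s ≤ 50 → Frame [53, 55, 56, 57] [] σ τ →
      τ.nat 55 0 = min (σ.nat 26 (h * W + a)) (σ.nat 26 (h * W + c)) →
      τ.nat 56 0 = max (σ.nat 26 (h * W + a)) (σ.nat 26 (h * W + c)) →
      Ends (loop 53 (var 14)
        (ite (natEq (.get 26 (var 54 + var 53)) (var 56))
          (setNat 26 (var 66 + var 53) (var 55))
          (setNat 26 (var 66 + var 53) (.get 26 (var 54 + var 53))))) τ fun τ t =>
      s + t ≤ 100 * (W + 1) ∧ Frame [26, 53, 55, 56, 57] [] σ τ ∧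
      (∀ j < b * W, τ.nat 26 j = σ.nat 26 j) ∧
      IsLabeling W (fun i => τ.nat 26 (b * W + i)) (r ⊔ Setoid.pair a c) := by
    intro τ s hs hf h55 h56
    have hm := hr.merge a c
    generalize min (σ.nat 26 (h * W + a)) (σ.nat 26 (h * W + c)) = lo at h55 hm
    generalize max (σ.nat 26 (h * W + a)) (σ.nat 26 (h * W + c)) = hi at h56 hm
    refine ends_loop W 40 (fun i ρ => Frame [26, 53] [] τ ρ ∧
      (∀ j < b * W, ρ.nat 26 j = σ.nat 26 j) ∧ ∀ j < i, ρ.nat 26 (b * W + j) =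
        if σ.nat 26 (h * W + j) = hi then lo else σ.nat 26 (h * W + j)) ?_ ?_ ?_ ?_
    · simp [frame_setNat, Frame.refl, hf.nat]
    · rintro i ρ - ⟨hf', -⟩ -
      simp [hf'.nat, hf.nat, hW]
    · rintro i ρ hi' ⟨hf', hlow, hrow⟩ hx
      have hlt := index_lt hh hi'
      by_cases hc : σ.nat 26 (h * W + i) = hi
      · simp [frame_setNat, hf', hf'.nat, hf.nat, hx, h54, h66, h55, h56, hlow _ hlt, hc]
        refine ⟨fun j hj => ?_, fun j hj => ?_⟩
        · rw [if_neg (by omega), hlow j hj]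
        · by_cases hj' : j = i
          · simp [hj', hc]
          · rw [if_neg hj', hrow j (by omega)]
      · simp [frame_setNat, hf', hf'.nat, hf.nat, hx, h54, h66, h55, h56, hlow _ hlt, hc]
        refine ⟨fun j hj => ?_, fun j hj => ?_⟩
        · rw [if_neg (by omega), hlow j hj]
        · by_cases hj' : j = i
          · simp [hj', hc]
          · rw [if_neg hj', hrow j (by omega)]
    · rintro ρ t ⟨hf', hlow, hrow⟩ ht
      refine ⟨?_, (hf.mono (by simp) (by simp)).trans hf' (by simp) (by simp), hlow,
        hm.congr fun i hi => hrow i hi⟩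
      simp at ht
      omega
  unfold mergeRowProgram
  rw [ends_seq, ends_assign, ends_seq, ends_assign, ends_seq, ends_ite]
  refine ⟨fun hlt => ?_, fun hlt => ?_⟩
  · simp [h54, ha, hc] at hlt
    simp only [ends_seq, ends_assign]
    refine (hloop _ 50 (by simp) ?_ ?_ ?_).mono ?_
    · simp [frame_setNat, Frame.refl]
    · simp [h54, ha, hc]; omega
    · simp [h54, ha, hc]; omega
    · rintro τ t ⟨ht, h⟩
      refine ⟨?_, h⟩
      simp
      omega
  · simp [h54, ha, hc] at hlt
    rw [ends_skip]
    refine (hloop _ 50 (by simp) ?_ ?_ ?_).mono ?_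
    · simp [frame_setNat, Frame.refl]
    · simp [h54, ha, hc]; omega
    · simp [h54, ha, hc]; omega
    · rintro τ t ⟨ht, h⟩
      refine ⟨?_, h⟩
      simp
      omega

/-- Variable `62` becomes the number of a row that agrees with the last one. -/
def findRowProgram : Program :=
  62 ≔ var 28 ;; 63 ≔ .const 0 ;;
  loop 64 (var 28)
    (65 ≔ .const 1 ;;
    loop 53 (var 14)
      (ite (natEq (.get 26 (var 63 + var 53)) (.get 26 (var 66 + var 53))) skip (65 ≔ .const 0)) ;;
    ite (natEq (var 65) (.const 1)) (62 ≔ var 64) skip ;;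
    63 ≔ var 63 + var 14)

theorem ends_findRowProgram {W b : ℕ} (hW : σ.nat 14 0 = W) (hb : σ.nat 28 0 = b)
    (h66 : σ.nat 66 0 = b * W) :
    Ends findRowProgram σ fun τ t =>
      t ≤ 150 * ((b + 1) * (W + 1)) ∧ Frame [53, 62, 63, 64, 65] [] σ τ ∧
      ((τ.nat 62 0 = b ∧
          ∀ π < b, ¬ ∀ i < W, σ.nat 26 (π * W + i) = σ.nat 26 (b * W + i)) ∨
        (τ.nat 62 0 < b ∧ ∀ i < W, σ.nat 26 (τ.nat 62 0 * W + i) = σ.nat 26 (b * W + i))) := by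
  unfold findRowProgram
  simp only [ends_seq, ends_assign]
  refine ends_loop b (50 * (W + 1)) (fun h τ => Frame [53, 62, 63, 64, 65] [] σ τ ∧
    τ.nat 63 0 = h * W ∧
    ((τ.nat 62 0 = b ∧
        ∀ π < h, ¬ ∀ i < W, σ.nat 26 (π * W + i) = σ.nat 26 (b * W + i)) ∨
      (τ.nat 62 0 < b ∧ ∀ i < W, σ.nat 26 (τ.nat 62 0 * W + i) = σ.nat 26 (b * W + i))))
    ?_ ?_ ?_ ?_
  · simp [frame_setNat, Frame.refl, hb]
  · rintro h τ - ⟨hf, -⟩ -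
    simp [hf.nat, hb]
  · rintro h τ hh ⟨hf, h63, hor⟩ hx
    rw [ends_seq, ends_assign, ends_seq]
    refine ends_loop W 20 (fun i ρ => Frame [53, 65] [] τ ρ ∧ ((ρ.nat 65 0 = 1 ∧
        ∀ j < i, σ.nat 26 (h * W + j) = σ.nat 26 (b * W + j)) ∨ (ρ.nat 65 0 = 0 ∧
        ¬ ∀ j < i, σ.nat 26 (h * W + j) = σ.nat 26 (b * W + j)))) ?_ ?_ ?_ ?_
    · simp [frame_setNat, Frame.refl]
    · rintro i ρ - ⟨hf', -⟩ -
      simp [hf'.nat, hf.nat, hW]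
    · rintro i ρ hi ⟨hf', h65⟩ hy
      by_cases hc : σ.nat 26 (h * W + i) = σ.nat 26 (b * W + i)
      · simp [frame_setNat, hf', hf'.nat, hf.nat, hy, h63, h66, hc]
        rcases h65 with ⟨h1, h2⟩ | ⟨h1, h2⟩
        · refine Or.inl ⟨h1, fun j hj => ?_⟩
          rcases Nat.lt_or_eq_of_le hj with hj | rfl
          exacts [h2 j hj, hc]
        · push Not at h2
          obtain ⟨j, hj, h2⟩ := h2
          exact Or.inr ⟨h1, j, hj.le, h2⟩
      · simp [frame_setNat, hf', hf'.nat, hf.nat, hy, h63, h66, hc]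
        exact ⟨i, by omega, hc⟩
    · rintro ρ t ⟨hf', h65⟩ ht
      simp at ht
      have hf'' : Frame [53, 62, 63, 64, 65] [] σ ρ := hf.trans hf' (by simp) (by simp)
      rcases h65 with ⟨h65, heq⟩ | ⟨h65, hne⟩
      · simp [frame_setNat, hf'', hf'.nat, hf.nat, hx, h63, h65, hW]
        exact ⟨by omega, by ring, Or.inr ⟨hh, heq⟩⟩
      · simp [frame_setNat, hf'', hf'.nat, hf.nat, hx, h63, h65, hW]
        refine ⟨by omega, by ring, ?_⟩
        rcases hor with ⟨h1, h2⟩ | h1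
        · refine Or.inl ⟨h1, fun π hπ => ?_⟩
          by_cases hπ' : π = h
          · subst hπ'; simpa using hne
          · simpa using h2 π (by omega)
        · exact Or.inr h1
  · rintro τ t ⟨hf, -, hor⟩ ht
    refine ⟨?_, hf, hor⟩
    simp at ht ⊢
    nlinarith

/-- Number the equivalence relations on `W` elements, and tabulate their labels in array `26` and
the results of merging two blocks in array `27`. -/
def partitionProgram : Program :=
  loop 53 (var 14) (setNat 26 (var 53) (var 53)) ;;
  28 ≔ .const 1 ;; 66 ≔ var 14 ;; 67 ≔ .const 0 ;; 54 ≔ .const 0 ;;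
  loop 50 (var 28)
    (loop 51 (var 14)
      (loop 52 (var 14)
        (mergeRowProgram ;;
        findRowProgram ;;
        setNat 27 (var 67) (var 62) ;;
        67 ≔ var 67 + .const 1 ;;
        ite (natEq (var 62) (var 28)) (28 ≔ var 28 + .const 1 ;; 66 ≔ var 66 + var 14) skip)) ;;
    54 ≔ var 54 + var 14)

/-- The labels of the merged relation are written to the spare row `b`. If an earlier row agrees
with it, that row is recorded and the spare row will be overwritten; otherwise the spare row joins
the table by raising `b`. The search through `b` rows dominates the time. -/
theorem ends_mergeStep {W h b cnt : ℕ} {a c : Fin W} {e : ℕ → Setoid (Fin W)}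
    (hW : σ.nat 14 0 = W) (hb : σ.nat 28 0 = b) (h54 : σ.nat 54 0 = h * W)
    (h66 : σ.nat 66 0 = b * W) (hh : h < b) (ha : σ.nat 51 0 = a) (hc : σ.nat 52 0 = c)
    (hcnt : (h * W + a) * W + c = cnt) (h67 : σ.nat 67 0 = cnt)
    (hT : IsMergeTable W (σ.nat 26) (σ.nat 27) b cnt e) :
    Ends (mergeRowProgram ;;
        findRowProgram ;;
        setNat 27 (var 67) (var 62) ;;
        67 ≔ var 67 + .const 1 ;;
        ite (natEq (var 62) (var 28)) (28 ≔ var 28 + .const 1 ;; 66 ≔ var 66 + var 14) skip) σ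
      fun τ t => t ≤ 300 * ((b + 1) * (W + 1)) ∧
        Frame [26, 27, 28, 53, 55, 56, 57, 62, 63, 64, 65, 66, 67] [] σ τ ∧
        τ.nat 67 0 = cnt + 1 ∧ ∃ b' ≥ b, τ.nat 28 0 = b' ∧ τ.nat 66 0 = b' * W ∧
          ∃ e', IsMergeTable W (τ.nat 26) (τ.nat 27) b' (cnt + 1) e' := by
  rw [ends_seq]
  refine (ends_mergeRowProgram a c hW h54 h66 hh ha hc (hT.labeling h hh)).mono ?_
  rintro τ t ⟨ht, hf, hlow, hrow⟩
  rw [ends_seq]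
  refine (ends_findRowProgram (b := b) (W := W) (by simp [hf.nat, hW]) (by simp [hf.nat, hb])
    (by simp [hf.nat, h66])).mono ?_
  rintro ρ s ⟨hs, hf', hor⟩
  have hf'' : Frame [26, 27, 28, 53, 55, 56, 57, 62, 63, 64, 65, 66, 67] [] σ ρ :=
    (hf.mono (by simp) (by simp)).trans hf' (by simp) (by simp)
  have hT' : IsMergeTable W (τ.nat 26) (τ.nat 27) b cnt e :=
    hT.of_eq hlow fun j _ => hf.nat _ (by simp) _
  have h67' : ρ.nat 67 0 = cnt := by simp [hf'.nat, hf.nat, h67]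
  have h28' : ρ.nat 28 0 = b := by simp [hf'.nat, hf.nat, hb]
  have h66' : ρ.nat 66 0 = b * W := by simp [hf'.nat, hf.nat, h66]
  have h14' : ρ.nat 14 0 = W := by simp [hf'.nat, hf.nat, hW]
  have htime : t + (s + 50) ≤ 300 * ((b + 1) * (W + 1)) := by nlinarith
  subst hcnt
  rcases hor with ⟨h62, hne⟩ | ⟨h62, heq⟩
  · simp [frame_setNat, hf'', h67', h62, h28', h66', h14']
    refine ⟨by omega, by ring, _, ((hT'.of_eq (M' := τ.nat 27)
      (fun _ _ => rfl) fun _ _ => rfl).new (M' := ?_) hh ?_ hrow ?_ ?_).of_eq ?_ ?_⟩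
    · exact Function.update (τ.nat 27) ((h * W + a) * W + c) b
    · intro π hπ he
      exact hne π hπ fun i hi =>
        ((he ▸ hT'.labeling π hπ : IsLabeling W _ (e h ⊔ Setoid.pair a c)).eq hrow i hi)
    · intro j hj
      simp [hj.ne]
    · simp
    · intro j _
      simp [hf'.nat]
    · intro j _
      simp [hf'.nat, Function.update_apply]
  · simp [frame_setNat, hf'', h67', h62.ne, h28', h66']
    refine ⟨by omega, e, (hT'.found (M' := ?_) hh h62 ?_ ?_ ?_).of_eq ?_ ?_⟩
    · exact Function.update (τ.nat 27) ((h * W + a) * W + c) (ρ.nat 62 0)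
    · exact (hT'.labeling _ h62).setoid_eq hrow heq
    · intro j hj
      simp [hj.ne]
    · simp
    · intro j _
      simp [hf'.nat]
    · intro j _
      simp [hf'.nat, Function.update_apply]

/-- There are `W ^ 2` merges for each of the relations, and each merge is followed by a search
through all rows found so far. This gives the quadratic dependence on the number of relations,
matching the bound for the dynamic program itself. -/
theorem ends_partitionProgram {W : ℕ} (hW : σ.nat 14 0 = W) :
    Ends partitionProgram σ fun τ t =>
      t ≤ 400 * ((Nat.card (Setoid (Fin W)) + 1) ^ 2 * (W + 1) ^ 3) ∧
      Frame [26, 27, 28, 50, 51, 52, 53, 54, 55, 56, 57, 62, 63, 64, 65, 66, 67] [] σ τ ∧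
      τ.nat 28 0 = Nat.card (Setoid (Fin W)) ∧ τ.nat 66 0 = τ.nat 28 0 * W ∧
      ∃ e, IsMergeTable W (τ.nat 26) (τ.nat 27) (τ.nat 28 0) (τ.nat 28 0 * W * W) e := by
  unfold partitionProgram
  obtain ⟨K, hK⟩ : ∃ K, K = Nat.card (Setoid (Fin W)) := ⟨_, rfl⟩
  rw [← hK]
  let L := [26, 27, 28, 50, 51, 52, 53, 54, 55, 56, 57, 62, 63, 64, 65, 66, 67]
  let P : ℕ → State → Prop := fun s τ => τ.nat 67 0 = s ∧
    τ.nat 66 0 = τ.nat 28 0 * W ∧ ∃ e, IsMergeTable W (τ.nat 26) (τ.nat 27) (τ.nat 28 0) s e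
  have hPcard : ∀ s τ, P s τ → τ.nat 28 0 ≤ K := by
    rintro s τ ⟨-, -, e, h⟩
    exact hK ▸ h.le_card
  have hPset : ∀ s τ x y, (x = 50 ∨ x = 51 ∨ x = 52 ∨ x = 54) → P s τ → P s (τ.setNat x 0 y) := by
    rintro s τ x y hx ⟨h1, h2, e, h3⟩
    refine ⟨?_, ?_, e, ?_⟩
    · rcases hx with rfl | rfl | rfl | rfl <;> simpa using h1
    · rcases hx with rfl | rfl | rfl | rfl <;> simpa using h2
    · rcases hx with rfl | rfl | rfl | rfl <;> simpa using h3.of_eq (by simp) (by simp)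
  rw [ends_seq]
  refine ends_loop W 10 (fun i τ => Frame L [] σ τ ∧ ∀ j < i, τ.nat 26 j = j) ?_ ?_ ?_ ?_
  · simp [frame_setNat, Frame.refl, L]
  · rintro i τ - ⟨hf, -⟩ -
    simp [hf.nat, hW, L]
  · rintro i τ hi ⟨hf, h⟩ hx
    simp [frame_setNat, hf, L, hx]
    intro j hj
    by_cases hj' : j = i
    · simp [hj']
    · simp [hj', h j (by omega)]
  rintro τ₀ t₀ ⟨hf₀, h26⟩ ht₀
  simp at ht₀
  simp only [ends_seq, ends_assign]
  refine ends_loop K (320 * ((K + 1) * (W + 1) ^ 3)) (fun h τ => Frame L [] σ τ ∧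
    τ.nat 54 0 = h * W ∧ h ≤ τ.nat 28 0 ∧ P (h * W * W) τ) ?_ ?_ ?_ ?_
  · simp [frame_setNat, hf₀, L, P]
    refine ⟨by simp [hf₀.nat, hW, L], fun _ => ⊥, ?_⟩
    refine ⟨by norm_num, rfl, fun π hπ => ?_, ?_, fun π a c h => by omega⟩
    · obtain rfl : π = 0 := by omega
      refine IsLabeling.bot.congr fun i hi => ?_
      simp [h26 i hi]
    · intro x hx y hy _
      simp at hx hy
      omega
  -- The bound, the number of rows, grows during the loop. The rows are pairwise different, so there
  -- are at most `K`; if all present rows have been treated, the list is closed and there are at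
  -- least `K`.
  · rintro h τ hle ⟨hf, h54, hh, hP⟩ hx
    simp only [eval_var]
    have hP' := hPcard _ _ hP
    refine ⟨fun hlt => by omega, fun hlt => ?_⟩
    by_contra hge
    obtain ⟨-, -, e, hT⟩ := hP
    have := (hT.card_le (by rw [show h = τ.nat 28 0 by omega])).1
    omega
  · rintro h τ hlt ⟨hf, h54, hh, hP⟩ hx
    have hhb : h < τ.nat 28 0 := by
      by_contra hge
      obtain ⟨-, -, e, hT⟩ := hP
      have := (hT.card_le (by rw [show h = τ.nat 28 0 by omega])).1
      omega
    rw [ends_seq]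
    refine ends_loop W (305 * ((K + 1) * (W + 1) ^ 2) + 10) (fun a τ => Frame L [] σ τ ∧
      τ.nat 50 0 = h ∧ τ.nat 54 0 = h * W ∧ h < τ.nat 28 0 ∧ P ((h * W + a) * W) τ) ?_ ?_ ?_ ?_
    · refine ⟨by simp [frame_setNat, hf, L], by simp [hx], by simp [h54], by simp [hhb],
        hPset _ _ _ _ (by simp) (by simpa using hP)⟩
    · rintro a ρ - ⟨hf, -⟩ -
      simp [hf.nat, hW, L]
    · rintro a ρ ha ⟨hf, h50, h54, hhb, hP⟩ h51
      refine ends_loop W (300 * ((K + 1) * (W + 1))) (fun c τ => Frame L [] σ τ ∧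
        τ.nat 50 0 = h ∧ τ.nat 51 0 = a ∧ τ.nat 54 0 = h * W ∧ h < τ.nat 28 0 ∧
        P ((h * W + a) * W + c) τ) ?_ ?_ ?_ ?_
      · refine ⟨by simp [frame_setNat, hf, L], by simp [h50], by simp [h51], by simp [h54],
          by simp [hhb], hPset _ _ _ _ (by simp) hP⟩
      · rintro c ρ - ⟨hf, -⟩ -
        simp [hf.nat, hW, L]
      · rintro c ρ hc ⟨hf, h50, h51, h54, hhb, hP⟩ h52
        have hcard := hPcard _ _ hP
        obtain ⟨h67, h66, e, hT⟩ := hP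
        refine (ends_mergeStep (a := ⟨a, ha⟩) (c := ⟨c, hc⟩) (by simp [hf.nat, hW, L]) rfl h54 h66
          hhb h51 h52 rfl h67 hT).mono ?_
        rintro ρ' t ⟨ht, hf', h67', b', hb', h28', h66', e', hT'⟩
        refine ⟨ht.trans (by gcongr), by simp [hf'.nat, h52], ?_, by simp [hf'.nat, h50],
          by simp [hf'.nat, h51], by simp [hf'.nat, h54], by simp [h28']; omega, ?_⟩
        · rw [frame_setNat (by simp [L])]
          exact hf.trans hf' (by simp [L]) (by simp)
        · refine hPset _ _ _ _ (by simp) ⟨h67', by rw [h66', h28'], e', ?_⟩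
          rw [h28']
          exact hT'
      · rintro ρ' t ⟨hf, h50, h51, h54, hhb, hP⟩ ht
        refine ⟨?_, h51, by simp [frame_setNat, hf, L], by simp [h50], by simp [h54], by simp [hhb],
          hPset _ _ _ _ (by simp) ?_⟩
        · simp at ht
          nlinarith
        · rwa [show (h * W + (a + 1)) * W = (h * W + a) * W + W by ring]
    · rintro ρ t ⟨hf, h50, h54, hhb, hP⟩ ht
      simp only [ends_assign]
      have h14 : ρ.nat 14 0 = W := by simp [hf.nat, hW, L]
      refine ⟨?_, by simp [h50], by simp [frame_setNat, hf, L], ?_, by simp; omega,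
        hPset _ _ _ _ (by simp) (hPset _ _ _ _ (by simp) ?_)⟩
      · simp at ht ⊢
        nlinarith
      · simp [h54, h14]
        ring
      · rwa [show (h + 1) * W * W = (h * W + W) * W by ring]
  · rintro τ t ⟨hf, h54, hh, hP⟩ ht
    have hP' := hPcard _ _ hP
    have h28 : τ.nat 28 0 = K := by omega
    obtain ⟨-, h66, e, hT⟩ := hP
    refine ⟨?_, hf, h28, h66, e, ?_⟩
    · simp at ht ⊢
      have hA : W + 1 ≤ (W + 1) ^ 3 := Nat.le_self_pow (by norm_num) _
      generalize (W + 1) ^ 3 = A at ht hA ⊢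
      nlinarith [Nat.zero_le (K * A), Nat.zero_le (K * (K * A))]
    · rw [h28] at hT ⊢
      exact hT

end RAM

/-! ### Numbering the states of partial solutions -/

theorem finFunctionFinEquiv_update {W m : ℕ} [NeZero m] (f : Fin W → Fin m) (a : Fin W) :
    (finFunctionFinEquiv (Function.update f a 0) : ℕ) =
      finFunctionFinEquiv f - f a * m ^ (a : ℕ) := by
  have h1 : (finFunctionFinEquiv f : ℕ) =
      f a * m ^ (a : ℕ) + ∑ i ∈ Finset.univ.erase a, (f i : ℕ) * m ^ (i : ℕ) := by
    rw [finFunctionFinEquiv_apply_val,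
      Finset.add_sum_erase _ (fun i => (f i : ℕ) * m ^ (i : ℕ)) (Finset.mem_univ a)]
  have h2 : (finFunctionFinEquiv (Function.update f a 0) : ℕ) =
      ∑ i ∈ Finset.univ.erase a, (f i : ℕ) * m ^ (i : ℕ) := by
    rw [finFunctionFinEquiv_apply_val, ← Finset.add_sum_erase _ _ (Finset.mem_univ a)]
    rw [Function.update_self, Fin.val_zero, zero_mul, zero_add]
    refine Finset.sum_congr rfl fun i hi => ?_
    rw [Function.update_of_ne (Finset.ne_of_mem_erase hi)]
  omega

theorem finFunctionFinEquiv_digit {W m : ℕ} (f : Fin W → Fin m) (a : Fin W) :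
    (finFunctionFinEquiv f : ℕ) / m ^ (a : ℕ) % m = f a := by
  rw [← finFunctionFinEquiv_symm_apply_val, Equiv.symm_apply_apply]

theorem IsMergeTable.exists_equiv {W b : ℕ} {q M : ℕ → ℕ} {e : ℕ → Setoid (Fin W)}
    (h : IsMergeTable W q M b (b * W * W) e) : ∃ ν : Setoid (Fin W) ≃ Fin b, ∀ r, e (ν r) = r := by
  have hbij : Function.Bijective fun i : Fin b => e i := by
    refine ⟨fun i j hij => Fin.ext (h.inj i.2 j.2 hij), fun r => ?_⟩
    obtain ⟨π, hπ, he⟩ := (h.card_le le_rfl).2 r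
    exact ⟨⟨π, hπ⟩, he⟩
  exact ⟨(Equiv.ofBijective _ hbij).symm, fun r => (Equiv.ofBijective _ hbij).apply_symm_apply r⟩

namespace PartialState

variable {W m b k : ℕ} {ν : Setoid (Fin W) ≃ Fin b}

/-- The index of a state in a table. -/
def code (ν : Setoid (Fin W) ≃ Fin b) (k : ℕ) (x : PartialState (Fin W) (Fin m)) : ℕ :=
  finFunctionFinEquiv x.fac * (b * (k + 1)) + (ν x.blocks * (k + 1) + x.closed)

variable {x y : PartialState (Fin W) (Fin m)}

theorem code_lt (hx : x.closed ≤ k) : code ν k x < m ^ W * (b * (k + 1)) :=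
  index_lt (finFunctionFinEquiv x.fac).2 (index_lt (ν x.blocks).2 (Nat.lt_succ_of_le hx))

theorem code_inj (hx : x.closed ≤ k) (hy : y.closed ≤ k) (h : code ν k x = code ν k y) : x = y := by
  obtain ⟨h1, h2⟩ := (index_eq_iff (index_lt (ν x.blocks).2 (Nat.lt_succ_of_le hx))
    (index_lt (ν y.blocks).2 (Nat.lt_succ_of_le hy))).1 h
  obtain ⟨h3, h4⟩ := (index_eq_iff (Nat.lt_succ_of_le hx) (Nat.lt_succ_of_le hy)).1 h2
  exact PartialState.ext (finFunctionFinEquiv.injective (Fin.ext h1)) (ν.injective (Fin.ext h3)) h4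

theorem exists_code_eq {i : ℕ} (hi : i < m ^ W * (b * (k + 1))) :
    ∃ x : PartialState (Fin W) (Fin m), x.closed ≤ k ∧ code ν k x = i := by
  have hb : 0 < b := by
    rcases Nat.eq_zero_or_pos b with rfl | h
    · simp at hi
    · exact h
  have h1 : i / (b * (k + 1)) < m ^ W := Nat.div_lt_of_lt_mul (by rwa [mul_comm])
  have h2 : i % (b * (k + 1)) / (k + 1) < b :=
    Nat.div_lt_of_lt_mul (by rw [mul_comm (k + 1)]; exact Nat.mod_lt _ (by positivity))
  refine ⟨⟨finFunctionFinEquiv.symm ⟨_, h1⟩, ν.symm ⟨_, h2⟩, i % (k + 1)⟩, ?_, ?_⟩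
  · exact Nat.le_of_lt_succ (Nat.mod_lt _ (by omega))
  · simp only [code, Equiv.apply_symm_apply]
    rw [← Nat.mod_mod_of_dvd i (Dvd.intro_left b rfl : k + 1 ∣ b * (k + 1)), Nat.div_add_mod',
      Nat.div_add_mod']

theorem code_unpack (hx : x.closed ≤ k) :
    code ν k x % (k + 1) = x.closed ∧ code ν k x / (k + 1) % b = ν x.blocks ∧
      code ν k x / (b * (k + 1)) = finFunctionFinEquiv x.fac := by
  have hk := Nat.lt_succ_of_le hx
  obtain ⟨h1, h2⟩ := RAM.div_add_mod_of_lt (i := finFunctionFinEquiv x.fac)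
    (index_lt (ν x.blocks).2 hk)
  have he : code ν k x =
      (finFunctionFinEquiv x.fac * b + ν x.blocks) * (k + 1) + x.closed := by
    unfold code; ring
  obtain ⟨h3, h4⟩ := RAM.div_add_mod_of_lt (i := finFunctionFinEquiv x.fac * b + ν x.blocks) hk
  refine ⟨by rw [he]; exact h4, ?_, h1⟩
  rw [he, show k + 1 = k.succ from rfl, h3]
  exact (RAM.div_add_mod_of_lt (ν x.blocks).2).2

/-- The all-zero assignment has number `0`, and so has the discrete partition. Thus the leaf state
has code `0`, and the answer is found in cell `k` of the root's table. -/
theorem code_init [NeZero m] (hν : (ν ⊥ : ℕ) = 0) (j : ℕ) :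
    code ν k (init (Fin W) (Fin m) j) = j := by
  have h0 : (finFunctionFinEquiv (0 : Fin W → Fin m) : ℕ) = 0 := by
    simp [finFunctionFinEquiv_apply_val]
  simp [code, init, h0, hν]

end PartialState

namespace RAM

open Test Program

variable {σ τ : State}

/-- The tables that do not depend on the tree decomposition are in place, and so are the multiples
of the table size and of `n`. -/
structure Tables (n N k W m : ℕ) {b : ℕ} [NeZero m] (ν : Setoid (Fin W) ≃ Fin b) (σ : State) :
    Prop where
  bot : (ν ⊥ : ℕ) = 0
  width : σ.nat 14 0 = W
  card : σ.nat 28 0 = b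
  layer : σ.nat 29 0 = b * (k + 1)
  size : σ.nat 30 0 = m ^ W * (b * (k + 1))
  row : ∀ i < m ^ W + b * W, σ.nat 25 i = i * W
  digit : ∀ (f : Fin W → Fin m) (a : Fin W), σ.nat 23 (finFunctionFinEquiv f * W + a) = f a
  erase : ∀ (f : Fin W → Fin m) (a : Fin W),
    σ.nat 24 (finFunctionFinEquiv f * W + a) = finFunctionFinEquiv (Function.update f a 0)
  label : ∀ r, IsLabeling W (fun i => σ.nat 26 (ν r * W + i)) r
  merge : ∀ (r : Setoid (Fin W)) (a c : Fin W), σ.nat 27 ((ν r * W + a) * W + c) = ν (r ⊔ Setoid.pair a c)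
  closed : ∀ x : PartialState (Fin W) (Fin m), x.closed ≤ k → σ.nat 31 (x.code ν k) = x.closed
  blocks : ∀ x : PartialState (Fin W) (Fin m), x.closed ≤ k → σ.nat 32 (x.code ν k) = ν x.blocks
  fac : ∀ x : PartialState (Fin W) (Fin m), x.closed ≤ k →
    σ.nat 33 (x.code ν k) = finFunctionFinEquiv x.fac
  offset_fac : ∀ f < m ^ W, σ.nat 34 f = f * (b * (k + 1))
  offset_blocks : ∀ p < b, σ.nat 35 p = p * (k + 1)
  offset_node : ∀ t < N, σ.nat 36 t = t * (m ^ W * (b * (k + 1)))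
  offset_vertex : ∀ v < n, σ.nat 15 v = v * n

variable {n N k W m b : ℕ} [NeZero m] {ν : Setoid (Fin W) ≃ Fin b}

/-- All permanent data lie in the arrays `14`, `15` and `20` to `36`, so every program that writes
elsewhere preserves them. -/
theorem Tables.of_frame (h : Tables n N k W m ν σ) {L M : List ℕ} (hf : Frame L M σ τ)
    (hL : ∀ a ∈ L, a < 14 ∨ (15 < a ∧ a < 20) ∨ 36 < a) : Tables n N k W m ν τ := by
  have he : ∀ a, (a = 14 ∨ a = 15 ∨ (20 ≤ a ∧ a ≤ 36)) → ∀ j, τ.nat a j = σ.nat a j :=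
    fun a ha j => hf.nat a (fun hmem => by have := hL a hmem; omega) j
  constructor
  case label => exact fun r => (h.label r).congr fun i hi => he 26 (by norm_num) _
  all_goals
    intros
    first
    | exact h.bot
    | (rw [he _ (by norm_num)]
       first
       | exact h.width
       | exact h.card
       | exact h.layer
       | exact h.size
       | exact h.row _ ‹_›
       | exact h.digit _ _
       | exact h.erase _ _
       | exact h.merge _ _ _
       | exact h.closed _ ‹_›
       | exact h.blocks _ ‹_›
       | exact h.fac _ ‹_›
       | exact h.offset_fac _ ‹_›
       | exact h.offset_blocks _ ‹_›
       | exact h.offset_node _ ‹_›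
       | exact h.offset_vertex _ ‹_›)

/-- Each table is built from earlier ones: variables `66`, `29` and `30` are products left over by
preceding loops. Row offsets are needed for the `m ^ W` assignments and for the `b * W` pairs of a
partition and a slot; the length of array `25` covers both. -/
def tablesProgram : Program :=
  partitionProgram ;;
  powersProgram ;;
  multiplesProgram 50 52 25 (.get 22 (var 14) + var 66) (var 14) ;;
  digitsProgram ;;
  multiplesProgram 50 29 35 (var 28) (.get 0 (.const 1) + .const 1) ;;
  multiplesProgram 50 30 34 (.get 22 (var 14)) (var 29) ;;
  unpackProgram ;;
  multiplesProgram 50 52 36 (.get 0 (.const 3)) (var 30) ;;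
  multiplesProgram 50 52 15 (.get 0 (.const 0)) (.get 0 (.const 0))

/-- The arrays used by `tablesProgram`. -/
def tableArrays : List ℕ :=
  [15, 22, 23, 24, 25, 26, 27, 28, 29, 30, 31, 32, 33, 34, 35, 36, 50, 51, 52, 53, 54, 55, 56, 57,
    62, 63, 64, 65, 66, 67]

theorem ends_tablesProgram (hn : σ.nat 0 0 = n) (hk : σ.nat 0 1 = k) (hm : σ.nat 0 2 = m)
    (hN : σ.nat 0 3 = N) (hW : σ.nat 14 0 = W) :
    Ends tablesProgram σ fun τ t =>
      t ≤ 1000 * ((Nat.card (Setoid (Fin W)) + 1) ^ 2 * (W + 1) ^ 3 + (W + 1) * (m + 1) +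
        (W + 1) * (m ^ W + 1) + m ^ W * (Nat.card (Setoid (Fin W)) * (k + 1)) + N + n + 1) ∧
      Frame tableArrays [] σ τ ∧
      ∃ ν : Setoid (Fin W) ≃ Fin (Nat.card (Setoid (Fin W))), Tables n N k W m ν τ := by
  have hm0 : 0 < m := NeZero.pos m
  obtain ⟨b, hb⟩ : ∃ b, b = Nat.card (Setoid (Fin W)) := ⟨_, rfl⟩
  unfold tablesProgram
  rw [← hb, ends_seq]
  refine (ends_partitionProgram hW).mono ?_
  rintro τ₁ t₁ ⟨ht₁, hf₁, h28, h66, e, hT⟩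
  rw [← hb] at ht₁ h28
  rw [h28] at h66 hT
  have hb0 := hT.pos
  rw [ends_seq]
  refine (ends_powersProgram (m := m) (W := W) (by simp [hf₁.nat, hm])
    (by simp [hf₁.nat, hW])).mono ?_
  rintro τ₂ t₂ ⟨ht₂, hf₂, h22⟩
  have hg₂ : Frame tableArrays [] σ τ₂ :=
    (hf₁.mono (by simp [tableArrays]) (by simp)).trans hf₂ (by simp [tableArrays]) (by simp)
  rw [ends_seq]
  refine (ends_multiplesProgram (m := m ^ W + b * W) (v := W) (by norm_num) (by norm_num)
    (by norm_num) ?_).mono ?_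
  · intro ρ hρ
    simp [hρ.nat, hg₂.nat, tableArrays, hW, h22, hf₂.nat, h66]
  rintro τ₃ t₃ ⟨ht₃, hf₃, -, h25⟩
  have hg₃ : Frame tableArrays [] σ τ₃ := hg₂.trans hf₃ (by simp [tableArrays]) (by simp)
  rw [ends_seq]
  refine (ends_digitsProgram (m := m) (W := W) (by simp [hg₃.nat, tableArrays, hm]) hm0
    (by simp [hg₃.nat, tableArrays, hW]) (fun a ha => by simp [hf₃.nat, h22 a ha])
    fun i hi => h25 i (by omega)).mono ?_
  rintro τ₄ t₄ ⟨ht₄, hf₄, hdig⟩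
  have hg₄ : Frame tableArrays [] σ τ₄ := hg₃.trans hf₄ (by simp [tableArrays]) (by simp)
  rw [ends_seq]
  refine (ends_multiplesProgram (m := b) (v := k + 1) (by norm_num) (by norm_num)
    (by norm_num) ?_).mono ?_
  · intro ρ hρ
    simp [hρ.nat, hg₄.nat, hf₄.nat, hf₃.nat, hf₂.nat, h28, tableArrays, hk]
  rintro τ₅ t₅ ⟨ht₅, hf₅, h29, h35⟩
  have hg₅ : Frame tableArrays [] σ τ₅ := hg₄.trans hf₅ (by simp [tableArrays]) (by simp)
  rw [ends_seq]
  refine (ends_multiplesProgram (m := m ^ W) (v := b * (k + 1)) (by norm_num) (by norm_num)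
    (by norm_num) ?_).mono ?_
  · intro ρ hρ
    simp [hρ.nat, hg₅.nat, hf₅.nat, hf₄.nat, hf₃.nat, h22, hW, tableArrays, h29]
  rintro τ₆ t₆ ⟨ht₆, hf₆, h30, h34⟩
  have hg₆ : Frame tableArrays [] σ τ₆ := hg₅.trans hf₆ (by simp [tableArrays]) (by simp)
  rw [ends_seq]
  refine (ends_unpackProgram (k := k) (b := b) (R := b * (k + 1)) (S := m ^ W * (b * (k + 1)))
    (by simp [hg₆.nat, tableArrays, hk]) (by simp [hf₆.nat, hf₅.nat, hf₄.nat, hf₃.nat, hf₂.nat, h28])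
    hb0 (by simp [hf₆.nat, h29]) (by positivity) h30).mono ?_
  rintro τ₇ t₇ ⟨ht₇, hf₇, hun⟩
  have hg₇ : Frame tableArrays [] σ τ₇ := hg₆.trans hf₇ (by simp [tableArrays]) (by simp)
  rw [ends_seq]
  refine (ends_multiplesProgram (m := N) (v := m ^ W * (b * (k + 1))) (by norm_num) (by norm_num)
    (by norm_num) ?_).mono ?_
  · intro ρ hρ
    simp [hρ.nat, hg₇.nat, hf₇.nat, h30, hN, tableArrays]
  rintro τ₈ t₈ ⟨ht₈, hf₈, -, h36⟩
  have hg₈ : Frame tableArrays [] σ τ₈ := hg₇.trans hf₈ (by simp [tableArrays]) (by simp)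
  refine (ends_multiplesProgram (m := n) (v := n) (by norm_num) (by norm_num)
    (by norm_num) ?_).mono ?_
  · intro ρ hρ
    simp [hρ.nat, hg₈.nat, hn, tableArrays]
  rintro τ₉ t₉ ⟨ht₉, hf₉, -, h15⟩
  have hg₉ : Frame tableArrays [] σ τ₉ := hg₈.trans hf₉ (by simp [tableArrays]) (by simp)
  refine ⟨?_, hg₉, ?_⟩
  · simp at ht₃ ht₅ ht₆ ht₈ ht₉
    have h1 : b * W ≤ (b + 1) ^ 2 * (W + 1) ^ 3 := Nat.mul_le_mul
      ((Nat.le_succ b).trans (Nat.le_self_pow (by norm_num) _))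
      ((Nat.le_succ W).trans (Nat.le_self_pow (by norm_num) _))
    have h2 : b ≤ (b + 1) ^ 2 * (W + 1) ^ 3 := le_mul_of_le_of_one_le
      ((Nat.le_succ b).trans (Nat.le_self_pow (by norm_num) _)) (Nat.one_le_pow _ _ (by omega))
    have h3 : m ^ W ≤ (W + 1) * (m ^ W + 1) := by nlinarith
    generalize (b + 1) ^ 2 * (W + 1) ^ 3 = A₁ at *
    generalize (W + 1) * (m + 1) = A₂ at *
    generalize (W + 1) * (m ^ W + 1) = A₃ at *
    generalize m ^ W * (b * (k + 1)) = A₄ at *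
    generalize m ^ W = A₅ at *
    generalize b * W = A₆ at *
    omega
  · subst hb
    obtain ⟨ν, hν⟩ := hT.exists_equiv
    have h26 : ∀ j, τ₉.nat 26 j = τ₁.nat 26 j := fun j => by
      simp [hf₉.nat, hf₈.nat, hf₇.nat, hf₆.nat, hf₅.nat, hf₄.nat, hf₃.nat, hf₂.nat]
    have h27 : ∀ j, τ₉.nat 27 j = τ₁.nat 27 j := fun j => by
      simp [hf₉.nat, hf₈.nat, hf₇.nat, hf₆.nat, hf₅.nat, hf₄.nat, hf₃.nat, hf₂.nat]
    have h23 : ∀ j, τ₉.nat 23 j = τ₄.nat 23 j := fun j => by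
      simp [hf₉.nat, hf₈.nat, hf₇.nat, hf₆.nat, hf₅.nat]
    have h24 : ∀ j, τ₉.nat 24 j = τ₄.nat 24 j := fun j => by
      simp [hf₉.nat, hf₈.nat, hf₇.nat, hf₆.nat, hf₅.nat]
    have hinj : ∀ i < Nat.card (Setoid (Fin W)), ∀ r, e i = r → i = ν r := fun i hi r he =>
      hT.inj hi (ν r).2 (he.trans (hν r).symm)
    refine ⟨ν, (hinj 0 hb0 ⊥ hT.zero).symm, ?_, ?_, ?_, ?_, fun i hi => ?_, fun f a => ?_,
      fun f a => ?_, fun r => ?_, fun r a c => ?_, fun x hx => ?_, fun x hx => ?_, fun x hx => ?_,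
      fun f hf => ?_, fun p hp => ?_, fun t ht => ?_, h15⟩
    · simp [hg₉.nat, tableArrays, hW]
    · simp [hf₉.nat, hf₈.nat, hf₇.nat, hf₆.nat, hf₅.nat, hf₄.nat, hf₃.nat, hf₂.nat, h28]
    · simp [hf₉.nat, hf₈.nat, hf₇.nat, hf₆.nat, h29]
    · simp [hf₉.nat, hf₈.nat, hf₇.nat, h30]
    · simp [hf₉.nat, hf₈.nat, hf₇.nat, hf₆.nat, hf₅.nat, hf₄.nat, h25 i hi]
    · rw [h23, (hdig _ (finFunctionFinEquiv f).2 a a.2).1, finFunctionFinEquiv_digit]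
    · rw [h24, (hdig _ (finFunctionFinEquiv f).2 a a.2).2, finFunctionFinEquiv_digit,
        finFunctionFinEquiv_update]
    · have := hT.labeling (ν r) (ν r).2
      rw [hν] at this
      exact this.congr fun i _ => h26 _
    · obtain ⟨-, h1, h2⟩ := hT.merge (ν r) a c (index_lt (index_lt (ν r).2 a.2) c.2)
      rw [h27]
      refine hinj _ h1 _ ?_
      rw [h2, hν]
    · simp [hf₉.nat, hf₈.nat, (hun _ (PartialState.code_lt hx)).1,
        (PartialState.code_unpack hx).1]
    · simp [hf₉.nat, hf₈.nat, (hun _ (PartialState.code_lt hx)).2.1,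
        (PartialState.code_unpack hx).2.1]
    · simp [hf₉.nat, hf₈.nat, (hun _ (PartialState.code_lt hx)).2.2,
        (PartialState.code_unpack hx).2.2]
    · simp [hf₉.nat, hf₈.nat, hf₇.nat, h34 f hf]
    · simp [hf₉.nat, hf₈.nat, hf₇.nat, hf₆.nat, h35 p hp]
    · simp [hf₉.nat, h36 t ht]

end RAM

/-! ### Operations on equivalence relations -/

namespace RAM

open Test Program

variable {n N k W m b : ℕ} [NeZero m] {ν : Setoid (Fin W) ≃ Fin b} {σ τ : State}

theorem Tables.row_blocks (h : Tables n N k W m ν σ) (hW : 0 < W) (r : Setoid (Fin W)) :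
    σ.nat 25 (ν r) = ν r * W := by
  refine h.row _ ?_
  have : b * 1 ≤ b * W := Nat.mul_le_mul_left _ hW
  have := (ν r).2
  omega

theorem Tables.row_merge (h : Tables n N k W m ν σ) (r : Setoid (Fin W)) (a : Fin W) :
    σ.nat 25 (ν r * W + a) = (ν r * W + a) * W :=
  h.row _ (by have := index_lt (ν r).2 a.2; omega)

theorem Tables.row_fac (h : Tables n N k W m ν σ) (f : Fin W → Fin m) :
    σ.nat 25 (finFunctionFinEquiv f) = finFunctionFinEquiv f * W :=
  h.row _ (by have := (finFunctionFinEquiv f).2; omega)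

/-- Merge the relation with the number in variable `61` into that of variable `60`. -/
def joinBlocksProgram : Program :=
  62 ≔ .get 25 (var 61) ;;
  loop 53 (var 14)
    (60 ≔ .get 27 (.get 25 (.get 25 (var 60) + var 53) + .get 26 (var 62 + var 53)))

/-- The pairs consisting of an element and its label generate `s`, so `W` merges suffice. The
relation built so far stays between `r` and `r ⊔ s`. -/
theorem ends_joinBlocksProgram (hT : Tables n N k W m ν σ) (hW : 0 < W) {r s : Setoid (Fin W)}
    (h60 : σ.nat 60 0 = ν r) (h61 : σ.nat 61 0 = ν s) :
    Ends joinBlocksProgram σ fun τ t =>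
      t ≤ 40 * (W + 1) ∧ Frame [53, 60, 62] [] σ τ ∧ τ.nat 60 0 = ν (r ⊔ s) := by
  unfold joinBlocksProgram
  simp only [ends_seq, ends_assign]
  refine ends_loop W 20 (fun i τ => Frame [53, 60, 62] [] σ τ ∧ τ.nat 62 0 = ν s * W ∧
    ∃ q, τ.nat 60 0 = ν q ∧ r ≤ q ∧ q ≤ r ⊔ s ∧
      ∀ j l : Fin W, (j : ℕ) < i → (l : ℕ) = σ.nat 26 (ν s * W + j) → q j l) ?_ ?_ ?_ ?_
  · simp [frame_setNat, Frame.refl, h60, h61, hT.row_blocks hW]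
    exact ⟨r, rfl, le_rfl, le_sup_left⟩
  · rintro i τ - ⟨hf, -⟩ -
    simp [hf.nat, hT.width]
  · rintro i τ hi ⟨hf, h62, q, h60, hrq, hq, hP⟩ hx
    have hlab := hT.label s
    have hl : σ.nat 26 (ν s * W + i) < W := (hlab.le i hi).trans_lt hi
    have hrow := hT.row_merge q ⟨i, hi⟩
    have hmer := hT.merge q ⟨i, hi⟩ ⟨_, hl⟩
    simp only at hrow hmer
    simp [frame_setNat, hf, hx, h62, h60, hf.nat, hT.row_blocks hW, hrow, hmer]
    refine ⟨_, rfl, hrq.trans le_sup_left, sup_le hq ?_, fun j l hj hjl => ?_⟩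
    · refine Setoid.pair_le_iff.2 ((le_sup_right : s ≤ r ⊔ s) ?_)
      exact (hlab.rel ⟨i, hi⟩ ⟨_, hl⟩).1 (hlab.idem i hi).symm
    · rcases Nat.lt_or_eq_of_le hj with hj | hj
      · exact (le_sup_left : q ≤ q ⊔ _) (hP j l hj hjl)
      · obtain rfl : j = ⟨i, hi⟩ := Fin.ext hj
        obtain rfl : l = ⟨_, hl⟩ := Fin.ext hjl
        exact (le_sup_right : Setoid.pair _ _ ≤ q ⊔ _) (Setoid.pair_rel _ _)
  · rintro τ t ⟨hf, -, q, h60, hrq, hq, hP⟩ ht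
    refine ⟨?_, hf, ?_⟩
    · simp at ht ⊢
      omega
    · have hlab := hT.label s
      rw [h60, le_antisymm hq (sup_le hrq fun i j hij => ?_)]
      have hl : σ.nat 26 (ν s * W + i) < W := (hlab.le i i.2).trans_lt i.2
      refine q.trans' (hP i ⟨_, hl⟩ i.2 rfl) (q.symm' (hP j ⟨_, hl⟩ j.2 ?_))
      exact (hlab.rel i j).2 hij

/-- Variable `60` becomes the number of the relation obtained from that of variable `61` by
isolating the element of variable `63`. -/
def isolateProgram : Program :=
  62 ≔ .get 25 (var 61) ;; 60 ≔ .const 0 ;;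
  loop 53 (var 14)
    (ite (natEq (var 53) (var 63)) skip
      (loop 54 (var 14)
        (ite ((natEq (.get 26 (var 62 + var 53)) (.get 26 (var 62 + var 54))).and
            (natEq (var 54) (var 63)).not)
          (60 ≔ .get 27 (.get 25 (.get 25 (var 60) + var 53) + var 54)) skip)))

/-- The relation is rebuilt from the discrete one. Here merging every element with its label would
not do, since the label may be `a` itself; hence all pairs with equal labels that avoid `a` are
merged. -/
theorem ends_isolateProgram (hT : Tables n N k W m ν σ) (hW : 0 < W) {r : Setoid (Fin W)}
    {a : Fin W} (h61 : σ.nat 61 0 = ν r) (h63 : σ.nat 63 0 = a) :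
    Ends isolateProgram σ fun τ t =>
      t ≤ 100 * (W + 1) ^ 2 ∧ Frame [53, 54, 60, 62] [] σ τ ∧ τ.nat 60 0 = ν (r.isolate a) := by
  have hlab := hT.label r
  let P : ℕ → ℕ → State → Prop := fun i j τ => Frame [53, 54, 60, 62] [] σ τ ∧
    τ.nat 62 0 = ν r * W ∧ ∃ q, τ.nat 60 0 = ν q ∧ q ≤ r.isolate a ∧
      ∀ x y : Fin W, ((x : ℕ) < i ∨ ((x : ℕ) = i ∧ (y : ℕ) < j)) → r.isolate a x y → q x y
  have hPset : ∀ i j τ x y, (x = 53 ∨ x = 54) → P i j τ → P i j (τ.setNat x 0 y) := by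
    rintro i j τ x y (rfl | rfl) ⟨hf, h62, q, h60, hq⟩
    · exact ⟨by simp [frame_setNat, hf], by simp [h62], q, by simp [h60], hq⟩
    · exact ⟨by simp [frame_setNat, hf], by simp [h62], q, by simp [h60], hq⟩
  unfold isolateProgram
  simp only [ends_seq, ends_assign]
  refine ends_loop W (60 * (W + 1)) (fun i τ => P i 0 τ) ?_ ?_ ?_ ?_
  · refine ⟨by simp [frame_setNat, Frame.refl], by simp [h61, hT.row_blocks hW], ⊥,
      by simp [hT.bot], bot_le, by simp⟩
  · rintro i τ - ⟨hf, -⟩ -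
    simp [hf.nat, hT.width]
  · rintro i τ hi hP hx
    have hnext : ∀ τ, P i W τ → P (i + 1) 0 τ := by
      rintro τ ⟨hf, h62, q, h60, hq, h⟩
      exact ⟨hf, h62, q, h60, hq, fun x y hxy => h x y (by have := y.2; omega)⟩
    rw [ends_ite]
    refine ⟨fun hia => ?_, fun hia => ?_⟩
    · simp [hP.1.nat, h63, hx] at hia
      simp [hx]
      refine ⟨by omega, hPset _ _ _ _ _ (by simp) (hnext _ ?_)⟩
      obtain ⟨hf, h62, q, h60, hq, h⟩ := hP
      refine ⟨hf, h62, q, h60, hq, fun x y hxy hr => ?_⟩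
      rcases hxy with hxy | ⟨hxy, -⟩
      · exact h x y (Or.inl hxy) hr
      · obtain rfl : x = a := Fin.ext (by omega)
        rcases hr with rfl | ⟨hne, -⟩
        · exact q.refl' _
        · exact absurd rfl hne
    · simp [hP.1.nat, h63, hx] at hia
      refine ends_loop W 40 (fun j τ => P i j τ ∧ τ.nat 53 0 = i) ?_ ?_ ?_ ?_
      · exact ⟨hPset _ _ _ _ _ (by simp) hP, by simp [hx]⟩
      · rintro j ρ - ⟨⟨hf, -⟩, -⟩ -
        simp [hf.nat, hT.width]
      · rintro j ρ hj ⟨hP, h53⟩ hy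
        obtain ⟨hf, h62, q, h60, hq, h⟩ := hP
        have hrow := hT.row_merge q ⟨i, hi⟩
        have hmer := hT.merge q ⟨i, hi⟩ ⟨j, hj⟩
        simp only at hrow hmer
        have hcases : ∀ x y : Fin W, ((x : ℕ) < i ∨ ((x : ℕ) = i ∧ (y : ℕ) < j + 1)) →
            ((x : ℕ) < i ∨ ((x : ℕ) = i ∧ (y : ℕ) < j)) ∨ (x = ⟨i, hi⟩ ∧ y = ⟨j, hj⟩) := by
          intro x y hxy
          simp only [Fin.ext_iff]
          omega
        by_cases hc : σ.nat 26 (ν r * W + i) = σ.nat 26 (ν r * W + j) ∧ j ≠ a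
        · have hiso : r.isolate a ⟨i, hi⟩ ⟨j, hj⟩ := by
            refine Or.inr ⟨fun h => hia (congrArg Fin.val h), fun h => hc.2 (congrArg Fin.val h), ?_⟩
            exact (hlab.rel ⟨i, hi⟩ ⟨j, hj⟩).1 hc.1
          simp [hf.nat, h53, hy, h62, h60, h63, hc, hT.row_blocks hW, hrow, hmer]
          refine ⟨by simp [frame_setNat, hf], by simp [h62], q ⊔ Setoid.pair ⟨i, hi⟩ ⟨j, hj⟩,
            by simp, sup_le hq (Setoid.pair_le_iff.2 hiso), fun x y hxy hr => ?_⟩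
          rcases hcases x y hxy with hxy | ⟨rfl, rfl⟩
          · exact (le_sup_left : q ≤ q ⊔ _) (h x y hxy hr)
          · exact (le_sup_right : Setoid.pair _ _ ≤ q ⊔ _) (Setoid.pair_rel _ _)
        · rw [ends_ite]
          refine ⟨fun hc' => absurd ?_ hc, fun _ => ?_⟩
          · simpa [hf.nat, h53, hy, h62, h63] using hc'
          simp only [ends_skip]
          refine ⟨by simp, hy, ⟨by simp [frame_setNat, hf], by simp [h62], q, by simp [h60], hq,
            fun x y hxy hr => ?_⟩, by simp [h53]⟩
          rcases hcases x y hxy with hxy | ⟨rfl, rfl⟩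
          · exact h x y hxy hr
          · rcases hr with he | ⟨-, hne, hr⟩
            · rw [he]
            · exact absurd ⟨(hlab.rel ⟨i, hi⟩ ⟨j, hj⟩).2 hr, fun h => hne (Fin.ext h)⟩ hc
      · rintro ρ t ⟨hP, h53⟩ ht
        refine ⟨?_, h53, hPset _ _ _ _ _ (by simp) (hnext _ hP)⟩
        simp at ht ⊢
        nlinarith
  · rintro τ t ⟨hf, -, q, h60, hq, h⟩ ht
    refine ⟨?_, hf, ?_⟩
    · simp at ht ⊢
      nlinarith
    · rw [h60, le_antisymm hq fun x y hxy => h x y (Or.inl x.2) hxy]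

/-- Variable `64` becomes `1` if the element of variable `63` is a block of its own in the relation
of variable `61`, and `0` otherwise. -/
def singletonProgram : Program :=
  62 ≔ .get 25 (var 61) ;; 64 ≔ .const 1 ;;
  loop 53 (var 14)
    (ite ((natEq (.get 26 (var 62 + var 53)) (.get 26 (var 62 + var 63))).and
        (natEq (var 53) (var 63)).not) (64 ≔ .const 0) skip)

open Classical in
theorem ends_singletonProgram (hT : Tables n N k W m ν σ) (hW : 0 < W) {r : Setoid (Fin W)}
    {a : Fin W} (h61 : σ.nat 61 0 = ν r) (h63 : σ.nat 63 0 = a) :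
    Ends singletonProgram σ fun τ t =>
      t ≤ 50 * (W + 1) ∧ Frame [53, 62, 64] [] σ τ ∧
        τ.nat 64 0 = if ∀ c, r a c → c = a then 1 else 0 := by
  have hlab := hT.label r
  unfold singletonProgram
  simp only [ends_seq, ends_assign]
  refine ends_loop W 30 (fun i τ => Frame [53, 62, 64] [] σ τ ∧ τ.nat 62 0 = ν r * W ∧
    τ.nat 64 0 = if ∀ c : Fin W, (c : ℕ) < i → r a c → c = a then 1 else 0) ?_ ?_ ?_ ?_
  · simp [frame_setNat, Frame.refl, h61, hT.row_blocks hW]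
  · rintro i τ - ⟨hf, -⟩ -
    simp [hf.nat, hT.width]
  · rintro i τ hi ⟨hf, h62, h64⟩ hx
    rw [ends_ite]
    have hsplit : (∀ c : Fin W, (c : ℕ) < i + 1 → r a c → c = a) ↔
        (∀ c : Fin W, (c : ℕ) < i → r a c → c = a) ∧ (r a ⟨i, hi⟩ → ⟨i, hi⟩ = a) := by
      refine ⟨fun h => ⟨fun c hc => h c (by omega), h ⟨i, hi⟩ (by simp)⟩, fun h c hc => ?_⟩
      rcases Nat.lt_succ_iff_lt_or_eq.1 hc with hc | hc
      · exact h.1 c hc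
      · obtain rfl : c = ⟨i, hi⟩ := Fin.ext hc
        exact h.2
    have hrel : r a ⟨i, hi⟩ ↔ σ.nat 26 (ν r * W + i) = σ.nat 26 (ν r * W + a) := by
      rw [← hlab.rel a ⟨i, hi⟩, eq_comm]
    rw [hrel, Fin.ext_iff] at hsplit
    simp only [Nat.lt_succ_iff] at hsplit
    refine ⟨fun hc => ?_, fun hc => ?_⟩
    · simp [hf.nat, hx, h62, h63] at hc
      simp [frame_setNat, hf, hx, h62]
      by_contra! h
      exact hc.2 ((hsplit.1 h).2 hc.1)
    · simp [hf.nat, hx, h62, h63] at hc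
      simp [frame_setNat, hf, hx, h62, h64]
      congr 1
      simp only [eq_iff_iff]
      constructor
      · exact fun h => hsplit.2 ⟨h, hc⟩
      · exact fun h => (hsplit.1 h).1
  · rintro τ t ⟨hf, -, h64⟩ ht
    refine ⟨?_, hf, ?_⟩
    · simp at ht ⊢
      omega
    · rw [h64]
      congr 1
      simp

end RAM

/-! ### The tables of the dynamic program -/

namespace RAM

open Test Program PartialState

variable {W m b k : ℕ} {ν : Setoid (Fin W) ≃ Fin b} {σ τ ρ : State} {base : ℕ}

/-- Outside of the given part of the tables, `τ` agrees with `σ`. -/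
structure SameOutside (base size : ℕ) (σ τ : State) : Prop where
  nat : ∀ a, a = 37 ∨ a = 38 ∨ a = 39 → ∀ j, (j < base ∨ base + size ≤ j) →
    τ.nat a j = σ.nat a j
  real : ∀ j, (j < base ∨ base + size ≤ j) → τ.real 1 j = σ.real 1 j

namespace SameOutside

variable {size : ℕ}

theorem of_frame {L M : List ℕ} (hf : Frame L M σ τ) (hL : ∀ a ∈ L, a ≠ 37 ∧ a ≠ 38 ∧ a ≠ 39)
    (hM : 1 ∉ M) : SameOutside base size σ τ :=
  ⟨fun a ha j _ => hf.nat a (fun h => by have := hL a h; omega) j, fun j _ => hf.real 1 hM j⟩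

theorem trans (h : SameOutside base size σ τ) (h' : SameOutside base size τ ρ) :
    SameOutside base size σ ρ :=
  ⟨fun a ha j hj => (h'.nat a ha j hj).trans (h.nat a ha j hj),
    fun j hj => (h'.real j hj).trans (h.real j hj)⟩

theorem setNat (h : SameOutside base size σ τ) {a i x : ℕ} (ha : a ≠ 37 ∧ a ≠ 38 ∧ a ≠ 39) :
    SameOutside base size σ (τ.setNat a i x) :=
  ⟨fun c hc j hj => by
    rw [State.setNat_nat, if_neg (by omega)]; exact h.nat c hc j hj, h.real⟩

end SameOutside

/-- The part of the tables that starts at `base` holds the best of the attempts in `A`, where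
`A x c x₁ x₂` says that the state `x` is reached with cost `c` from the states `x₁` and `x₂`. -/
structure IsBest (ν : Setoid (Fin W) ≃ Fin b) (k : ℕ) (base : ℕ)
    (A : PartialState (Fin W) (Fin m) → ℝ → PartialState (Fin W) (Fin m) →
      PartialState (Fin W) (Fin m) → Prop) (σ : State) : Prop where
  sound : ∀ x : PartialState (Fin W) (Fin m), x.closed ≤ k → σ.nat 37 (base + x.code ν k) ≠ 0 →
    ∃ x₁ x₂ : PartialState (Fin W) (Fin m), x₁.closed ≤ k ∧ x₂.closed ≤ k ∧
      σ.nat 38 (base + x.code ν k) = x₁.code ν k ∧ σ.nat 39 (base + x.code ν k) = x₂.code ν k ∧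
      A x (σ.real 1 (base + x.code ν k)) x₁ x₂
  complete : ∀ x c x₁ x₂, A x c x₁ x₂ → x.closed ≤ k ∧ σ.nat 37 (base + x.code ν k) ≠ 0 ∧
    σ.real 1 (base + x.code ν k) ≤ c

variable {A A' : PartialState (Fin W) (Fin m) → ℝ → PartialState (Fin W) (Fin m) →
  PartialState (Fin W) (Fin m) → Prop}

theorem IsBest.congr (h : IsBest ν k base A σ) (hA : ∀ x c x₁ x₂, A x c x₁ x₂ ↔ A' x c x₁ x₂) :
    IsBest ν k base A' σ := by
  have : A = A' := by
    funext x c x₁ x₂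
    exact propext (hA x c x₁ x₂)
  exact this ▸ h

theorem IsBest.of_eq (h : IsBest ν k base A σ)
    (hn : ∀ a, a = 37 ∨ a = 38 ∨ a = 39 → ∀ j, base ≤ j → j < base + m ^ W * (b * (k + 1)) →
      τ.nat a j = σ.nat a j)
    (hr : ∀ j, base ≤ j → j < base + m ^ W * (b * (k + 1)) → τ.real 1 j = σ.real 1 j) :
    IsBest ν k base A τ := by
  have hn' : ∀ a, a = 37 ∨ a = 38 ∨ a = 39 → ∀ x : PartialState (Fin W) (Fin m), x.closed ≤ k →
      τ.nat a (base + x.code ν k) = σ.nat a (base + x.code ν k) := fun a ha x hx =>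
    hn a ha _ (by omega) (by have := code_lt (ν := ν) hx; omega)
  have hr' : ∀ x : PartialState (Fin W) (Fin m), x.closed ≤ k →
      τ.real 1 (base + x.code ν k) = σ.real 1 (base + x.code ν k) := fun x hx =>
    hr _ (by omega) (by have := code_lt (ν := ν) hx; omega)
  refine ⟨fun x hx hd => ?_, fun x c x₁ x₂ hA => ?_⟩
  · rw [hn' _ (by simp) x hx] at hd
    rw [hn' _ (by simp) x hx, hn' _ (by simp) x hx, hr' x hx]
    exact h.sound x hx hd
  · obtain ⟨hx, hd, hc⟩ := h.complete x c x₁ x₂ hA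
    rw [hn' _ (by simp) x hx, hr' x hx]
    exact ⟨hx, hd, hc⟩

theorem IsBest.of_frame (h : IsBest ν k base A σ) {L M : List ℕ} (hf : Frame L M σ τ)
    (hL : ∀ a ∈ L, a ≠ 37 ∧ a ≠ 38 ∧ a ≠ 39) (hM : 1 ∉ M) : IsBest ν k base A τ :=
  h.of_eq (fun a ha j _ _ => hf.nat a (fun h => by have := hL a h; omega) j)
    fun j _ _ => hf.real 1 hM j

theorem IsBest.setNat (h : IsBest ν k base A σ) {a i x : ℕ} (ha : a ≠ 37 ∧ a ≠ 38 ∧ a ≠ 39) :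
    IsBest ν k base A (σ.setNat a i x) :=
  h.of_eq (fun c hc j _ _ => by rw [State.setNat_nat, if_neg (by omega)]) fun _ _ _ => rfl

/-- Take the attempt into account that reaches the state with code in variable `55` with the cost
in the real variable `2` from the states with codes in variables `56` and `57`. The table starts at
variable `18`. -/
def relaxProgram : Program :=
  58 ≔ var 18 + var 55 ;;
  ite ((natEq (.get 37 (var 58)) (.const 0)).not.and
      (realLt (.get 2 (.const 0)) (.get 1 (var 58))).not)
    skip
    (setNat 37 (var 58) (.const 1) ;;
    setReal 1 (var 58) (.get 2 (.const 0)) ;;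
    setNat 38 (var 58) (var 56) ;;
    setNat 39 (var 58) (var 57))

/-- A zero in array `37` plays the role of infinite cost. Comparing with the stored value preserves
both halves of `IsBest`: the entry is attained by some attempt, and no attempt is cheaper. -/
theorem ends_relaxProgram {x x₁ x₂ : PartialState (Fin W) (Fin m)} {c : ℝ}
    (h : IsBest ν k base A σ) (hx : x.closed ≤ k) (hx₁ : x₁.closed ≤ k) (hx₂ : x₂.closed ≤ k)
    (h18 : σ.nat 18 0 = base) (h55 : σ.nat 55 0 = x.code ν k) (h56 : σ.nat 56 0 = x₁.code ν k)
    (h57 : σ.nat 57 0 = x₂.code ν k) (hc : σ.real 2 0 = c) :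
    Ends relaxProgram σ fun τ t => t ≤ 50 ∧ Frame [37, 38, 39, 58] [1] σ τ ∧
      SameOutside base (m ^ W * (b * (k + 1))) σ τ ∧
      IsBest ν k base (fun y c' y₁ y₂ => A y c' y₁ y₂ ∨ (y = x ∧ c' = c ∧ y₁ = x₁ ∧ y₂ = x₂)) τ := by
  have hlt := code_lt (ν := ν) hx
  have hcode : ∀ y : PartialState (Fin W) (Fin m), y.closed ≤ k →
      (y.code ν k = x.code ν k ↔ y = x) := fun y hy => ⟨code_inj hy hx, fun h => by rw [h]⟩
  unfold relaxProgram
  rw [ends_seq, ends_assign, ends_ite]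
  refine ⟨fun hd => ?_, fun hd => ?_⟩
  · simp [h18, h55, hc] at hd
    simp [frame_setNat, Frame.refl]
    refine ⟨SameOutside.setNat ⟨fun _ _ _ _ => rfl, fun _ _ => rfl⟩ (by simp), ?_⟩
    refine IsBest.setNat (a := 58) ⟨fun y hy hd' => ?_, fun y c' y₁ y₂ hA => ?_⟩ (by simp)
    · obtain ⟨y₁, y₂, hy₁, hy₂, h38, h39, hA⟩ := h.sound y hy hd'
      exact ⟨y₁, y₂, hy₁, hy₂, h38, h39, Or.inl hA⟩
    · rcases hA with hA | ⟨rfl, rfl, rfl, rfl⟩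
      · exact h.complete y c' y₁ y₂ hA
      · exact ⟨hx, hd⟩
  · simp [h18, h55, hc] at hd
    simp [frame_setNat, frame_setReal, Frame.refl, h18, h55, h56, h57, hc]
    refine ⟨⟨fun a ha j hj => ?_, fun j hj => ?_⟩, ⟨fun y hy hd' => ?_, fun y c' y₁ y₂ hA => ?_⟩⟩
    · have : j ≠ base + x.code ν k := by omega
      have : a ≠ 58 := by omega
      simp [*]
    · have : j ≠ base + x.code ν k := by omega
      simp [this]
    · by_cases hyx : y = x
      · subst hyx
        refine ⟨x₁, x₂, hx₁, hx₂, by simp, by simp, Or.inr (by simp)⟩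
      · simp [hcode y hy, hyx] at hd' ⊢
        obtain ⟨y₁, y₂, hy₁, hy₂, h38, h39, hA⟩ := h.sound y hy hd'
        exact ⟨y₁, hy₁, y₂, hy₂, h38, h39, hA⟩
    · rcases hA with hA | ⟨rfl, rfl, rfl, rfl⟩
      · obtain ⟨hy, hd', hc'⟩ := h.complete y c' y₁ y₂ hA
        refine ⟨hy, ?_⟩
        by_cases hyx : y = x
        · subst hyx
          simp
          exact (hd hd').le.trans hc'
        · simp [hcode y hy, hyx, hd', hc']
      · exact ⟨hx, by simp, by simp⟩

theorem ends_relaxProgram_of_frame {L L' : List ℕ} {x x₁ x₂ : PartialState (Fin W) (Fin m)} {c : ℝ}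
    (h : IsBest ν k base A σ) (hf : Frame L [2] σ τ) (hL : ∀ a ∈ L, a ≠ 37 ∧ a ≠ 38 ∧ a ≠ 39)
    (hL' : L ⊆ L') (hL'' : [37, 38, 39, 58] ⊆ L') (hx : x.closed ≤ k) (hx₁ : x₁.closed ≤ k)
    (hx₂ : x₂.closed ≤ k) (h18 : τ.nat 18 0 = base) (h55 : τ.nat 55 0 = x.code ν k)
    (h56 : τ.nat 56 0 = x₁.code ν k) (h57 : τ.nat 57 0 = x₂.code ν k) (hc : τ.real 2 0 = c) :
    Ends relaxProgram τ fun τ' t => t ≤ 50 ∧ Frame L' [1, 2] σ τ' ∧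
      SameOutside base (m ^ W * (b * (k + 1))) σ τ' ∧
      IsBest ν k base (fun y c' y₁ y₂ => A y c' y₁ y₂ ∨ (y = x ∧ c' = c ∧ y₁ = x₁ ∧ y₂ = x₂))
        τ' ∧ Frame [37, 38, 39, 58] [1] τ τ' := by
  refine (ends_relaxProgram (h.of_frame hf hL (by simp)) hx hx₁ hx₂ h18 h55 h56 h57 hc).mono ?_
  rintro τ' t ⟨ht, hf', hs, hb⟩
  exact ⟨ht, (hf.mono hL' (by simp)).trans hf' hL'' (by simp),
    (SameOutside.of_frame hf hL (by simp)).trans hs, hb, hf'⟩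

/-- A loop that takes the attempts in `D i` into account in round `i`. -/
theorem ends_bestLoop {v : ℕ} {e : NatExpr} {body : Program} {L : List ℕ} (M B : ℕ)
    (D : ℕ → PartialState (Fin W) (Fin m) → ℝ → PartialState (Fin W) (Fin m) →
      PartialState (Fin W) (Fin m) → Prop)
    (hv : v ∉ L) (hv' : v ≠ 37 ∧ v ≠ 38 ∧ v ≠ 39)
    (he : ∀ τ, Frame (v :: L) [1, 2] σ τ → e.eval τ = M) (hbest : IsBest ν k base A σ)
    (hbody : ∀ i < M, ∀ τ A', Frame (v :: L) [1, 2] σ τ →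
      SameOutside base (m ^ W * (b * (k + 1))) σ τ → τ.nat v 0 = i → IsBest ν k base A' τ →
      Ends body τ fun τ' t => t ≤ B ∧ Frame L [1, 2] τ τ' ∧
        SameOutside base (m ^ W * (b * (k + 1))) τ τ' ∧
        IsBest ν k base (fun x c x₁ x₂ => A' x c x₁ x₂ ∨ D i x c x₁ x₂) τ') :
    Ends (loop v e body) σ fun τ t => t ≤ M * (B + e.cost + 10) + (e.cost + 7) ∧
      Frame (v :: L) [1, 2] σ τ ∧ SameOutside base (m ^ W * (b * (k + 1))) σ τ ∧
      IsBest ν k base (fun x c x₁ x₂ => A x c x₁ x₂ ∨ ∃ i < M, D i x c x₁ x₂) τ := by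
  refine ends_loop M B (fun i τ => Frame (v :: L) [1, 2] σ τ ∧
    SameOutside base (m ^ W * (b * (k + 1))) σ τ ∧
    IsBest ν k base (fun x c x₁ x₂ => A x c x₁ x₂ ∨ ∃ j < i, D j x c x₁ x₂) τ) ?_ ?_ ?_ ?_
  · have hf : Frame [v] [] σ (σ.setNat v 0 0) := by simp [frame_setNat, Frame.refl]
    exact ⟨hf.mono (by simp) (by simp), SameOutside.of_frame hf (by simpa using hv') (by simp),
      (hbest.setNat hv').congr (by simp)⟩
  · rintro i τ - ⟨hf, -⟩ -
    rw [he τ hf]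
  · rintro i τ hi ⟨hf, hs, hb⟩ hx
    refine (hbody i hi τ _ hf hs hx hb).mono ?_
    rintro τ' t ⟨ht, hf', hs', hb'⟩
    refine ⟨ht, by rw [hf'.nat v hv, hx], ?_, (hs.trans hs').setNat hv',
      (hb'.setNat hv').congr fun x c x₁ x₂ => ?_⟩
    · rw [frame_setNat (by simp)]
      exact hf.trans hf' (by simp) (by simp)
    · simp only [Nat.exists_lt_succ_right, or_assoc]
  · rintro τ t ⟨hf, hs, hb⟩ ht
    exact ⟨ht, hf, hs, hb⟩

end RAM

/-! ### Processing a node -/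

namespace NiceTreeDecomposition

variable {V : Type*} [DecidableEq V] {G : SimpleGraph V} {ι : Type*}
  {T : NiceTreeDecomposition G ι} {X Y : Type*} [DecidableEq X] [Zero Y]
  {slot : V → X} {ch₁ ch₂ : ι → ι} {cost : V → Y → ℝ} {k : ℕ}
  {tab : ι → PartialState X Y → Option ℝ} {t : ι} {x x₁ x₂ : PartialState X Y} {c : ℝ}

theorem attempt_leaf_iff (hk : T.kind t = .leaf) :
    Attempt T slot ch₁ ch₂ cost k tab t x c x₁ x₂ ↔
      x = .init X Y 0 ∧ c = 0 ∧ x₁ = .init X Y 0 ∧ x₂ = .init X Y 0 := by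
  constructor
  · intro h
    cases h <;> simp_all
  · rintro ⟨rfl, rfl, rfl, rfl⟩
    exact .leaf hk

theorem attempt_introVertex_iff {v : V} (hk : T.kind t = .introVertex v) :
    Attempt T slot ch₁ ch₂ cost k tab t x c x₁ x₂ ↔
      x₁ = x.clear (slot v) ∧ x₂ = .init X Y 0 ∧ tab (ch₁ t) x₁ = some c := by
  constructor
  · intro h
    cases h <;> simp_all
  · rintro ⟨rfl, rfl, h⟩
    exact .introVertex hk x c h

theorem attempt_introEdge_iff {u v : V} (hk : T.kind t = .introEdge u v) :
    Attempt T slot ch₁ ch₂ cost k tab t x c x₁ x₂ ↔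
      x₂ = .init X Y 0 ∧ tab (ch₁ t) x₁ = some c ∧ (x = x₁ ∨ (x₁.fac (slot u) = x₁.fac (slot v) ∧
        x = ⟨x₁.fac, x₁.blocks ⊔ Setoid.pair (slot u) (slot v), x₁.closed⟩)) := by
  constructor
  · intro h
    cases h <;> simp_all
  · rintro ⟨rfl, h, rfl | ⟨hf, rfl⟩⟩
    · exact .skipEdge hk x c h
    · exact .joinEdge hk x₁ c h hf

theorem attempt_forget_iff {v : V} (hk : T.kind t = .forget v) :
    Attempt T slot ch₁ ch₂ cost k tab t x c x₁ x₂ ↔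
      x₂ = .init X Y 0 ∧ x = x₁.forget (slot v) ∧ x.closed ≤ k ∧
        ∃ c', tab (ch₁ t) x₁ = some c' ∧ c = c' + cost v (x₁.fac (slot v)) := by
  constructor
  · intro h
    cases h <;> simp_all
  · rintro ⟨rfl, rfl, hj, c', h, rfl⟩
    exact .forget hk x₁ c' h hj

theorem attempt_join_iff (hk : T.kind t = .join) :
    Attempt T slot ch₁ ch₂ cost k tab t x c x₁ x₂ ↔
      x₂.fac = x₁.fac ∧ x₁.closed + x₂.closed ≤ k ∧
      x = ⟨x₁.fac, x₁.blocks ⊔ x₂.blocks, x₁.closed + x₂.closed⟩ ∧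
        ∃ c₁ c₂, tab (ch₁ t) x₁ = some c₁ ∧ tab (ch₂ t) x₂ = some c₂ ∧ c = c₁ + c₂ := by
  constructor
  · intro h
    cases h <;> simp_all
  · rintro ⟨hf, hj, rfl, c₁, c₂, h₁, h₂, rfl⟩
    obtain ⟨f, p₁, j₁⟩ := x₁
    obtain ⟨f', p₂, j₂⟩ := x₂
    obtain rfl : f' = f := hf
    exact .join hk f' p₁ p₂ j₁ j₂ c₁ c₂ h₁ h₂ hj

theorem ne_of_mem_children {t s : ι} (h : s ∈ T.children t) : s ≠ t :=
  ((T.mem_children t s).1 h).1.ne.symm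

end NiceTreeDecomposition

/-! ### The table of a node; leaf and introduce nodes -/

namespace RAM

open Test Program PartialState

section Table

variable {W m b k N : ℕ} {ν : Setoid (Fin W) ≃ Fin b} {σ τ : State}

open Classical in
/-- The table of the node `t`. -/
noncomputable def table (ν : Setoid (Fin W) ≃ Fin b) (k : ℕ) (σ : State) (t : Fin N)
    (x : PartialState (Fin W) (Fin m)) : Option ℝ :=
  if x.closed ≤ k ∧ σ.nat 37 (t * (m ^ W * (b * (k + 1))) + x.code ν k) ≠ 0 then
    some (σ.real 1 (t * (m ^ W * (b * (k + 1))) + x.code ν k)) else none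

theorem table_eq_some_iff {t : Fin N} {x : PartialState (Fin W) (Fin m)} {c : ℝ} :
    table ν k σ t x = some c ↔ x.closed ≤ k ∧
      σ.nat 37 (t * (m ^ W * (b * (k + 1))) + x.code ν k) ≠ 0 ∧
      σ.real 1 (t * (m ^ W * (b * (k + 1))) + x.code ν k) = c := by
  unfold table
  split_ifs with h
  · simp [h]
  · simp only [false_iff]
    exact fun h' => h ⟨h'.1, h'.2.1⟩

theorem outside_of_ne {s t size j : ℕ} (hne : s ≠ t) (hj : j < size) :
    s * size + j < t * size ∨ t * size + size ≤ s * size + j := by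
  rcases Nat.lt_or_gt_of_ne hne with h | h
  · exact Or.inl (index_lt h hj)
  · right
    have : (t + 1) * size ≤ s * size := Nat.mul_le_mul_right _ h
    rw [add_mul] at this
    omega

theorem SameOutside.nat_row {t s : Fin N}
    (h : SameOutside (t * (m ^ W * (b * (k + 1)))) (m ^ W * (b * (k + 1))) σ τ) (hne : s ≠ t)
    {x : PartialState (Fin W) (Fin m)} (hx : x.closed ≤ k) {a : ℕ} (ha : a = 37 ∨ a = 38 ∨ a = 39) :
    τ.nat a (s * (m ^ W * (b * (k + 1))) + x.code ν k) =
      σ.nat a (s * (m ^ W * (b * (k + 1))) + x.code ν k) :=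
  h.nat a ha _ (outside_of_ne (fun h => hne (Fin.ext h)) (code_lt hx))

theorem SameOutside.real_row {t s : Fin N}
    (h : SameOutside (t * (m ^ W * (b * (k + 1)))) (m ^ W * (b * (k + 1))) σ τ) (hne : s ≠ t)
    {x : PartialState (Fin W) (Fin m)} (hx : x.closed ≤ k) :
    τ.real 1 (s * (m ^ W * (b * (k + 1))) + x.code ν k) =
      σ.real 1 (s * (m ^ W * (b * (k + 1))) + x.code ν k) :=
  h.real _ (outside_of_ne (fun h => hne (Fin.ext h)) (code_lt hx))

theorem SameOutside.table_eq {t s : Fin N}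
    (h : SameOutside (t * (m ^ W * (b * (k + 1)))) (m ^ W * (b * (k + 1))) σ τ) (hne : s ≠ t)
    (x : PartialState (Fin W) (Fin m)) : table ν k τ s x = table ν k σ s x := by
  by_cases hx : x.closed ≤ k
  · unfold table
    rw [h.nat_row hne hx (by simp), h.real_row hne hx]
  · unfold table
    rw [if_neg (fun h => hx h.1), if_neg (fun h => hx h.1)]

end Table

/-- The arrays used when a node is processed. -/
def nodeArrays : List ℕ :=
  [19, 37, 38, 39, 50, 51, 53, 54, 55, 56, 57, 58, 59, 60, 61, 62, 63, 64, 65, 66, 67, 68]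

variable {n N k W b : ℕ} {G : SimpleGraph (Fin n)} {F : Finset (Fin n)} {d : Fin n → Fin n → ℝ}
  {T : NiceTreeDecomposition G (Fin N)} {ch₁ ch₂ : Fin N → Fin N} {fac : Fin F.card → Fin n}
  {slot : Fin n → Fin W} [NeZero F.card] {ν : Setoid (Fin W) ≃ Fin b} {σ τ : State} {t : Fin N}
  {A : PartialState (Fin W) (Fin F.card) → ℝ → PartialState (Fin W) (Fin F.card) →
    PartialState (Fin W) (Fin F.card) → Prop}

def leafProgram : Program :=
  55 ≔ .const 0 ;; 56 ≔ .const 0 ;; 57 ≔ .const 0 ;;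
  setReal 2 (.const 0) .zero ;;
  relaxProgram

theorem ends_leafProgram (hT : Tables n N k W F.card ν σ)
    (hk : T.kind t = .leaf)
    (h18 : σ.nat 18 0 = t * (F.card ^ W * (b * (k + 1))))
    (hbest : IsBest ν k (t * (F.card ^ W * (b * (k + 1)))) (m := F.card)
      (fun _ _ _ _ => False) σ) :
    Ends leafProgram σ fun τ s => s ≤ 100 ∧ Frame nodeArrays [1, 2] σ τ ∧
      SameOutside (t * (F.card ^ W * (b * (k + 1)))) (F.card ^ W * (b * (k + 1))) σ τ ∧
      IsBest ν k (t * (F.card ^ W * (b * (k + 1)))) (T.Attempt slot ch₁ ch₂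
        (fun v y => d v (fac y)) k (table ν k σ) t) τ := by
  unfold leafProgram
  simp only [ends_seq, ends_assign, ends_setReal]
  refine (ends_relaxProgram_of_frame (L := [55, 56, 57]) (L' := nodeArrays)
    (x := .init (Fin W) (Fin F.card) 0) (x₁ := .init (Fin W) (Fin F.card) 0)
    (x₂ := .init (Fin W) (Fin F.card) 0) (c := 0) hbest
    (by simp [frame_setNat, frame_setReal, Frame.refl])
    (by simp) (by simp [nodeArrays]) (by simp [nodeArrays]) (Nat.zero_le _) (Nat.zero_le _)
    (Nat.zero_le _) (by simp [h18]) ?_ ?_ ?_ (by simp)).mono ?_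
  · simp [code_init hT.bot]
  · simp [code_init hT.bot]
  · simp [code_init hT.bot]
  · rintro τ s ⟨hs, hf, hso, hb, -⟩
    refine ⟨by simp; omega, hf, hso, hb.congr fun x c x₁ x₂ => ?_⟩
    rw [NiceTreeDecomposition.attempt_leaf_iff hk]
    simp

/-- The loop runs over the states at the node rather than at its child: such a state determines that
of the child by clearing one slot, so guessing the facility of the new vertex needs no inner loop.
-/
def introVertexProgram : Program :=
  19 ≔ .get 36 (.get 6 (var 17)) ;;
  61 ≔ .get 21 (.get 4 (var 17)) ;;
  loop 50 (var 30)
    (56 ≔ .get 34 (.get 24 (.get 25 (.get 33 (var 50)) + var 61)) +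
      (.get 35 (.get 32 (var 50)) + .get 31 (var 50)) ;;
    ite (natEq (.get 37 (var 19 + var 56)) (.const 0)) skip
      (55 ≔ var 50 ;; 57 ≔ .const 0 ;;
      setReal 2 (.const 0) (.get 1 (var 19 + var 56)) ;;
      relaxProgram))

theorem ends_introVertexProgram (hin : Input k G F d T ch₁ ch₂ fac σ)
    (hT : Tables n N k W F.card ν σ) (hslot : ∀ v : Fin n, σ.nat 21 v = slot v) {v : Fin n}
    (hk : T.kind t = .introVertex v) (h17 : σ.nat 17 0 = t)
    (h18 : σ.nat 18 0 = t * (F.card ^ W * (b * (k + 1))))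
    (hbest : IsBest ν k (t * (F.card ^ W * (b * (k + 1)))) (m := F.card)
      (fun _ _ _ _ => False) σ) :
    Ends introVertexProgram σ fun τ s => s ≤ 300 * (F.card ^ W * (b * (k + 1)) + 1) ∧
      Frame nodeArrays [1, 2] σ τ ∧
      SameOutside (t * (F.card ^ W * (b * (k + 1)))) (F.card ^ W * (b * (k + 1))) σ τ ∧
      IsBest ν k (t * (F.card ^ W * (b * (k + 1)))) (T.Attempt slot ch₁ ch₂
        (fun v y => d v (fac y)) k (table ν k σ) t) τ := by
  have hkind := hin.kind t
  rw [hk] at hkind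
  obtain ⟨-, h4⟩ := hkind
  have h6 := hin.child₁ t (by simp [hk])
  have hne : ch₁ t ≠ t := NiceTreeDecomposition.ne_of_mem_children (T := T)
    (by rw [hin.isChildMap.introVertex hk]; simp)
  unfold introVertexProgram
  simp only [ends_seq, ends_assign]
  obtain ⟨σ', hσ'⟩ : ∃ σ', σ' = (σ.setNat 19 0 ((NatExpr.get 36 (.get 6 (var 17))).eval σ)).setNat
    61 0 ((NatExpr.get 21 (.get 4 (var 17))).eval (σ.setNat 19 0
      ((NatExpr.get 36 (.get 6 (var 17))).eval σ))) := ⟨_, rfl⟩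
  rw [← hσ']
  have hf₀ : Frame [19, 61] [] σ σ' := by simp [hσ', frame_setNat, Frame.refl]
  have h19 : σ'.nat 19 0 = ch₁ t * (F.card ^ W * (b * (k + 1))) := by
    simp [hσ', h17, h6, hT.offset_node _ (ch₁ t).2]
  have h61 : σ'.nat 61 0 = slot v := by simp [hσ', h17, h4, hslot]
  refine (ends_bestLoop (L := [37, 38, 39, 55, 56, 57, 58]) (F.card ^ W * (b * (k + 1))) 200
    (fun i x c x₁ x₂ => T.Attempt slot ch₁ ch₂ (fun v y => d v (fac y)) k (table ν k σ) t x c x₁ x₂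
      ∧ x.code ν k = i) (by norm_num) (by norm_num) ?_
    (hbest.of_frame hf₀ (by simp) (by simp)) ?_).mono ?_
  · intro τ hf
    simp [hf.nat, hf₀.nat, hT.size]
  · intro i hi τ A' hf hso hx hb
    obtain ⟨x, hxk, rfl⟩ := exists_code_eq (ν := ν) hi
    have hg : Frame nodeArrays [1, 2] σ τ :=
      (hf₀.mono (by simp [nodeArrays]) (by simp)).trans hf (by simp [nodeArrays]) (by simp)
    have hT' := hT.of_frame hg (by simp [nodeArrays])
    have hck : (x.clear (slot v)).closed ≤ k := hxk
    have hcode : (x.clear (slot v)).code ν k =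
        finFunctionFinEquiv (Function.update x.fac (slot v) 0) * (b * (k + 1)) +
          (ν x.blocks * (k + 1) + x.closed) := rfl
    -- Only the part of the tables belonging to `t` has been changed, so the child's entries are
    -- still the original ones.
    have h37 := (hso.nat_row (ν := ν) hne hck (Or.inl rfl)).trans (hf₀.nat 37 (by simp) _)
    have hr1 := (hso.real_row (ν := ν) hne hck).trans (hf₀.real 1 (by simp) _)
    rw [ends_seq, ends_assign]
    simp only [eval_add, eval_get, eval_var, hx, hT'.closed x hxk, hT'.blocks x hxk, hT'.fac x hxk,
      hT'.row_fac, hf.nat 61 (by simp), h61, hT'.erase, hT'.offset_fac _ (Fin.is_lt _),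
      hT'.offset_blocks _ (Fin.is_lt _), ← hcode]
    rw [ends_ite]
    refine ⟨fun hd => ?_, fun hd => ?_⟩
    · simp [hf.nat, h19, h37] at hd
      have hf' : Frame [56] [] τ (τ.setNat 56 0 ((x.clear (slot v)).code ν k)) := by
        simp [frame_setNat, Frame.refl]
      refine (ends_skip).2 ⟨by simp, hf'.mono (by simp) (by simp),
        SameOutside.of_frame hf' (by simp) (by simp),
        (hb.setNat (by simp)).congr fun y c y₁ y₂ => (or_iff_left ?_).symm⟩
      rintro ⟨hA, hy⟩
      obtain ⟨rfl, rfl, hc⟩ := (NiceTreeDecomposition.attempt_introVertex_iff hk).1 hA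
      obtain ⟨hy', hd', -⟩ := table_eq_some_iff.1 hc
      obtain rfl := code_inj (show y.closed ≤ k from hy') hxk hy
      exact hd' hd
    · simp [hf.nat, h19, h37] at hd
      simp only [ends_seq, ends_assign, ends_setReal]
      refine (ends_relaxProgram_of_frame (L := [55, 56, 57]) (L' := [37, 38, 39, 55, 56, 57, 58])
        (x := x) (x₁ := x.clear (slot v)) (x₂ := .init (Fin W) (Fin F.card) 0)
        (c := σ.real 1 (ch₁ t * (F.card ^ W * (b * (k + 1))) + (x.clear (slot v)).code ν k)) hb
        (by simp [frame_setNat, frame_setReal, Frame.refl])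
        (by simp) (by simp) (by simp) hxk hck
        (Nat.zero_le _) ?_ ?_ ?_ ?_ ?_).mono ?_
      · simp [hg.nat, nodeArrays, h18]
      · simp [hx]
      · simp
      · simp [code_init hT.bot]
      · simp [hf.nat, h19, hr1]
      · rintro τ' s ⟨hs, hf', hso', hb', -⟩
        refine ⟨by simp; omega, hf', hso', hb'.congr fun y c y₁ y₂ => or_congr Iff.rfl ?_⟩
        rw [NiceTreeDecomposition.attempt_introVertex_iff hk]
        constructor
        · rintro ⟨rfl, rfl, rfl, rfl⟩
          exact ⟨⟨rfl, rfl, table_eq_some_iff.2 ⟨hck, hd, rfl⟩⟩, rfl⟩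
        · rintro ⟨⟨rfl, rfl, hc⟩, hy⟩
          obtain ⟨hy', hd', hc'⟩ := table_eq_some_iff.1 hc
          obtain rfl := code_inj (show y.closed ≤ k from hy') hxk hy
          exact ⟨rfl, hc'.symm, rfl, rfl⟩
  · rintro τ s ⟨hs, hf, hso, hb⟩
    refine ⟨?_, (hf₀.mono (by simp [nodeArrays]) (by simp)).trans hf (by simp [nodeArrays])
      (by simp), (SameOutside.of_frame hf₀ (by simp) (by simp)).trans hso,
      hb.congr fun x c x₁ x₂ => ?_⟩
    · simp at hs ⊢
      omega
    · constructor
      · rintro (h | ⟨i, -, h, -⟩)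
        exacts [h.elim, h]
      · intro h
        have hc := ((NiceTreeDecomposition.attempt_introVertex_iff hk).1 h)
        obtain ⟨rfl, -, hc⟩ := hc
        exact Or.inr ⟨_, code_lt (show x.closed ≤ k from (table_eq_some_iff.1 hc).1), h, rfl⟩

/-- The loop runs over the states of the child. Each of them yields the attempt that drops the edge
and, if the ends have the same facility, a second one that merges their slots. -/
def introEdgeProgram : Program :=
  19 ≔ .get 36 (.get 6 (var 17)) ;;
  61 ≔ .get 21 (.get 4 (var 17)) ;;
  63 ≔ .get 21 (.get 5 (var 17)) ;;
  loop 50 (var 30)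
    (ite (natEq (.get 37 (var 19 + var 50)) (.const 0)) skip
      (55 ≔ var 50 ;; 56 ≔ var 50 ;; 57 ≔ .const 0 ;;
      setReal 2 (.const 0) (.get 1 (var 19 + var 50)) ;;
      relaxProgram ;;
      65 ≔ .get 25 (.get 33 (var 50)) ;;
      ite (natEq (.get 23 (var 65 + var 61)) (.get 23 (var 65 + var 63)))
        (55 ≔ .get 34 (.get 33 (var 50)) +
          (.get 35 (.get 27 (.get 25 (.get 25 (.get 32 (var 50)) + var 61) + var 63)) +
            .get 31 (var 50)) ;;
        relaxProgram)
        skip))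

theorem ends_introEdgeProgram (hin : Input k G F d T ch₁ ch₂ fac σ)
    (hT : Tables n N k W F.card ν σ) (hW : 0 < W) (hslot : ∀ v : Fin n, σ.nat 21 v = slot v)
    {u v : Fin n}
    (hk : T.kind t = .introEdge u v) (h17 : σ.nat 17 0 = t)
    (h18 : σ.nat 18 0 = t * (F.card ^ W * (b * (k + 1))))
    (hbest : IsBest ν k (t * (F.card ^ W * (b * (k + 1)))) (m := F.card)
      (fun _ _ _ _ => False) σ) :
    Ends introEdgeProgram σ fun τ s => s ≤ 400 * (F.card ^ W * (b * (k + 1)) + 1) ∧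
      Frame nodeArrays [1, 2] σ τ ∧
      SameOutside (t * (F.card ^ W * (b * (k + 1)))) (F.card ^ W * (b * (k + 1))) σ τ ∧
      IsBest ν k (t * (F.card ^ W * (b * (k + 1)))) (T.Attempt slot ch₁ ch₂
        (fun v y => d v (fac y)) k (table ν k σ) t) τ := by
  have hkind := hin.kind t
  rw [hk] at hkind
  obtain ⟨-, h4, h5⟩ := hkind
  have h6 := hin.child₁ t (by simp [hk])
  have hne : ch₁ t ≠ t := NiceTreeDecomposition.ne_of_mem_children (T := T)
    (by rw [hin.isChildMap.introEdge hk]; simp)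
  unfold introEdgeProgram
  rw [ends_seq, ends_assign, ends_seq, ends_assign, ends_seq, ends_assign]
  generalize hσ' : State.setNat _ 63 0 _ = σ'
  have hf₀ : Frame [19, 61, 63] [] σ σ' := by simp [← hσ', frame_setNat, Frame.refl]
  have h19 : σ'.nat 19 0 = ch₁ t * (F.card ^ W * (b * (k + 1))) := by
    simp [← hσ', h17, h6, hT.offset_node _ (ch₁ t).2]
  have h61 : σ'.nat 61 0 = slot u := by simp [← hσ', h17, h4, hslot]
  have h63 : σ'.nat 63 0 = slot v := by simp [← hσ', h17, h5, hslot]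
  clear hσ'
  refine (ends_bestLoop (L := [37, 38, 39, 55, 56, 57, 58, 65]) (F.card ^ W * (b * (k + 1))) 300
    (fun i x c x₁ x₂ => T.Attempt slot ch₁ ch₂ (fun v y => d v (fac y)) k (table ν k σ) t x c x₁ x₂
      ∧ x₁.code ν k = i) (by norm_num) (by norm_num) ?_
    (hbest.of_frame hf₀ (by simp) (by simp)) ?_).mono ?_
  · intro τ hf
    simp [hf.nat, hf₀.nat, hT.size]
  · intro i hi τ A' hf hso hx hb
    obtain ⟨x, hxk, rfl⟩ := exists_code_eq (ν := ν) hi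
    have hg : Frame nodeArrays [1, 2] σ τ :=
      (hf₀.mono (by simp [nodeArrays]) (by simp)).trans hf (by simp [nodeArrays]) (by simp)
    have hT' := hT.of_frame hg (by simp [nodeArrays])
    have h37 := (hso.nat_row (ν := ν) hne hxk (Or.inl rfl)).trans (hf₀.nat 37 (by simp) _)
    have hr1 := (hso.real_row (ν := ν) hne hxk).trans (hf₀.real 1 (by simp) _)
    rw [ends_ite]
    refine ⟨fun hd => ?_, fun hd => ?_⟩
    · simp [hf.nat, h19, hx, h37] at hd
      refine (ends_skip).2 ⟨by simp, Frame.refl, SameOutside.of_frame (L := []) (M := []) Frame.refl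
        (by simp) (by simp), hb.congr fun y c y₁ y₂ => (or_iff_left ?_).symm⟩
      rintro ⟨hA, hy⟩
      obtain ⟨-, hc, -⟩ := (NiceTreeDecomposition.attempt_introEdge_iff hk).1 hA
      obtain ⟨hy', hd', -⟩ := table_eq_some_iff.1 hc
      obtain rfl := code_inj hy' hxk hy
      exact hd' hd
    · simp [hf.nat, h19, hx, h37] at hd
      have htab : ∀ y : PartialState (Fin W) (Fin F.card), y.code ν k = x.code ν k → ∀ c,
          (table ν k σ (ch₁ t) y = some c ↔ y = x ∧
            c = σ.real 1 (ch₁ t * (F.card ^ W * (b * (k + 1))) + x.code ν k)) := by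
        intro y hy c
        rw [table_eq_some_iff]
        constructor
        · rintro ⟨hyk, -, rfl⟩
          obtain rfl := code_inj hyk hxk hy
          exact ⟨rfl, rfl⟩
        · rintro ⟨rfl, rfl⟩
          exact ⟨hxk, hd, rfl⟩
      generalize σ.real 1 (ch₁ t * (F.card ^ W * (b * (k + 1))) + x.code ν k) = c₀ at hr1 htab
      simp only [ends_seq, ends_assign, ends_setReal]
      refine (ends_relaxProgram_of_frame (L := [55, 56, 57])
        (L' := [37, 38, 39, 55, 56, 57, 58, 65])
        (x := x) (x₁ := x) (x₂ := .init (Fin W) (Fin F.card) 0)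
        (c := c₀) hb
        (by simp [frame_setNat, frame_setReal, Frame.refl])
        (by simp) (by simp) (by simp) hxk hxk
        (Nat.zero_le _) ?_ ?_ ?_ ?_ ?_).mono ?_
      · simp [hg.nat, nodeArrays, h18]
      · simp [hx]
      · simp [hx]
      · simp [code_init hT.bot]
      · simp [hf.nat, h19, hx, hr1]
      · rintro τ₁ s ⟨hs, hf₁, hso₁, hb₁, hf₁'⟩
        have hg₁ : Frame nodeArrays [1, 2] σ τ₁ := hg.trans hf₁ (by simp [nodeArrays]) (by simp)
        have hT₁ := hT.of_frame hg₁ (by simp [nodeArrays])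
        have h50 : τ₁.nat 50 0 = x.code ν k := by simp [hf₁'.nat, hx]
        have h61' : τ₁.nat 61 0 = slot u := by simp [hf₁'.nat, hf.nat, h61]
        have h63' : τ₁.nat 63 0 = slot v := by simp [hf₁'.nat, hf.nat, h63]
        have hdig : ∀ a : Fin W, τ₁.nat 23 (τ₁.nat 25 (τ₁.nat 33 (x.code ν k)) + a) =
            x.fac a := fun a => by rw [hT₁.fac x hxk, hT₁.row_fac, hT₁.digit]
        have hg₂ : ∀ e, Frame [65] [] τ₁ (τ₁.setNat 65 0 e) := fun e => by
          simp [frame_setNat, Frame.refl]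
        rw [ends_ite]
        refine ⟨fun hc => ?_, fun hc => ?_⟩
        · simp [h50, h61', h63', hdig, Fin.val_inj] at hc
          rw [ends_seq, ends_assign]
          refine (ends_relaxProgram_of_frame (L := [55, 65])
            (L' := [37, 38, 39, 55, 56, 57, 58, 65]) (x := ⟨x.fac,
              x.blocks ⊔ Setoid.pair (slot u) (slot v), x.closed⟩) (x₁ := x)
            (x₂ := .init (Fin W) (Fin F.card) 0) (c := c₀) hb₁
            (by simp [frame_setNat, Frame.refl])
            (by simp) (by simp) (by simp) hxk hxk
            (Nat.zero_le _) ?_ ?_ ?_ ?_ ?_).mono ?_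
          · simp [hg₁.nat, nodeArrays, h18]
          · simp [-finFunctionFinEquiv_apply_val, h50, h61', h63', hT₁.fac x hxk, hT₁.blocks x hxk, hT₁.closed x hxk,
              hT₁.row_blocks hW, hT₁.row_merge, hT₁.merge, hT₁.offset_fac _ (Fin.is_lt _),
              hT₁.offset_blocks _ (Fin.is_lt _)]
            rfl
          · simp [hf₁'.nat, hx]
          · simp [hf₁'.nat, code_init hT.bot]
          · simp [hf₁'.real, hf.nat, h19, hx, hr1]
          · rintro τ₂ s₂ ⟨hs₂, hf₂, hso₂, hb₂, -⟩
            refine ⟨by simp; omega, hf₁.trans hf₂ (by simp) (by simp), hso₁.trans hso₂,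
              hb₂.congr fun y c y₁ y₂ => ?_⟩
            rw [or_assoc]
            refine or_congr Iff.rfl ?_
            rw [NiceTreeDecomposition.attempt_introEdge_iff hk]
            constructor
            · rintro (⟨rfl, rfl, rfl, rfl⟩ | ⟨rfl, rfl, rfl, rfl⟩)
              · exact ⟨⟨rfl, (htab _ rfl _).2 ⟨rfl, rfl⟩, Or.inl rfl⟩, rfl⟩
              · exact ⟨⟨rfl, (htab _ rfl _).2 ⟨rfl, rfl⟩, Or.inr ⟨hc, rfl⟩⟩, rfl⟩
            · rintro ⟨⟨rfl, h, hor⟩, hy⟩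
              obtain ⟨rfl, rfl⟩ := (htab _ hy _).1 h
              rcases hor with rfl | ⟨-, rfl⟩
              · exact Or.inl ⟨rfl, rfl, rfl, rfl⟩
              · exact Or.inr ⟨rfl, rfl, rfl, rfl⟩
        · simp [h50, h61', h63', hdig, Fin.val_inj] at hc
          rw [ends_skip]
          refine ⟨by simp; omega, hf₁.trans (hg₂ _) (by simp) (by simp),
            hso₁.trans (SameOutside.of_frame (hg₂ _) (by simp) (by simp)),
            (hb₁.setNat (by simp)).congr fun y c y₁ y₂ => or_congr Iff.rfl ?_⟩
          rw [NiceTreeDecomposition.attempt_introEdge_iff hk]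
          constructor
          · rintro ⟨rfl, rfl, rfl, rfl⟩
            exact ⟨⟨rfl, (htab _ rfl _).2 ⟨rfl, rfl⟩, Or.inl rfl⟩, rfl⟩
          · rintro ⟨⟨rfl, h, hor⟩, hy⟩
            obtain ⟨rfl, rfl⟩ := (htab _ hy _).1 h
            rcases hor with rfl | ⟨hc', -⟩
            · exact ⟨rfl, rfl, rfl, rfl⟩
            · exact absurd hc' hc
  · rintro τ s ⟨hs, hf, hso, hb⟩
    refine ⟨?_, (hf₀.mono (by simp [nodeArrays]) (by simp)).trans hf (by simp [nodeArrays])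
      (by simp), (SameOutside.of_frame hf₀ (by simp) (by simp)).trans hso,
      hb.congr fun x c x₁ x₂ => ?_⟩
    · simp at hs ⊢
      omega
    · constructor
      · rintro (h | ⟨i, -, h, -⟩)
        exacts [h.elim, h]
      · intro h
        obtain ⟨-, hc, -⟩ := (NiceTreeDecomposition.attempt_introEdge_iff hk).1 h
        exact Or.inr ⟨_, code_lt (table_eq_some_iff.1 hc).1, h, rfl⟩

end RAM

/-! ### Forget and join nodes -/

namespace RAM

open Test Program PartialState

variable {n N k W b : ℕ} {G : SimpleGraph (Fin n)} {F : Finset (Fin n)} {d : Fin n → Fin n → ℝ}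
  {T : NiceTreeDecomposition G (Fin N)} {ch₁ ch₂ : Fin N → Fin N} {fac : Fin F.card → Fin n}
  {slot : Fin n → Fin W} [NeZero F.card] {ν : Setoid (Fin W) ≃ Fin b} {σ τ : State} {t : Fin N}

/-- Many states of the child lead to the same state, because facility and block of the forgotten
vertex are lost. Running over the states of the child and relaxing takes the minimum without
enumerating preimages. -/
def forgetProgram : Program :=
  19 ≔ .get 36 (.get 6 (var 17)) ;;
  63 ≔ .get 21 (.get 4 (var 17)) ;;
  59 ≔ .get 15 (.get 4 (var 17)) ;;
  loop 50 (var 30)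
    (ite (natEq (.get 37 (var 19 + var 50)) (.const 0)) skip
      (61 ≔ .get 32 (var 50) ;;
      singletonProgram ;;
      65 ≔ .get 31 (var 50) + var 64 ;;
      ite (natLt (.get 0 (.const 1)) (var 65)) skip
        (isolateProgram ;;
        66 ≔ .get 25 (.get 33 (var 50)) + var 63 ;;
        55 ≔ .get 34 (.get 24 (var 66)) + (.get 35 (var 60) + var 65) ;;
        56 ≔ var 50 ;; 57 ≔ .const 0 ;;
        setReal 2 (.const 0)
          (.get 1 (var 19 + var 50) + .get 0 (var 59 + .get 1 (.get 23 (var 66)))) ;;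
        relaxProgram)))

theorem ends_forgetProgram (hin : Input k G F d T ch₁ ch₂ fac σ)
    (hdist : ∀ u v : Fin n, σ.real 0 (u * n + v) = d u v)
    (hT : Tables n N k W F.card ν σ) (hW : 0 < W) (hslot : ∀ v : Fin n, σ.nat 21 v = slot v)
    {v : Fin n} (hk : T.kind t = .forget v) (h17 : σ.nat 17 0 = t)
    (h18 : σ.nat 18 0 = t * (F.card ^ W * (b * (k + 1))))
    (hbest : IsBest ν k (t * (F.card ^ W * (b * (k + 1)))) (m := F.card)
      (fun _ _ _ _ => False) σ) :
    Ends forgetProgram σ fun τ s => s ≤ 400 * ((F.card ^ W * (b * (k + 1)) + 1) * (W + 1) ^ 2) ∧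
      Frame nodeArrays [1, 2] σ τ ∧
      SameOutside (t * (F.card ^ W * (b * (k + 1)))) (F.card ^ W * (b * (k + 1))) σ τ ∧
      IsBest ν k (t * (F.card ^ W * (b * (k + 1)))) (T.Attempt slot ch₁ ch₂
        (fun v y => d v (fac y)) k (table ν k σ) t) τ := by
  have hkind := hin.kind t
  rw [hk] at hkind
  obtain ⟨-, h4⟩ := hkind
  have h6 := hin.child₁ t (by simp [hk])
  have hne : ch₁ t ≠ t := NiceTreeDecomposition.ne_of_mem_children (T := T)
    (by rw [hin.isChildMap.forget hk]; simp)
  unfold forgetProgram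
  rw [ends_seq, ends_assign, ends_seq, ends_assign, ends_seq, ends_assign]
  generalize hσ' : State.setNat _ 59 0 _ = σ'
  have hf₀ : Frame [19, 59, 63] [] σ σ' := by simp [← hσ', frame_setNat, Frame.refl]
  have h19 : σ'.nat 19 0 = ch₁ t * (F.card ^ W * (b * (k + 1))) := by
    simp [← hσ', h17, h6, hT.offset_node _ (ch₁ t).2]
  have h59 : σ'.nat 59 0 = v * n := by simp [← hσ', h17, h4, hT.offset_vertex]
  have h63 : σ'.nat 63 0 = slot v := by simp [← hσ', h17, h4, hslot]
  clear hσ'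
  let L := [37, 38, 39, 53, 54, 55, 56, 57, 58, 60, 61, 62, 64, 65, 66]
  refine (ends_bestLoop (L := L)
    (F.card ^ W * (b * (k + 1))) (300 * (W + 1) ^ 2)
    (fun i x c x₁ x₂ => T.Attempt slot ch₁ ch₂ (fun v y => d v (fac y)) k (table ν k σ) t x c x₁ x₂
      ∧ x₁.code ν k = i) (by simp [L]) (by norm_num) ?_
    (hbest.of_frame hf₀ (by simp) (by simp)) ?_).mono ?_
  · intro τ hf
    simp [hf.nat, hf₀.nat, hT.size, L]
  · intro i hi τ A' hf hso hx hb
    obtain ⟨x, hxk, rfl⟩ := exists_code_eq (ν := ν) hi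
    have hg : Frame nodeArrays [1, 2] σ τ :=
      (hf₀.mono (by simp [nodeArrays]) (by simp)).trans hf (by simp [nodeArrays, L]) (by simp)
    have hT' := hT.of_frame hg (by simp [nodeArrays])
    have h37 := (hso.nat_row (ν := ν) hne hxk (Or.inl rfl)).trans (hf₀.nat 37 (by simp) _)
    have hr1 := (hso.real_row (ν := ν) hne hxk).trans (hf₀.real 1 (by simp) _)
    have htab : ∀ y : PartialState (Fin W) (Fin F.card), y.code ν k = x.code ν k → ∀ c,
        (table ν k σ (ch₁ t) y = some c ↔ y = x ∧
          σ.nat 37 (ch₁ t * (F.card ^ W * (b * (k + 1))) + x.code ν k) ≠ 0 ∧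
          c = σ.real 1 (ch₁ t * (F.card ^ W * (b * (k + 1))) + x.code ν k)) := by
      intro y hy c
      rw [table_eq_some_iff]
      constructor
      · rintro ⟨hyk, hd, rfl⟩
        obtain rfl := code_inj hyk hxk hy
        exact ⟨rfl, hd, rfl⟩
      · rintro ⟨rfl, hd, rfl⟩
        exact ⟨hxk, hd, rfl⟩
    generalize σ.real 1 (ch₁ t * (F.card ^ W * (b * (k + 1))) + x.code ν k) = c₀ at hr1 htab
    have hWp : 1 ≤ (W + 1) ^ 2 := Nat.one_le_pow _ _ (by omega)
    have hWp' : W + 1 ≤ (W + 1) ^ 2 := Nat.le_self_pow (by norm_num) _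
    rw [ends_ite]
    refine ⟨fun hd => ?_, fun hd => ?_⟩
    · simp [hf.nat, L, h19, hx, h37] at hd
      refine (ends_skip).2 ⟨by simp; omega, Frame.refl,
        SameOutside.of_frame (L := []) (M := []) Frame.refl
        (by simp) (by simp), hb.congr fun y c y₁ y₂ => (or_iff_left ?_).symm⟩
      rintro ⟨hA, hy⟩
      obtain ⟨-, -, -, c', hc, -⟩ := (NiceTreeDecomposition.attempt_forget_iff hk).1 hA
      exact ((htab _ hy _).1 hc).2.1 hd
    · simp [hf.nat, L, h19, hx, h37] at hd
      simp only [ends_seq, ends_assign]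
      have hf₁ : ∀ e, Frame [61] [] τ (τ.setNat 61 0 e) := fun e => by
        simp [frame_setNat, Frame.refl]
      refine (ends_singletonProgram (r := x.blocks) (a := slot v) (hT'.of_frame (hf₁ _) (by simp))
        hW (by simp [hx, hT'.blocks x hxk]) (by simp [hf.nat, L, h63])).mono ?_
      rintro τ₂ s₂ ⟨hs₂, hf₂, h64⟩
      have hg₂ : Frame [53, 61, 62, 64] [] τ τ₂ :=
        ((hf₁ _).mono (by simp) (by simp)).trans hf₂ (by simp) (by simp)
      have hcl : x.closed + τ₂.nat 64 0 = (x.forget (slot v)).closed := by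
        rw [h64]
        unfold PartialState.forget
        congr
      have hkτ : τ.nat 0 1 = k := by simp [hg.nat, nodeArrays, hin.clusters]
      rw [ends_ite]
      refine ⟨fun hlt => ?_, fun hlt => ?_⟩
      · simp [hg₂.nat, hx, hT'.closed x hxk, hkτ, hcl] at hlt
        have hf₃ : ∀ e, Frame [53, 61, 62, 64, 65] [] τ (τ₂.setNat 65 0 e) := fun e => by
          rw [frame_setNat (by simp)]
          exact hg₂.mono (by simp) (by simp)
        refine (ends_skip).2 ⟨by simp; omega, (hf₃ _).mono (by simp [L]) (by simp),
          SameOutside.of_frame (hf₃ _) (by simp) (by simp),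
          (hb.of_frame (hf₃ _) (by simp) (by simp)).congr fun y c y₁ y₂ => (or_iff_left ?_).symm⟩
        rintro ⟨hA, hy⟩
        obtain ⟨-, rfl, hle, c', hc, -⟩ := (NiceTreeDecomposition.attempt_forget_iff hk).1 hA
        obtain ⟨rfl, -, -⟩ := (htab _ hy _).1 hc
        omega
      · simp [hg₂.nat, hx, hT'.closed x hxk, hkτ, hcl] at hlt
        have hf₃ : ∀ e, Frame [53, 61, 62, 64, 65] [] τ (τ₂.setNat 65 0 e) := fun e => by
          rw [frame_setNat (by simp)]
          exact hg₂.mono (by simp) (by simp)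
        rw [ends_seq]
        refine (ends_isolateProgram (r := x.blocks) (a := slot v) (hT'.of_frame (hf₃ _) (by simp))
          hW (by simp [hf₂.nat, hx, hT'.blocks x hxk]) (by simp [hg₂.nat, hf.nat, L, h63])).mono ?_
        rintro τ₄ s₄ ⟨hs₄, hf₄, h60⟩
        have h65 : τ₄.nat 65 0 = (x.forget (slot v)).closed := by
          rw [hf₄.nat _ (by simp)]
          simp [hg₂.nat, hx, hT'.closed x hxk, hcl]
        have hg₄ : Frame [53, 54, 60, 61, 62, 64, 65] [] τ τ₄ :=
          ((hf₃ _).mono (by simp) (by simp)).trans hf₄ (by simp) (by simp)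
        clear hf₄ hf₃ hf₂ hg₂ hf₁
        have hT₄ := hT'.of_frame hg₄ (by simp)
        have h50 : τ₄.nat 50 0 = x.code ν k := by simp [hg₄.nat, hx]
        have h63' : τ₄.nat 63 0 = slot v := by simp [hg₄.nat, hf.nat, L, h63]
        simp only [ends_seq, ends_assign, ends_setReal]
        refine (ends_relaxProgram_of_frame (L := [53, 54, 55, 56, 57, 60, 61, 62, 64, 65, 66])
          (L' := L) (x := x.forget (slot v)) (x₁ := x)
          (x₂ := .init (Fin W) (Fin F.card) 0) (c := c₀ + d v (fac (x.fac (slot v)))) hb ?_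
          (by simp) (by simp [L]) (by simp [L]) hlt hxk (Nat.zero_le _) ?_ ?_ ?_ ?_ ?_).mono ?_
        · simp [frame_setNat, frame_setReal]
          exact hg₄.mono (by simp) (by simp)
        · simp [hg₄.nat, hg.nat, nodeArrays, h18]
        · simp [-finFunctionFinEquiv_apply_val, h50, h63', h60, h65, hT₄.fac x hxk, hT₄.row_fac,
            hT₄.erase, hT₄.offset_fac _ (Fin.is_lt _), hT₄.offset_blocks _ (Fin.is_lt _)]
          rfl
        · simp [h50]
        · simp [code_init hT.bot]
        · simp [-finFunctionFinEquiv_apply_val, h50, h63', hT₄.fac x hxk, hT₄.row_fac, hT₄.digit,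
            hg₄.nat, hg₄.real, hf.nat, hf.real, hf₀.nat, hf₀.real, L, h19, h59, hr1,
            hin.facilities, hdist]
        · rintro τ₅ s₅ ⟨hs₅, hf₅, hso₅, hb₅, -⟩
          refine ⟨by simp; omega, hf₅, hso₅, hb₅.congr fun y c y₁ y₂ => or_congr Iff.rfl ?_⟩
          rw [NiceTreeDecomposition.attempt_forget_iff hk]
          constructor
          · rintro ⟨rfl, rfl, rfl, rfl⟩
            exact ⟨⟨rfl, rfl, hlt, c₀, (htab _ rfl _).2 ⟨rfl, hd, rfl⟩, rfl⟩, rfl⟩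
          · rintro ⟨⟨rfl, rfl, -, c', h, rfl⟩, hy⟩
            obtain ⟨rfl, -, rfl⟩ := (htab _ hy _).1 h
            exact ⟨rfl, rfl, rfl, rfl⟩
  · rintro τ s ⟨hs, hf, hso, hb⟩
    refine ⟨?_, (hf₀.mono (by simp [nodeArrays]) (by simp)).trans hf (by simp [nodeArrays, L])
      (by simp), (SameOutside.of_frame hf₀ (by simp) (by simp)).trans hso,
      hb.congr fun x c x₁ x₂ => ?_⟩
    · have hWp : 1 ≤ (W + 1) ^ 2 := Nat.one_le_pow _ _ (by omega)
      generalize F.card ^ W * (b * (k + 1)) = S at hs ⊢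
      generalize (W + 1) ^ 2 = w at hs hWp ⊢
      simp at hs ⊢
      nlinarith [Nat.mul_le_mul_left S hWp]
    · constructor
      · rintro (h | ⟨i, -, h, -⟩)
        exacts [h.elim, h]
      · intro h
        obtain ⟨-, -, -, c', hc, -⟩ := (NiceTreeDecomposition.attempt_forget_iff hk).1 h
        exact Or.inr ⟨_, code_lt (table_eq_some_iff.1 hc).1, h, rfl⟩

/-- Codes with the same facilities form one layer of `b * (k + 1)` consecutive cells, starting at
variable `67`. Restricting the inner loop to the layer of the outer state is what keeps the factor
`m ^ W` from being squared. -/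
def joinProgram : Program :=
  19 ≔ .get 36 (.get 6 (var 17)) ;;
  59 ≔ .get 36 (.get 7 (var 17)) ;;
  loop 50 (var 30)
    (ite (natEq (.get 37 (var 19 + var 50)) (.const 0)) skip
      (67 ≔ .get 34 (.get 33 (var 50)) ;;
      loop 51 (var 29)
        (68 ≔ var 67 + var 51 ;;
        ite (natEq (.get 37 (var 59 + var 68)) (.const 0)) skip
          (ite (natLt (.get 0 (.const 1)) (.get 31 (var 50) + .get 31 (var 68))) skip
            (60 ≔ .get 32 (var 50) ;;
            61 ≔ .get 32 (var 68) ;;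
            joinBlocksProgram ;;
            55 ≔ var 67 + (.get 35 (var 60) + (.get 31 (var 50) + .get 31 (var 68))) ;;
            56 ≔ var 50 ;; 57 ≔ var 68 ;;
            setReal 2 (.const 0) (.get 1 (var 19 + var 50) + .get 1 (var 59 + var 68)) ;;
            relaxProgram)))))

theorem ends_joinProgram (hin : Input k G F d T ch₁ ch₂ fac σ)
    (hT : Tables n N k W F.card ν σ) (hW : 0 < W)
    (hk : T.kind t = .join) (h17 : σ.nat 17 0 = t)
    (h18 : σ.nat 18 0 = t * (F.card ^ W * (b * (k + 1))))
    (hbest : IsBest ν k (t * (F.card ^ W * (b * (k + 1)))) (m := F.card)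
      (fun _ _ _ _ => False) σ) :
    Ends joinProgram σ fun τ s =>
      s ≤ 400 * ((F.card ^ W * (b * (k + 1)) + 1) * ((b * (k + 1) + 1) * (W + 1))) ∧
      Frame nodeArrays [1, 2] σ τ ∧
      SameOutside (t * (F.card ^ W * (b * (k + 1)))) (F.card ^ W * (b * (k + 1))) σ τ ∧
      IsBest ν k (t * (F.card ^ W * (b * (k + 1)))) (T.Attempt slot ch₁ ch₂
        (fun v y => d v (fac y)) k (table ν k σ) t) τ := by
  have h6 := hin.child₁ t (by simp [hk])
  have h7 := hin.child₂ t hk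
  have hne : ch₁ t ≠ t := NiceTreeDecomposition.ne_of_mem_children (T := T)
    (by rw [(hin.isChildMap.join hk).2]; simp)
  have hne₂ : ch₂ t ≠ t := NiceTreeDecomposition.ne_of_mem_children (T := T)
    (by rw [(hin.isChildMap.join hk).2]; simp)
  unfold joinProgram
  rw [ends_seq, ends_assign, ends_seq, ends_assign]
  generalize hσ' : State.setNat _ 59 0 _ = σ'
  have hf₀ : Frame [19, 59] [] σ σ' := by simp [← hσ', frame_setNat, Frame.refl]
  have h19 : σ'.nat 19 0 = ch₁ t * (F.card ^ W * (b * (k + 1))) := by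
    simp [← hσ', h17, h6, hT.offset_node _ (ch₁ t).2]
  have h59 : σ'.nat 59 0 = ch₂ t * (F.card ^ W * (b * (k + 1))) := by
    simp [← hσ', h17, h7, hT.offset_node _ (ch₂ t).2]
  clear hσ'
  let L := [37, 38, 39, 53, 55, 56, 57, 58, 60, 61, 62, 68]
  let A := T.Attempt slot ch₁ ch₂ (fun v y => d v (fac y)) k (table ν k σ) t
  refine (ends_bestLoop (L := 67 :: 51 :: L)
    (F.card ^ W * (b * (k + 1))) (300 * ((b * (k + 1) + 1) * (W + 1)))
    (fun i x c x₁ x₂ => A x c x₁ x₂ ∧ x₁.code ν k = i) (by simp [L]) (by norm_num) ?_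
    (hbest.of_frame hf₀ (by simp) (by simp)) ?_).mono ?_
  · intro τ hf
    simp [hf.nat, hf₀.nat, hT.size, L]
  · intro i hi τ A' hf hso hx hb
    obtain ⟨x, hxk, rfl⟩ := exists_code_eq (ν := ν) hi
    have hg : Frame nodeArrays [1, 2] σ τ :=
      (hf₀.mono (by simp [nodeArrays]) (by simp)).trans hf (by simp [nodeArrays, L]) (by simp)
    have hT' := hT.of_frame hg (by simp [nodeArrays])
    have h37 := (hso.nat_row (ν := ν) hne hxk (Or.inl rfl)).trans (hf₀.nat 37 (by simp) _)
    rw [ends_ite]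
    refine ⟨fun hd => ?_, fun hd => ?_⟩
    · simp [hf.nat, L, h19, hx, h37] at hd
      have hp : 0 < (b * (k + 1) + 1) * (W + 1) := by positivity
      refine (ends_skip).2 ⟨by simp; omega, Frame.refl,
        SameOutside.of_frame (L := []) (M := []) Frame.refl
        (by simp) (by simp), hb.congr fun y c y₁ y₂ => (or_iff_left ?_).symm⟩
      rintro ⟨hA, hy⟩
      obtain ⟨-, -, -, c', -, hc, -⟩ := (NiceTreeDecomposition.attempt_join_iff hk).1 hA
      obtain ⟨hyk, hd', -⟩ := table_eq_some_iff.1 hc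
      obtain rfl := code_inj hyk hxk hy
      exact hd' hd
    · simp [hf.nat, L, h19, hx, h37] at hd
      rw [ends_seq, ends_assign]
      have hf₁ : ∀ e, Frame [67] [] τ (τ.setNat 67 0 e) := fun e => by
        simp [frame_setNat, Frame.refl]
      generalize hτ₁ : State.setNat τ 67 0 _ = τ₁
      have h67 : τ₁.nat 67 0 = finFunctionFinEquiv x.fac * (b * (k + 1)) := by
        simp [-finFunctionFinEquiv_apply_val, ← hτ₁, hx, hT'.fac x hxk,
          hT'.offset_fac _ (Fin.is_lt _)]
      replace hf₁ : Frame [67] [] τ τ₁ := hτ₁ ▸ hf₁ _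
      clear hτ₁
      refine (ends_bestLoop (L := L) (b * (k + 1)) (200 * (W + 1))
        (fun i x' c x₁ x₂ => A x' c x₁ x₂ ∧ x₁ = x ∧
          x₂.code ν k = finFunctionFinEquiv x.fac * (b * (k + 1)) + i) (by simp [L]) (by norm_num) ?_
        (hb.of_frame hf₁ (by simp) (by simp)) ?_).mono ?_
      · intro ρ hρ
        simp [hρ.nat, hf₁.nat, hT'.layer, L]
      · intro j hj ρ A'' hρ hsoρ hy hbρ
        obtain ⟨y, hyk, hy'⟩ := exists_code_eq (ν := ν)
          (index_lt (finFunctionFinEquiv x.fac).2 hj)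
        -- Codes in the same layer have the same highest digit, which encodes the facilities.
        have hyf : y.fac = x.fac := by
          have := (code_unpack (ν := ν) hyk).2.2
          rw [hy', (div_add_mod_of_lt hj).1] at this
          exact finFunctionFinEquiv.injective (Fin.ext this.symm)
        have hgρ : Frame nodeArrays [1, 2] σ ρ :=
          (hg.trans hf₁ (by simp [nodeArrays]) (by simp)).trans hρ (by simp [nodeArrays, L]) (by simp)
        have hso' := (hso.trans (SameOutside.of_frame hf₁ (by simp) (by simp))).trans hsoρ
        have hTρ := hT.of_frame hgρ (by simp [nodeArrays])
        have h37y := (hso'.nat_row (ν := ν) hne₂ hyk (Or.inl rfl)).trans (hf₀.nat 37 (by simp) _)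
        have hr1x := (hso'.real_row (ν := ν) hne hxk).trans (hf₀.real 1 (by simp) _)
        have hr1y := (hso'.real_row (ν := ν) hne₂ hyk).trans (hf₀.real 1 (by simp) _)
        have h50 : ρ.nat 50 0 = x.code ν k := by simp [hρ.nat, hf₁.nat, hx, L]
        have h68 : ρ.nat 67 0 + ρ.nat 51 0 = y.code ν k := by
          simp [-finFunctionFinEquiv_apply_val, hρ.nat, h67, hy, hy', L]
        -- Both child states are fixed in this round, so at most one attempt has to be taken into
        -- account.
        have hD : ∀ x' c x₁ x₂, (A x' c x₁ x₂ ∧ x₁ = x ∧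
            x₂.code ν k = finFunctionFinEquiv x.fac * (b * (k + 1)) + j) ↔
            σ.nat 37 (ch₂ t * (F.card ^ W * (b * (k + 1))) + y.code ν k) ≠ 0 ∧
            x.closed + y.closed ≤ k ∧
            x' = ⟨x.fac, x.blocks ⊔ y.blocks, x.closed + y.closed⟩ ∧
            c = σ.real 1 (ch₁ t * (F.card ^ W * (b * (k + 1))) + x.code ν k) +
              σ.real 1 (ch₂ t * (F.card ^ W * (b * (k + 1))) + y.code ν k) ∧ x₁ = x ∧ x₂ = y := by
          intro x' c x₁ x₂
          simp only [A]
          rw [NiceTreeDecomposition.attempt_join_iff hk, ← hy']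
          constructor
          · rintro ⟨⟨-, hle, rfl, c₁, c₂, hc₁, hc₂, rfl⟩, rfl, h⟩
            obtain ⟨-, -, rfl⟩ := table_eq_some_iff.1 hc₁
            obtain ⟨hk₂, hd₂, rfl⟩ := table_eq_some_iff.1 hc₂
            obtain rfl := code_inj hk₂ hyk h
            exact ⟨hd₂, hle, rfl, rfl, rfl, rfl⟩
          · rintro ⟨hd₂, hle, rfl, rfl, rfl, rfl⟩
            exact ⟨⟨hyf, hle, rfl, _, _, table_eq_some_iff.2 ⟨hxk, hd, rfl⟩,
              table_eq_some_iff.2 ⟨hyk, hd₂, rfl⟩, rfl⟩, rfl, rfl⟩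
        rw [ends_seq, ends_assign, ends_ite]
        simp only [eval_add, eval_var, h68]
        have hf₂ : Frame [68] [] ρ (ρ.setNat 68 0 (y.code ν k)) := by
          simp [frame_setNat, Frame.refl]
        have h59' : ρ.nat 59 0 = ch₂ t * (F.card ^ W * (b * (k + 1))) := by
          simp [hρ.nat, hf₁.nat, hf.nat, h59, L]
        have h19' : ρ.nat 19 0 = ch₁ t * (F.card ^ W * (b * (k + 1))) := by
          simp [hρ.nat, hf₁.nat, hf.nat, h19, L]
        have hkρ : ρ.nat 0 1 = k := by simp [hgρ.nat, nodeArrays, hin.clusters]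
        refine ⟨fun hd₂ => ?_, fun hd₂ => ?_⟩
        · simp [h59', h37y] at hd₂
          refine (ends_skip).2 ⟨by simp; omega, hf₂.mono (by simp [L]) (by simp),
            SameOutside.of_frame hf₂ (by simp) (by simp),
            (hbρ.setNat (by simp)).congr fun x' c y₁ y₂ => (or_iff_left ?_).symm⟩
          rw [hD]
          exact fun h => h.1 hd₂
        · simp [h59', h37y] at hd₂
          rw [ends_ite]
          refine ⟨fun hlt => ?_, fun hlt => ?_⟩
          · simp [h50, hkρ, hTρ.closed x hxk, hTρ.closed y hyk] at hlt
            refine (ends_skip).2 ⟨by simp; omega, hf₂.mono (by simp [L]) (by simp),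
              SameOutside.of_frame hf₂ (by simp) (by simp),
              (hbρ.setNat (by simp)).congr fun x' c y₁ y₂ => (or_iff_left ?_).symm⟩
            rw [hD]
            exact fun h => by omega
          · simp [h50, hkρ, hTρ.closed x hxk, hTρ.closed y hyk] at hlt
            rw [ends_seq, ends_assign, ends_seq, ends_assign, ends_seq]
            generalize hρ₃ : State.setNat _ 61 0 _ = ρ₃
            have hf₃ : Frame [60, 61, 68] [] ρ ρ₃ := by
              simp [← hρ₃, frame_setNat, Frame.refl]
            have h60 : ρ₃.nat 60 0 = ν x.blocks := by
              simp [← hρ₃, h50, hTρ.blocks x hxk]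
            have h61 : ρ₃.nat 61 0 = ν y.blocks := by
              simp [← hρ₃, hTρ.blocks y hyk]
            have h68' : ρ₃.nat 68 0 = y.code ν k := by simp [← hρ₃]
            clear hρ₃
            refine (ends_joinBlocksProgram (hTρ.of_frame hf₃ (by simp)) hW h60 h61).mono ?_
            rintro ρ₄ s₄ ⟨hs₄, hf₄, h60'⟩
            have hg₄ : Frame [53, 60, 61, 62, 68] [] ρ ρ₄ :=
              (hf₃.mono (by simp) (by simp)).trans hf₄ (by simp) (by simp)
            have h50' : ρ₄.nat 50 0 = x.code ν k := by simp [hg₄.nat, h50]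
            have h68'' : ρ₄.nat 68 0 = y.code ν k := by simp [hf₄.nat, h68']
            have hT₄ := hTρ.of_frame hg₄ (by simp)
            simp only [ends_seq, ends_assign, ends_setReal]
            refine (ends_relaxProgram_of_frame (L := [53, 55, 56, 57, 60, 61, 62, 68])
              (L' := L) (x := ⟨x.fac, x.blocks ⊔ y.blocks, x.closed + y.closed⟩) (x₁ := x)
              (x₂ := y) (c := σ.real 1 (ch₁ t * (F.card ^ W * (b * (k + 1))) + x.code ν k) +
                σ.real 1 (ch₂ t * (F.card ^ W * (b * (k + 1))) + y.code ν k)) hbρ ?_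
              (by simp) (by simp [L]) (by simp [L]) hlt hxk hyk ?_ ?_ ?_ ?_ ?_).mono ?_
            · simp [frame_setNat, frame_setReal]
              exact hg₄.mono (by simp) (by simp)
            · simp [hg₄.nat, hgρ.nat, nodeArrays, h18]
            · simp [-finFunctionFinEquiv_apply_val, h50', h68'', hT₄.closed x hxk,
                hT₄.closed y hyk, hT₄.offset_blocks _ (Fin.is_lt _), h60', hg₄.nat, hρ.nat, L, h67]
              rfl
            · simp [h50']
            · simp [h68'']
            · simp [h50', h68'', hg₄.nat, hg₄.real, h19', h59', hr1x, hr1y]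
            · rintro ρ₅ s₅ ⟨hs₅, hf₅, hso₅, hb₅, -⟩
              refine ⟨by simp; omega, hf₅, hso₅, hb₅.congr fun x' c y₁ y₂ => or_congr Iff.rfl ?_⟩
              rw [hD]
              exact ⟨fun h => ⟨hd₂, hlt, h⟩, fun h => h.2.2⟩
      · rintro ρ s ⟨hs, hρ, hsoρ, hbρ⟩
        refine ⟨?_, (hf₁.mono (by simp) (by simp)).trans hρ (by simp [L]) (by simp),
          (SameOutside.of_frame hf₁ (by simp) (by simp)).trans hsoρ,
          hbρ.congr fun x' c x₁ x₂ => or_congr Iff.rfl ?_⟩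
        · generalize b * (k + 1) = R at hs ⊢
          simp at hs ⊢
          nlinarith
        · constructor
          · rintro ⟨j, -, hA, rfl, -⟩
            exact ⟨hA, rfl⟩
          · rintro ⟨hA, hx₁⟩
            obtain ⟨hfac, -, -, c₁, c₂, hc₁, hc₂, -⟩ :=
              (NiceTreeDecomposition.attempt_join_iff hk).1 hA
            obtain rfl := code_inj (table_eq_some_iff.1 hc₁).1 hxk hx₁
            refine ⟨_, index_lt (ν x₂.blocks).2 (Nat.lt_succ_of_le (table_eq_some_iff.1 hc₂).1), hA,
              rfl, ?_⟩
            rw [← hfac]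
            rfl
  · rintro τ s ⟨hs, hf, hso, hb⟩
    refine ⟨?_, (hf₀.mono (by simp [nodeArrays]) (by simp)).trans hf (by simp [nodeArrays, L])
      (by simp), (SameOutside.of_frame hf₀ (by simp) (by simp)).trans hso,
      hb.congr fun x c x₁ x₂ => ?_⟩
    · have hp : 1 ≤ (b * (k + 1) + 1) * (W + 1) := Nat.succ_le_of_lt (by positivity)
      generalize F.card ^ W * (b * (k + 1)) = S at hs ⊢
      generalize (b * (k + 1) + 1) * (W + 1) = w at hs hp ⊢
      simp at hs ⊢
      nlinarith [Nat.mul_le_mul_left S hp]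
    · constructor
      · rintro (h | ⟨i, -, h, -⟩)
        exacts [h.elim, h]
      · intro h
        obtain ⟨-, -, -, c', -, hc, -⟩ := (NiceTreeDecomposition.attempt_join_iff hk).1 h
        exact Or.inr ⟨_, code_lt (table_eq_some_iff.1 hc).1, h, rfl⟩

end RAM

/-! ### Filling all tables, children before parents -/

/-- An attempt at `t` looks only at the tables of the children of `t`. This allows the tables at the
time of processing to be replaced by the final ones. -/
theorem NiceTreeDecomposition.Attempt.congr {V : Type*} [DecidableEq V] {G : SimpleGraph V}
    {ι : Type*} {T : NiceTreeDecomposition G ι} {X Y : Type*} [DecidableEq X] [Zero Y]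
    {slot : V → X} {ch₁ ch₂ : ι → ι} {cost : V → Y → ℝ} {k : ℕ}
    {tab tab' : ι → PartialState X Y → Option ℝ} {t : ι} {x x₁ x₂ : PartialState X Y} {c : ℝ}
    (h₁ : T.kind t ≠ .leaf → ∀ y, tab' (ch₁ t) y = tab (ch₁ t) y)
    (h₂ : T.kind t = .join → ∀ y, tab' (ch₂ t) y = tab (ch₂ t) y)
    (h : T.Attempt slot ch₁ ch₂ cost k tab t x c x₁ x₂) :
    T.Attempt slot ch₁ ch₂ cost k tab' t x c x₁ x₂ := by
  cases h with
  | leaf hk => exact .leaf hk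
  | introVertex hk _ _ h => exact .introVertex hk _ _ (by rw [h₁ (by simp [hk]), h])
  | skipEdge hk _ _ h => exact .skipEdge hk _ _ (by rw [h₁ (by simp [hk]), h])
  | joinEdge hk _ _ h hf => exact .joinEdge hk _ _ (by rw [h₁ (by simp [hk]), h]) hf
  | forget hk _ _ h hj => exact .forget hk _ _ (by rw [h₁ (by simp [hk]), h]) hj
  | join hk _ _ _ _ _ _ _ h h' hj =>
    exact .join hk _ _ _ _ _ _ _ (by rw [h₁ (by simp [hk]), h]) (by rw [h₂ hk, h']) hj

theorem NiceTreeDecomposition.IsChildMap.mem_children {V : Type*} [DecidableEq V]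
    {G : SimpleGraph V} {ι : Type*} {T : NiceTreeDecomposition G ι} {ch₁ ch₂ : ι → ι}
    (h : T.IsChildMap ch₁ ch₂) (t : ι) :
    (T.kind t ≠ .leaf → ch₁ t ∈ T.children t) ∧ (T.kind t = .join → ch₂ t ∈ T.children t) := by
  refine ⟨fun hk => ?_, fun hk => by rw [(h.join hk).2]; simp⟩
  cases hkt : T.kind t with
  | leaf => exact absurd hkt hk
  | introVertex v => rw [h.introVertex hkt]; rfl
  | introEdge u v => rw [h.introEdge hkt]; rfl
  | forget v => rw [h.forget hkt]; rfl
  | join => rw [(h.join hkt).2]; simp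

namespace RAM

open Test Program PartialState

variable {n N k W b : ℕ} {G : SimpleGraph (Fin n)} {F : Finset (Fin n)} {d : Fin n → Fin n → ℝ}
  {T : NiceTreeDecomposition G (Fin N)} {ch₁ ch₂ : Fin N → Fin N} {fac : Fin F.card → Fin n}
  {slot : Fin n → Fin W} [NeZero F.card] {ν : Setoid (Fin W) ≃ Fin b} {σ τ : State} {t : Fin N}
  {ord : Fin N → Fin N}

def nodeProgram : Program :=
  ite (natEq (.get 3 (var 17)) (.const 0)) leafProgram
    (ite (natEq (.get 3 (var 17)) (.const 1)) introVertexProgram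
      (ite (natEq (.get 3 (var 17)) (.const 2)) introEdgeProgram
        (ite (natEq (.get 3 (var 17)) (.const 3)) forgetProgram joinProgram)))

theorem ends_nodeProgram (hin : Input k G F d T ch₁ ch₂ fac σ)
    (hdist : ∀ u v : Fin n, σ.real 0 (u * n + v) = d u v)
    (hT : Tables n N k W F.card ν σ) (hW : 0 < W) (hslot : ∀ v : Fin n, σ.nat 21 v = slot v)
    (h17 : σ.nat 17 0 = t) (h18 : σ.nat 18 0 = t * (F.card ^ W * (b * (k + 1))))
    (hbest : IsBest ν k (t * (F.card ^ W * (b * (k + 1)))) (m := F.card)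
      (fun _ _ _ _ => False) σ) :
    Ends nodeProgram σ fun τ s =>
      s ≤ 500 * ((F.card ^ W * (b * (k + 1)) + 1) * ((b * (k + 1) + 1) * (W + 1) ^ 2)) ∧
      Frame nodeArrays [1, 2] σ τ ∧
      SameOutside (t * (F.card ^ W * (b * (k + 1)))) (F.card ^ W * (b * (k + 1))) σ τ ∧
      IsBest ν k (t * (F.card ^ W * (b * (k + 1)))) (T.Attempt slot ch₁ ch₂
        (fun v y => d v (fac y)) k (table ν k σ) t) τ := by
  have hkind := hin.kind t
  have h1 : 1 ≤ b * (k + 1) + 1 := by omega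
  have h2 : W + 1 ≤ (W + 1) ^ 2 := Nat.le_self_pow (by norm_num) _
  have hbound : F.card ^ W * (b * (k + 1)) + 1 ≤
      (F.card ^ W * (b * (k + 1)) + 1) * ((b * (k + 1) + 1) * (W + 1) ^ 2) :=
    Nat.le_mul_of_pos_right _ (by positivity)
  have hbound₁ : (F.card ^ W * (b * (k + 1)) + 1) * (W + 1) ^ 2 ≤
      (F.card ^ W * (b * (k + 1)) + 1) * ((b * (k + 1) + 1) * (W + 1) ^ 2) :=
    Nat.mul_le_mul_left _ (Nat.le_mul_of_pos_left _ (by omega))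
  have hbound₂ : (F.card ^ W * (b * (k + 1)) + 1) * ((b * (k + 1) + 1) * (W + 1)) ≤
      (F.card ^ W * (b * (k + 1)) + 1) * ((b * (k + 1) + 1) * (W + 1) ^ 2) :=
    Nat.mul_le_mul_left _ (Nat.mul_le_mul_left _ h2)
  generalize (F.card ^ W * (b * (k + 1)) + 1) * ((b * (k + 1) + 1) * (W + 1) ^ 2) = Z at *
  have hpos : 1 ≤ F.card ^ W * (b * (k + 1)) + 1 := by omega
  unfold nodeProgram
  rw [ends_ite, ends_ite, ends_ite, ends_ite]
  cases hk : T.kind t with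
  | leaf =>
    rw [hk] at hkind
    have h3 : σ.nat 3 t = 0 := hkind
    simp [h17, h3]
    refine (ends_leafProgram (slot := slot) (fac := fac) (ch₁ := ch₁) (ch₂ := ch₂) (d := d) hT hk
      h18 hbest).mono fun τ s ⟨hs, h⟩ => ⟨by omega, h⟩
  | introVertex v =>
    rw [hk] at hkind
    have h3 : σ.nat 3 t = 1 := hkind.1
    simp [h17, h3]
    exact (ends_introVertexProgram hin hT hslot hk h17 h18 hbest).mono fun τ s ⟨hs, h⟩ =>
      ⟨by omega, h⟩
  | introEdge u v =>
    rw [hk] at hkind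
    have h3 : σ.nat 3 t = 2 := hkind.1
    simp [h17, h3]
    exact (ends_introEdgeProgram hin hT hW hslot hk h17 h18 hbest).mono fun τ s ⟨hs, h⟩ =>
      ⟨by omega, h⟩
  | forget v =>
    rw [hk] at hkind
    have h3 : σ.nat 3 t = 3 := hkind.1
    simp [h17, h3]
    exact (ends_forgetProgram hin hdist hT hW hslot hk h17 h18 hbest).mono fun τ s ⟨hs, h⟩ =>
      ⟨by omega, h⟩
  | join =>
    rw [hk] at hkind
    have h3 : σ.nat 3 t = 4 := hkind
    simp [h17, h3]
    exact (ends_joinProgram (slot := slot) hin hT hW hk h17 h18 hbest).mono fun τ s ⟨hs, h⟩ =>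
      ⟨by omega, h⟩

/-- Fill the tables of all nodes, the children before their parents. -/
def fillProgram : Program :=
  loop 16 (.get 0 (.const 3))
    (17 ≔ .get 20 (.get 0 (.const 3) - (var 16 + .const 1)) ;;
    18 ≔ .get 36 (var 17) ;;
    nodeProgram)

theorem ends_fillProgram (hin : Input k G F d T ch₁ ch₂ fac σ)
    (hdist : ∀ u v : Fin n, σ.real 0 (u * n + v) = d u v)
    (hord : IsOrder T (σ.nat 20) ord)
    (hT : Tables n N k W F.card ν σ) (hW : 0 < W) (hslot : ∀ v : Fin n, σ.nat 21 v = slot v)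
    (h37 : ∀ j, σ.nat 37 j = 0) :
    Ends fillProgram σ fun τ s =>
      s ≤ 600 * ((N + 1) *
        ((F.card ^ W * (b * (k + 1)) + 1) * ((b * (k + 1) + 1) * (W + 1) ^ 2))) ∧
      Frame (16 :: 17 :: 18 :: nodeArrays) [1, 2] σ τ ∧
      ∀ t : Fin N, IsBest ν k (t * (F.card ^ W * (b * (k + 1)))) (T.Attempt slot ch₁ ch₂
        (fun v y => d v (fac y)) k (table ν k τ) t) τ := by
  obtain ⟨B, hB⟩ : ∃ B, B = (F.card ^ W * (b * (k + 1)) + 1) *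
    ((b * (k + 1) + 1) * (W + 1) ^ 2) := ⟨_, rfl⟩
  rw [← hB]
  have hB0 : 0 < B := by rw [hB]; positivity
  unfold fillProgram
  -- The order is traversed backwards, so `N ≤ j + h` says that the node at position `j` was treated
  -- in the first `h` rounds. For other nodes no attempt counts, which means that their tables are
  -- still empty.
  refine ends_loop N (500 * B + 50) (fun h τ => Frame (16 :: 17 :: 18 :: nodeArrays) [1, 2] σ τ ∧
    ∀ j : Fin N, IsBest ν k (ord j * (F.card ^ W * (b * (k + 1)))) (fun x c x₁ x₂ => N ≤ j + h ∧
      T.Attempt slot ch₁ ch₂ (fun v y => d v (fac y)) k (table ν k τ) (ord j) x c x₁ x₂) τ)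
    ?_ ?_ ?_ ?_
  · refine ⟨by simp [frame_setNat, Frame.refl], fun j => ⟨fun x _ h => ?_, fun x c x₁ x₂ h => ?_⟩⟩
    · simp [h37] at h
    · have := j.2
      omega
  · rintro h τ - ⟨hf, -⟩ -
    simp [hf.nat, hin.nodes, nodeArrays]
  · rintro h τ hh ⟨hf, hall⟩ hx
    obtain ⟨j₀, hj₀⟩ : ∃ j₀ : Fin N, (j₀ : ℕ) = N - (h + 1) := ⟨⟨N - (h + 1), by omega⟩, rfl⟩
    rw [ends_seq, ends_assign, ends_seq, ends_assign]
    generalize hτ₁ : State.setNat _ 18 0 _ = τ₁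
    have hf₁ : Frame [17, 18] [] τ τ₁ := by simp [← hτ₁, frame_setNat, Frame.refl]
    have hg₁ : Frame (16 :: 17 :: 18 :: nodeArrays) [1, 2] σ τ₁ := hf.trans hf₁ (by simp) (by simp)
    have h17 : τ₁.nat 17 0 = ord j₀ := by
      simp [← hτ₁, hf.nat, nodeArrays, hin.nodes, hx, ← hj₀, hord.eq]
    have h18 : τ₁.nat 18 0 = ord j₀ * (F.card ^ W * (b * (k + 1))) := by
      simp [← hτ₁, hf.nat, nodeArrays, hin.nodes, hx, ← hj₀, hord.eq, hT.offset_node]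
    have h16 : τ₁.nat 16 0 = h := by simp [hf₁.nat, hx]
    clear hτ₁
    have hin₁ : Input k G F d T ch₁ ch₂ fac τ₁ := hin.of_eq fun a ha j =>
      hg₁.nat a (fun h => by simp [nodeArrays] at h; omega) j
    refine (ends_nodeProgram (slot := slot) (t := ord j₀) hin₁ (fun u v => ?_)
      (hT.of_frame hg₁ (by simp [nodeArrays])) hW (fun v => ?_) h17 h18 ?_).mono ?_
    · rw [hg₁.real _ (by simp), hdist]
    · rw [hg₁.nat _ (by simp [nodeArrays]), hslot]
    · refine ((hall j₀).of_frame hf₁ (by simp) (by simp)).congr fun x c x₁ x₂ => ?_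
      simp only [iff_false]
      omega
    · rintro τ₂ s ⟨hs, hf₂, hso, hb⟩
      rw [← hB] at hs
      have hb₁ : ∀ j, IsBest ν k (ord j * (F.card ^ W * (b * (k + 1)))) (fun x c x₁ x₂ => N ≤ j + h ∧
          T.Attempt slot ch₁ ch₂ (fun v y => d v (fac y)) k (table ν k τ₁) (ord j) x c x₁ x₂)
          τ₁ := by
        intro j
        refine ((hall j).of_frame hf₁ (by simp) (by simp)).congr fun x c x₁ x₂ => ?_
        have : table (m := F.card) (N := N) ν k τ₁ = table ν k τ := by
          funext t x
          unfold table
          rw [hf₁.nat _ (by simp), hf₁.real _ (by simp)]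
        rw [this]
      -- Children come later in the order than their parents. So writing the table of `ord j₀` does
      -- not touch the children of any node at position `j₀` or later, and their attempts stay the
      -- same.
      have htab : ∀ j, j₀ ≤ j → ∀ x c x₁ x₂,
          (T.Attempt slot ch₁ ch₂ (fun v y => d v (fac y)) k (table ν k τ₁) (ord j) x c x₁ x₂ ↔
          T.Attempt slot ch₁ ch₂ (fun v y => d v (fac y)) k (table ν k τ₂) (ord j) x c x₁ x₂) := by
        intro j hj x c x₁ x₂
        have hne : ∀ s ∈ T.children (ord j), s ≠ ord j₀ := by
          rintro s hs rfl
          exact absurd (hord.lt j j₀ hs) (not_lt.2 hj)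
        obtain ⟨hc₁, hc₂⟩ := hin.isChildMap.mem_children (ord j)
        constructor
        · exact NiceTreeDecomposition.Attempt.congr
            (fun h y => hso.table_eq (hne _ (hc₁ h)) y) (fun h y => hso.table_eq (hne _ (hc₂ h)) y)
        · exact NiceTreeDecomposition.Attempt.congr
            (fun h y => (hso.table_eq (hne _ (hc₁ h)) y).symm)
            (fun h y => (hso.table_eq (hne _ (hc₂ h)) y).symm)
      have htab' : table (m := F.card) (N := N) ν k (τ₂.setNat 16 0 (h + 1)) = table ν k τ₂ := by
        funext t x
        unfold table
        simp
      refine ⟨by simp; omega, ?_, ?_, fun j => ?_⟩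
      · rw [hf₂.nat _ (by simp [nodeArrays]), h16]
      · rw [frame_setNat (by simp)]
        exact hg₁.trans hf₂ (by simp [nodeArrays]) (by simp)
      · rw [htab']
        refine IsBest.setNat ?_ (by simp)
        by_cases hj : j = j₀
        · subst hj
          refine hb.congr fun x c x₁ x₂ => ?_
          rw [htab j le_rfl, iff_and_self]
          intro
          omega
        · refine ((hb₁ j).of_eq (fun a ha i h1 h2 => ?_) fun i h1 h2 => ?_).congr
            fun x c x₁ x₂ => ?_
          · have hne : (ord j : ℕ) ≠ ord j₀ := fun h => hj (hord.bij.1 (Fin.ext h))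
            have := outside_of_ne hne (j := i - ord j * (F.card ^ W * (b * (k + 1))))
              (size := F.card ^ W * (b * (k + 1))) (by omega)
            rw [Nat.add_sub_cancel' h1] at this
            exact hso.nat a ha i this
          · have hne : (ord j : ℕ) ≠ ord j₀ := fun h => hj (hord.bij.1 (Fin.ext h))
            have := outside_of_ne hne (j := i - ord j * (F.card ^ W * (b * (k + 1))))
              (size := F.card ^ W * (b * (k + 1))) (by omega)
            rw [Nat.add_sub_cancel' h1] at this
            exact hso.real i this
          · have hjne : (j : ℕ) ≠ j₀ := fun h => hj (Fin.ext h)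
            by_cases hle : j₀ ≤ j
            · rw [htab j hle]
              have : (j₀ : ℕ) ≤ j := hle
              refine and_congr_left fun _ => ?_
              omega
            · have : (j : ℕ) < j₀ := not_le.1 hle
              constructor
              · intro h
                omega
              · intro h
                omega
  · rintro τ s ⟨hf, hall⟩ hs
    refine ⟨?_, hf, fun t => ?_⟩
    · simp at hs
      nlinarith
    · obtain ⟨j, rfl⟩ := hord.bij.2 t
      refine (hall j).congr fun x c x₁ x₂ => ?_
      simp

end RAM

/-! ### Reading off a solution -/

namespace NiceTreeDecomposition

variable {V : Type*} [DecidableEq V] {G : SimpleGraph V} {ι : Type*}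
  {T : NiceTreeDecomposition G ι} {X Y : Type*} [DecidableEq X] [Zero Y]
  {slot : V → X} {ch₁ ch₂ : ι → ι} {cost : V → Y → ℝ} {k : ℕ}
  {tab : ι → PartialState X Y → Option ℝ} {t : ι} {x x₁ x₂ : PartialState X Y} {c : ℝ}

theorem Attempt.children_ne_none (h : T.Attempt slot ch₁ ch₂ cost k tab t x c x₁ x₂) :
    (T.kind t ≠ .leaf → ∃ c', tab (ch₁ t) x₁ = some c') ∧
      (T.kind t = .join → ∃ c', tab (ch₂ t) x₂ = some c') := by
  cases h <;> simp_all

/-- By `IsRun.spec` the blocks of a run come from actual connections between bag vertices, so free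
slots are blocks of their own and a slot related to that of `v` is occupied. -/
theorem IsRun.exists_mem_bag [Finite ι] [Fintype V] {cs : ι → PartialState X Y}
    (hB : ∀ t, Set.InjOn slot (T.bag t)) (hch : T.IsChildMap ch₁ ch₂)
    (h : IsRun T slot ch₁ ch₂ cost k tab cs) {v : V} (hk : T.kind t = .forget v)
    (hne : ¬ ∀ b, (cs (ch₁ t)).blocks (slot v) b → b = slot v) :
    ∃ u ∈ T.bag t, (cs (ch₁ t)).blocks (slot v) (slot u) := by
  obtain ⟨s, hc, -, hb⟩ := T.forget_spec t v hk
  have hs : ch₁ t = s := by simpa [hch.forget hk] using hc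
  push Not at hne
  obtain ⟨b, hvb, hb'⟩ := hne
  have hrel := hvb
  rw [(h.spec hB hch _).1, slotBlocks, Setoid.onSlots_rel (hB _)] at hrel
  rcases hrel with rfl | ⟨-, -, u, hu, -, rfl, -⟩
  · exact absurd rfl hb'
  · refine ⟨u, ?_, hvb⟩
    rw [hb, Finset.mem_erase, ← hs]
    exact ⟨fun he => hb' (he ▸ rfl), hu⟩

end NiceTreeDecomposition

namespace RAM

open Test Program PartialState NiceTreeDecomposition

variable {n N k W b : ℕ} {G : SimpleGraph (Fin n)} {F : Finset (Fin n)} {d : Fin n → Fin n → ℝ}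
  {T : NiceTreeDecomposition G (Fin N)} {ch₁ ch₂ : Fin N → Fin N} {fac : Fin F.card → Fin n}
  {slot : Fin n → Fin W} [NeZero F.card] {ν : Setoid (Fin W) ≃ Fin b} {σ τ : State} {t : Fin N}
  {ord : Fin N → Fin N}

/-- Follow the back pointers from the root. -/
def traceProgram : Program :=
  setNat 40 (.get 0 (.const 4)) (.get 0 (.const 1)) ;;
  loop 16 (.get 0 (.const 3))
    (17 ≔ .get 20 (var 16) ;;
    50 ≔ .get 36 (var 17) + .get 40 (var 17) ;;
    ite (natEq (.get 3 (var 17)) (.const 0)) skip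
      (setNat 40 (.get 6 (var 17)) (.get 38 (var 50)) ;;
      ite (natEq (.get 3 (var 17)) (.const 4))
        (setNat 40 (.get 7 (var 17)) (.get 39 (var 50))) skip))

/-- The first `h` nodes of the order have been traced. -/
structure IsTrace (T : NiceTreeDecomposition G (Fin N)) (ch₁ ch₂ ord : Fin N → Fin N)
    (ν : Setoid (Fin W) ≃ Fin b) (k m : ℕ) (σ τ : State) (h : ℕ) : Prop where
  reached : ∀ s, (s = T.root ∨ ∃ i : Fin N, (i : ℕ) < h ∧ s ∈ T.children (ord i)) →
    ∃ x : PartialState (Fin W) (Fin m), x.closed ≤ k ∧ τ.nat 40 s = x.code ν k ∧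
      ∃ c, table ν k σ s x = some c
  child₁ : ∀ i : Fin N, (i : ℕ) < h → T.kind (ord i) ≠ .leaf → τ.nat 40 (ch₁ (ord i)) =
    σ.nat 38 (ord i * (m ^ W * (b * (k + 1))) + τ.nat 40 (ord i))
  child₂ : ∀ i : Fin N, (i : ℕ) < h → T.kind (ord i) = .join → τ.nat 40 (ch₂ (ord i)) =
    σ.nat 39 (ord i * (m ^ W * (b * (k + 1))) + τ.nat 40 (ord i))

/-- Different nodes have no common child, and a child comes after its parent in the order. So
writing the entries for the children of the present node disturbs nothing that was fixed before. -/
theorem IsTrace.succ {m h : ℕ} (hch : T.IsChildMap ch₁ ch₂) {q : ℕ → ℕ} (hord : IsOrder T q ord)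
    (hh : h < N) (htr : IsTrace T ch₁ ch₂ ord ν k m σ τ h) {τ' : State}
    (hne : ∀ s : Fin N, s ∉ T.children (ord ⟨h, hh⟩) → τ'.nat 40 s = τ.nat 40 s)
    (hre : ∀ s ∈ T.children (ord ⟨h, hh⟩),
      ∃ x : PartialState (Fin W) (Fin m), x.closed ≤ k ∧ τ'.nat 40 s = x.code ν k ∧
        ∃ c, table ν k σ s x = some c)
    (h₁ : T.kind (ord ⟨h, hh⟩) ≠ .leaf → τ'.nat 40 (ch₁ (ord ⟨h, hh⟩)) =
      σ.nat 38 (ord ⟨h, hh⟩ * (m ^ W * (b * (k + 1))) + τ.nat 40 (ord ⟨h, hh⟩)))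
    (h₂ : T.kind (ord ⟨h, hh⟩) = .join → τ'.nat 40 (ch₂ (ord ⟨h, hh⟩)) =
      σ.nat 39 (ord ⟨h, hh⟩ * (m ^ W * (b * (k + 1))) + τ.nat 40 (ord ⟨h, hh⟩))) :
    IsTrace T ch₁ ch₂ ord ν k m σ τ' (h + 1) := by
  have hself : ∀ i : Fin N, (i : ℕ) < h + 1 → τ'.nat 40 (ord i) = τ.nat 40 (ord i) := by
    intro i hi
    refine hne _ fun hmem => ?_
    have := hord.lt _ _ hmem
    rw [Fin.lt_def] at this
    simp only at this
    omega
  have hchild : ∀ i : Fin N, (i : ℕ) < h → ∀ s ∈ T.children (ord i),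
      s ∉ T.children (ord ⟨h, hh⟩) := by
    intro i hi s hs hmem
    have := hord.bij.1 (eq_of_mem_children hs hmem)
    rw [this] at hi
    simp at hi
  have hlast : ∀ i : Fin N, (i : ℕ) < h + 1 → (i : ℕ) < h ∨ i = ⟨h, hh⟩ := by
    intro i hi
    rw [Fin.ext_iff]
    simp only
    omega
  refine ⟨fun s hs => ?_, fun i hi hk => ?_, fun i hi hk => ?_⟩
  · by_cases hmem : s ∈ T.children (ord ⟨h, hh⟩)
    · exact hre s hmem
    · rw [hne s hmem]
      refine htr.reached s (hs.imp id ?_)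
      rintro ⟨i, hi, hs⟩
      rcases hlast i hi with hi | rfl
      · exact ⟨i, hi, hs⟩
      · exact absurd hs hmem
  · rw [hself i hi]
    rcases hlast i hi with hi | rfl
    · rw [hne _ (hchild i hi _ ((hch.mem_children _).1 hk))]
      exact htr.child₁ i hi hk
    · exact h₁ hk
  · rw [hself i hi]
    rcases hlast i hi with hi | rfl
    · rw [hne _ (hchild i hi _ ((hch.mem_children _).2 hk))]
      exact htr.child₂ i hi hk
    · exact h₂ hk

/-- Soundness of a defined entry provides two predecessor states, whose entries in the tables of the
existing children are again defined. So the trace never leaves the defined part of the tables, and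
the chosen states form a run. -/
theorem ends_traceProgram (hin : Input k G F d T ch₁ ch₂ fac σ) (hord : IsOrder T (σ.nat 20) ord)
    (hT : Tables n N k W F.card ν σ)
    (hbest : ∀ t : Fin N, IsBest ν k (t * (F.card ^ W * (b * (k + 1)))) (T.Attempt slot ch₁ ch₂
      (fun v y => d v (fac y)) k (table ν k σ) t) σ)
    (hroot : σ.nat 37 (T.root * (F.card ^ W * (b * (k + 1))) + k) ≠ 0) :
    Ends traceProgram σ fun τ s => s ≤ 100 * (N + 1) ∧ Frame [16, 17, 40, 50] [] σ τ ∧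
      ∃ cs : Fin N → PartialState (Fin W) (Fin F.card), (∀ t, (cs t).closed ≤ k) ∧
        (∀ t : Fin N, τ.nat 40 t = (cs t).code ν k) ∧ cs T.root = .init _ _ k ∧
        T.IsRun slot ch₁ ch₂ (fun v y => d v (fac y)) k (table ν k σ) cs := by
  unfold traceProgram
  rw [ends_seq, ends_setNat]
  refine ends_loop N 80 (fun h τ => Frame [16, 17, 40, 50] [] σ τ ∧ τ.nat 40 T.root = k ∧
    IsTrace T ch₁ ch₂ ord ν k F.card σ τ h) ?_ ?_ ?_ ?_
  · refine ⟨by simp [frame_setNat, Frame.refl], by simp [hin.root, hin.clusters], ?_, by simp,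
      by simp⟩
    rintro s (rfl | ⟨i, hi, -⟩)
    · refine ⟨.init _ _ k, le_rfl, ?_, _, table_eq_some_iff.2 ⟨le_rfl, ?_, rfl⟩⟩
      · simp [hin.root, hin.clusters, code_init hT.bot]
      · rwa [code_init hT.bot]
    · omega
  · rintro h τ - ⟨hf, -⟩ -
    simp [hf.nat, hin.nodes]
  · rintro h τ hh ⟨hf, hr, htr⟩ hx
    obtain ⟨t, ht⟩ : ∃ t, t = ord ⟨h, hh⟩ := ⟨_, rfl⟩
    have hq : σ.nat 20 h = t := by rw [ht, ← hord.eq]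
    obtain ⟨x, hxk, h40, c, hc⟩ := htr.reached t (by
      rw [ht]
      exact (hord.eq_root_or ⟨h, hh⟩).imp id fun ⟨j, hj, hm⟩ => ⟨j, hj, hm⟩)
    obtain ⟨-, hd, -⟩ := table_eq_some_iff.1 hc
    obtain ⟨x₁, x₂, hx₁, hx₂, h38, h39, hA⟩ := (hbest t).sound x hxk hd
    obtain ⟨ht₁, ht₂⟩ := hA.children_ne_none
    have hrootne : T.root ∉ T.children t := by
      intro hm
      obtain ⟨i, hi⟩ := hord.bij.2 T.root
      rw [ht, ← hi] at hm
      have := hord.lt _ _ hm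
      have := hord.root i hi
      simp_all [Fin.lt_def]
    have hsucc : ∀ τ' : State, Frame [16, 17, 40, 50] [] σ τ' → τ'.nat 16 0 = h →
        (∀ s : Fin N, s ∉ T.children t → τ'.nat 40 s = τ.nat 40 s) →
        (∀ s ∈ T.children t, ∃ x : PartialState (Fin W) (Fin F.card), x.closed ≤ k ∧
          τ'.nat 40 s = x.code ν k ∧ ∃ c, table ν k σ s x = some c) →
        (T.kind t ≠ .leaf → τ'.nat 40 (ch₁ t) = x₁.code ν k) →
        (T.kind t = .join → τ'.nat 40 (ch₂ t) = x₂.code ν k) →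
        τ'.nat 16 0 = h ∧ Frame [16, 17, 40, 50] [] σ (τ'.setNat 16 0 (h + 1)) ∧
        (τ'.setNat 16 0 (h + 1)).nat 40 T.root = k ∧
          IsTrace T ch₁ ch₂ ord ν k F.card σ (τ'.setNat 16 0 (h + 1)) (h + 1) := by
      intro τ' hf' h16 hne hre h₁ h₂
      refine ⟨h16, by simp [frame_setNat, hf'], by simp [hne _ hrootne, hr],
        htr.succ hin.isChildMap hord hh ?_ ?_ ?_ ?_⟩
      · rw [← ht]; simpa using hne
      · rw [← ht]; simpa using hre
      · rw [← ht, h40, h38]; simpa using h₁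
      · rw [← ht, h40, h39]; simpa using h₂
    simp only [ends_seq, ends_assign]
    have h3 : σ.nat 3 t = 0 ↔ T.kind t = .leaf := by
      have := hin.kind t
      cases hk : T.kind t <;> rw [hk] at this <;> simp [EncodesKind] at this <;> simp [this]
    have h3' : σ.nat 3 t = 4 ↔ T.kind t = .join := by
      have := hin.kind t
      cases hk : T.kind t <;> rw [hk] at this <;> simp [EncodesKind] at this <;> simp [this]
    by_cases hleaf : T.kind t = .leaf
    · have hch0 : T.children t = ∅ := (T.leaf_spec t hleaf).1
      rw [ends_ite]
      refine ⟨fun _ => ?_, fun hc => absurd (by simp [hf.nat, hx, hq, h3.2 hleaf]) hc⟩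
      rw [ends_skip]
      refine ⟨by simp, hsucc _ (by simp [frame_setNat, hf]) (by simp [hx]) (fun s _ => by simp)
        (by simp [hch0]) (fun h => absurd hleaf h) (fun h => by simp [hleaf] at h)⟩
    · have h6 := hin.child₁ t hleaf
      rw [ends_ite]
      refine ⟨fun hc => absurd hc (by simp [hf.nat, hx, hq, h3, hleaf]), fun _ => ?_⟩
      rw [ends_seq, ends_setNat, ends_ite]
      by_cases hjoin : T.kind t = .join
      · have h7 := hin.child₂ t hjoin
        obtain ⟨hne, hchs⟩ := hin.isChildMap.join hjoin
        have hne' : ((ch₁ t : Fin N) : ℕ) ≠ ch₂ t := fun h => hne (Fin.ext h)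
        refine ⟨fun _ => ?_, fun hc => absurd (by simp [hf.nat, hx, hq, h3'.2 hjoin]) hc⟩
        rw [ends_setNat]
        refine ⟨by simp, hsucc _ (by simp [frame_setNat, hf]) (by simp [hx]) (fun s hs => ?_)
          (fun s hs => ?_) (fun _ => ?_) (fun _ => ?_)⟩
        · rw [hchs] at hs
          simp [Fin.ext_iff] at hs
          simp [hf.nat, hx, hq, h6, h7, hs]
        · rw [hchs] at hs
          rcases hs with rfl | rfl
          · exact ⟨x₁, hx₁, by simp [hf.nat, hx, hq, h6, h7, hT.offset_node, h40, h38, hne'],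
              ht₁ hleaf⟩
          · exact ⟨x₂, hx₂, by simp [hf.nat, hx, hq, h7, hT.offset_node, h40, h39], ht₂ hjoin⟩
        · simp [hf.nat, hx, hq, h6, h7, hT.offset_node, h40, h38, hne']
        · simp [hf.nat, hx, hq, h7, hT.offset_node, h40, h39]
      · have hchs : T.children t = {ch₁ t} := by
          cases hk : T.kind t with
          | leaf => exact absurd hk hleaf
          | introVertex v => exact hin.isChildMap.introVertex hk
          | introEdge u v => exact hin.isChildMap.introEdge hk
          | forget v => exact hin.isChildMap.forget hk
          | join => exact absurd hk hjoin
        refine ⟨fun hc => absurd hc (by simp [hf.nat, hx, hq, h3', hjoin]), fun _ => ?_⟩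
        rw [ends_skip]
        refine ⟨by simp, hsucc _ (by simp [frame_setNat, hf]) (by simp [hx]) (fun s hs => ?_)
          (fun s hs => ?_) (fun _ => ?_) (fun h => absurd h hjoin)⟩
        · rw [hchs] at hs
          simp [Fin.ext_iff] at hs
          simp [hf.nat, hx, hq, h6, hs]
        · rw [hchs] at hs
          obtain rfl : s = ch₁ t := hs
          exact ⟨x₁, hx₁, by simp [hf.nat, hx, hq, h6, hT.offset_node, h40, h38], ht₁ hleaf⟩
        · simp [hf.nat, hx, hq, h6, hT.offset_node, h40, h38]
  · rintro τ s ⟨hf, hr, htr⟩ hs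
    refine ⟨by simp at hs ⊢; omega, hf, ?_⟩
    have hall : ∀ t : Fin N, ∃ x : PartialState (Fin W) (Fin F.card), x.closed ≤ k ∧
        τ.nat 40 t = x.code ν k ∧ ∃ c, table ν k σ t x = some c := by
      intro t
      obtain ⟨j, rfl⟩ := hord.bij.2 t
      exact htr.reached _ ((hord.eq_root_or j).imp id fun ⟨i, _, hm⟩ => ⟨i, i.2, hm⟩)
    choose cs hcs h40 hc using hall
    refine ⟨cs, hcs, h40, code_inj (ν := ν) (hcs _) (show k ≤ k from le_rfl) ?_, fun t => ?_⟩
    · rw [← h40, hr, code_init hT.bot]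
    · obtain ⟨c, hc⟩ := hc t
      obtain ⟨-, hd, rfl⟩ := table_eq_some_iff.1 hc
      obtain ⟨x₁, x₂, hx₁, hx₂, h38, h39, hA⟩ := (hbest t).sound _ (hcs t) hd
      obtain ⟨j, rfl⟩ := hord.bij.2 t
      refine ⟨_, x₁, x₂, hc, hA, fun hk => code_inj (ν := ν) (hcs _) hx₁ ?_,
        fun hk => code_inj (ν := ν) (hcs _) hx₂ ?_⟩
      · rw [← h40, htr.child₁ j j.2 hk, h40, h38]
      · rw [← h40, htr.child₂ j j.2 hk, h40, h39]

end RAM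

/-! ### Numbering the clusters along the trace -/

namespace RAM

open Test Program PartialState NiceTreeDecomposition

variable {n N k W b : ℕ} {G : SimpleGraph (Fin n)} {F : Finset (Fin n)} {d : Fin n → Fin n → ℝ}
  {T : NiceTreeDecomposition G (Fin N)} {ch₁ ch₂ : Fin N → Fin N} {fac : Fin F.card → Fin n}
  {slot : Fin n → Fin W} [NeZero F.card] {ν : Setoid (Fin W) ≃ Fin b} {σ τ : State} {t : Fin N}
  {ord : Fin N → Fin N} {cs : Fin N → PartialState (Fin W) (Fin F.card)}

/-- In the state `x`, the slot `a` is a block of its own. -/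
def IsAlone (x : PartialState (Fin W) (Fin F.card)) (a : Fin W) : Prop :=
  ∀ c, x.blocks a c → c = a

/-- The vertices forgotten at the first `h` nodes have been assigned to the first `cnt` clusters. -/
structure IsClusterLabeling (T : NiceTreeDecomposition G (Fin N)) (ch₁ ord : Fin N → Fin N)
    (fac : Fin F.card → Fin n) (slot : Fin n → Fin W)
    (cs : Fin N → PartialState (Fin W) (Fin F.card)) (cl ctr : ℕ → ℕ) (cnt h : ℕ) : Prop where
  bij : Set.BijOn (fun v : Fin n => cl v) {v | ∃ i : Fin N, (i : ℕ) < h ∧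
    T.kind (ord i) = .forget v ∧ IsAlone (cs (ch₁ (ord i))) (slot v)} (Set.Iio cnt)
  center : ∀ i : Fin N, (i : ℕ) < h → ∀ v, T.kind (ord i) = .forget v →
    IsAlone (cs (ch₁ (ord i))) (slot v) → ctr (cl v) = fac ((cs (ch₁ (ord i))).fac (slot v))
  copy : ∀ i : Fin N, (i : ℕ) < h → ∀ v, T.kind (ord i) = .forget v →
    ¬ IsAlone (cs (ch₁ (ord i))) (slot v) → ∃ u ∈ T.bag (ord i),
      (cs (ch₁ (ord i))).blocks (slot v) (slot u) ∧ cl v = cl u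

namespace IsClusterLabeling

variable {cl ctr cl' ctr' : ℕ → ℕ} {cnt h : ℕ}

theorem lt_or_eq (hh : h < N) {i : Fin N} (hi : (i : ℕ) < h + 1) : (i : ℕ) < h ∨ i = ⟨h, hh⟩ := by
  rw [Fin.ext_iff]
  simp only
  omega

theorem zero : IsClusterLabeling T ch₁ ord fac slot cs cl ctr 0 0 :=
  ⟨by simp [Set.BijOn, Set.MapsTo, Set.InjOn, Set.SurjOn], by simp, by simp⟩

theorem of_eq (hl : IsClusterLabeling T ch₁ ord fac slot cs cl ctr cnt h)
    (h1 : ∀ i, cl' i = cl i) (h2 : ∀ i, ctr' i = ctr i) :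
    IsClusterLabeling T ch₁ ord fac slot cs cl' ctr' cnt h := by
  obtain rfl : cl' = cl := funext h1
  obtain rfl : ctr' = ctr := funext h2
  exact hl

theorem succ_other (hl : IsClusterLabeling T ch₁ ord fac slot cs cl ctr cnt h) (hh : h < N)
    (hk : ∀ v, T.kind (ord ⟨h, hh⟩) ≠ .forget v) :
    IsClusterLabeling T ch₁ ord fac slot cs cl ctr cnt (h + 1) := by
  have hset : ∀ v, (∃ i : Fin N, (i : ℕ) < h + 1 ∧ T.kind (ord i) = .forget v ∧
      IsAlone (cs (ch₁ (ord i))) (slot v)) ↔ ∃ i : Fin N, (i : ℕ) < h ∧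
      T.kind (ord i) = .forget v ∧ IsAlone (cs (ch₁ (ord i))) (slot v) := by
    refine fun v => ⟨?_, fun ⟨i, hi, h⟩ => ⟨i, by omega, h⟩⟩
    rintro ⟨i, hi, hkv, ha⟩
    rcases lt_or_eq hh hi with hi | rfl
    · exact ⟨i, hi, hkv, ha⟩
    · exact absurd hkv (hk v)
  refine ⟨by simpa only [hset] using hl.bij, fun i hi v hkv => ?_, fun i hi v hkv => ?_⟩
  · rcases lt_or_eq hh hi with hi | rfl
    · exact hl.center i hi v hkv
    · exact absurd hkv (hk v)
  · rcases lt_or_eq hh hi with hi | rfl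
    · exact hl.copy i hi v hkv
    · exact absurd hkv (hk v)

variable {q : ℕ → ℕ} {v : Fin n}

/-- If a vertex treated or seen at an earlier node were `v`, that node would be the forget node of
`v` or lie below it, against the order. Hence labelling `v` alters no label used before. -/
theorem ne_of_lt (hord : IsOrder T q ord) (hh : h < N) (hk : T.kind (ord ⟨h, hh⟩) = .forget v)
    {i : Fin N} (hi : (i : ℕ) < h) {u : Fin n}
    (hu : T.kind (ord i) = .forget u ∨ u ∈ T.bag (ord i)) : (u : ℕ) ≠ v := by
  intro he
  obtain rfl : u = v := Fin.ext he
  rcases hu with hu | hu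
  · have := hord.bij.1 ((eq_forgetNode hu).trans (eq_forgetNode hk).symm)
    rw [this] at hi
    simp at hi
  · have := (below_forgetNode hu).1
    rw [← eq_forgetNode hk] at this
    have := hord.le_of_below this
    rw [Fin.le_def] at this
    simp only at this
    omega

theorem succ_top (hl : IsClusterLabeling T ch₁ ord fac slot cs cl ctr cnt h)
    (hord : IsOrder T q ord) (hh : h < N) (hk : T.kind (ord ⟨h, hh⟩) = .forget v)
    (ha : IsAlone (cs (ch₁ (ord ⟨h, hh⟩))) (slot v)) (h1 : ∀ i, i ≠ (v : ℕ) → cl' i = cl i)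
    (h2 : cl' v = cnt) (h3 : ∀ i, i ≠ cnt → ctr' i = ctr i)
    (h4 : ctr' cnt = fac ((cs (ch₁ (ord ⟨h, hh⟩))).fac (slot v))) :
    IsClusterLabeling T ch₁ ord fac slot cs cl' ctr' (cnt + 1) (h + 1) := by
  have hne := fun i hi u => ne_of_lt hord hh hk (i := i) hi (u := u)
  refine ⟨⟨?_, ?_, ?_⟩, fun i hi u hku hau => ?_, fun i hi u hku hau => ?_⟩
  · rintro u ⟨i, hi, hku, hau⟩
    rcases lt_or_eq hh hi with hi | rfl
    · have : cl u < cnt := hl.bij.mapsTo ⟨i, hi, hku, hau⟩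
      simp only [Set.mem_Iio, h1 u (hne i hi u (Or.inl hku))]
      omega
    · obtain rfl : v = u := by simpa [hk] using hku
      simp [h2]
  · rintro u ⟨i, hi, hku, hau⟩ u' ⟨i', hi', hku', hau'⟩ he
    simp only at he
    rcases lt_or_eq hh hi with hi | rfl <;> rcases lt_or_eq hh hi' with hi' | rfl
    · rw [h1 u (hne i hi u (Or.inl hku)), h1 u' (hne i' hi' u' (Or.inl hku'))] at he
      exact hl.bij.injOn ⟨i, hi, hku, hau⟩ ⟨i', hi', hku', hau'⟩ he
    · have : cl u < cnt := hl.bij.mapsTo ⟨i, hi, hku, hau⟩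
      obtain rfl : v = u' := by simpa [hk] using hku'
      rw [h1 u (hne i hi u (Or.inl hku)), h2] at he
      omega
    · have : cl u' < cnt := hl.bij.mapsTo ⟨i', hi', hku', hau'⟩
      obtain rfl : v = u := by simpa [hk] using hku
      rw [h1 u' (hne i' hi' u' (Or.inl hku')), h2] at he
      omega
    · rw [hku] at hku'
      simpa using hku'
  · intro j hj
    by_cases hjc : j = cnt
    · exact ⟨v, ⟨⟨h, hh⟩, by simp, hk, ha⟩, by simp [h2, hjc]⟩
    · obtain ⟨u, ⟨i, hi, hku, hau⟩, hu⟩ := hl.bij.surjOn (show j ∈ Set.Iio cnt by simp at hj ⊢; omega)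
      exact ⟨u, ⟨i, by omega, hku, hau⟩, by simpa [h1 u (hne i hi u (Or.inl hku))] using hu⟩
  · rcases lt_or_eq hh hi with hi | rfl
    · have : cl u < cnt := hl.bij.mapsTo ⟨i, hi, hku, hau⟩
      rw [h1 u (hne i hi u (Or.inl hku)), h3 _ this.ne]
      exact hl.center i hi u hku hau
    · obtain rfl : v = u := by simpa [hk] using hku
      rw [h2, h4]
  · rcases lt_or_eq hh hi with hi | rfl
    · obtain ⟨w, hw, h5, h6⟩ := hl.copy i hi u hku hau
      refine ⟨w, hw, h5, ?_⟩
      rw [h1 u (hne i hi u (Or.inl hku)), h1 w (hne i hi w (Or.inr hw)), h6]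
    · obtain rfl : v = u := by simpa [hk] using hku
      exact absurd ha hau

theorem succ_copy (hl : IsClusterLabeling T ch₁ ord fac slot cs cl ctr cnt h)
    (hord : IsOrder T q ord) (hh : h < N) (hk : T.kind (ord ⟨h, hh⟩) = .forget v)
    (ha : ¬ IsAlone (cs (ch₁ (ord ⟨h, hh⟩))) (slot v)) (h1 : ∀ i, i ≠ (v : ℕ) → cl' i = cl i)
    (h2 : ∃ u ∈ T.bag (ord ⟨h, hh⟩),
      (cs (ch₁ (ord ⟨h, hh⟩))).blocks (slot v) (slot u) ∧ cl' v = cl u) :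
    IsClusterLabeling T ch₁ ord fac slot cs cl' ctr cnt (h + 1) := by
  have hne := fun i hi u => ne_of_lt hord hh hk (i := i) hi (u := u)
  have hset : ∀ u, (∃ i : Fin N, (i : ℕ) < h + 1 ∧ T.kind (ord i) = .forget u ∧
      IsAlone (cs (ch₁ (ord i))) (slot u)) ↔ ∃ i : Fin N, (i : ℕ) < h ∧
      T.kind (ord i) = .forget u ∧ IsAlone (cs (ch₁ (ord i))) (slot u) := by
    refine fun u => ⟨?_, fun ⟨i, hi, h⟩ => ⟨i, by omega, h⟩⟩
    rintro ⟨i, hi, hku, hau⟩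
    rcases lt_or_eq hh hi with hi | rfl
    · exact ⟨i, hi, hku, hau⟩
    · obtain rfl : v = u := by simpa [hk] using hku
      exact absurd hau ha
  refine ⟨?_, fun i hi u hku hau => ?_, fun i hi u hku hau => ?_⟩
  · simp only [hset]
    refine hl.bij.congr ?_
    rintro u ⟨i, hi, hku, -⟩
    exact (h1 u (hne i hi u (Or.inl hku))).symm
  · rcases lt_or_eq hh hi with hi | rfl
    · rw [h1 u (hne i hi u (Or.inl hku))]
      exact hl.center i hi u hku hau
    · obtain rfl : v = u := by simpa [hk] using hku
      exact absurd hau ha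
  · rcases lt_or_eq hh hi with hi | rfl
    · obtain ⟨w, hw, h5, h6⟩ := hl.copy i hi u hku hau
      refine ⟨w, hw, h5, ?_⟩
      rw [h1 u (hne i hi u (Or.inl hku)), h1 w (hne i hi w (Or.inr hw)), h6]
    · obtain rfl : v = u := by simpa [hk] using hku
      obtain ⟨w, hw, h5, h6⟩ := h2
      have hwv : w ≠ v := by
        rintro rfl
        exact (below_forgetNode hw).2 (eq_forgetNode hk)
      exact ⟨w, hw, h5, by rw [h6, h1 w fun h => hwv (Fin.ext h)]⟩

end IsClusterLabeling

/-- Assign the vertices to clusters: a vertex that completes a component opens a new cluster, any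
other vertex joins the cluster of a vertex that is forgotten later. -/
def clusterProgram : Program :=
  41 ≔ .const 0 ;;
  loop 16 (.get 0 (.const 3))
    (17 ≔ .get 20 (var 16) ;;
    ite (natEq (.get 3 (var 17)) (.const 3))
      (19 ≔ .get 40 (.get 6 (var 17)) ;;
      59 ≔ .get 4 (var 17) ;;
      63 ≔ .get 21 (var 59) ;;
      61 ≔ .get 32 (var 19) ;;
      singletonProgram ;;
      ite (natEq (var 64) (.const 1))
        (setNat 12 (var 59) (var 41) ;;
        setNat 13 (var 41) (.get 1 (.get 23 (.get 25 (.get 33 (var 19)) + var 63))) ;;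
        41 ≔ var 41 + .const 1)
        (65 ≔ .get 25 (var 61) ;;
        loop 51 (.get 8 (var 17))
          (66 ≔ .get 10 (.get 9 (var 17) + var 51) ;;
          ite (natEq (.get 26 (var 65 + .get 21 (var 66))) (.get 26 (var 65 + var 63)))
            (setNat 12 (var 59) (.get 12 (var 66))) skip)))
      skip)

theorem ends_clusterProgram (hin : Input k G F d T ch₁ ch₂ fac σ) (hord : IsOrder T (σ.nat 20) ord)
    (hT : Tables n N k W F.card ν σ) (hW : 0 < W) (hslot : ∀ v : Fin n, σ.nat 21 v = slot v)
    (hB : ∀ t, Set.InjOn slot (T.bag t)) (hbag : ∀ t, (T.bag t).card ≤ W)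
    {cost : Fin n → Fin F.card → ℝ}
    {tab : Fin N → PartialState (Fin W) (Fin F.card) → Option ℝ}
    (hcs : ∀ t, (cs t).closed ≤ k) (h40 : ∀ t : Fin N, σ.nat 40 t = (cs t).code ν k)
    (hrun : T.IsRun slot ch₁ ch₂ cost k tab cs) :
    Ends clusterProgram σ fun τ s => s ≤ 300 * ((N + 1) * (W + 1)) ∧
      Frame [12, 13, 16, 17, 19, 41, 51, 53, 59, 61, 62, 63, 64, 65, 66] [] σ τ ∧
      ∃ cnt, IsClusterLabeling T ch₁ ord fac slot cs (τ.nat 12) (τ.nat 13) cnt N := by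
  classical
  let L := [12, 13, 16, 17, 19, 41, 51, 53, 59, 61, 62, 63, 64, 65, 66]
  unfold clusterProgram
  rw [ends_seq, ends_assign]
  refine ends_loop N (250 * (W + 1)) (fun h τ => Frame L [] σ τ ∧
    IsClusterLabeling T ch₁ ord fac slot cs (τ.nat 12) (τ.nat 13) (τ.nat 41 0) h) ?_ ?_ ?_ ?_
  · refine ⟨by simp [frame_setNat, Frame.refl, L], by simpa using IsClusterLabeling.zero⟩
  · rintro h τ - ⟨hf, -⟩ -
    simp [hf.nat, hin.nodes, L]
  · rintro h τ hh ⟨hf, hl⟩ hx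
    obtain ⟨t, ht⟩ : ∃ t, t = ord ⟨h, hh⟩ := ⟨_, rfl⟩
    have hq : σ.nat 20 h = t := by rw [ht, ← hord.eq]
    have hfin : ∀ (τ' : State) (s : ℕ), s ≤ 250 * (W + 1) → Frame L [] σ τ' → τ'.nat 16 0 = h →
        IsClusterLabeling T ch₁ ord fac slot cs (τ'.nat 12) (τ'.nat 13) (τ'.nat 41 0) (h + 1) →
        s ≤ 250 * (W + 1) ∧ τ'.nat 16 0 = h ∧ Frame L [] σ (τ'.setNat 16 0 (h + 1)) ∧
        IsClusterLabeling T ch₁ ord fac slot cs ((τ'.setNat 16 0 (h + 1)).nat 12)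
          ((τ'.setNat 16 0 (h + 1)).nat 13) ((τ'.setNat 16 0 (h + 1)).nat 41 0) (h + 1) := by
      intro τ' s hs hf' h16 hl'
      refine ⟨hs, h16, by simp [frame_setNat, hf', L], ?_⟩
      rw [show (τ'.setNat 16 0 (h + 1)).nat 41 0 = τ'.nat 41 0 by simp]
      exact hl'.of_eq (by simp) (by simp)
    rw [ends_seq, ends_assign, ends_ite]
    generalize hτ₁ : State.setNat τ 17 0 _ = τ₁
    have hf₁ : Frame [17] [] τ τ₁ := by simp [← hτ₁, frame_setNat, Frame.refl]
    have hg₁ : Frame L [] σ τ₁ := hf.trans hf₁ (by simp [L]) (by simp)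
    have h17 : τ₁.nat 17 0 = t := by simp [← hτ₁, hf.nat, L, hx, hq]
    have h16 : τ₁.nat 16 0 = h := by simp [hf₁.nat, hx]
    have hl₁ : IsClusterLabeling T ch₁ ord fac slot cs (τ₁.nat 12) (τ₁.nat 13) (τ₁.nat 41 0) h := by
      rw [hf₁.nat _ (by simp)]
      exact hl.of_eq (fun i => hf₁.nat _ (by simp) i) (fun i => hf₁.nat _ (by simp) i)
    clear hτ₁ hl hx hf
    have hkind := hin.kind_eq_three t
    refine ⟨fun h3 => ?_, fun h3 => ?_⟩
    · simp [hg₁.nat, L, h17] at h3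
      obtain ⟨v, hk⟩ := hkind.1 h3
      have h4 : σ.nat 4 t = v := by
        have := hin.kind t
        rw [hk] at this
        exact this.2
      have h6 := hin.child₁ t (by simp [hk])
      simp only [ends_seq, ends_assign]
      generalize hτ₂ : State.setNat _ 61 0 _ = τ₂
      have hf₂ : Frame [19, 59, 61, 63] [] τ₁ τ₂ := by simp [← hτ₂, frame_setNat, Frame.refl]
      have hg₂ : Frame L [] σ τ₂ := hg₁.trans hf₂ (by simp [L]) (by simp)
      have h19 : τ₂.nat 19 0 = (cs (ch₁ t)).code ν k := by
        simp [← hτ₂, h17, hg₁.nat, L, h6, h40]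
      have h59 : τ₂.nat 59 0 = v := by simp [← hτ₂, h17, hg₁.nat, L, h4]
      have h63 : τ₂.nat 63 0 = slot v := by simp [← hτ₂, h17, hg₁.nat, L, h4, hslot]
      have h61 : τ₂.nat 61 0 = ν (cs (ch₁ t)).blocks := by
        simp [← hτ₂, h17, hg₁.nat, L, h6, h40, hT.blocks _ (hcs _)]
      clear hτ₂
      refine (ends_singletonProgram (hT.of_frame hg₂ (by simp [L])) hW h61 h63).mono ?_
      rintro τ₃ s₃ ⟨hs₃, hf₃, h64⟩
      have hg₃ : Frame L [] σ τ₃ := hg₂.trans hf₃ (by simp [L]) (by simp)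
      have hg₁₃ : Frame [19, 53, 59, 61, 62, 63, 64] [] τ₁ τ₃ :=
        (hf₂.mono (by simp) (by simp)).trans hf₃ (by simp) (by simp)
      have hl₃ : IsClusterLabeling T ch₁ ord fac slot cs (τ₃.nat 12) (τ₃.nat 13) (τ₃.nat 41 0)
          h := by
        rw [hg₁₃.nat _ (by simp)]
        exact hl₁.of_eq (fun i => hg₁₃.nat _ (by simp) i) (fun i => hg₁₃.nat _ (by simp) i)
      have hT₃ := hT.of_frame hg₃ (by simp [L])
      have h59' : τ₃.nat 59 0 = v := by simp [hf₃.nat, h59]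
      have h63' : τ₃.nat 63 0 = slot v := by simp [hf₃.nat, h63]
      have h61' : τ₃.nat 61 0 = ν (cs (ch₁ t)).blocks := by simp [hf₃.nat, h61]
      have h19' : τ₃.nat 19 0 = (cs (ch₁ t)).code ν k := by simp [hf₃.nat, h19]
      have h17' : τ₃.nat 17 0 = t := by simp [hg₁₃.nat, h17]
      have h16' : τ₃.nat 16 0 = h := by simp [hg₁₃.nat, h16]
      have halone : τ₃.nat 64 0 = 1 ↔ IsAlone (cs (ch₁ t)) (slot v) := by
        rw [h64]
        unfold IsAlone
        split_ifs with hc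
        · exact iff_of_true rfl hc
        · exact iff_of_false (by simp) hc
      clear hf₃ hf₂ hg₂ hg₁₃ h64 hl₁
      rw [ends_ite]
      refine ⟨fun hc => ?_, fun hc => ?_⟩
      · have ha := halone.1 (by simpa using hc)
        simp only [ends_seq, ends_assign, ends_setNat]
        refine hfin _ _ (by simp; omega) (by simp [frame_setNat, hg₃, L]) (by simp [h16']) ?_
        refine (hl₃.succ_top (cl' := Function.update (τ₃.nat 12) v (τ₃.nat 41 0))
          (ctr' := Function.update (τ₃.nat 13) (τ₃.nat 41 0)
            (fac ((cs (ch₁ t)).fac (slot v)))) hord hh (ht ▸ hk) (ht ▸ ha)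
          (fun i hi => by simp [hi]) (by simp) (fun i hi => by simp [hi]) (by simp [ht])).of_eq
          (fun i => ?_) (fun i => ?_)
        · simp [Function.update_apply, h59']
        · simp [-finFunctionFinEquiv_apply_val, Function.update_apply, h19', h63',
            hT₃.fac _ (hcs _), hT₃.row_fac, hT₃.digit, hg₃.nat, L, hin.facilities]
      · have ha := halone.not.1 (by simpa using hc)
        obtain ⟨u₀, hu₀, hrel₀⟩ := hrun.exists_mem_bag hB hin.isChildMap hk ha
        rw [ends_seq, ends_assign]
        have hlab := hT₃.label (cs (ch₁ t)).blocks
        have h65 : ∀ e, Frame [65] [] τ₃ (τ₃.setNat 65 0 e) := fun e => by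
          simp [frame_setNat, Frame.refl]
        -- Every bag vertex in the block of `v` overwrites the label of `v`, so the invariant claims
        -- only that, once such a vertex has been met, the label agrees with that of one of them.
        -- These vertices are forgotten closer to the root and have final labels.
        refine ends_loop (T.bag t).card 50 (fun j ρ => Frame [12, 51, 65, 66] [] τ₃ ρ ∧
          ρ.nat 65 0 = ν (cs (ch₁ t)).blocks * W ∧
          (∀ i, i ≠ (v : ℕ) → ρ.nat 12 i = τ₃.nat 12 i) ∧
          ((∃ j' < j, ∃ u ∈ T.bag t, σ.nat 10 (σ.nat 9 t + j') = u ∧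
              (cs (ch₁ t)).blocks (slot v) (slot u)) →
            ∃ u ∈ T.bag t, (cs (ch₁ t)).blocks (slot v) (slot u) ∧ ρ.nat 12 v = τ₃.nat 12 u))
          ?_ ?_ ?_ ?_
        · refine ⟨by simp [frame_setNat, Frame.refl], ?_, by simp, by simp⟩
          simp [h61', hT₃.row_blocks hW]
        · rintro j ρ - ⟨hρ, -⟩ -
          simp [hρ.nat, h17', hg₃.nat, L, hin.bag_card]
        · rintro j ρ hj ⟨hρ, h65', h12, hex⟩ hy
          obtain ⟨u, hu, hju⟩ := (hin.bag t).mapsTo (show j ∈ Set.Iio (T.bag t).card from hj)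
          simp only at hju
          have huv : (u : ℕ) ≠ v := by
            intro he
            obtain rfl : u = v := Fin.ext he
            exact (below_forgetNode hu).2 (eq_forgetNode hk)
          rw [ends_seq, ends_assign]
          have h66 : (NatExpr.get 10 (.get 9 (var 17) + var 51)).eval ρ = u := by
            simp [hρ.nat, h17', hg₃.nat, L, hy, hju]
          rw [h66, ends_ite]
          have hlabel : σ.nat 26 (ν (cs (ch₁ t)).blocks * W + slot u) =
              σ.nat 26 (ν (cs (ch₁ t)).blocks * W + slot v) ↔
              (cs (ch₁ t)).blocks (slot v) (slot u) := by
            rw [eq_comm, ← (hT.label _).rel]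
          refine ⟨fun hc => ?_, fun hc => ?_⟩
          · simp [hρ.nat, hg₃.nat, L, h65', h63', hslot, hlabel] at hc
            rw [ends_setNat]
            refine ⟨by simp, by simp [hy], by simp [frame_setNat, hρ], by simp [h65'],
              fun i hi => ?_, fun _ => ⟨u, hu, hc, ?_⟩⟩
            · simp [hρ.nat, h59', hi, h12]
            · simp [hρ.nat, h59', h12 _ huv]
          · simp [hρ.nat, hg₃.nat, L, h65', h63', hslot, hlabel] at hc
            rw [ends_skip]
            refine ⟨by simp, by simp [hy], by simp [frame_setNat, hρ], by simp [h65'],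
              fun i hi => by simp [h12 i hi], fun ⟨j', hj', w, hw, hjw, hrel⟩ => ?_⟩
            have hlt : j' < j := by
              rcases Nat.lt_succ_iff_lt_or_eq.1 hj' with h | rfl
              · exact h
              · obtain rfl : w = u := Fin.ext (hjw.symm.trans hju.symm)
                exact absurd hrel hc
            simpa using hex ⟨j', hlt, w, hw, hjw, hrel⟩
        · rintro ρ s ⟨hρ, -, h12, hex⟩ hs
          refine hfin _ _ ?_ (hg₃.trans hρ (by simp [L]) (by simp)) (by simp [hρ.nat, h16']) ?_
          · have := hbag t
            simp at hs ⊢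
            nlinarith
          · rw [hρ.nat 41 (by simp)]
            refine (hl₃.succ_copy (cl' := ρ.nat 12) hord hh (ht ▸ hk) (ht ▸ ha) h12 ?_).of_eq
              (fun _ => rfl) (fun i => hρ.nat _ (by simp) i)
            rw [← ht]
            -- The vertex `u₀` from `IsRun.exists_mem_bag` is somewhere in the list of the bag, so
            -- the premise of the invariant holds at the end.
            obtain ⟨j, hj, he⟩ := (hin.bag t).surjOn (Set.mem_image_of_mem _ hu₀)
            exact hex ⟨j, hj, u₀, hu₀, he, hrel₀⟩
    · simp [hg₁.nat, L, h17] at h3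
      rw [ends_skip]
      refine hfin _ _ (by simp; omega) hg₁ h16 (hl₁.succ_other hh fun v hk => h3 ?_)
      have := hin.kind t
      rw [ht, hk, ← ht] at this
      exact this.1
  · rintro τ s ⟨hf, hl⟩ hs
    refine ⟨?_, hf, _, hl⟩
    have h1 : (NatExpr.const 0).cost = 1 := rfl
    have h2 : (NatExpr.get 0 (NatExpr.const 3)).cost = 2 := rfl
    rw [h2] at hs
    nlinarith

end RAM

/-! ### The complete program and its running time -/

namespace RAM

open Test Program PartialState NiceTreeDecomposition

variable {n N k : ℕ} {G : SimpleGraph (Fin n)} {F : Finset (Fin n)} {d : Fin n → Fin n → ℝ}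
  {T : NiceTreeDecomposition G (Fin N)} {σ τ : State}

/-- Solve the connected `k`-median problem by dynamic programming on a nice tree decomposition. -/
def medianProgram : Program :=
  widthProgram ;; orderProgram ;; slotProgram ;; tablesProgram ;; fillProgram ;;
  ite (natEq (.get 37 (.get 36 (.get 0 (.const 4)) + .get 0 (.const 1))) (.const 0)) skip
    (traceProgram ;; clusterProgram ;; setNat 11 (.const 0) (.const 1))

/-- The number of steps of `medianProgram`, where `W` bounds the sizes of the bags, `m` is the
number of facilities and `b` the number of partitions of a set of `W` elements. -/
def medianSteps (n k N W m b : ℕ) : ℕ :=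
  220 * (N + 1) + 200 * ((N + 1) * (W + 1) ^ 2) +
    1000 * ((b + 1) ^ 2 * (W + 1) ^ 3 + (W + 1) * (m + 1) + (W + 1) * (m ^ W + 1) +
      m ^ W * (b * (k + 1)) + N + n + 1) +
    600 * ((N + 1) * ((m ^ W * (b * (k + 1)) + 1) * ((b * (k + 1) + 1) * (W + 1) ^ 2))) +
    300 * ((N + 1) * (W + 1)) + 30

/-- Every summand is at most a constant times `Z`; the join nodes give the only summand that needs
`k ^ 2`, `m ^ W` and `b ^ 2` together. Using `k + 1 ≤ 2 * k` and similar estimates, the constants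
add up to `18150`. -/
theorem medianSteps_le {n k N W m b C : ℕ} (hn : 0 < n) (hk : 0 < k) (hW : 0 < W) (hm : 0 < m)
    (hb : 0 < b) (hN : N ≤ C * (n * W)) :
    medianSteps n k N W m b ≤
      20000 * ((C + 1) * (W + 1) ^ 3 * (n * k ^ 2 * m ^ W * b ^ 2)) := by
  unfold medianSteps
  obtain ⟨M, hM⟩ : ∃ M, M = m ^ W := ⟨_, rfl⟩
  have hmM : m ≤ M := hM ▸ Nat.le_self_pow hW.ne' m
  have hM0 : 0 < M := hm.trans_le hmM
  rw [← hM]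
  obtain ⟨Z, hZ⟩ : ∃ Z, Z = (C + 1) * (W + 1) ^ 3 * (n * k ^ 2 * M * b ^ 2) := ⟨_, rfl⟩
  have hN1 : N + 1 ≤ (C + 1) * n * (W + 1) := by
    calc N + 1 ≤ C * (n * W) + n * 1 := by omega
      _ ≤ C * (n * (W + 1)) + n * (W + 1) := by gcongr <;> omega
      _ = _ := by ring
  have h1 : (N + 1) * (W + 1) ^ 2 ≤ Z := by
    calc _ ≤ (C + 1) * n * (W + 1) * (W + 1) ^ 2 := by gcongr
      _ ≤ (C + 1) * n * (W + 1) * (W + 1) ^ 2 * (k ^ 2 * M * b ^ 2) :=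
        Nat.le_mul_of_pos_right _ (by positivity)
      _ = Z := by rw [hZ]; ring
  have h2 : (N + 1) * (W + 1) ≤ (N + 1) * (W + 1) ^ 2 := by
    gcongr
    exact Nat.le_self_pow two_ne_zero _
  have h3 : N + 1 ≤ (N + 1) * (W + 1) := Nat.le_mul_of_pos_right _ (by positivity)
  have h4 : (b + 1) ^ 2 * (W + 1) ^ 3 ≤ 4 * Z := by
    calc _ ≤ (2 * b) ^ 2 * (W + 1) ^ 3 := by gcongr; omega
      _ ≤ (2 * b) ^ 2 * (W + 1) ^ 3 * ((C + 1) * (n * k ^ 2 * M)) :=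
        Nat.le_mul_of_pos_right _ (by positivity)
      _ = 4 * Z := by rw [hZ]; ring
  have h5 : (W + 1) * M ≤ Z := by
    calc _ ≤ (W + 1) * M * ((C + 1) * (W + 1) ^ 2 * (n * k ^ 2 * b ^ 2)) :=
        Nat.le_mul_of_pos_right _ (by positivity)
      _ = Z := by rw [hZ]; ring
  have h6 : (W + 1) * (m + 1) ≤ 2 * Z := by
    calc _ ≤ (W + 1) * (2 * M) := by gcongr; omega
      _ = 2 * ((W + 1) * M) := by ring
      _ ≤ _ := by omega
  have h7 : (W + 1) * (M + 1) ≤ 2 * Z := by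
    calc _ ≤ (W + 1) * (2 * M) := by gcongr; omega
      _ = 2 * ((W + 1) * M) := by ring
      _ ≤ _ := by omega
  have h8 : M * (b * (k + 1)) ≤ 2 * Z := by
    calc _ ≤ M * (b * (2 * k)) := by gcongr; omega
      _ ≤ M * (b * (2 * k)) * ((C + 1) * (W + 1) ^ 3 * (n * k * b)) :=
        Nat.le_mul_of_pos_right _ (by positivity)
      _ = 2 * Z := by rw [hZ]; ring
  have h9 : n ≤ Z := by
    calc n ≤ n * ((C + 1) * (W + 1) ^ 3 * (k ^ 2 * M * b ^ 2)) :=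
        Nat.le_mul_of_pos_right _ (by positivity)
      _ = Z := by rw [hZ]; ring
  have hbk : b * (k + 1) ≤ b * (2 * k) := by gcongr; omega
  have h10 : b * (k + 1) + 1 ≤ 3 * (b * k) := by
    have : 0 < b * k := by positivity
    linarith
  have h11 : M * (b * (k + 1)) + 1 ≤ 3 * (M * (b * k)) := by
    have : 0 < M * (b * k) := by positivity
    have := Nat.mul_le_mul_left M hbk
    linarith
  -- The dominant summand. The factor `9` comes from absorbing the additive ones in the size of a
  -- table and in the size of a layer, with a factor `3` each.
  have h12 : (N + 1) * ((M * (b * (k + 1)) + 1) * ((b * (k + 1) + 1) * (W + 1) ^ 2)) ≤ 9 * Z := by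
    calc _ ≤ (C + 1) * n * (W + 1) * (3 * (M * (b * k)) * (3 * (b * k) * (W + 1) ^ 2)) := by
          gcongr
      _ = 9 * Z := by rw [hZ]; ring
  rw [← hZ]
  omega

theorem ends_medianProgram (hσ : EncodesInstance k G F d T σ) (hn : 0 < n) (hF : F.Nonempty) :
    Ends medianProgram σ fun τ s => HoldsOptimum k G F d τ ∧
      s ≤ medianSteps n k N (T.width + 1) F.card (Nat.card (Setoid (Fin (T.width + 1)))) := by
  obtain ⟨ch₁, ch₂, fac, hin⟩ := hσ.exists_input
  have : NeZero F.card := ⟨hF.card_pos.ne'⟩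
  obtain ⟨W, hWdef⟩ : ∃ W, W = T.width + 1 := ⟨_, rfl⟩
  -- As `n > 0`, some bag is nonempty, so the subtraction in the width is not truncated and the
  -- largest bag has exactly `w + 1` vertices.
  have hWsup : W = Finset.univ.sup fun t => (T.bag t).card := by
    obtain ⟨t, ht⟩ := T.exists_mem_bag ⟨0, hn⟩
    have h1 := Finset.card_pos.2 ⟨_, ht⟩
    have h2 := Finset.le_sup (f := fun t => (T.bag t).card) (Finset.mem_univ t)
    rw [hWdef, TreeDecomposition.width]
    omega
  have hbag : ∀ t, (T.bag t).card ≤ W := fun t =>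
    hWsup ▸ Finset.le_sup (f := fun t => (T.bag t).card) (Finset.mem_univ t)
  have hW : 0 < W := by omega
  rw [← hWdef]
  clear hWdef
  unfold medianProgram
  rw [ends_seq]
  refine ends_widthProgram.mono ?_
  rintro τ₁ s₁ ⟨hs₁, hf₁, h14⟩
  have hW₁ : τ₁.nat 14 0 = W := by
    rw [h14, hWsup, hin.nodes]
    refine le_antisymm (Finset.sup_le fun i hi => ?_) (Finset.sup_le fun t _ => ?_)
    · rw [show i = (⟨i, Finset.mem_range.1 hi⟩ : Fin N) from rfl, hin.bag_card]
      exact Finset.le_sup (f := fun t => (T.bag t).card) (Finset.mem_univ _)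
    · rw [← hin.bag_card]
      exact Finset.le_sup (f := σ.nat 8) (Finset.mem_range.2 t.2)
  rw [hin.nodes] at hs₁
  have hin₁ : Input k G F d T ch₁ ch₂ fac τ₁ :=
    hin.of_eq fun a ha => hf₁.nat a (by simp; omega)
  rw [ends_seq]
  refine (ends_orderProgram hin₁).mono ?_
  rintro τ₂ s₂ ⟨hs₂, hf₂, ord, hord⟩
  have hW₂ : τ₂.nat 14 0 = W := by rw [hf₂.nat _ (by simp), hW₁]
  have hin₂ := hin₁.of_eq fun a ha => hf₂.nat a (by simp; omega)
  rw [ends_seq]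
  refine (ends_slotProgram hin₂ hord (by rwa [hW₂])).mono ?_
  rintro τ₃ s₃ ⟨hs₃, hf₃, h3⟩
  rw [hW₂] at hs₃ h3
  obtain ⟨slot, hslot, hB⟩ := h3
  have hW₃ : τ₃.nat 14 0 = W := by rw [hf₃.nat _ (by simp), hW₂]
  have hin₃ := hin₂.of_eq fun a ha => hf₃.nat a (by simp; omega)
  rw [ends_seq]
  have h4 := ends_tablesProgram hin₃.vertices hin₃.clusters hin₃.facilities_card hin₃.nodes hW₃
  obtain ⟨b, hb⟩ : ∃ b, b = Nat.card (Setoid (Fin W)) := ⟨_, rfl⟩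
  rw [← hb] at h4 ⊢
  refine h4.mono ?_
  rintro τ₄ s₄ ⟨hs₄, hf₄, ν, hT₄⟩
  clear h4
  have hg₄ : Frame ([14, 50] ++ [20, 15, 16, 17] ++ [16, 17, 21, 51, 52, 53] ++ tableArrays) []
      σ τ₄ := by
    refine Frame.trans (Frame.trans (Frame.trans (hf₁.mono ?_ ?_) hf₂ ?_ ?_) hf₃ ?_ ?_) hf₄ ?_ ?_
    all_goals simp +contextual [tableArrays]
  have hin₄ := hin₃.of_eq fun a ha => hf₄.nat a (by simp [tableArrays]; omega)
  have hord₄ : IsOrder T (τ₄.nat 20) ord := by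
    rwa [show τ₄.nat 20 = τ₂.nat 20 from funext fun j => by
      rw [hf₄.nat _ (by simp [tableArrays]), hf₃.nat _ (by simp)]]
  have hslot₄ : ∀ v : Fin n, τ₄.nat 21 v = slot v := fun v => by
    rw [hf₄.nat _ (by simp [tableArrays]), hslot]
  rw [ends_seq]
  refine (ends_fillProgram hin₄ (fun u v => by rw [hg₄.real _ (by simp), hσ.dist]) hord₄ hT₄ hW
    hslot₄ fun j => by rw [hg₄.nat _ (by simp [tableArrays]), hσ.nat_zero _ _ (by simp)]).mono ?_
  rintro τ₅ s₅ ⟨hs₅, hf₅, hbest⟩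
  have hin₅ := hin₄.of_eq fun a ha => hf₅.nat a (by simp [nodeArrays]; omega)
  have hT₅ := hT₄.of_frame hf₅ (by simp [nodeArrays])
  have hord₅ : IsOrder T (τ₅.nat 20) ord := by
    rwa [show τ₅.nat 20 = τ₄.nat 20 from funext fun j => hf₅.nat _ (by simp [nodeArrays]) j]
  have hslot₅ : ∀ v : Fin n, τ₅.nat 21 v = slot v := fun v => by
    rw [hf₅.nat _ (by simp [nodeArrays]), hslot₄]
  have hopt : ∀ t x c x₁ x₂, T.Attempt slot ch₁ ch₂ (fun v y => d v (fac y)) k (table ν k τ₅) t x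
      c x₁ x₂ → ∃ c' ≤ c, table ν k τ₅ t x = some c' := fun t x c x₁ x₂ hA => by
    obtain ⟨h1, h2, h3⟩ := (hbest t).complete x c x₁ x₂ hA
    exact ⟨_, h3, table_eq_some_iff.2 ⟨h1, h2, rfl⟩⟩
  have hroot : (natEq (.get 37 (.get 36 (.get 0 (.const 4)) + .get 0 (.const 1)))
      (.const 0)).Holds τ₅ ↔ τ₅.nat 37 (T.root * (F.card ^ W * (b * (k + 1))) + k) = 0 := by
    simp [hin₅.root, hin₅.clusters, hT₅.offset_node]
  rw [ends_ite, hroot]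
  clear hroot
  have hcost : (natEq (.get 37 (.get 36 (.get 0 (.const 4)) + .get 0 (.const 1)))
      (.const 0)).cost = 9 := rfl
  rw [hcost]
  unfold medianSteps
  refine ⟨fun h0 => ?_, fun h0 => ?_⟩
  · rw [ends_skip]
    refine ⟨Or.inl ⟨?_, fun ⟨P, c, hPc⟩ => ?_⟩, ?_⟩
    -- Array `11` is initially zero and has not been written, so the negative answer is already in
    -- place.
    · rw [hf₅.nat _ (by simp [nodeArrays]), hg₄.nat _ (by simp [tableArrays]),
        hσ.nat_zero _ _ (by simp)]
    · obtain ⟨c, -, hc⟩ := exists_tab_root_le hB hin.isChildMap hin.fac_surj hopt hPc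
      have := (table_eq_some_iff.1 hc).2.1
      rw [code_init hT₅.bot] at this
      exact this h0
    · omega
  · rw [ends_seq]
    refine (ends_traceProgram hin₅ hord₅ hT₅ hbest h0).mono ?_
    rintro τ₆ s₆ ⟨hs₆, hf₆, cs, hcs, h40, hcroot, hrun⟩
    have hord₆ : IsOrder T (τ₆.nat 20) ord := by
      rwa [show τ₆.nat 20 = τ₅.nat 20 from funext fun j => hf₆.nat _ (by simp) j]
    rw [ends_seq]
    refine (ends_clusterProgram (hin₅.of_eq fun a ha => hf₆.nat a (by simp; omega)) hord₆
      (hT₅.of_frame hf₆ (by simp)) hW (fun v => by rw [hf₆.nat _ (by simp), hslot₅]) hB hbag hcs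
      h40 hrun).mono ?_
    rintro τ₇ s₇ ⟨hs₇, hf₇, cnt, hl⟩
    rw [ends_setNat]
    have hex : ∀ {p : Fin N → Prop}, (∃ t, p t) ↔ ∃ i : Fin N, (i : ℕ) < N ∧ p (ord i) :=
      fun {p} => ⟨fun ⟨t, ht⟩ => let ⟨i, hi⟩ := hord.bij.2 t; ⟨i, i.2, hi.symm ▸ ht⟩,
        fun ⟨i, _, hi⟩ => ⟨_, hi⟩⟩
    obtain ⟨P, c, hPc, hcl, hctr⟩ := hrun.exists_isOptimal hB hin.isChildMap hin.fac_mem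
      hin.fac_surj hopt hcroot (cl := fun v => τ₇.nat 12 v) (cnt := cnt)
      (fun t v hk ha => by
        obtain ⟨i, rfl⟩ := hord.bij.2 t
        exact hl.copy i i.2 v hk ha)
      (by
        convert hl.bij using 1
        exact Set.ext fun v => hex)
    refine ⟨Or.inr ⟨by simp, P, c, hPc, fun i v hv => by simpa using hcl i v hv, fun i => ?_⟩, ?_⟩
    · obtain ⟨t, v, hk, ha, hi, hc⟩ := hctr i
      obtain ⟨j, rfl⟩ := hord.bij.2 t
      have := hl.center j j.2 v hk ha
      rw [hi] at this
      simp [this, hc]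
    · simp only [NatExpr.cost]
      omega

end RAM

theorem mainTheorem9 :
    ∃ prog : RAM.Program, ∀ C : ℕ, ∃ p : Polynomial ℕ,
      ∀ (n k N : ℕ) (G : SimpleGraph (Fin n)) (F : Finset (Fin n)) (d : Fin n → Fin n → ℝ)
        (T : NiceTreeDecomposition G (Fin N)) (w : ℕ) (σ : RAM.State),
        0 < n → 0 < k → F.Nonempty → IsDistanceMetric d →
        T.width = w → N ≤ C * (n * (w + 1)) →
        EncodesInstance k G F d T σ →
        ∃ (σ' : RAM.State) (t : ℕ), RAM.Exec prog σ σ' t ∧ HoldsOptimum k G F d σ' ∧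
          t ≤ n * k ^ 2 * F.card ^ (w + 1) * Nat.bell (w + 1) ^ 2 * p.eval w := by
  -- The bound of `medianSteps_le` has the factor `(W + 1) ^ 3`, which is `(w + 2) ^ 3` since `W = w
  -- + 1`.
  refine ⟨RAM.medianProgram, fun C => ⟨.C (20000 * (C + 1)) * (.X + 2) ^ 3, ?_⟩⟩
  intro n k N G F d T w σ hn hk hF _ hw hN hσ
  obtain ⟨τ, t, he, hopt, ht⟩ := RAM.ends_medianProgram hσ hn hF
  refine ⟨τ, t, he, hopt, ht.trans ?_⟩
  rw [hw]
  have hb : Nat.card (Setoid (Fin (w + 1))) ≤ Nat.bell (w + 1) :=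
    Setoid.card_le_bell _ _ (Fintype.card_fin _)
  calc _ ≤ 20000 * ((C + 1) * (w + 1 + 1) ^ 3 *
        (n * k ^ 2 * F.card ^ (w + 1) * Nat.card (Setoid (Fin (w + 1))) ^ 2)) :=
        RAM.medianSteps_le hn hk (Nat.succ_pos w) hF.card_pos Nat.card_pos hN
    _ ≤ 20000 * ((C + 1) * (w + 1 + 1) ^ 3 *
        (n * k ^ 2 * F.card ^ (w + 1) * Nat.bell (w + 1) ^ 2)) := by gcongr
    _ = _ := by
        simp only [Polynomial.eval_mul, Polynomial.eval_C, Polynomial.eval_pow,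
          Polynomial.eval_add, Polynomial.eval_X, Polynomial.eval_ofNat]
        ring
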